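/- Let $\Bbbk$ be a field, $H$ a Hopf algebra over $\Bbbk$ with bijective antipode, and $A$ a right $H$-comodule algebra with coaction $\rho(a)=a_{(0)}\otimes a_{(1)}$ and coinvariants $B=A^{\mathrm{co}H}=\{a\mid \rho(a)=a\otimes 1\}$. Assume that $B\subseteq A$ is a faithfully flat Hopf–Galois extension: $\chi\colon A\otimes_BA\to A\otimes H$, $a\otimes_Ba'\mapsto aa'_{(0)}\otimes a'_{(1)}$, is bijective and $A$ is faithfully flat as a left $B$-module. Write $\tau(h)=\chi^{-1}(1\otimes h)$, and let $\rho_\otimes(a\otimes a')=a_{(0)}\otimes a'_{(0)}\otimes a_{(1)}a'_{(1)}$ be the diagonal coaction on $A\otimes A$. Let $\mathcal H=(A\otimes A)^{\mathrm{co}H}$ be the Ehresmann–Schauenburg bialgebroid over $B$: product $(a\otimes a')(c\otimes c')=ac\otimes c'a'$, source $s(b)=b\otimes1$, target $t(b)=1\otimes b$, counit $\varepsilon(a\otimes a')=aa'$, and coproduct $\Delta\colon\mathcal H\to\mathcal H\otimes_B\mathcal H$, $a\otimes a'\mapsto a_{(0)}\otimes\tau(a_{(1)})\otimes a'$; in $\mathcal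 H\otimes_BM$, for a left $\mathcal H$-module $M$, one has $t(b)h\otimes_Bm=h\otimes_Bs(b)m$. Here the coproduct is well defined: the canonical map $\mathcal H\otimes_B\mathcal H\to A\otimes(A\otimes_BA)\otimes A$ is injective and its image contains all $a_{(0)}\otimes\tau(a_{(1)})\otimes a'$ with $a\otimes a'\in\mathcal H$. Put $\mathcal H^+=\ker\varepsilon$. A left covariant first order differential calculus on $\mathcal H$ is an $\mathcal H$-bimodule $\Omega$ with a linear map $d\colon\mathcal H\to\Omega$ satisfying $d(xy)=(dx)y+x\,dy$, $d(s(b)x)=s(b)dx$, $d(xs(b))=(dx)s(b)$, and such that the elements $x\,dy$ span $\Omega$, together with a coassociative, counital, left $B$-linear coaction $\lambda\colon\Omega\to\mathcal H\otimes_B\Omega$, $\omega\mapsto\omega_{(-1)}\otimes_B\omega_{(0)}$, such that $\varepsilon(\omega_{(-1)}s(b))\,\omega_{(0)}=\omega\, s(b)$ (with $B$ acting on the left through $s$), $\lambda(x\omega y)=\Delta(x)\lambda(\omega)\Delta(y)$ and $\lambda\circ d=(\mathrm{id}\otimes_B d)\Delta$. A right $H$-covariant first order differential calculus on $A$ is an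 $A$-bimodule $\Omega$ with a derivation $d\colon A\to\Omega$ such that the elements $a\,da'$ span $\Omega$, together with a right $H$-coaction on $\Omega$ that is compatible with both $A$-actions and for which $d$ is colinear. Isomorphisms of calculi are bijections compatible with the bimodule structures, the coactions and the differentials. Let $\Omega^u_A=\ker(A\otimes A\to A)$, with $d_ua=1\otimes a-a\otimes1$, be the universal calculus. Then: 1. $\mathcal H^+=(\Omega^u_A)^{\mathrm{co}H}$ as subspaces of $A\otimes A$. 2. For every left ideal $I\subseteq\mathcal H^+$ of $\mathcal H$, the space $\mathcal H\otimes_B\mathcal H^+/I$ with $x(g\otimes[g'])y=x_{(1)}gy\otimes[x_{(2)}g']$, coaction $\Delta\otimes\mathrm{id}$ and $dx=(\mathrm{id}\otimes\pi)(\Delta x-x\otimes1)$, where $\pi\colon\mathcal H^+\to\mathcal H^+/I$ is the projection, is a left covariant first order differential calculus on $\mathcal H$, and every left covariant calculus is isomorphic to it for exactly one $I$. 3. For every $A$-subbimodule and right $H$-subcomodule $J\subseteq\Omega^u_A$, the quotient $\Omega^u_A/J$ is a right $H$-covariant first order differential calculus on $A$, and every right $H$-covariant calculus is isomorphic to it for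 exactly one $J$. 4. $I\mapsto AI$ and $J\mapsto J^{\mathrm{co}H}$ are mutually inverse bijections between the left ideals $I\subseteq\mathcal H^+$ of $\mathcal H$ and the $A$-subbimodules and right $H$-subcomodules $J\subseteq\Omega^u_A$. Consequently there is a bijection between the isomorphism classes of left covariant first order differential calculi on $\mathcal H$ and those of right $H$-covariant first order differential calculi on $A$, which sends the class of $\mathcal H\otimes_B\mathcal H^+/I$ to that of $\Omega^u_A/AI$, and whose inverse sends the class of $\Omega^u_A/J$ to that of $\mathcal H\otimes_B\mathcal H^+/J^{\mathrm{co}H}$. -/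

import Mathlib

open scoped TensorProduct
open MulOpposite

universe u v w

namespace ESCalculus

/-! ### Tensor products over a possibly noncommutative `k`-algebra `B`

The right action on `M` and the left action on `N` are given as families of `k`-linear
endomorphisms, because the same space will carry several actions of the same algebra. -/

section Balanced

variable {k : Type*} [CommRing k] {B : Type*}
  {M : Type*} [AddCommGroup M] [Module k M] {N : Type*} [AddCommGroup N] [Module k N]
  {P : Type*} [AddCommGroup P] [Module k P]
  {M' : Type*} [AddCommGroup M'] [Module k M'] {N' : Type*} [AddCommGroup N'] [Module k N']

/-- The relations `m b ⊗ n = m ⊗ b n`. -/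
def balRel (r : B → Module.End k M) (l : B → Module.End k N) : Submodule k (M ⊗[k] N) :=
  Submodule.span k {z | ∃ b m n, z = r b m ⊗ₜ[k] n - m ⊗ₜ[k] l b n}

/-- The balanced tensor product `M ⊗_B N`. -/
abbrev BalTensor (r : B → Module.End k M) (l : B → Module.End k N) : Type _ :=
  (M ⊗[k] N) ⧸ balRel r l

/-- The projection `M ⊗ N → M ⊗_B N`. -/
abbrev BalTensor.mk (r : B → Module.End k M) (l : B → Module.End k N) :
    M ⊗[k] N →ₗ[k] BalTensor r l :=
  (balRel r l).mkQ

theorem BalTensor.mk_eq (r : B → Module.End k M) (l : B → Module.End k N) (b : B) (m : M)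
    (n : N) : BalTensor.mk r l (r b m ⊗ₜ[k] n) = BalTensor.mk r l (m ⊗ₜ[k] l b n) := by
  rw [← sub_eq_zero, ← map_sub]
  exact (Submodule.Quotient.mk_eq_zero _).2 (Submodule.subset_span ⟨b, m, n, rfl⟩)

/-- A `k`-linear map on `M ⊗ N` that respects the relations descends to `M ⊗_B N`. -/
def BalTensor.lift (r : B → Module.End k M) (l : B → Module.End k N) (f : M ⊗[k] N →ₗ[k] P)
    (hf : ∀ b m n, f (r b m ⊗ₜ[k] n) = f (m ⊗ₜ[k] l b n)) : BalTensor r l →ₗ[k] P :=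
  (balRel r l).liftQ f (by
    rw [balRel, Submodule.span_le]
    rintro _ ⟨b, m, n, rfl⟩
    simp [hf])

/-- `f ⊗_B g` for a map `f` of right `B`-modules and a map `g` of left `B`-modules. -/
def BalTensor.map {r : B → Module.End k M} {l : B → Module.End k N}
    {r' : B → Module.End k M'} {l' : B → Module.End k N'}
    (f : M →ₗ[k] M') (g : N →ₗ[k] N')
    (hf : ∀ b m, f (r b m) = r' b (f m)) (hg : ∀ b n, g (l b n) = l' b (g n)) :
    BalTensor r l →ₗ[k] BalTensor r' l' :=
  BalTensor.lift r l (BalTensor.mk r' l' ∘ₗ TensorProduct.map f g) (by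
    intro b m n
    simp only [LinearMap.comp_apply, TensorProduct.map_tmul, hf, hg]
    exact BalTensor.mk_eq r' l' b (f m) (g n))

/-- The relations of the triple tensor product over `B`. -/
def balRel₃ (rM : B → Module.End k M) (lN rN : B → Module.End k N) (lP : B → Module.End k P) :
    Submodule k (M ⊗[k] (N ⊗[k] P)) :=
  Submodule.span k
    ({z | ∃ b m n p, z = rM b m ⊗ₜ[k] (n ⊗ₜ[k] p) - m ⊗ₜ[k] (lN b n ⊗ₜ[k] p)} ∪
      {z | ∃ b m n p, z = m ⊗ₜ[k] (rN b n ⊗ₜ[k] p) - m ⊗ₜ[k] (n ⊗ₜ[k] lP b p)})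

/-- The triple tensor product `M ⊗_B N ⊗_B P`. -/
abbrev BalTensor₃ (rM : B → Module.End k M) (lN rN : B → Module.End k N)
    (lP : B → Module.End k P) : Type _ :=
  (M ⊗[k] (N ⊗[k] P)) ⧸ balRel₃ rM lN rN lP

/-- The canonical map `M ⊗ (N ⊗_B P) → M ⊗_B N ⊗_B P`. -/
noncomputable def toBal₃Right (rM : B → Module.End k M) (lN rN : B → Module.End k N)
    (lP : B → Module.End k P) :
    M ⊗[k] BalTensor rN lP →ₗ[k] BalTensor₃ rM lN rN lP :=
  TensorProduct.lift (LinearMap.flip (BalTensor.lift rN lP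
    (LinearMap.flip ((TensorProduct.mk k M (N ⊗[k] P)).compr₂ (balRel₃ rM lN rN lP).mkQ)) (by
      intro b n p
      ext m
      rw [← sub_eq_zero, ← LinearMap.sub_apply, ← map_sub]
      refine (Submodule.Quotient.mk_eq_zero _).2 ?_
      refine Submodule.subset_span (Or.inr ⟨b, m, n, p, ?_⟩)
      simp [TensorProduct.tmul_sub])))

/-- The canonical map `(M ⊗_B N) ⊗ P → M ⊗_B N ⊗_B P`. -/
noncomputable def toBal₃Left (rM : B → Module.End k M) (lN rN : B → Module.End k N)
    (lP : B → Module.End k P) :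
    BalTensor rM lN ⊗[k] P →ₗ[k] BalTensor₃ rM lN rN lP :=
  TensorProduct.lift (BalTensor.lift rM lN
    (TensorProduct.curry ((balRel₃ rM lN rN lP).mkQ ∘ₗ
      (TensorProduct.assoc k M N P).toLinearMap)) (by
      intro b m n
      ext p
      rw [← sub_eq_zero, ← LinearMap.sub_apply, ← map_sub]
      refine (Submodule.Quotient.mk_eq_zero _).2 ?_
      refine Submodule.subset_span (Or.inl ⟨b, m, n, p, ?_⟩)
      simp))

end Balanced

section Actions

variable (k : Type*) [CommRing k] (S : Type*) [Ring S] [Algebra k S]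
  (M : Type*) [AddCommGroup M] [Module k M]

/-- The left action `S → Hom_k(M, M)`, `s ↦ (m ↦ s m)`. -/
def lact [Module S M] [IsScalarTower k S M] : S →ₗ[k] M →ₗ[k] M :=
  (Algebra.lsmul k k M : S →ₐ[k] Module.End k M).toLinearMap

/-- The right action `S → Hom_k(M, M)`, `s ↦ (m ↦ m s)`; as usual in Mathlib, right
`S`-modules are modules over `Sᵐᵒᵖ`. -/
def ract [Module Sᵐᵒᵖ M] [IsScalarTower k Sᵐᵒᵖ M] : S →ₗ[k] M →ₗ[k] M :=
  (Algebra.lsmul k k M : Sᵐᵒᵖ →ₐ[k] Module.End k M).toLinearMap ∘ₗ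
    (opLinearEquiv k : S ≃ₗ[k] Sᵐᵒᵖ).toLinearMap

end Actions

/-! ### Comodule algebras and Hopf-Galois extensions -/

/-- A right comodule algebra `A` over the bialgebra `H`. -/
structure RightComoduleAlgebra (k : Type u) (H : Type v) (A : Type w) [Field k]
    [Ring H] [HopfAlgebra k H] [Ring A] [Algebra k A] where
  /-- the coaction `a ↦ a₍₀₎ ⊗ a₍₁₎`, an algebra map -/
  ρ : A →ₐ[k] A ⊗[k] H
  coassoc : ∀ a, TensorProduct.assoc k A H H (ρ.toLinearMap.rTensor H (ρ a)) =
    (Coalgebra.comul (R := k) (A := H)).lTensor A (ρ a)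
  counit : ∀ a, TensorProduct.rid k A ((Coalgebra.counit (R := k) (A := H)).lTensor A (ρ a)) = a

namespace RightComoduleAlgebra

variable {k : Type u} {H : Type v} {A : Type w} [Field k] [Ring H] [HopfAlgebra k H]
  [Ring A] [Algebra k A] (C : RightComoduleAlgebra k H A)

/-- The subalgebra `B = A^{co H} = {a | a₍₀₎ ⊗ a₍₁₎ = a ⊗ 1}`. -/
def coinv : Subalgebra k A :=
  AlgHom.equalizer C.ρ Algebra.TensorProduct.includeLeft

theorem ρ_coinv (b : C.coinv) : C.ρ (b : A) = (b : A) ⊗ₜ[k] (1 : H) := b.2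

/-- Right multiplication by elements of `B` on `A`. -/
def rB (b : C.coinv) : Module.End k A := LinearMap.mulRight k (b : A)

/-- Left multiplication by elements of `B` on `A`. -/
def lB (b : C.coinv) : Module.End k A := LinearMap.mulLeft k (b : A)

/-- `A ⊗_B A`. -/
abbrev ABA : Type _ := BalTensor C.rB C.lB

/-- The Galois map `χ : A ⊗_B A → A ⊗ H`, `a ⊗ a' ↦ a a'₍₀₎ ⊗ a'₍₁₎`. -/
noncomputable def galoisMap : C.ABA →ₗ[k] A ⊗[k] H :=
  BalTensor.lift C.rB C.lB
    (LinearMap.mul' k (A ⊗[k] H) ∘ₗ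
      TensorProduct.map (Algebra.TensorProduct.includeLeft (R := k) (S := k) (A := A)
        (B := H)).toLinearMap C.ρ.toLinearMap) (by
      intro b a a'
      simp [rB, lB, C.ρ_coinv, ← mul_assoc])

/-- `A^{co H} ⊆ A` is a Hopf-Galois extension: the Galois map is bijective. -/
def IsHopfGalois : Prop := Function.Bijective C.galoisMap

/-- The map `f ⊗_B A : M ⊗_B A → N ⊗_B A` induced by a map of right `B`-modules. -/
noncomputable def tensorA {M N : Type w} [AddCommGroup M] [Module k M] [Module C.coinvᵐᵒᵖ M]
    [IsScalarTower k C.coinvᵐᵒᵖ M] [AddCommGroup N] [Module k N] [Module C.coinvᵐᵒᵖ N]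
    [IsScalarTower k C.coinvᵐᵒᵖ N] (f : M →ₗ[C.coinvᵐᵒᵖ] N) :
    BalTensor (ract k C.coinv M) C.lB →ₗ[k] BalTensor (ract k C.coinv N) C.lB :=
  BalTensor.map (f.restrictScalars k) LinearMap.id (by intro b m; simp [ract]) (by simp)

/-- `A` is faithfully flat as a left `B`-module: a sequence `M → N → P` of right `B`-modules is
exact if and only if `M ⊗_B A → N ⊗_B A → P ⊗_B A` is exact. -/
def IsLeftFaithfullyFlat : Prop :=
  ∀ (M N P : Type w) [AddCommGroup M] [Module k M] [Module C.coinvᵐᵒᵖ M]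
    [IsScalarTower k C.coinvᵐᵒᵖ M] [AddCommGroup N] [Module k N] [Module C.coinvᵐᵒᵖ N]
    [IsScalarTower k C.coinvᵐᵒᵖ N] [AddCommGroup P] [Module k P] [Module C.coinvᵐᵒᵖ P]
    [IsScalarTower k C.coinvᵐᵒᵖ P] (f : M →ₗ[C.coinvᵐᵒᵖ] N) (g : N →ₗ[C.coinvᵐᵒᵖ] P),
    Function.Exact f g ↔ Function.Exact (C.tensorA f) (C.tensorA g)

/-- The translation map `τ : H → A ⊗_B A`, `τ(h) = χ⁻¹(1 ⊗ h)`. -/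
noncomputable def translation (hG : C.IsHopfGalois) : H →ₗ[k] C.ABA :=
  (LinearEquiv.ofBijective C.galoisMap hG).symm.toLinearMap ∘ₗ TensorProduct.mk k A H 1

/-- The diagonal coaction on `A ⊗ A`, `a ⊗ a' ↦ (a₍₀₎ ⊗ a'₍₀₎) ⊗ a₍₁₎ a'₍₁₎`. -/
noncomputable def diag : A ⊗[k] A →ₗ[k] (A ⊗[k] A) ⊗[k] H :=
  TensorProduct.map LinearMap.id (LinearMap.mul' k H) ∘ₗ
    (TensorProduct.tensorTensorTensorComm k A H A H).toLinearMap ∘ₗ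
      TensorProduct.map C.ρ.toLinearMap C.ρ.toLinearMap

/-- `(A ⊗ A)^{co H}` as a subspace of `A ⊗ A`. -/
noncomputable def diagCoinv : Submodule k (A ⊗[k] A) :=
  LinearMap.eqLocus C.diag ((TensorProduct.mk k (A ⊗[k] A) H).flip 1)

/-! ### The Ehresmann-Schauenburg bialgebroid -/

variable (k A) in
/-- The identification of `A ⊗ A` with the algebra `A ⊗ Aᵒᵖ`, whose product is
`(a ⊗ a')(c ⊗ c') = a c ⊗ c' a'`. -/
noncomputable def unopR : A ⊗[k] Aᵐᵒᵖ ≃ₗ[k] A ⊗[k] A :=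
  LinearEquiv.lTensor A (opLinearEquiv k : A ≃ₗ[k] Aᵐᵒᵖ).symm

theorem unopR_tmul (a a' : A) : unopR k A (a ⊗ₜ[k] op a') = a ⊗ₜ[k] a' := by
  simp [unopR]

/-- The map `(a ⊗ g) ⊗ (a' ⊗ g') ↦ (a ⊗ a') ⊗ g g'`. -/
noncomputable def collect : (A ⊗[k] H) ⊗[k] (A ⊗[k] H) →ₗ[k] (A ⊗[k] A) ⊗[k] H :=
  TensorProduct.map LinearMap.id (LinearMap.mul' k H) ∘ₗ
    (TensorProduct.tensorTensorTensorComm k A H A H).toLinearMap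

theorem diag_tmul (a a' : A) : C.diag (a ⊗ₜ[k] a') = collect (C.ρ a ⊗ₜ[k] C.ρ a') := rfl

theorem collect_mul (p q : A) (g h : H) (X Y : A ⊗[k] H) :
    collect (((p ⊗ₜ[k] g) * X) ⊗ₜ[k] (Y * (q ⊗ₜ[k] h))) =
      TensorProduct.map (TensorProduct.map (LinearMap.mulLeft k p) (LinearMap.mulRight k q))
        (LinearMap.mulLeft k g ∘ₗ LinearMap.mulRight k h) (collect (X ⊗ₜ[k] Y)) := by
  induction X with
  | zero => simp
  | add X₁ X₂ h₁ h₂ => simp only [mul_add, TensorProduct.add_tmul, map_add, h₁, h₂]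
  | tmul c f =>
    induction Y with
    | zero => simp
    | add X₁ X₂ h₁ h₂ => simp only [add_mul, TensorProduct.tmul_add, map_add, h₁, h₂]
    | tmul c' f' => simp [collect, mul_assoc]

theorem diag_mul_of_coinv (x y : A ⊗[k] Aᵐᵒᵖ)
    (hy : C.diag (unopR k A y) = unopR k A y ⊗ₜ[k] (1 : H)) :
    C.diag (unopR k A (x * y)) =
      TensorProduct.map ((unopR k A).toLinearMap ∘ₗ LinearMap.mulRight k y ∘ₗ
        (unopR k A).symm.toLinearMap) LinearMap.id (C.diag (unopR k A x)) := by
  classical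
  induction x with
  | zero => simp
  | add x₁ x₂ h₁ h₂ => simp only [add_mul, map_add, h₁, h₂]
  | tmul a a' =>
    obtain ⟨a', rfl⟩ := op_surjective a'
    obtain ⟨s, hs⟩ := TensorProduct.exists_finset (C.ρ a)
    obtain ⟨s', hs'⟩ := TensorProduct.exists_finset (C.ρ a')
    have key : ∀ z : A ⊗[k] Aᵐᵒᵖ, C.diag (unopR k A ((a ⊗ₜ[k] op a') * z)) =
        ∑ i ∈ s, ∑ j ∈ s', TensorProduct.map
          (TensorProduct.map (LinearMap.mulLeft k i.1) (LinearMap.mulRight k j.1))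
          (LinearMap.mulLeft k i.2 ∘ₗ LinearMap.mulRight k j.2) (C.diag (unopR k A z)) := by
      intro z
      induction z with
      | zero => simp
      | add z₁ z₂ h₁ h₂ =>
        simp only [mul_add, map_add, h₁, h₂, Finset.sum_add_distrib]
      | tmul c c' =>
        obtain ⟨c', rfl⟩ := op_surjective c'
        rw [Algebra.TensorProduct.tmul_mul_tmul, ← op_mul, unopR_tmul, unopR_tmul, diag_tmul,
          diag_tmul, map_mul, map_mul, hs, hs']
        simp only [Finset.sum_mul, Finset.mul_sum, TensorProduct.sum_tmul,
          TensorProduct.tmul_sum, map_sum, collect_mul]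
        exact Finset.sum_comm
    have key2 : ∀ (p q : A) (g h : H) (z : A ⊗[k] Aᵐᵒᵖ),
        TensorProduct.map (TensorProduct.map (LinearMap.mulLeft k p) (LinearMap.mulRight k q))
          (LinearMap.mulLeft k g ∘ₗ LinearMap.mulRight k h) (unopR k A z ⊗ₜ[k] (1 : H)) =
        unopR k A ((p ⊗ₜ[k] op q) * z) ⊗ₜ[k] (g * h) := by
      intro p q g h z
      induction z with
      | zero => simp
      | add z₁ z₂ h₁ h₂ => simp only [mul_add, map_add, TensorProduct.add_tmul, h₁, h₂]
      | tmul c c' =>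
        obtain ⟨c', rfl⟩ := op_surjective c'
        rw [Algebra.TensorProduct.tmul_mul_tmul, ← op_mul, unopR_tmul, unopR_tmul]
        simp
    have symm_tmul : ∀ p q : A, (unopR k A).symm (p ⊗ₜ[k] q) = p ⊗ₜ[k] op q := by
      intro p q
      rw [LinearEquiv.symm_apply_eq, unopR_tmul]
    rw [key, hy, unopR_tmul, diag_tmul, hs, hs']
    simp only [key2, TensorProduct.sum_tmul, TensorProduct.tmul_sum, map_sum]
    rw [Finset.sum_comm]
    refine Finset.sum_congr rfl fun j _ => Finset.sum_congr rfl fun i _ => ?_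
    simp [collect, symm_tmul]

/-- `(A ⊗ A)^{co H}` as a subalgebra of `A ⊗ Aᵒᵖ`. -/
noncomputable def esSubalgebra : Subalgebra k (A ⊗[k] Aᵐᵒᵖ) where
  carrier := {x | unopR k A x ∈ C.diagCoinv}
  mul_mem' := by
    intro x y hx hy
    have hx' : C.diag (unopR k A x) = unopR k A x ⊗ₜ[k] (1 : H) := hx
    change C.diag (unopR k A (x * y)) = unopR k A (x * y) ⊗ₜ[k] (1 : H)
    rw [C.diag_mul_of_coinv x y hy, hx']
    simp
  add_mem' := by
    intro x y hx hy
    change unopR k A (x + y) ∈ C.diagCoinv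
    rw [map_add]
    exact add_mem hx hy
  algebraMap_mem' := by
    intro c
    change C.diag (unopR k A (algebraMap k (A ⊗[k] Aᵐᵒᵖ) c)) =
      unopR k A (algebraMap k (A ⊗[k] Aᵐᵒᵖ) c) ⊗ₜ[k] (1 : H)
    rw [Algebra.algebraMap_eq_smul_one, Algebra.TensorProduct.one_def, ← op_one, map_smul,
      unopR_tmul, map_smul, diag_tmul, map_one, Algebra.TensorProduct.one_def]
    simp [collect, TensorProduct.smul_tmul']

/-- The algebra `(A ⊗ A)^{co H}` underlying the Ehresmann-Schauenburg bialgebroid. -/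
def ES : Type w := C.esSubalgebra

noncomputable instance : Ring C.ES := inferInstanceAs (Ring C.esSubalgebra)

noncomputable instance : Algebra k C.ES := inferInstanceAs (Algebra k C.esSubalgebra)

/-- The inclusion of `(A ⊗ A)^{co H}` into `A ⊗ Aᵒᵖ`. -/
noncomputable def esVal : C.ES →ₐ[k] A ⊗[k] Aᵐᵒᵖ := C.esSubalgebra.val

theorem esVal_injective : Function.Injective C.esVal := Subtype.val_injective

/-- The inclusion of `(A ⊗ A)^{co H}` into `A ⊗ A`. -/
noncomputable def esIncl : C.ES →ₗ[k] A ⊗[k] A :=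
  (unopR k A).toLinearMap ∘ₗ C.esVal.toLinearMap

/-- The source map `s(b) = b ⊗ 1`. -/
noncomputable def source (b : C.coinv) : C.ES :=
  ⟨(b : A) ⊗ₜ[k] 1, by
    change C.diag (unopR k A ((b : A) ⊗ₜ[k] op 1)) = unopR k A ((b : A) ⊗ₜ[k] op 1) ⊗ₜ[k] (1 : H)
    rw [unopR_tmul, diag_tmul, C.ρ_coinv, map_one, Algebra.TensorProduct.one_def]
    simp [collect]⟩

/-- The target map `t(b) = 1 ⊗ b`. -/
noncomputable def target (b : C.coinv) : C.ES :=
  ⟨1 ⊗ₜ[k] op (b : A), by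
    change C.diag (unopR k A (1 ⊗ₜ[k] op (b : A))) = unopR k A (1 ⊗ₜ[k] op (b : A)) ⊗ₜ[k] (1 : H)
    rw [unopR_tmul, diag_tmul, C.ρ_coinv, map_one, Algebra.TensorProduct.one_def]
    simp [collect]⟩

theorem esVal_source (b : C.coinv) : C.esVal (C.source b) = (b : A) ⊗ₜ[k] 1 := rfl

theorem esVal_target (b : C.coinv) : C.esVal (C.target b) = 1 ⊗ₜ[k] op (b : A) := rfl

theorem source_mul_target (b c : C.coinv) :
    C.source b * C.target c = C.target c * C.source b := by
  apply C.esVal_injective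
  simp [esVal_source, esVal_target]

/-- The right `B`-action `h ◁ b = t(b) h` on the bialgebroid. -/
noncomputable def rES (b : C.coinv) : Module.End k C.ES := LinearMap.mulLeft k (C.target b)

/-- The left `B`-action `b ▷ m = s(b) m` on a left module over the bialgebroid. -/
noncomputable def lES (M : Type*) [AddCommGroup M] [Module k M] [Module C.ES M]
    [IsScalarTower k C.ES M] (b : C.coinv) : Module.End k M :=
  lact k C.ES M (C.source b)

/-- The balanced tensor product of the bialgebroid (with `◁`) and a left module `M` (with `▷`)
over `B`. -/
noncomputable abbrev ESTensor (M : Type*) [AddCommGroup M] [Module k M] [Module C.ES M]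
    [IsScalarTower k C.ES M] : Type _ :=
  BalTensor C.rES (C.lES M)

/-- The projection onto the balanced tensor product. -/
noncomputable abbrev esMk (M : Type*) [AddCommGroup M] [Module k M] [Module C.ES M]
    [IsScalarTower k C.ES M] : C.ES ⊗[k] M →ₗ[k] C.ESTensor M :=
  BalTensor.mk C.rES (C.lES M)

/-- The counit with values in `A`: `a ⊗ a' ↦ a a'`. -/
noncomputable def counitA : C.ES →ₗ[k] A := LinearMap.mul' k A ∘ₗ C.esIncl

theorem mul'_collect (X Y : A ⊗[k] H) :
    (LinearMap.mul' k A).rTensor H (collect (X ⊗ₜ[k] Y)) = X * Y := by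
  induction X with
  | zero => simp
  | add X₁ X₂ h₁ h₂ => simp only [add_mul, TensorProduct.add_tmul, map_add, h₁, h₂]
  | tmul c f =>
    induction Y with
    | zero => simp
    | add X₁ X₂ h₁ h₂ => simp only [mul_add, TensorProduct.tmul_add, map_add, h₁, h₂]
    | tmul c' f' => simp [collect]

theorem mul'_diag (x : A ⊗[k] A) :
    (LinearMap.mul' k A).rTensor H (C.diag x) = C.ρ (LinearMap.mul' k A x) := by
  induction x with
  | zero => simp
  | add x y hx hy => simp only [map_add, hx, hy]
  | tmul a a' => rw [diag_tmul, mul'_collect, LinearMap.mul'_apply, map_mul]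

theorem counitA_mem (x : C.ES) : C.counitA x ∈ Subalgebra.toSubmodule C.coinv := by
  have hx : C.diag (C.esIncl x) = C.esIncl x ⊗ₜ[k] (1 : H) := x.2
  change C.ρ (LinearMap.mul' k A (C.esIncl x)) = LinearMap.mul' k A (C.esIncl x) ⊗ₜ[k] (1 : H)
  rw [← mul'_diag, hx]
  simp

/-- The counit `ε : (A ⊗ A)^{co H} → B`, `a ⊗ a' ↦ a a'`. -/
noncomputable def ε : C.ES →ₗ[k] C.coinv :=
  C.counitA.codRestrict (Subalgebra.toSubmodule C.coinv) C.counitA_mem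

theorem mul'_unopR_mul (x y : A ⊗[k] Aᵐᵒᵖ) : LinearMap.mul' k A (unopR k A (x * y)) =
    TensorProduct.lift ((LinearMap.mul k A).compr₂ (LinearMap.id))
      (TensorProduct.map (LinearMap.id) (LinearMap.mulLeft k (LinearMap.mul' k A (unopR k A y)))
        (unopR k A x)) := by
  induction x with
  | zero => simp
  | add x₁ x₂ h₁ h₂ => simp only [add_mul, map_add, h₁, h₂]
  | tmul a a' =>
    obtain ⟨a', rfl⟩ := op_surjective a'
    induction y with
    | zero => simp
    | add y₁ y₂ h₁ h₂ =>
      rw [mul_add, map_add, map_add, h₁, h₂, unopR_tmul]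
      simp [add_mul, mul_add]
    | tmul c c' =>
      obtain ⟨c', rfl⟩ := op_surjective c'
      rw [Algebra.TensorProduct.tmul_mul_tmul, ← op_mul, unopR_tmul, unopR_tmul, unopR_tmul]
      simp [mul_assoc]

/-- The kernel of the counit, which is a left ideal. (`Ideal` means left ideal here.) -/
noncomputable def plus : Ideal C.ES where
  carrier := {x | C.ε x = 0}
  add_mem' := by
    intro x y hx hy
    change C.ε (x + y) = 0
    rw [map_add, show C.ε x = 0 from hx, show C.ε y = 0 from hy, add_zero]
  zero_mem' := map_zero _
  smul_mem' := by
    intro x y hy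
    have hy' : LinearMap.mul' k A (unopR k A (C.esVal y)) = 0 :=
      congrArg Subtype.val (show C.ε y = 0 from hy)
    apply Subtype.ext
    change LinearMap.mul' k A (unopR k A (C.esVal x * C.esVal y)) = 0
    rw [mul'_unopR_mul, hy']
    simp

/-- `x ↦ a₍₀₎ ⊗ τ(a₍₁₎) ⊗ a'` for `x = a ⊗ a'`, as a map to `A ⊗ (A ⊗_B A) ⊗ A`. -/
noncomputable def comulFormula (hG : C.IsHopfGalois) : C.ES →ₗ[k] (A ⊗[k] C.ABA) ⊗[k] A :=
  ((C.translation hG).lTensor A ∘ₗ C.ρ.toLinearMap).rTensor A ∘ₗ C.esIncl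

/-- The map `(a ⊗ a') ⊗ (c ⊗ c') ↦ a ⊗ (a' ⊗_B c) ⊗ c'`. -/
noncomputable def regroup : (A ⊗[k] A) ⊗[k] (A ⊗[k] A) →ₗ[k] (A ⊗[k] C.ABA) ⊗[k] A :=
  (((BalTensor.mk C.rB C.lB).lTensor A ∘ₗ
      (TensorProduct.assoc k A A A).toLinearMap).rTensor A) ∘ₗ
    (TensorProduct.assoc k (A ⊗[k] A) A A).symm.toLinearMap

theorem regroup_bal (b : C.coinv) (x y : A ⊗[k] Aᵐᵒᵖ) :
    C.regroup (unopR k A ((1 ⊗ₜ[k] op (b : A)) * x) ⊗ₜ[k] unopR k A y) =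
      C.regroup (unopR k A x ⊗ₜ[k] unopR k A (((b : A) ⊗ₜ[k] 1) * y)) := by
  induction x with
  | zero => simp
  | add x₁ x₂ h₁ h₂ => simp only [mul_add, map_add, TensorProduct.add_tmul, h₁, h₂]
  | tmul a a' =>
    obtain ⟨a', rfl⟩ := op_surjective a'
    induction y with
    | zero => simp
    | add x₁ x₂ h₁ h₂ => simp only [mul_add, map_add, TensorProduct.tmul_add, h₁, h₂]
    | tmul c c' =>
      obtain ⟨c', rfl⟩ := op_surjective c'
      rw [Algebra.TensorProduct.tmul_mul_tmul, Algebra.TensorProduct.tmul_mul_tmul, ← op_mul,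
        one_mul, one_mul, unopR_tmul, unopR_tmul, unopR_tmul, unopR_tmul]
      have := BalTensor.mk_eq C.rB C.lB b a' c
      simp only [rB, lB, LinearMap.mulRight_apply, LinearMap.mulLeft_apply] at this
      simp only [regroup, LinearMap.comp_apply, LinearEquiv.coe_coe,
        TensorProduct.assoc_symm_tmul, LinearMap.rTensor_tmul, TensorProduct.assoc_tmul,
        LinearMap.lTensor_tmul]
      rw [this]

/-- The map `(a ⊗ a') ⊗ (c ⊗ c') ↦ a ⊗ (a' ⊗_B c) ⊗ c'` on the bialgebroid. -/
noncomputable def regroupES : C.ES ⊗[k] C.ES →ₗ[k] (A ⊗[k] C.ABA) ⊗[k] A :=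
  C.regroup ∘ₗ TensorProduct.map C.esIncl C.esIncl

theorem regroupES_bal (b : C.coinv) (x y : C.ES) :
    C.regroupES (C.rES b x ⊗ₜ[k] y) = C.regroupES (x ⊗ₜ[k] C.lES C.ES b y) := by
  have h := C.regroup_bal b (C.esVal x) (C.esVal y)
  rw [← esVal_target, ← esVal_source, ← map_mul, ← map_mul] at h
  exact h

/-- The canonical map from the balanced square of the bialgebroid to `A ⊗ (A ⊗_B A) ⊗ A`,
`(a ⊗ a') ⊗_B (c ⊗ c') ↦ a ⊗ (a' ⊗_B c) ⊗ c'`. -/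
noncomputable def esSquareIncl : C.ESTensor C.ES →ₗ[k] (A ⊗[k] C.ABA) ⊗[k] A :=
  BalTensor.lift (P := (A ⊗[k] C.ABA) ⊗[k] A) C.rES (C.lES C.ES) C.regroupES C.regroupES_bal

open Classical in
/-- The coproduct `Δ` of the bialgebroid: the map with
`Δ(a ⊗ a') = (a₍₀₎ ⊗ a₍₁₎^⟨1⟩) ⊗_B (a₍₁₎^⟨2⟩ ⊗ a')`, an identity that is read in
`A ⊗ (A ⊗_B A) ⊗ A`. That such a map exists, and that it is unique because the comparison map
`esSquareIncl` is injective, is a fact about faithfully flat extensions. -/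
noncomputable def Δ (hG : C.IsHopfGalois) : C.ES →ₗ[k] C.ESTensor C.ES :=
  if h : ∃ D : C.ES →ₗ[k] C.ESTensor C.ES, C.esSquareIncl ∘ₗ D = C.comulFormula hG
  then h.choose else 0

/-! ### Left covariant calculi on the bialgebroid -/

theorem counitA_target_mul (b : C.coinv) (x : C.ES) (c : C.coinv) :
    C.ε (C.target b * x * C.source c) = C.ε (x * C.source c) * b := by
  apply Subtype.ext
  change LinearMap.mul' k A (unopR k A ((1 ⊗ₜ[k] op (b : A)) * (C.esVal x) *
      ((c : A) ⊗ₜ[k] 1))) =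
    LinearMap.mul' k A (unopR k A ((C.esVal x) * ((c : A) ⊗ₜ[k] 1))) * (b : A)
  rw [mul_assoc]
  generalize (C.esVal x) * ((c : A) ⊗ₜ[k] 1) = z
  induction z with
  | zero => simp
  | add x₁ x₂ h₁ h₂ => simp only [mul_add, add_mul, map_add, h₁, h₂]
  | tmul a a' =>
    obtain ⟨a', rfl⟩ := op_surjective a'
    rw [Algebra.TensorProduct.tmul_mul_tmul, ← op_mul, unopR_tmul, unopR_tmul]
    simp [mul_assoc]

theorem source_mul (b c : C.coinv) : C.source (b * c) = C.source b * C.source c := by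
  apply C.esVal_injective
  simp [esVal_source]

/-- The source map as a `k`-linear map. -/
noncomputable def sourceLin : C.coinv →ₗ[k] C.ES where
  toFun := C.source
  map_add' b c := C.esVal_injective (by simp [esVal_source, TensorProduct.add_tmul])
  map_smul' r b := C.esVal_injective (by simp [esVal_source, TensorProduct.smul_tmul'])

section Modules

variable (M : Type*) [AddCommGroup M] [Module k M] [Module C.ES M] [IsScalarTower k C.ES M]

/-- The map `h ⊗_B m ↦ ε(h ◂ b) m`, where `h ◂ b = h s(b)`. -/
noncomputable def contract (b : C.coinv) : C.ESTensor M →ₗ[k] M :=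
  BalTensor.lift C.rES (C.lES M)
    (TensorProduct.lift (lact k C.ES M ∘ₗ C.sourceLin ∘ₗ C.ε ∘ₗ
      LinearMap.mulRight k (C.source b))) (by
    intro c h m
    simp only [TensorProduct.lift.tmul, LinearMap.comp_apply, rES, lES, lact,
      LinearMap.mulLeft_apply, LinearMap.mulRight_apply, counitA_target_mul]
    change C.source _ • m = C.source _ • (C.source _ • m)
    rw [source_mul, mul_smul])

/-- Left multiplication by `s(b)` on the first factor of the balanced tensor product. -/
noncomputable def sourceMulLeft (b : C.coinv) : C.ESTensor M →ₗ[k] C.ESTensor M :=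
  BalTensor.map (LinearMap.mulLeft k (C.source b)) LinearMap.id (by
    intro c h
    simp only [rES, LinearMap.mulLeft_apply, ← mul_assoc, source_mul_target]) (by simp)

/-- The product `(g ⊗ g') · (h ⊗ m) = g h ⊗ g' m`. -/
noncomputable def leftProd : C.ES ⊗[k] C.ES →ₗ[k] C.ES ⊗[k] M →ₗ[k] C.ES ⊗[k] M :=
  TensorProduct.map₂ (LinearMap.mul k C.ES) (lact k C.ES M)

/-- The product `(h ⊗ m) · (g ⊗ g') = h g ⊗ m g'`, with the factor `g ⊗ g'` written first. -/
noncomputable def rightProd [Module C.ESᵐᵒᵖ M] [IsScalarTower k C.ESᵐᵒᵖ M] :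
    C.ES ⊗[k] C.ES →ₗ[k] C.ES ⊗[k] M →ₗ[k] C.ES ⊗[k] M :=
  TensorProduct.map₂ (LinearMap.mul k C.ES).flip (ract k C.ES M)

end Modules

/-- A left covariant first order differential calculus `(Ω, d)` on the Ehresmann-Schauenburg
bialgebroid.

The products `Δ(x) λ(ω)` and `λ(ω) Δ(x)` are those of the Takeuchi product; they are computed on
arbitrary representatives `y`, `z` of `Δ(x)`, `λ(ω)` in the tensor products over `k`. -/
structure LeftCovariantCalculus (hG : C.IsHopfGalois) where
  /-- the space of one-forms -/
  Ω : Type w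
  [addCommGroup : AddCommGroup Ω]
  [module : Module k Ω]
  [leftModule : Module C.ES Ω]
  [rightModule : Module C.ESᵐᵒᵖ Ω]
  [leftTower : IsScalarTower k C.ES Ω]
  [rightTower : IsScalarTower k C.ESᵐᵒᵖ Ω]
  [bimodule : SMulCommClass C.ES C.ESᵐᵒᵖ Ω]
  /-- the differential -/
  d : C.ES →ₗ[k] Ω
  d_source_mul : ∀ (b : C.coinv) (x : C.ES), d (C.source b * x) = C.source b • d x
  d_mul_source : ∀ (b : C.coinv) (x : C.ES), d (x * C.source b) = op (C.source b) • d x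
  leibniz : ∀ x y : C.ES, d (x * y) = op y • d x + x • d y
  span_d : Submodule.span k {ω | ∃ x y : C.ES, ω = x • d y} = ⊤
  /-- the left coaction -/
  coact : Ω →ₗ[k] C.ESTensor Ω
  coact_source : ∀ (b : C.coinv) (ω : Ω),
    coact (C.source b • ω) = C.sourceMulLeft Ω b (coact ω)
  counit : ∀ ω : Ω, C.contract Ω 1 (coact ω) = ω
  coassoc : ∀ (ω : Ω) (z : C.ES ⊗[k] Ω), C.esMk Ω z = coact ω →
    toBal₃Left C.rES (C.lES C.ES) C.rES (C.lES Ω) ((C.Δ hG).rTensor Ω z) =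
      toBal₃Right C.rES (C.lES C.ES) C.rES (C.lES Ω) (coact.lTensor C.ES z)
  /-- the right `B`-action induced by the coaction is the one induced by the right module
  structure -/
  induced_right : ∀ (b : C.coinv) (ω : Ω), C.contract Ω b (coact ω) = op (C.source b) • ω
  coact_left : ∀ (x : C.ES) (ω : Ω) (y : C.ES ⊗[k] C.ES) (z : C.ES ⊗[k] Ω),
    C.esMk C.ES y = C.Δ hG x → C.esMk Ω z = coact ω →
      coact (x • ω) = C.esMk Ω (C.leftProd Ω y z)
  coact_right : ∀ (x : C.ES) (ω : Ω) (y : C.ES ⊗[k] C.ES) (z : C.ES ⊗[k] Ω),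
    C.esMk C.ES y = C.Δ hG x → C.esMk Ω z = coact ω →
      coact (op x • ω) = C.esMk Ω (C.rightProd Ω y z)
  /-- the differential is colinear -/
  coact_d : ∀ x : C.ES, coact (d x) =
    BalTensor.map (LinearMap.id : C.ES →ₗ[k] C.ES) d (by simp)
      (fun b y => d_source_mul b y) (C.Δ hG x)

attribute [instance] LeftCovariantCalculus.addCommGroup LeftCovariantCalculus.module
  LeftCovariantCalculus.leftModule LeftCovariantCalculus.rightModule
  LeftCovariantCalculus.leftTower LeftCovariantCalculus.rightTower
  LeftCovariantCalculus.bimodule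

/-- An isomorphism of left covariant calculi. -/
structure LeftCovariantCalculus.Iso {C : RightComoduleAlgebra k H A} {hG : C.IsHopfGalois}
    (X Y : C.LeftCovariantCalculus hG) where
  /-- the underlying bijection -/
  toEquiv : X.Ω ≃ₗ[k] Y.Ω
  map_left : ∀ (x : C.ES) (ω : X.Ω), toEquiv (x • ω) = x • toEquiv ω
  map_right : ∀ (x : C.ES) (ω : X.Ω), toEquiv (op x • ω) = op x • toEquiv ω
  map_d : ∀ x : C.ES, toEquiv (X.d x) = Y.d x
  map_coact : ∀ ω : X.Ω, Y.coact (toEquiv ω) =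
    BalTensor.map (LinearMap.id : C.ES →ₗ[k] C.ES) toEquiv.toLinearMap (by simp)
      (fun b η => map_left (C.source b) η) (X.coact ω)

/-- The left module `H⁺/I` over the bialgebroid, for a left ideal `I ⊆ H⁺`. -/
abbrev plusQuot (I : Ideal C.ES) : Type _ := C.plus ⧸ (I.submoduleOf C.plus)

/-- The left covariant calculus `X` is isomorphic to the calculus on the balanced tensor product
of the bialgebroid with `H⁺/I`, whose structure is `(g ⊗ [g']) x = g x ⊗ [g']`,
`x (g ⊗ [g']) = x₍₁₎ g ⊗ [x₍₂₎ g']`, `λ(g ⊗ [g']) = g₍₁₎ ⊗ (g₍₂₎ ⊗ [g'])` and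
`d x = (id ⊗ π)(Δ x - x ⊗ 1)`, where `π : H⁺ → H⁺/I` is the projection. -/
structure LeftCovariantCalculus.IdealIso {C : RightComoduleAlgebra k H A} {hG : C.IsHopfGalois}
    (I : Ideal C.ES) (X : C.LeftCovariantCalculus hG) where
  /-- the underlying bijection -/
  toEquiv : C.ESTensor (C.plusQuot I) ≃ₗ[k] X.Ω
  map_right : ∀ (x g : C.ES) (v : C.plusQuot I),
    toEquiv (C.esMk (C.plusQuot I) ((g * x) ⊗ₜ[k] v)) =
      op x • toEquiv (C.esMk (C.plusQuot I) (g ⊗ₜ[k] v))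
  map_left : ∀ (x g : C.ES) (v : C.plusQuot I) (y : C.ES ⊗[k] C.ES),
    C.esMk C.ES y = C.Δ hG x →
      toEquiv (C.esMk (C.plusQuot I) (C.leftProd (C.plusQuot I) y (g ⊗ₜ[k] v))) =
        x • toEquiv (C.esMk (C.plusQuot I) (g ⊗ₜ[k] v))
  map_coact : ∀ (g : C.ES) (v : C.plusQuot I) (y : C.ES ⊗[k] C.ES),
    C.esMk C.ES y = C.Δ hG g →
      X.coact (toEquiv (C.esMk (C.plusQuot I) (g ⊗ₜ[k] v))) =
        C.esMk X.Ω ((toEquiv.toLinearMap ∘ₗ C.esMk (C.plusQuot I) ∘ₗ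
          (TensorProduct.mk k C.ES (C.plusQuot I)).flip v).lTensor C.ES y)
  map_d : ∀ x : C.ES, ∃ z : C.ES ⊗[k] C.plus,
    C.esMk C.ES ((C.plus.subtype.restrictScalars k).lTensor C.ES z) =
        C.Δ hG x - C.esMk C.ES (x ⊗ₜ[k] 1) ∧
      X.d x = toEquiv (C.esMk (C.plusQuot I)
        (((I.submoduleOf C.plus).mkQ.restrictScalars k).lTensor C.ES z))

/-! ### Right covariant calculi on `A` -/

/-- A right `H`-covariant first order differential calculus `(Ω, d)` on `A`. -/
structure RightCovariantCalculus where
  /-- the space of one-forms -/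
  Ω : Type w
  [addCommGroup : AddCommGroup Ω]
  [module : Module k Ω]
  [leftModule : Module A Ω]
  [rightModule : Module Aᵐᵒᵖ Ω]
  [leftTower : IsScalarTower k A Ω]
  [rightTower : IsScalarTower k Aᵐᵒᵖ Ω]
  [bimodule : SMulCommClass A Aᵐᵒᵖ Ω]
  /-- the differential -/
  d : A →ₗ[k] Ω
  leibniz : ∀ a a' : A, d (a * a') = op a' • d a + a • d a'
  span_d : Submodule.span k {ω | ∃ a a' : A, ω = a • d a'} = ⊤
  /-- the right coaction -/
  coact : Ω →ₗ[k] Ω ⊗[k] H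
  counit : ∀ ω : Ω,
    TensorProduct.rid k Ω ((Coalgebra.counit (R := k) (A := H)).lTensor Ω (coact ω)) = ω
  coassoc : ∀ ω : Ω, TensorProduct.assoc k Ω H H (coact.rTensor H (coact ω)) =
    (Coalgebra.comul (R := k) (A := H)).lTensor Ω (coact ω)
  /-- `(a ω)₍₀₎ ⊗ (a ω)₍₁₎ = a₍₀₎ ω₍₀₎ ⊗ a₍₁₎ ω₍₁₎` -/
  coact_left : ∀ (a : A) (ω : Ω), coact (a • ω) =
    TensorProduct.map₂ (lact k A Ω) (LinearMap.mul k H) (C.ρ a) (coact ω)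
  /-- `(ω a)₍₀₎ ⊗ (ω a)₍₁₎ = ω₍₀₎ a₍₀₎ ⊗ ω₍₁₎ a₍₁₎` -/
  coact_right : ∀ (a : A) (ω : Ω), coact (op a • ω) =
    TensorProduct.map₂ (ract k A Ω) (LinearMap.mul k H).flip (C.ρ a) (coact ω)
  /-- the differential is colinear -/
  coact_d : ∀ a : A, coact (d a) = d.rTensor H (C.ρ a)

attribute [instance] RightCovariantCalculus.addCommGroup RightCovariantCalculus.module
  RightCovariantCalculus.leftModule RightCovariantCalculus.rightModule
  RightCovariantCalculus.leftTower RightCovariantCalculus.rightTower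
  RightCovariantCalculus.bimodule

/-- An isomorphism of right covariant calculi. -/
structure RightCovariantCalculus.Iso {C : RightComoduleAlgebra k H A}
    (X Y : C.RightCovariantCalculus) where
  /-- the underlying bijection -/
  toEquiv : X.Ω ≃ₗ[k] Y.Ω
  map_left : ∀ (a : A) (ω : X.Ω), toEquiv (a • ω) = a • toEquiv ω
  map_right : ∀ (a : A) (ω : X.Ω), toEquiv (op a • ω) = op a • toEquiv ω
  map_d : ∀ a : A, toEquiv (X.d a) = Y.d a
  map_coact : ∀ ω : X.Ω, Y.coact (toEquiv ω) = toEquiv.toLinearMap.rTensor H (X.coact ω)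

variable (k A) in
/-- The universal calculus `Ω^u_A = ker(m : A ⊗ A → A)`. -/
noncomputable def univ : Submodule k (A ⊗[k] A) := LinearMap.ker (LinearMap.mul' k A)

/-- `c (a ⊗ a') = c a ⊗ a'`. -/
noncomputable def leftMul (c : A) : Module.End k (A ⊗[k] A) :=
  (LinearMap.mulLeft k c).rTensor A

/-- `(a ⊗ a') c = a ⊗ a' c`. -/
noncomputable def rightMul (c : A) : Module.End k (A ⊗[k] A) :=
  (LinearMap.mulRight k c).lTensor A

/-- `J` is an `A`-subbimodule and right `H`-subcomodule of the universal calculus. -/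
structure IsCovariantSub (J : Submodule k (A ⊗[k] A)) : Prop where
  le_univ : J ≤ univ k A
  left_mem : ∀ (c : A), ∀ x ∈ J, leftMul c x ∈ J
  right_mem : ∀ (c : A), ∀ x ∈ J, rightMul c x ∈ J
  diag_mem : ∀ x ∈ J, C.diag x ∈ LinearMap.range (J.subtype.rTensor H)

/-- The right covariant calculus `X` is isomorphic to the quotient `Ω^u_A/J`, with the bimodule
structure and the coaction induced from `A ⊗ A` and with `d a = [1 ⊗ a - a ⊗ 1]`. -/
structure RightCovariantCalculus.QuotIso {C : RightComoduleAlgebra k H A}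
    (J : Submodule k (A ⊗[k] A)) (X : C.RightCovariantCalculus) where
  /-- the underlying bijection -/
  toEquiv : (univ k A ⧸ J.submoduleOf (univ k A)) ≃ₗ[k] X.Ω
  map_left : ∀ (c : A) (x y : univ k A), (y : A ⊗[k] A) = leftMul c (x : A ⊗[k] A) →
    toEquiv (Submodule.Quotient.mk y) = c • toEquiv (Submodule.Quotient.mk x)
  map_right : ∀ (c : A) (x y : univ k A), (y : A ⊗[k] A) = rightMul c (x : A ⊗[k] A) →
    toEquiv (Submodule.Quotient.mk y) = op c • toEquiv (Submodule.Quotient.mk x)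
  map_coact : ∀ x : univ k A, ∃ z : univ k A ⊗[k] H,
    (univ k A).subtype.rTensor H z = C.diag (x : A ⊗[k] A) ∧
      X.coact (toEquiv (Submodule.Quotient.mk x)) =
        (toEquiv.toLinearMap ∘ₗ (J.submoduleOf (univ k A)).mkQ).rTensor H z
  map_d : ∀ (a : A) (x : univ k A), (x : A ⊗[k] A) = 1 ⊗ₜ[k] a - a ⊗ₜ[k] 1 →
    X.d a = toEquiv (Submodule.Quotient.mk x)

/-! ### The two constructions and isomorphism classes -/

/-- `A I ⊆ A ⊗ A` for a left ideal `I` of the bialgebroid. -/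
noncomputable def extend (I : Ideal C.ES) : Submodule k (A ⊗[k] A) :=
  Submodule.span k {z | ∃ (a : A) (x : C.ES), x ∈ I ∧ z = leftMul a (C.esIncl x)}

/-- The left ideals of the bialgebroid that are contained in the kernel of the counit. -/
abbrev LeftIdealsInPlus : Type _ := {I : Ideal C.ES // I ≤ C.plus}

/-- The subbimodules and subcomodules of the universal calculus. -/
abbrev CovariantSubs : Type _ := {J : Submodule k (A ⊗[k] A) // C.IsCovariantSub J}

/-- Isomorphism of left covariant calculi, as an equivalence relation. -/
def leftSetoid (hG : C.IsHopfGalois) : Setoid (C.LeftCovariantCalculus hG) where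
  r X Y := Nonempty (X.Iso Y)
  iseqv := by
    refine ⟨fun X => ⟨⟨LinearEquiv.refl k X.Ω, fun _ _ => rfl, fun _ _ => rfl, fun _ => rfl,
      fun ω => ?_⟩⟩, fun {X Y} ⟨f⟩ => ⟨⟨f.toEquiv.symm, fun x ω => ?_, fun x ω => ?_,
      fun x => ?_, fun ω => ?_⟩⟩, fun {X Y Z} ⟨f⟩ ⟨g⟩ => ⟨⟨f.toEquiv.trans g.toEquiv,
      fun x ω => ?_, fun x ω => ?_, fun x => ?_, fun ω => ?_⟩⟩⟩
    · obtain ⟨z, hz⟩ := (balRel C.rES (C.lES X.Ω)).mkQ_surjective (X.coact ω)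
      change X.coact ω = _
      rw [← hz]
      exact (congrArg (C.esMk X.Ω) (LinearMap.congr_fun TensorProduct.map_id z)).symm
    · rw [LinearEquiv.symm_apply_eq, f.map_left, LinearEquiv.apply_symm_apply]
    · rw [LinearEquiv.symm_apply_eq, f.map_right, LinearEquiv.apply_symm_apply]
    · rw [LinearEquiv.symm_apply_eq, f.map_d]
    · obtain ⟨η, rfl⟩ := f.toEquiv.surjective ω
      rw [LinearEquiv.symm_apply_apply, f.map_coact]
      obtain ⟨z, hz⟩ := (balRel C.rES (C.lES X.Ω)).mkQ_surjective (X.coact η)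
      rw [← hz]
      refine congrArg (C.esMk X.Ω) (?_ : z = TensorProduct.map _ _ (TensorProduct.map _ _ z))
      rw [← LinearMap.comp_apply, ← TensorProduct.map_comp, LinearEquiv.symm_comp]
      exact (LinearMap.congr_fun TensorProduct.map_id z).symm
    · simp [f.map_left, g.map_left]
    · simp [f.map_right, g.map_right]
    · simp [f.map_d, g.map_d]
    · rw [LinearEquiv.trans_apply, g.map_coact, f.map_coact]
      obtain ⟨z, hz⟩ := (balRel C.rES (C.lES X.Ω)).mkQ_surjective (X.coact ω)
      rw [← hz]
      refine congrArg (C.esMk Z.Ω)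
        (?_ : TensorProduct.map _ _ (TensorProduct.map _ _ z) = TensorProduct.map _ _ z)
      rw [← LinearMap.comp_apply, ← TensorProduct.map_comp]
      rfl

/-- Isomorphism of right covariant calculi, as an equivalence relation. -/
def rightSetoid : Setoid C.RightCovariantCalculus where
  r X Y := Nonempty (X.Iso Y)
  iseqv := by
    refine ⟨fun X => ⟨⟨LinearEquiv.refl k X.Ω, fun _ _ => rfl, fun _ _ => rfl, fun _ => rfl,
      fun ω => ?_⟩⟩, fun {X Y} ⟨f⟩ => ⟨⟨f.toEquiv.symm, fun x ω => ?_, fun x ω => ?_,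
      fun x => ?_, fun ω => ?_⟩⟩, fun {X Y Z} ⟨f⟩ ⟨g⟩ => ⟨⟨f.toEquiv.trans g.toEquiv,
      fun x ω => ?_, fun x ω => ?_, fun x => ?_, fun ω => ?_⟩⟩⟩
    · exact (LinearMap.congr_fun (LinearMap.rTensor_id H X.Ω) (X.coact ω)).symm
    · rw [LinearEquiv.symm_apply_eq, f.map_left, LinearEquiv.apply_symm_apply]
    · rw [LinearEquiv.symm_apply_eq, f.map_right, LinearEquiv.apply_symm_apply]
    · rw [LinearEquiv.symm_apply_eq, f.map_d]
    · obtain ⟨η, rfl⟩ := f.toEquiv.surjective ω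
      rw [LinearEquiv.symm_apply_apply, f.map_coact, ← LinearMap.comp_apply,
        ← LinearMap.rTensor_comp, LinearEquiv.symm_comp, LinearMap.rTensor_id]
      rfl
    · simp [f.map_left, g.map_left]
    · simp [f.map_right, g.map_right]
    · simp [f.map_d, g.map_d]
    · rw [LinearEquiv.trans_apply, g.map_coact, f.map_coact, ← LinearMap.comp_apply,
        ← LinearMap.rTensor_comp]
      rfl

end RightComoduleAlgebra

end ESCalculus

/-! Write ℋ for the bialgebroid (A ⊗ A)^{co H}. The engine is descent. Let L be an A-bimodule with a
compatible H-coaction (`HopfBimodule`). Its coinvariants are the kernel of a right B-linear map from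
L to L ⊗_B A; after tensoring with A over B, the canonical maps turn the condition defining this
kernel into coassociativity, and flatness yields L^{co H} ⊗_B A ≅ L (`actMap_coinv_bijective`).
Faithfulness adds two converses: a B-stable subspace V of L^{co H} equals VA ∩ L^{co H}
(`mem_of_mem_spanA`), and a right B-linear map from M to L^{co H} is bijective as soon as the
induced map M ⊗_B A → L is (`injective_and_range_eq`).

Applied to A ⊗ L, this identifies ℋ ⊗_B L^{co H} with (A ⊗ L)^{co H} through (q ⊗ q') ⊗ m ↦ q ⊗ q'm
(`emb_injective_range`). In these terms the coproduct is a ⊗ a' ↦ a ⊗ 1 ⊗ a' (`embES_comul`), so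
statements about balanced tensors become visible identities in tensor powers of A. A right covariant
calculus Ω on A induces the left covariant calculus (A ⊗ Ω)^{co H} with differential id ⊗ d, where ℋ
acts from the left on the outer sides and from the right on the inner sides (`leftCalculus`). If Ω =
Ω^u/J and I = J^{co H}, then Ω^{co H} ≅ ℋ⁺/I, so this is the calculus of I (`idealIso`).

For the converse, bijectivity of the antipode gives a second isomorphism A ⊗_B ℋ ≅ A ⊗ A
(`leftES_bijective`) and from it an isomorphism of the tensor square of ℋ over the source map with
(A ⊗ A ⊗ A)^{co H} (`sourceGalois_injective_range`). Every left covariant calculus is therefore a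
quotient of (A ⊗ A ⊗ A)^{co H} by p(q ⊗ 1) ↦ p dq, and it is determined by the space R of relations
∑ p dq = 0 with ∑ pq = 0. The coaction forces RA = A ⊗ W for a subspace W of A ⊗ A
(`formSpan_eq_range`); W is a covariant subspace of Ω^u (`isCovariantSub_oneForms`), and the
calculus is the one induced by Ω^u/W (`nonempty_iso_leftCalculus`).

On the right-hand side a ⊗ a' ↦ a da' presents every calculus as a quotient of Ω^u in only one way.
The two isomorphisms for A ⊗ A show AI = IA, after which descent gives (AI)^{co H} = I and A J^{co
H} = J. -/

namespace ESCalculus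

/-! ### Balanced tensor products: right exactness, associativity. -/

section Balanced

variable {k : Type*} [CommRing k] {B : Type*}
  {M : Type*} [AddCommGroup M] [Module k M] {N : Type*} [AddCommGroup N] [Module k N]
  {P : Type*} [AddCommGroup P] [Module k P]
  {M' : Type*} [AddCommGroup M'] [Module k M'] {N' : Type*} [AddCommGroup N'] [Module k N']

namespace BalTensor

theorem mk_surjective (r : B → Module.End k M) (l : B → Module.End k N) :
    Function.Surjective (BalTensor.mk r l) :=
  Submodule.mkQ_surjective _

theorem hom_ext {r : B → Module.End k M} {l : B → Module.End k N}
    {f g : BalTensor r l →ₗ[k] P}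
    (h : ∀ m n, f (BalTensor.mk r l (m ⊗ₜ[k] n)) = g (BalTensor.mk r l (m ⊗ₜ[k] n))) : f = g :=
  Submodule.linearMap_qext _ (TensorProduct.ext' h)

theorem map_mk {r : B → Module.End k M} {l : B → Module.End k N}
    {r' : B → Module.End k M'} {l' : B → Module.End k N'}
    (f : M →ₗ[k] M') (g : N →ₗ[k] N')
    (hf : ∀ b m, f (r b m) = r' b (f m)) (hg : ∀ b n, g (l b n) = l' b (g n)) (z : M ⊗[k] N) :
    BalTensor.map f g hf hg (BalTensor.mk r l z) =
      BalTensor.mk r' l' (TensorProduct.map f g z) := rfl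

theorem map_bijective {r : B → Module.End k M} {l : B → Module.End k N}
    {r' : B → Module.End k M'} {l' : B → Module.End k N'}
    {f : M →ₗ[k] M'} {g : N →ₗ[k] N'}
    (hf : ∀ b m, f (r b m) = r' b (f m)) (hg : ∀ b n, g (l b n) = l' b (g n))
    (hf' : Function.Bijective f) (hg' : Function.Bijective g) :
    Function.Bijective (BalTensor.map f g hf hg) := by
  let e := LinearEquiv.ofBijective f hf'
  let e' := LinearEquiv.ofBijective g hg'
  have he : ∀ m, f (e.symm m) = m := e.apply_symm_apply
  have he' : ∀ m, g (e'.symm m) = m := e'.apply_symm_apply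
  have he₂ : ∀ m, e.symm (f m) = m := e.symm_apply_apply
  have he₂' : ∀ m, e'.symm (g m) = m := e'.symm_apply_apply
  let i : BalTensor r' l' →ₗ[k] BalTensor r l := BalTensor.map e.symm.toLinearMap
    e'.symm.toLinearMap (fun b m => hf'.1 (by simp [-Submodule.mkQ_apply, hf, he])) (fun b n => hg'.1 (by simp [hg, he']))
  refine Function.bijective_iff_has_inverse.2 ⟨i, fun x => ?_, fun x => ?_⟩
  · refine LinearMap.congr_fun (f := i ∘ₗ BalTensor.map f g hf hg) (g := LinearMap.id)
      (hom_ext fun m n => ?_) x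
    simp [-Submodule.mkQ_apply, i, map_mk, he₂, he₂']
  · refine LinearMap.congr_fun (f := BalTensor.map f g hf hg ∘ₗ i) (g := LinearMap.id)
      (hom_ext fun m n => ?_) x
    simp [-Submodule.mkQ_apply, i, map_mk, he, he']

/-- The flip of the two factors of a balanced tensor product. -/
noncomputable def comm (r : B → Module.End k M) (l : B → Module.End k N) :
    BalTensor r l ≃ₗ[k] BalTensor l r :=
  LinearEquiv.ofLinearMap
    (BalTensor.lift r l (BalTensor.mk l r ∘ₗ (TensorProduct.comm k M N).toLinearMap)
      fun b m n => by simpa [-Submodule.mkQ_apply] using (BalTensor.mk_eq l r b n m).symm)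
    (BalTensor.lift l r (BalTensor.mk r l ∘ₗ (TensorProduct.comm k N M).toLinearMap)
      fun b m n => by simpa [-Submodule.mkQ_apply] using (BalTensor.mk_eq r l b n m).symm)
    (hom_ext fun _ _ => rfl) (hom_ext fun _ _ => rfl)

theorem comm_mk (r : B → Module.End k M) (l : B → Module.End k N) (m : M) (n : N) :
    comm r l (BalTensor.mk r l (m ⊗ₜ[k] n)) = BalTensor.mk l r (n ⊗ₜ[k] m) := rfl

/-- Right exactness of the balanced tensor product. As g is onto, every relation of M ⊗_B N' lifts
to a relation of M ⊗_B N, so z can be changed by relations until M ⊗ g kills it; exactness over k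
then finishes. -/
theorem map_id_ker {r : B → Module.End k M} {l : B → Module.End k N} {l' : B → Module.End k N'}
    {g : N →ₗ[k] N'} (hg : ∀ b n, g (l b n) = l' b (g n)) (hg' : Function.Surjective g)
    (z : M ⊗[k] N)
    (hz : BalTensor.map (r := r) (r' := r) LinearMap.id g (fun _ _ => rfl) hg
      (BalTensor.mk r l z) = 0) :
    ∃ y : M ⊗[k] LinearMap.ker g,
      BalTensor.mk r l ((LinearMap.ker g).subtype.lTensor M y) = BalTensor.mk r l z := by
  rw [map_mk] at hz
  have h : TensorProduct.map LinearMap.id g z ∈ balRel r l' :=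
    (Submodule.Quotient.mk_eq_zero _).1 hz
  have h' : balRel r l' ≤ (balRel r l).map (g.lTensor M) := by
    rw [balRel, Submodule.span_le]
    rintro _ ⟨b, m, n, rfl⟩
    obtain ⟨n, rfl⟩ := hg' n
    refine ⟨r b m ⊗ₜ[k] n - m ⊗ₜ[k] l b n, Submodule.subset_span ⟨b, m, n, rfl⟩, ?_⟩
    simp [-Submodule.mkQ_apply, hg]
  obtain ⟨y, hy, hyz⟩ := h' h
  have hex := lTensor_exact M (f := (LinearMap.ker g).subtype) (g := g)
    (LinearMap.exact_subtype_ker_map g) hg'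
  obtain ⟨x, hx⟩ := (hex (z - y)).1 (by rw [map_sub, hyz]; exact sub_self _)
  refine ⟨x, ?_⟩
  rw [hx, map_sub, sub_eq_self]
  exact (Submodule.Quotient.mk_eq_zero _).2 hy

end BalTensor

section Triple

variable (rM : B → Module.End k M) (lN rN : B → Module.End k N) (lP : B → Module.End k P)

/-- The projection onto the triple tensor product. -/
abbrev BalTensor₃.mk : M ⊗[k] (N ⊗[k] P) →ₗ[k] BalTensor₃ rM lN rN lP :=
  (balRel₃ rM lN rN lP).mkQ

theorem BalTensor₃.hom_ext {Q : Type*} [AddCommGroup Q] [Module k Q]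
    {f g : BalTensor₃ rM lN rN lP →ₗ[k] Q}
    (h : ∀ m n p, f (BalTensor₃.mk rM lN rN lP (m ⊗ₜ[k] (n ⊗ₜ[k] p))) =
      g (BalTensor₃.mk rM lN rN lP (m ⊗ₜ[k] (n ⊗ₜ[k] p)))) : f = g :=
  Submodule.linearMap_qext _ (TensorProduct.ext_threefold' h)

theorem toBal₃Left_tmul (m : M) (n : N) (p : P) :
    toBal₃Left rM lN rN lP (BalTensor.mk rM lN (m ⊗ₜ[k] n) ⊗ₜ[k] p) =
      BalTensor₃.mk rM lN rN lP (m ⊗ₜ[k] (n ⊗ₜ[k] p)) := rfl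

theorem toBal₃Right_tmul (m : M) (n : N) (p : P) :
    toBal₃Right rM lN rN lP (m ⊗ₜ[k] BalTensor.mk rN lP (n ⊗ₜ[k] p)) =
      BalTensor₃.mk rM lN rN lP (m ⊗ₜ[k] (n ⊗ₜ[k] p)) := rfl

theorem BalTensor₃.mk_left (b : B) (m : M) (n : N) (p : P) :
    BalTensor₃.mk rM lN rN lP (rM b m ⊗ₜ[k] (n ⊗ₜ[k] p)) =
      BalTensor₃.mk rM lN rN lP (m ⊗ₜ[k] (lN b n ⊗ₜ[k] p)) := by
  rw [← sub_eq_zero, ← map_sub]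
  exact (Submodule.Quotient.mk_eq_zero _).2 (Submodule.subset_span (Or.inl ⟨b, m, n, p, rfl⟩))

theorem BalTensor₃.mk_right (b : B) (m : M) (n : N) (p : P) :
    BalTensor₃.mk rM lN rN lP (m ⊗ₜ[k] (rN b n ⊗ₜ[k] p)) =
      BalTensor₃.mk rM lN rN lP (m ⊗ₜ[k] (n ⊗ₜ[k] lP b p)) := by
  rw [← sub_eq_zero, ← map_sub]
  exact (Submodule.Quotient.mk_eq_zero _).2 (Submodule.subset_span (Or.inr ⟨b, m, n, p, rfl⟩))

/-- A linear map on the threefold tensor product that respects the relations descends. -/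
def BalTensor₃.lift {Q : Type*} [AddCommGroup Q] [Module k Q] (f : M ⊗[k] (N ⊗[k] P) →ₗ[k] Q)
    (h₁ : ∀ b m n p, f (rM b m ⊗ₜ[k] (n ⊗ₜ[k] p)) = f (m ⊗ₜ[k] (lN b n ⊗ₜ[k] p)))
    (h₂ : ∀ b m n p, f (m ⊗ₜ[k] (rN b n ⊗ₜ[k] p)) = f (m ⊗ₜ[k] (n ⊗ₜ[k] lP b p))) :
    BalTensor₃ rM lN rN lP →ₗ[k] Q :=
  (balRel₃ rM lN rN lP).liftQ f (by
    rw [balRel₃, Submodule.span_le]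
    rintro _ (⟨b, m, n, p, rfl⟩ | ⟨b, m, n, p, rfl⟩)
    · simp [-Submodule.mkQ_apply, h₁]
    · simp [-Submodule.mkQ_apply, h₂])

/-- `(M ⊗_B N) ⊗_B P ≃ M ⊗_B N ⊗_B P`. -/
noncomputable def bal₃LeftEquiv (r : B → Module.End k (BalTensor rM lN))
    (hr : ∀ b m n, r b (BalTensor.mk rM lN (m ⊗ₜ[k] n)) = BalTensor.mk rM lN (m ⊗ₜ[k] rN b n)) :
    BalTensor r lP ≃ₗ[k] BalTensor₃ rM lN rN lP :=
  LinearEquiv.ofLinearMap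
    (BalTensor.lift r lP (toBal₃Left rM lN rN lP) (by
      intro b y p
      obtain ⟨y, rfl⟩ := BalTensor.mk_surjective rM lN y
      induction y with
      | zero => simp
      | add y₁ y₂ h₁ h₂ => simp only [map_add, TensorProduct.add_tmul, h₁, h₂]
      | tmul m n =>
        rw [hr, toBal₃Left_tmul, toBal₃Left_tmul, BalTensor₃.mk_right]))
    (BalTensor₃.lift rM lN rN lP (BalTensor.mk r lP ∘ₗ (BalTensor.mk rM lN).rTensor P ∘ₗ
        (TensorProduct.assoc k M N P).symm.toLinearMap) (by
      intro b m n p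
      simp [-Submodule.mkQ_apply, BalTensor.mk_eq]) (by
      intro b m n p
      have := BalTensor.mk_eq r lP b (BalTensor.mk rM lN (m ⊗ₜ[k] n)) p
      rw [hr] at this
      simpa [-Submodule.mkQ_apply] using this))
    (BalTensor₃.hom_ext _ _ _ _ fun m n p => rfl)
    (BalTensor.hom_ext fun y p => by
      obtain ⟨y, rfl⟩ := BalTensor.mk_surjective rM lN y
      induction y with
      | zero => simp
      | add y₁ y₂ h₁ h₂ => simp only [map_add, TensorProduct.add_tmul, h₁, h₂]
      | tmul m n => rfl)

/-- `M ⊗_B (N ⊗_B P) ≃ M ⊗_B N ⊗_B P`. -/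
noncomputable def bal₃RightEquiv (l : B → Module.End k (BalTensor rN lP))
    (hl : ∀ b n p, l b (BalTensor.mk rN lP (n ⊗ₜ[k] p)) = BalTensor.mk rN lP (lN b n ⊗ₜ[k] p)) :
    BalTensor rM l ≃ₗ[k] BalTensor₃ rM lN rN lP :=
  LinearEquiv.ofLinearMap
    (BalTensor.lift rM l (toBal₃Right rM lN rN lP) (by
      intro b m y
      obtain ⟨y, rfl⟩ := BalTensor.mk_surjective rN lP y
      induction y with
      | zero => simp
      | add y₁ y₂ h₁ h₂ => simp only [map_add, TensorProduct.tmul_add, h₁, h₂]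
      | tmul n p =>
        rw [hl, toBal₃Right_tmul, toBal₃Right_tmul, BalTensor₃.mk_left]))
    (BalTensor₃.lift rM lN rN lP (BalTensor.mk rM l ∘ₗ (BalTensor.mk rN lP).lTensor M) (by
      intro b m n p
      have := BalTensor.mk_eq rM l b m (BalTensor.mk rN lP (n ⊗ₜ[k] p))
      rw [hl] at this
      simpa [-Submodule.mkQ_apply] using this) (by
      intro b m n p
      simp [-Submodule.mkQ_apply, BalTensor.mk_eq]))
    (BalTensor₃.hom_ext _ _ _ _ fun m n p => rfl)
    (BalTensor.hom_ext fun m y => by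
      obtain ⟨y, rfl⟩ := BalTensor.mk_surjective rN lP y
      induction y with
      | zero => simp
      | add y₁ y₂ h₁ h₂ => simp only [map_add, TensorProduct.tmul_add, h₁, h₂]
      | tmul n p => rfl)

variable {rM lN rN lP}

/-- Associativity of the balanced tensor product. -/
noncomputable def BalTensor.assoc {r : B → Module.End k (BalTensor rM lN)}
    (hr : ∀ b m n, r b (BalTensor.mk rM lN (m ⊗ₜ[k] n)) = BalTensor.mk rM lN (m ⊗ₜ[k] rN b n))
    {l : B → Module.End k (BalTensor rN lP)}
    (hl : ∀ b n p, l b (BalTensor.mk rN lP (n ⊗ₜ[k] p)) = BalTensor.mk rN lP (lN b n ⊗ₜ[k] p)) :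
    BalTensor r lP ≃ₗ[k] BalTensor rM l :=
  (bal₃LeftEquiv rM lN rN lP r hr).trans (bal₃RightEquiv rM lN rN lP l hl).symm

end Triple

/-! ### Base change of Galois-type isomorphisms. -/

section BaseChange

variable {A : Type*} [AddCommGroup A] [Module k A] {V : Type*} [AddCommGroup V] [Module k V]
  {L : Type*} [AddCommGroup L] [Module k L]

/-- Base change of an isomorphism `M ⊗_B A ≃ V ⊗ A` of `A`-modules along an `A`-module `L`:
the map `M ⊗_B L → V ⊗ L` is bijective. Here `mulop` is the product of the algebra `A` (in
either order), and `act` is its action on `L`. -/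
theorem baseChange_bijective {r : B → Module.End k M} {lA : B → Module.End k A}
    {lL : B → Module.End k L} (one : A) (mulop : A → Module.End k A)
    (act : A →ₗ[k] Module.End k L)
    (one_mulop : ∀ a, mulop one a = a) (mulop_one : ∀ a, mulop a one = a)
    (mulop_assoc : ∀ a c e, mulop c (mulop a e) = mulop (mulop c a) e)
    (mulop_lA : ∀ b a c, mulop c (lA b a) = lA b (mulop c a))
    (act_one : ∀ l, act one l = l) (act_mulop : ∀ a c l, act (mulop a c) l = act c (act a l))
    (act_lA : ∀ b a l, act (lA b a) l = lL b (act a l))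
    (j : M →ₗ[k] V ⊗[k] A) (μ : BalTensor r lA →ₗ[k] V ⊗[k] A)
    (hμ : ∀ m a, μ (BalTensor.mk r lA (m ⊗ₜ[k] a)) = (mulop a).lTensor V (j m))
    (hμb : Function.Bijective μ) (F : BalTensor r lL →ₗ[k] V ⊗[k] L)
    (hF : ∀ m l, F (BalTensor.mk r lL (m ⊗ₜ[k] l)) = (act.flip l).lTensor V (j m)) :
    Function.Bijective F := by
  let e := LinearEquiv.ofBijective μ hμb
  -- These maps m ⊗ a ↦ m ⊗ al replace the isomorphism (M ⊗_B A) ⊗_A L ≅ M ⊗_B L, so that no tensor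
  -- product over A is needed.
  let n : L → BalTensor r lA →ₗ[k] BalTensor r lL := fun l =>
    BalTensor.lift r lA (BalTensor.mk r lL ∘ₗ (act.flip l).lTensor M) (by
      intro b m a
      simp [-Submodule.mkQ_apply, BalTensor.mk_eq, act_lA])
  have hn : ∀ l m a, n l (BalTensor.mk r lA (m ⊗ₜ[k] a)) = BalTensor.mk r lL (m ⊗ₜ[k] act a l) :=
    fun l m a => rfl
  have n_add : ∀ l l', n (l + l') = n l + n l' := fun l l' =>
    BalTensor.hom_ext fun m a => by simp [-Submodule.mkQ_apply, hn, TensorProduct.tmul_add]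
  have n_smul : ∀ (c : k) l, n (c • l) = c • n l := fun c l =>
    BalTensor.hom_ext fun m a => by simp [-Submodule.mkQ_apply, hn]
  -- The inverse: pull v ⊗ 1 back through μ, then let the factor A act on l.
  let G : V ⊗[k] L →ₗ[k] BalTensor r lL := TensorProduct.lift (LinearMap.mk₂ k
    (fun v l => n l (e.symm (v ⊗ₜ[k] one)))
    (fun v v' l => by rw [TensorProduct.add_tmul, map_add, map_add])
    (fun c v l => by rw [← TensorProduct.smul_tmul', map_smul, map_smul])
    (fun v l l' => by rw [n_add, LinearMap.add_apply])
    (fun c v l => by rw [n_smul, LinearMap.smul_apply]))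
  have hG : ∀ v l, G (v ⊗ₜ[k] l) = n l (e.symm (v ⊗ₜ[k] one)) := fun v l => rfl
  have he : ∀ y, μ (e.symm y) = y := e.apply_symm_apply
  have key₁ : ∀ l w, F (n l w) = (act.flip l).lTensor V (μ w) := by
    intro l w
    refine LinearMap.congr_fun (f := F ∘ₗ n l) (g := (act.flip l).lTensor V ∘ₗ μ)
      (BalTensor.hom_ext fun m a => ?_) w
    simp only [LinearMap.comp_apply, hn, hF, hμ]
    rw [← LinearMap.lTensor_comp_apply]
    congr 2
    ext c
    simp [-Submodule.mkQ_apply, act_mulop]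
  -- A-linearity of μ⁻¹: the operator `t`, multiplication by c on the factor A, corresponds under μ
  -- to multiplication by c on V ⊗ A, which takes v ⊗ 1 to v ⊗ c.
  have key₂ : ∀ l v c, n (act c l) (e.symm (v ⊗ₜ[k] one)) = n l (e.symm (v ⊗ₜ[k] c)) := by
    intro l v c
    let t : BalTensor r lA →ₗ[k] BalTensor r lA :=
      BalTensor.map LinearMap.id (mulop c) (fun _ _ => rfl) (fun b a => mulop_lA b a c)
    have ht : ∀ w, μ (t w) = (mulop c).lTensor V (μ w) := by
      intro w
      refine LinearMap.congr_fun (f := μ ∘ₗ t) (g := (mulop c).lTensor V ∘ₗ μ)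
        (BalTensor.hom_ext fun m a => ?_) w
      simp only [LinearMap.comp_apply, t, BalTensor.map_mk, TensorProduct.map_tmul, hμ,
        LinearMap.id_apply]
      rw [← LinearMap.lTensor_comp_apply]
      congr 2
      ext e
      simp [-Submodule.mkQ_apply, mulop_assoc]
    have h₁ : n (act c l) = n l ∘ₗ t := BalTensor.hom_ext fun m a => by
      simp [-Submodule.mkQ_apply, hn, t, BalTensor.map_mk, act_mulop]
    rw [h₁, LinearMap.comp_apply]
    congr 1
    apply hμb.1
    rw [ht, he, he, LinearMap.lTensor_tmul, mulop_one]
  have key₃ : ∀ l y, G ((act.flip l).lTensor V y) = n l (e.symm y) := by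
    intro l y
    induction y with
    | zero => simp
    | add y₁ y₂ h₁ h₂ => simp only [map_add, h₁, h₂]
    | tmul v c => rw [LinearMap.lTensor_tmul, hG]; exact key₂ l v c
  refine Function.bijective_iff_has_inverse.2 ⟨G, fun x => ?_, fun x => ?_⟩
  · refine LinearMap.congr_fun (f := G ∘ₗ F) (g := LinearMap.id)
      (BalTensor.hom_ext fun m l => ?_) x
    rw [LinearMap.comp_apply, hF, key₃]
    have : j m = μ (BalTensor.mk r lA (m ⊗ₜ[k] one)) := by
      rw [hμ, show mulop one = LinearMap.id from LinearMap.ext one_mulop, LinearMap.lTensor_id]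
      rfl
    rw [this, show e.symm (μ _) = _ from e.symm_apply_apply _, hn, act_one]
    rfl
  · induction x with
    | zero => simp
    | add y₁ y₂ h₁ h₂ => simp only [map_add, h₁, h₂]
    | tmul v l =>
      rw [hG, key₁, he, LinearMap.lTensor_tmul, LinearMap.flip_apply, act_one]

end BaseChange

end Balanced

end ESCalculus

namespace ESCalculus.RightComoduleAlgebra

variable {k : Type u} {H : Type v} {A : Type w} [Field k] [Ring H] [HopfAlgebra k H]
  [Ring A] [Algebra k A] (C : RightComoduleAlgebra k H A)

/-! ### Faithful flatness for actions given as families of endomorphisms. -/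

section FaithfullyFlat

variable {M N P : Type w} [AddCommGroup M] [Module k M] [AddCommGroup N] [Module k N]
  [AddCommGroup P] [Module k P]

/-- The family `r` of endomorphisms is a right action of `B`. -/
structure RAct {M : Type*} [AddCommGroup M] [Module k M] (r : C.coinv → Module.End k M) :
    Prop where
  one : ∀ m, r 1 m = m
  mul : ∀ b c m, r (b * c) m = r c (r b m)
  add : ∀ b c m, r (b + c) m = r b m + r c m
  smul : ∀ (t : k) b m, r (t • b) m = t • r b m

variable {C}

/-- The module structure of a right action. -/
abbrev RAct.module {r : C.coinv → Module.End k M} (h : C.RAct r) : Module C.coinvᵐᵒᵖ M where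
  smul b m := r (unop b) m
  one_smul := h.one
  mul_smul b c m := h.mul (unop c) (unop b) m
  smul_zero b := map_zero _
  smul_add b := map_add _
  add_smul b c m := h.add (unop b) (unop c) m
  zero_smul m := (congrArg (fun b => r b m) (zero_smul k (0 : C.coinv)).symm).trans
    ((h.smul 0 0 m).trans (zero_smul k _))

variable {rM : C.coinv → Module.End k M} {rN : C.coinv → Module.End k N}
  {rP : C.coinv → Module.End k P}

/-- The same space carries several actions of B, so actions are bare families of endomorphisms
throughout; module instances are installed only here, to invoke the hypothesis. -/
theorem IsLeftFaithfullyFlat.exact_iff (hF : C.IsLeftFaithfullyFlat) (hM : C.RAct rM)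
    (hN : C.RAct rN) (hP : C.RAct rP) (f : M →ₗ[k] N) (g : N →ₗ[k] P)
    (hf : ∀ b m, f (rM b m) = rN b (f m)) (hg : ∀ b m, g (rN b m) = rP b (g m)) :
    Function.Exact f g ↔ Function.Exact
      (BalTensor.map f LinearMap.id hf (fun _ _ => rfl) : BalTensor rM C.lB →ₗ[k] _)
      (BalTensor.map g LinearMap.id hg (fun _ _ => rfl) : BalTensor rN C.lB →ₗ[k]
        BalTensor rP C.lB) := by
  letI := hM.module
  letI := hN.module
  letI := hP.module
  haveI : IsScalarTower k C.coinvᵐᵒᵖ M := ⟨fun t b m => hM.smul t (unop b) m⟩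
  haveI : IsScalarTower k C.coinvᵐᵒᵖ N := ⟨fun t b m => hN.smul t (unop b) m⟩
  haveI : IsScalarTower k C.coinvᵐᵒᵖ P := ⟨fun t b m => hP.smul t (unop b) m⟩
  exact hF M N P { f with map_smul' := fun b m => hf (unop b) m }
    { g with map_smul' := fun b m => hg (unop b) m }

/-- Injectivity is exactness of M → M → N with the zero map first; taking M itself as the source
avoids introducing a zero module. -/
theorem IsLeftFaithfullyFlat.injective_iff (hF : C.IsLeftFaithfullyFlat) (hM : C.RAct rM)
    (hN : C.RAct rN) (f : M →ₗ[k] N) (hf : ∀ b m, f (rM b m) = rN b (f m)) :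
    Function.Injective f ↔ Function.Injective
      (BalTensor.map f LinearMap.id hf (fun _ _ => rfl) : BalTensor rM C.lB →ₗ[k]
        BalTensor rN C.lB) := by
  have h := hF.exact_iff hM hM hN 0 f (by simp) hf
  have h0 : (BalTensor.map (0 : M →ₗ[k] M) LinearMap.id (by simp) (fun _ _ => rfl) :
      BalTensor rM C.lB →ₗ[k] BalTensor rM C.lB) = 0 :=
    BalTensor.hom_ext fun m n => by simp [-Submodule.mkQ_apply, BalTensor.map_mk]
  rw [h0, LinearMap.exact_zero_iff_injective, LinearMap.exact_zero_iff_injective] at h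
  exact h

theorem IsLeftFaithfullyFlat.surjective_iff (hF : C.IsLeftFaithfullyFlat) (hM : C.RAct rM)
    (hN : C.RAct rN) (f : M →ₗ[k] N) (hf : ∀ b m, f (rM b m) = rN b (f m)) :
    Function.Surjective f ↔ Function.Surjective
      (BalTensor.map f LinearMap.id hf (fun _ _ => rfl) : BalTensor rM C.lB →ₗ[k]
        BalTensor rN C.lB) := by
  have h := hF.exact_iff hM hN hN f 0 hf (by simp)
  have h0 : (BalTensor.map (0 : N →ₗ[k] N) LinearMap.id (by simp) (fun _ _ => rfl) :
      BalTensor rN C.lB →ₗ[k] BalTensor rN C.lB) = 0 :=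
    BalTensor.hom_ext fun m n => by simp [-Submodule.mkQ_apply, BalTensor.map_mk]
  rw [h0, LinearMap.exact_zero_iff_surjective, LinearMap.exact_zero_iff_surjective] at h
  exact h

end FaithfullyFlat

/-- The structure of an `A`-bimodule with a compatible right coaction of `H`. -/
structure HopfBimodule (L : Type*) [AddCommGroup L] [Module k L] where
  /-- the left action -/
  lm : A →ₗ[k] Module.End k L
  /-- the right action -/
  rm : A →ₗ[k] Module.End k L
  /-- the coaction -/
  δ : L →ₗ[k] L ⊗[k] H
  lm_one : ∀ l, lm 1 l = l
  lm_mul : ∀ a a' l, lm (a * a') l = lm a (lm a' l)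
  rm_one : ∀ l, rm 1 l = l
  rm_mul : ∀ a a' l, rm (a * a') l = rm a' (rm a l)
  lm_rm : ∀ a a' l, lm a (rm a' l) = rm a' (lm a l)
  counit : ∀ l, TensorProduct.rid k L ((Coalgebra.counit (R := k) (A := H)).lTensor L (δ l)) = l
  coassoc : ∀ l, TensorProduct.assoc k L H H (δ.rTensor H (δ l)) =
    (Coalgebra.comul (R := k) (A := H)).lTensor L (δ l)
  δ_lm : ∀ a l, δ (lm a l) = TensorProduct.map₂ lm (LinearMap.mul k H) (C.ρ a) (δ l)
  δ_rm : ∀ a l, δ (rm a l) = TensorProduct.map₂ rm (LinearMap.mul k H).flip (C.ρ a) (δ l)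

/-! ### Canonical maps and the structure theorem for Hopf bimodules. -/

namespace HopfBimodule

variable {C} {L : Type*} [AddCommGroup L] [Module k L] (T : C.HopfBimodule L)

/-- The coinvariants `L^{co H}`. -/
def coinv : Submodule k L := LinearMap.eqLocus T.δ ((TensorProduct.mk k L H).flip 1)

variable {T} in
theorem mem_coinv {l : L} : l ∈ T.coinv ↔ T.δ l = l ⊗ₜ[k] (1 : H) := Iff.rfl

/-- The right action of `B`. -/
abbrev rmB (b : C.coinv) : Module.End k L := T.rm (b : A)

/-- The left action of `B`. -/
abbrev lmB (b : C.coinv) : Module.End k L := T.lm (b : A)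

theorem rAct_rmB : C.RAct T.rmB where
  one := T.rm_one
  mul b c := T.rm_mul b c
  add b c m := by simp [rmB]
  smul t b m := by simp [rmB]

theorem rm_mem_coinv (b : C.coinv) {l : L} (hl : l ∈ T.coinv) : T.rm (b : A) l ∈ T.coinv := by
  rw [mem_coinv] at hl ⊢
  rw [T.δ_rm, hl, C.ρ_coinv]
  simp

theorem lm_mem_coinv (b : C.coinv) {l : L} (hl : l ∈ T.coinv) : T.lm (b : A) l ∈ T.coinv := by
  rw [mem_coinv] at hl ⊢
  rw [T.δ_lm, hl, C.ρ_coinv]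
  simp

/-- The right action of `B` on the coinvariants. -/
def rmCo (b : C.coinv) : Module.End k T.coinv :=
  (T.rm (b : A)).restrict fun _ hl => T.rm_mem_coinv b hl

theorem rAct_rmCo : C.RAct T.rmCo where
  one m := Subtype.ext (T.rm_one _)
  mul b c m := Subtype.ext (T.rm_mul b c _)
  add b c m := Subtype.ext (by simp [rmCo])
  smul t b m := Subtype.ext (by simp [rmCo])

/-- The canonical map `can : L ⊗_B A → L ⊗ H`, `l ⊗ a ↦ l a₍₀₎ ⊗ a₍₁₎`, for any right `A`-action
on `L`. -/
noncomputable def canMap {L : Type*} [AddCommGroup L] [Module k L] (rm : A →ₗ[k] Module.End k L)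
    (rm_mul : ∀ a a' l, rm (a * a') l = rm a' (rm a l)) :
    BalTensor (fun b : C.coinv => rm (b : A)) C.lB →ₗ[k] L ⊗[k] H :=
  BalTensor.lift _ _
    (TensorProduct.lift ((LinearMap.rTensorHom H ∘ₗ rm.flip).compl₂ C.ρ.toLinearMap)) (by
      intro b l a
      have h : ∀ X : A ⊗[k] H, (rm.flip (rm (b : A) l)).rTensor H X =
          (rm.flip l).rTensor H ((b : A) ⊗ₜ[k] (1 : H) * X) := by
        intro X
        induction X with
        | zero => simp
        | add X Y hX hY => simp only [mul_add, map_add, hX, hY]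
        | tmul a h => simp [rm_mul]
      simp [lB, C.ρ_coinv, h])

theorem canMap_mk {L : Type*} [AddCommGroup L] [Module k L] (rm : A →ₗ[k] Module.End k L)
    (rm_mul : ∀ a a' l, rm (a * a') l = rm a' (rm a l)) (l : L) (a : A) :
    canMap (C := C) rm rm_mul (BalTensor.mk _ _ (l ⊗ₜ[k] a)) = (rm.flip l).rTensor H (C.ρ a) :=
  rfl

theorem _root_.ESCalculus.RightComoduleAlgebra.galoisMap_mk (a a' : A) :
    C.galoisMap (BalTensor.mk _ _ (a ⊗ₜ[k] a')) = (LinearMap.mulLeft k a).rTensor H (C.ρ a') := by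
  have h : ∀ X : A ⊗[k] H, (a ⊗ₜ[k] (1 : H)) * X = (LinearMap.mulLeft k a).rTensor H X := by
    intro X
    induction X with
    | zero => simp
    | add X Y hX hY => simp only [mul_add, map_add, hX, hY]
    | tmul a h => simp
  rw [← h]
  rfl

theorem comm_rTensor {M N P : Type*} [AddCommGroup M] [AddCommGroup N] [AddCommGroup P]
    [Module k M] [Module k N] [Module k P] (f : M →ₗ[k] N) (x : M ⊗[k] P) :
    TensorProduct.comm k N P (f.rTensor P x) = f.lTensor P (TensorProduct.comm k M P x) :=
  LinearMap.congr_fun (f := (TensorProduct.comm k N P).toLinearMap ∘ₗ f.rTensor P)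
    (g := f.lTensor P ∘ₗ (TensorProduct.comm k M P).toLinearMap)
    (TensorProduct.ext' fun _ _ => rfl) x

/-- The Galois map is left A-linear, so tensoring it over A with the right A-module L gives the
canonical map of L. Base change was set up for the second tensor factor, hence the flips. -/
theorem canMap_bijective (hG : C.IsHopfGalois) {L : Type*} [AddCommGroup L] [Module k L]
    (rm : A →ₗ[k] Module.End k L) (rm_one : ∀ l, rm 1 l = l)
    (rm_mul : ∀ a a' l, rm (a * a') l = rm a' (rm a l)) :
    Function.Bijective (canMap (C := C) rm rm_mul) := by
  have h := baseChange_bijective (k := k) (V := H) (r := C.lB) (lA := C.rB)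
    (lL := fun b : C.coinv => rm (b : A)) 1 (LinearMap.mulLeft k) rm (by simp) (by simp)
    (by simp) (by simp [rB, mul_assoc]) rm_one (by simp [rm_mul]) (by simp [rB, rm_mul])
    ((TensorProduct.comm k A H).toLinearMap ∘ₗ C.ρ.toLinearMap)
    ((TensorProduct.comm k A H).toLinearMap ∘ₗ C.galoisMap ∘ₗ
      (BalTensor.comm C.lB C.rB).toLinearMap)
    (by
      intro m a
      simp only [LinearMap.comp_apply, LinearEquiv.coe_coe, BalTensor.comm_mk, galoisMap_mk,
        comm_rTensor]
      rfl)
    (by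
      simp only [LinearMap.coe_comp, LinearEquiv.coe_coe]
      exact (LinearEquiv.bijective _).comp (Function.Bijective.comp hG (LinearEquiv.bijective _)))
    ((TensorProduct.comm k L H).toLinearMap ∘ₗ canMap rm rm_mul ∘ₗ
      (BalTensor.comm C.lB fun b : C.coinv => rm (b : A)).toLinearMap)
    (by
      intro m a
      simp only [LinearMap.comp_apply, LinearEquiv.coe_coe, BalTensor.comm_mk, canMap_mk,
        comm_rTensor]
      rfl)
  simp only [LinearMap.coe_comp, LinearEquiv.coe_coe] at h
  exact (Function.Bijective.of_comp_iff _ (LinearEquiv.bijective _)).1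
    ((Function.Bijective.of_comp_iff' (LinearEquiv.bijective _) _).1 h)

/-- The map `M ⊗_B A → L`, `m ⊗ a ↦ f(m) a`, for a map `f` of right `B`-modules. -/
noncomputable def actMap {M : Type*} [AddCommGroup M] [Module k M] (r : C.coinv → Module.End k M)
    (f : M →ₗ[k] L) (hf : ∀ b m, f (r b m) = T.rm (b : A) (f m)) : BalTensor r C.lB →ₗ[k] L :=
  BalTensor.lift _ _ (TensorProduct.lift (T.rm.flip ∘ₗ f)) (by
    intro b m a
    simp [hf, lB, T.rm_mul])

theorem actMap_mk {M : Type*} [AddCommGroup M] [Module k M] (r : C.coinv → Module.End k M)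
    (f : M →ₗ[k] L) (hf : ∀ b m, f (r b m) = T.rm (b : A) (f m)) (m : M) (a : A) :
    T.actMap r f hf (BalTensor.mk _ _ (m ⊗ₜ[k] a)) = T.rm a (f m) := rfl

/-- The diagonal right action of `A` on `L ⊗ H`. -/
noncomputable def diagRm : A →ₗ[k] Module.End k (L ⊗[k] H) :=
  TensorProduct.map₂ T.rm (LinearMap.mul k H).flip ∘ₗ C.ρ.toLinearMap

theorem diagRm_one (y : L ⊗[k] H) : T.diagRm 1 y = y := by
  have h : T.diagRm 1 = LinearMap.id := by
    refine TensorProduct.ext' fun l h => ?_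
    simp [diagRm, Algebra.TensorProduct.one_def, T.rm_one]
  rw [h, LinearMap.id_apply]

theorem diagRm_mul (a a' : A) (y : L ⊗[k] H) :
    T.diagRm (a * a') y = T.diagRm a' (T.diagRm a y) := by
  simp only [diagRm, LinearMap.comp_apply, AlgHom.toLinearMap_apply, map_mul]
  generalize C.ρ a = X
  generalize C.ρ a' = X'
  induction X with
  | zero => simp
  | add X Y hX hY => simp only [add_mul, map_add, LinearMap.add_apply, hX, hY]
  | tmul a h =>
    induction X' with
    | zero => simp
    | add X Y hX hY => simp only [mul_add, map_add, LinearMap.add_apply, hX, hY]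
    | tmul a' h' =>
      induction y with
      | zero => simp
      | add X Y hX hY => simp only [map_add, hX, hY]
      | tmul l g => simp [T.rm_mul, mul_assoc]

theorem diagRm_coinv (b : C.coinv) (y : L ⊗[k] H) :
    T.diagRm (b : A) y = (T.rm (b : A)).rTensor H y := by
  have h : T.diagRm (b : A) = (T.rm (b : A)).rTensor H := by
    refine TensorProduct.ext' fun l h => ?_
    simp [diagRm, C.ρ_coinv]
  rw [h]

/-- The right action of `B` on `L ⊗_B A` through the second factor. -/
noncomputable def rmBal (b : C.coinv) : Module.End k (BalTensor T.rmB C.lB) :=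
  BalTensor.map LinearMap.id (LinearMap.mulRight k (b : A)) (fun _ _ => rfl)
    (fun c a => by simp [lB, mul_assoc])

theorem rmBal_mk (b : C.coinv) (l : L) (a : A) :
    T.rmBal b (BalTensor.mk T.rmB C.lB (l ⊗ₜ[k] a)) =
      BalTensor.mk T.rmB C.lB (l ⊗ₜ[k] (a * b)) := rfl

theorem rAct_rmBal : C.RAct T.rmBal where
  one m := LinearMap.congr_fun (f := T.rmBal 1) (g := LinearMap.id)
    (BalTensor.hom_ext fun l a => by rw [rmBal_mk]; simp) m
  mul b c m := LinearMap.congr_fun (f := T.rmBal (b * c)) (g := T.rmBal c ∘ₗ T.rmBal b)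
    (BalTensor.hom_ext fun l a => by
      rw [LinearMap.comp_apply, rmBal_mk, rmBal_mk, rmBal_mk]; simp [mul_assoc]) m
  add b c m := LinearMap.congr_fun (f := T.rmBal (b + c)) (g := T.rmBal b + T.rmBal c)
    (BalTensor.hom_ext fun l a => by
      rw [LinearMap.add_apply, rmBal_mk, rmBal_mk, rmBal_mk, ← map_add, ← TensorProduct.tmul_add,
        Subalgebra.coe_add, mul_add]) m
  smul t b m := LinearMap.congr_fun (f := T.rmBal (t • b)) (g := t • T.rmBal b)
    (BalTensor.hom_ext fun l a => by
      rw [LinearMap.smul_apply, rmBal_mk, rmBal_mk, ← map_smul, ← TensorProduct.tmul_smul,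
        Subalgebra.coe_smul, mul_smul_comm]) m

theorem canMap_rmBal (b : C.coinv) (y : BalTensor T.rmB C.lB) :
    canMap T.rm T.rm_mul (T.rmBal b y) = (T.rm (b : A)).rTensor H (canMap T.rm T.rm_mul y) := by
  refine LinearMap.congr_fun (f := canMap T.rm T.rm_mul ∘ₗ T.rmBal b)
      (g := (T.rm (b : A)).rTensor H ∘ₗ canMap T.rm T.rm_mul)
      (BalTensor.hom_ext fun l a => ?_) y
  have h : ∀ X : A ⊗[k] H, (T.rm.flip l).rTensor H (X * ((b : A) ⊗ₜ[k] (1 : H))) =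
      (T.rm (b : A)).rTensor H ((T.rm.flip l).rTensor H X) := by
    intro X
    induction X with
    | zero => simp
    | add X Y hX hY => simp only [add_mul, map_add, hX, hY]
    | tmul a h => simp [T.rm_mul]
  rw [LinearMap.comp_apply, LinearMap.comp_apply, rmBal_mk]
  refine (canMap_mk T.rm T.rm_mul l (a * b)).trans ?_
  rw [map_mul, C.ρ_coinv, h]
  exact congrArg ((T.rm (b : A)).rTensor H) (canMap_mk T.rm T.rm_mul l a).symm

theorem δ_rm_coinv (b : C.coinv) (l : L) :
    T.δ (T.rm (b : A) l) = (T.rm (b : A)).rTensor H (T.δ l) := by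
  rw [← diagRm_coinv, T.δ_rm]
  rfl

/-- The map that cuts out the coinvariants is the difference of l ↦ δ l and l ↦ l ⊗ 1. This lemma
and `diag_canMap_one` apply the canonical map of L ⊗ H, with its diagonal A-action, to the two
halves: they become δ ⊗ H and L ⊗ Δ after the canonical map of L. Their agreement on δ l is
coassociativity. -/
theorem diag_canMap_δ (l : L) (a : A) :
    (T.diagRm.flip (T.δ l)).rTensor H (C.ρ a) =
      T.δ.rTensor H (canMap T.rm T.rm_mul (BalTensor.mk T.rmB C.lB (l ⊗ₜ[k] a))) := by
  rw [show canMap T.rm T.rm_mul (BalTensor.mk T.rmB C.lB (l ⊗ₜ[k] a)) = _ from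
    canMap_mk T.rm T.rm_mul l a, ← LinearMap.rTensor_comp_apply]
  congr 2
  ext a'
  simp [T.δ_rm, diagRm]

theorem diag_canMap_one (l : L) (a : A) :
    TensorProduct.assoc k L H H ((T.diagRm.flip (l ⊗ₜ[k] (1 : H))).rTensor H (C.ρ a)) =
      (Coalgebra.comul (R := k) (A := H)).lTensor L
        (canMap T.rm T.rm_mul (BalTensor.mk T.rmB C.lB (l ⊗ₜ[k] a))) := by
  rw [show canMap T.rm T.rm_mul (BalTensor.mk T.rmB C.lB (l ⊗ₜ[k] a)) = _ from
    canMap_mk T.rm T.rm_mul l a]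
  have h₁ : T.diagRm.flip (l ⊗ₜ[k] (1 : H)) = (T.rm.flip l).rTensor H ∘ₗ C.ρ.toLinearMap := by
    ext a'
    simp only [LinearMap.flip_apply, diagRm, LinearMap.comp_apply, AlgHom.toLinearMap_apply]
    generalize C.ρ a' = X
    induction X with
    | zero => simp
    | add X Y hX hY => simp only [map_add, hX, hY, LinearMap.add_apply]
    | tmul a h => simp
  have h₂ : ∀ Y : (A ⊗[k] H) ⊗[k] H,
      TensorProduct.assoc k L H H (((T.rm.flip l).rTensor H).rTensor H Y) =
        (T.rm.flip l).rTensor (H ⊗[k] H) (TensorProduct.assoc k A H H Y) := by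
    intro Y
    refine LinearMap.congr_fun
      (f := (TensorProduct.assoc k L H H).toLinearMap ∘ₗ ((T.rm.flip l).rTensor H).rTensor H)
      (g := (T.rm.flip l).rTensor (H ⊗[k] H) ∘ₗ (TensorProduct.assoc k A H H).toLinearMap)
      (TensorProduct.ext_threefold fun x y z => ?_) Y
    simp
  rw [h₁, LinearMap.rTensor_comp_apply, h₂, C.coassoc, ← LinearMap.comp_apply,
    ← LinearMap.comp_apply, LinearMap.rTensor_comp_lTensor, LinearMap.lTensor_comp_rTensor]

theorem subtype_rmCo (b : C.coinv) (m : T.coinv) :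
    T.coinv.subtype (T.rmCo b m) = T.rm (b : A) (T.coinv.subtype m) := rfl

section Structure

variable {L : Type w} [AddCommGroup L] [Module k L] (T : C.HopfBimodule L)

theorem injective_subtype_map (hF : C.IsLeftFaithfullyFlat) :
    Function.Injective (BalTensor.map T.coinv.subtype LinearMap.id
      (fun _ _ => rfl) (fun _ _ => rfl) :
      BalTensor T.rmCo C.lB →ₗ[k] BalTensor T.rmB C.lB) :=
  (hF.injective_iff T.rAct_rmCo T.rAct_rmB T.coinv.subtype (fun _ _ => rfl)).1
    T.coinv.injective_subtype

/-- The structure theorem for relative Hopf modules: `L^{co H} ⊗_B A → L` is bijective. -/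
theorem actMap_coinv_bijective (hG : C.IsHopfGalois) (hF : C.IsLeftFaithfullyFlat) :
    Function.Bijective (T.actMap T.rmCo T.coinv.subtype T.subtype_rmCo) := by
  have hcan := canMap_bijective hG T.rm T.rm_one T.rm_mul
  let can := canMap (C := C) T.rm T.rm_mul
  let e := LinearEquiv.ofBijective can hcan
  have he : ∀ y, can (e.symm y) = y := e.apply_symm_apply
  let ι : BalTensor T.rmCo C.lB →ₗ[k] BalTensor T.rmB C.lB :=
    BalTensor.map T.coinv.subtype LinearMap.id (fun _ _ => rfl) (fun _ _ => rfl)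
  -- g measures the failure of coinvariance: under the canonical map it becomes δ l - l ⊗ 1, so that
  -- its kernel is L^{co H}. It is right B-linear for the action on the factor A.
  let g : L →ₗ[k] BalTensor T.rmB C.lB :=
    e.symm.toLinearMap ∘ₗ T.δ - BalTensor.mk T.rmB C.lB ∘ₗ (TensorProduct.mk k L A).flip 1
  have hg : ∀ l, can (g l) = T.δ l - l ⊗ₜ[k] 1 := by
    intro l
    have h₁ : can (BalTensor.mk T.rmB C.lB (l ⊗ₜ[k] (1 : A))) = l ⊗ₜ[k] (1 : H) := by
      refine (canMap_mk T.rm T.rm_mul l 1).trans ?_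
      simp [Algebra.TensorProduct.one_def, T.rm_one]
    rw [← h₁]
    simp only [g, LinearMap.sub_apply, LinearMap.comp_apply, map_sub, LinearEquiv.coe_coe, he]
    rfl
  have hgB : ∀ b l, g (T.rmB b l) = T.rmBal b (g l) := by
    intro b l
    apply hcan.1
    change can _ = _
    rw [canMap_rmBal, hg, show canMap T.rm T.rm_mul (g l) = _ from hg l, map_sub, δ_rm_coinv]
    rfl
  have hex : Function.Exact T.coinv.subtype g := by
    intro l
    rw [show Set.range T.coinv.subtype = (T.coinv : Set L) from Subtype.range_coe]
    change _ ↔ T.δ l = l ⊗ₜ[k] 1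
    rw [← sub_eq_zero (a := T.δ l), ← hg, map_eq_zero_iff can hcan.1]
  -- Flatness: L^{co H} ⊗_B A is the kernel of g ⊗_B A.
  have hex' := (hF.exact_iff T.rAct_rmCo T.rAct_rmB T.rAct_rmBal T.coinv.subtype g
    (fun _ _ => rfl) hgB).1 hex
  have hι : Function.Injective ι := T.injective_subtype_map hF
  have hcan' := canMap_bijective hG T.diagRm T.diagRm_one T.diagRm_mul
  have hcanB : ∀ b y, can (T.rmBal b y) = T.diagRm (b : A) (can y) := fun b y => by
    rw [diagRm_coinv]
    exact T.canMap_rmBal b y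
  let K : BalTensor T.rmBal C.lB →ₗ[k] BalTensor (fun b : C.coinv => T.diagRm (b : A)) C.lB :=
    BalTensor.map can LinearMap.id hcanB (fun _ _ => rfl)
  have hmap : Function.Bijective K := BalTensor.map_bijective _ _ hcan Function.bijective_id
  let G : BalTensor T.rmB C.lB →ₗ[k] BalTensor T.rmBal C.lB :=
    BalTensor.map g LinearMap.id hgB (fun _ _ => rfl)
  have hι' : ∀ y, can (ι y) = T.δ (T.actMap T.rmCo T.coinv.subtype T.subtype_rmCo y) := by
    intro y
    refine LinearMap.congr_fun (f := can ∘ₗ ι)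
      (g := T.δ ∘ₗ T.actMap T.rmCo T.coinv.subtype T.subtype_rmCo)
      (BalTensor.hom_ext fun m a => ?_) y
    have hm : T.δ (m : L) = (m : L) ⊗ₜ[k] (1 : H) := m.2
    rw [LinearMap.comp_apply, LinearMap.comp_apply, actMap_mk, T.δ_rm]
    refine (canMap_mk T.rm T.rm_mul (m : L) a).trans ?_
    rw [Submodule.subtype_apply, hm]
    generalize C.ρ a = X
    induction X with
    | zero => simp
    | add X Y hX hY => simp only [map_add, hX, hY, LinearMap.add_apply]
    | tmul a h => simp
  constructor
  · rw [injective_iff_map_eq_zero]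
    intro y hy
    have := hι' y
    rw [hy, map_zero, map_eq_zero_iff can hcan.1, map_eq_zero_iff ι hι] at this
    exact this
  · intro l
    -- The candidate preimage of l. By coassociativity of δ it lies in the kernel of g ⊗_B A.
    let z := e.symm (T.δ l)
    have hz : G z = 0 := by
      rw [← map_eq_zero_iff _ hmap.1, ← map_eq_zero_iff _ hcan'.1,
        ← map_eq_zero_iff _ (TensorProduct.assoc k L H H).injective]
      have h : ∀ y : BalTensor T.rmB C.lB, TensorProduct.assoc k L H H
          (canMap T.diagRm T.diagRm_mul (K (G y))) =
          TensorProduct.assoc k L H H (T.δ.rTensor H (can y)) -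
            (Coalgebra.comul (R := k) (A := H)).lTensor L (can y) := by
        intro y
        refine LinearMap.congr_fun (f := (TensorProduct.assoc k L H H).toLinearMap ∘ₗ
          canMap T.diagRm T.diagRm_mul ∘ₗ K ∘ₗ G)
          (g := (TensorProduct.assoc k L H H).toLinearMap ∘ₗ T.δ.rTensor H ∘ₗ can -
            (Coalgebra.comul (R := k) (A := H)).lTensor L ∘ₗ can)
          (BalTensor.hom_ext fun m a => ?_) y
        simp only [LinearMap.comp_apply, LinearMap.sub_apply, LinearEquiv.coe_coe]
        have h₁ : canMap T.diagRm T.diagRm_mul (K (G (BalTensor.mk T.rmB C.lB (m ⊗ₜ[k] a)))) =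
            (T.diagRm.flip (can (g m))).rTensor H (C.ρ a) := rfl
        have h₂ := T.diag_canMap_one m a
        have h₃ := T.diag_canMap_δ m a
        rw [h₁, hg, map_sub, LinearMap.rTensor_sub, LinearMap.sub_apply, map_sub, h₂, h₃]
      rw [h, he, T.coassoc, sub_self]
    obtain ⟨y, hy⟩ := (hex' z).1 hz
    refine ⟨y, ?_⟩
    have h₁ : T.δ (T.actMap T.rmCo T.coinv.subtype T.subtype_rmCo y) = T.δ l := by
      rw [← hι', show ι y = z from hy, he]
    -- The counit splits δ, so equality after δ suffices.
    rw [← T.counit l, ← h₁, T.counit]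

end Structure

end HopfBimodule

end ESCalculus.RightComoduleAlgebra

namespace ESCalculus.RightComoduleAlgebra

variable {k : Type u} {H : Type v} {A : Type w} [Field k] [Ring H] [HopfAlgebra k H]
  [Ring A] [Algebra k A] {C : RightComoduleAlgebra k H A}

namespace HopfBimodule

/-! ### Descent: recovering spaces of coinvariants from the A-modules they generate. -/

section Descent

variable {L : Type w} [AddCommGroup L] [Module k L] (T : C.HopfBimodule L)

/-- The right `A`-submodule generated by a subspace. -/
def spanA (V : Submodule k L) : Submodule k L :=
  Submodule.span k {z | ∃ (a : A) (v : L), v ∈ V ∧ z = T.rm a v}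

theorem le_spanA (V : Submodule k L) : V ≤ T.spanA V := fun v hv =>
  Submodule.subset_span ⟨1, v, hv, (T.rm_one v).symm⟩

theorem rm_mem_spanA (V : Submodule k L) (a : A) {l : L} (hl : l ∈ T.spanA V) :
    T.rm a l ∈ T.spanA V := by
  have : T.spanA V ≤ (T.spanA V).comap (T.rm a) := by
    rw [spanA, Submodule.span_le]
    rintro _ ⟨a', v, hv, rfl⟩
    exact Submodule.subset_span ⟨a' * a, v, hv, (T.rm_mul a' a v).symm⟩
  exact this hl

theorem actMap_mem {M : Type*} [AddCommGroup M] [Module k M] (r : C.coinv → Module.End k M)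
    (f : M →ₗ[k] L) (hf : ∀ b m, f (r b m) = T.rm (b : A) (f m)) (W : Submodule k L)
    (hW : ∀ a m, T.rm a (f m) ∈ W) (y : BalTensor r C.lB) : T.actMap r f hf y ∈ W := by
  obtain ⟨z, rfl⟩ := BalTensor.mk_surjective _ _ y
  induction z with
  | zero => simp
  | add y₁ y₂ h₁ h₂ => rw [map_add, map_add]; exact add_mem h₁ h₂
  | tmul m a => exact hW a m

/-- The action map factors through f ⊗_B A, which is therefore injective, and faithful flatness
reflects injectivity. -/
theorem injective_of_actMap (hF : C.IsLeftFaithfullyFlat) {M : Type w} [AddCommGroup M]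
    [Module k M] {r : C.coinv → Module.End k M} (hr : C.RAct r) (f : M →ₗ[k] L)
    (hf : ∀ b m, f (r b m) = T.rm (b : A) (f m)) (h : Function.Injective (T.actMap r f hf)) :
    Function.Injective f := by
  rw [hF.injective_iff hr T.rAct_rmB f hf]
  have : T.actMap r f hf = T.actMap T.rmB LinearMap.id (fun _ _ => rfl) ∘ₗ
      BalTensor.map f LinearMap.id hf (fun _ _ => rfl) := BalTensor.hom_ext fun _ _ => rfl
  rw [this, LinearMap.coe_comp] at h
  exact h.of_comp

/-- A `B`-submodule of the coinvariants is recovered from the `A`-module it generates. -/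
theorem mem_of_mem_spanA (hG : C.IsHopfGalois) (hF : C.IsLeftFaithfullyFlat)
    (V : Submodule k L) (hV : V ≤ T.coinv) (hVB : ∀ (b : C.coinv), ∀ v ∈ V, T.rm (b : A) v ∈ V)
    {l : L} (hl : l ∈ T.coinv) (hl' : l ∈ T.spanA V) : l ∈ V := by
  -- V' is the largest possible enlargement of V, namely VA ∩ L^{co H}. Equality with V is tested
  -- after tensoring with A.
  let V' : Submodule k L := T.spanA V ⊓ T.coinv
  have hVV' : V ≤ V' := le_inf (T.le_spanA V) hV
  let r : C.coinv → Module.End k V := fun b => (T.rm (b : A)).restrict (hVB b)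
  let r' : C.coinv → Module.End k V' := fun b => (T.rm (b : A)).restrict fun v hv =>
    ⟨T.rm_mem_spanA V b hv.1, T.rm_mem_coinv b hv.2⟩
  have hr : C.RAct r := ⟨fun m => Subtype.ext (T.rm_one _),
    fun b c m => Subtype.ext (T.rm_mul b c _), fun b c m => Subtype.ext (T.rAct_rmB.add b c m),
    fun t b m => Subtype.ext (T.rAct_rmB.smul t b m)⟩
  have hr' : C.RAct r' := ⟨fun m => Subtype.ext (T.rm_one _),
    fun b c m => Subtype.ext (T.rm_mul b c _), fun b c m => Subtype.ext (T.rAct_rmB.add b c m),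
    fun t b m => Subtype.ext (T.rAct_rmB.smul t b m)⟩
  let i : V →ₗ[k] V' := Submodule.inclusion hVV'
  have hi : ∀ b m, i (r b m) = r' b (i m) := fun _ _ => rfl
  let j : V' →ₗ[k] T.coinv := Submodule.inclusion inf_le_right
  have hj : ∀ b m, j (r' b m) = T.rmCo b (j m) := fun _ _ => rfl
  have hact' : ∀ b m, V'.subtype (r' b m) = T.rm (b : A) (V'.subtype m) := fun _ _ => rfl
  have hact : ∀ b m, V.subtype (r b m) = T.rm (b : A) (V.subtype m) := fun _ _ => rfl
  have hinj : Function.Injective (T.actMap r' V'.subtype hact') := by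
    have : T.actMap r' V'.subtype hact' = T.actMap T.rmCo T.coinv.subtype T.subtype_rmCo ∘ₗ
        BalTensor.map j LinearMap.id hj (fun _ _ => rfl) := BalTensor.hom_ext fun _ _ => rfl
    rw [this, LinearMap.coe_comp]
    exact (T.actMap_coinv_bijective hG hF).1.comp
      ((hF.injective_iff hr' T.rAct_rmCo j hj).1 (Submodule.inclusion_injective _))
  -- V' ⊗_B A embeds into L with image inside VA, and VA is already covered by V ⊗_B A.
  have hsurj : Function.Surjective i := by
    rw [hF.surjective_iff hr hr' i hi]
    intro y
    have hy : T.actMap r' V'.subtype hact' y ∈ T.spanA V :=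
      T.actMap_mem r' V'.subtype hact' _ (fun a m => T.rm_mem_spanA V a m.2.1) y
    have hle : T.spanA V ≤ LinearMap.range (T.actMap r V.subtype hact) := by
      rw [spanA, Submodule.span_le]
      rintro _ ⟨a, v, hv, rfl⟩
      exact ⟨BalTensor.mk r C.lB ((⟨v, hv⟩ : V) ⊗ₜ[k] a), rfl⟩
    obtain ⟨x, hx⟩ := hle hy
    refine ⟨x, hinj ?_⟩
    rw [← hx]
    refine LinearMap.congr_fun (f := T.actMap r' V'.subtype hact' ∘ₗ
      BalTensor.map i LinearMap.id hi (fun _ _ => rfl)) (g := T.actMap r V.subtype hact)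
      (BalTensor.hom_ext fun _ _ => rfl) x
  obtain ⟨v, hv⟩ := hsurj ⟨l, hl', hl⟩
  rw [show l = (v : L) from (congrArg Subtype.val hv).symm]
  exact v.2

theorem spanA_coinv (hG : C.IsHopfGalois) (hF : C.IsLeftFaithfullyFlat) :
    T.spanA T.coinv = ⊤ := by
  rw [eq_top_iff]
  intro l _
  obtain ⟨y, rfl⟩ := (T.actMap_coinv_bijective hG hF).2 l
  exact T.actMap_mem T.rmCo T.coinv.subtype T.subtype_rmCo (T.spanA T.coinv) (fun a m => Submodule.subset_span ⟨a, m, m.2, rfl⟩) y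

theorem eq_coinv_of_spanA_eq_top (hG : C.IsHopfGalois) (hF : C.IsLeftFaithfullyFlat)
    (V : Submodule k L) (hV : V ≤ T.coinv) (hVB : ∀ (b : C.coinv), ∀ v ∈ V, T.rm (b : A) v ∈ V)
    (h : T.spanA V = ⊤) : V = T.coinv :=
  le_antisymm hV fun _ hl => T.mem_of_mem_spanA hG hF V hV hVB hl (h ▸ Submodule.mem_top)

/-- The recognition principle for coinvariants: faithful flatness reflects the isomorphism M ⊗_B A ≅
L to one of M with L^{co H}. It is applied below to ℋ ⊗_B L^{co H} and to the tensor square of ℋ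
over the source map. -/
theorem injective_and_range_eq (hG : C.IsHopfGalois) (hF : C.IsLeftFaithfullyFlat) {M : Type w}
    [AddCommGroup M] [Module k M] {r : C.coinv → Module.End k M} (hr : C.RAct r) (f : M →ₗ[k] L)
    (hf : ∀ b m, f (r b m) = T.rm (b : A) (f m)) (hco : ∀ m, f m ∈ T.coinv)
    (h : Function.Bijective (T.actMap r f hf)) :
    Function.Injective f ∧ LinearMap.range f = T.coinv := by
  refine ⟨T.injective_of_actMap hF hr f hf h.1, T.eq_coinv_of_spanA_eq_top hG hF _ ?_ ?_ ?_⟩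
  · rintro _ ⟨m, rfl⟩
    exact hco m
  · rintro b _ ⟨m, rfl⟩
    exact ⟨r b m, hf b m⟩
  · rw [eq_top_iff]
    intro l _
    obtain ⟨y, rfl⟩ := h.2 l
    exact T.actMap_mem r f hf (T.spanA (LinearMap.range f))
      (fun a m => Submodule.subset_span ⟨a, f m, ⟨m, rfl⟩, rfl⟩) y

end Descent

/-! ### Subobjects of Hopf bimodules, and the Hopf bimodules A and A ⊗ L. -/

section Constructions

/-- Restriction of the structure of a Hopf bimodule along an injective map. -/
def ofInjective {L L' : Type*} [AddCommGroup L] [Module k L] [AddCommGroup L'] [Module k L']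
    (T : C.HopfBimodule L) (i : L' →ₗ[k] L) (hi : Function.Injective i)
    (lm : A →ₗ[k] Module.End k L') (rm : A →ₗ[k] Module.End k L') (δ : L' →ₗ[k] L' ⊗[k] H)
    (hlm : ∀ a l, i (lm a l) = T.lm a (i l)) (hrm : ∀ a l, i (rm a l) = T.rm a (i l))
    (hδ : ∀ l, i.rTensor H (δ l) = T.δ (i l)) : C.HopfBimodule L' where
  lm := lm
  rm := rm
  δ := δ
  lm_one l := hi (by rw [hlm, T.lm_one])
  lm_mul a a' l := hi (by simp only [hlm, T.lm_mul])
  rm_one l := hi (by rw [hrm, T.rm_one])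
  rm_mul a a' l := hi (by simp only [hrm, T.rm_mul])
  lm_rm a a' l := hi (by simp only [hlm, hrm, T.lm_rm])
  counit l := hi (by
    have h : ∀ X : L' ⊗[k] H, i (TensorProduct.rid k L'
        ((Coalgebra.counit (R := k) (A := H)).lTensor L' X)) = TensorProduct.rid k L
        ((Coalgebra.counit (R := k) (A := H)).lTensor L (i.rTensor H X)) := by
      intro X
      induction X with
      | zero => simp
      | add X Y hX hY => simp only [map_add, hX, hY]
      | tmul l h => simp
    rw [h, hδ, T.counit])
  coassoc l := by
    -- Over a field i ⊗ (H ⊗ H) stays injective, so the identity may be checked in L ⊗ (H ⊗ H),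
    -- where it holds for T.
    apply Module.Flat.rTensor_preserves_injective_linearMap (M := H ⊗[k] H) i hi
    have h₁ : ∀ X : L' ⊗[k] H, i.rTensor (H ⊗[k] H) (TensorProduct.assoc k L' H H
        (δ.rTensor H X)) = TensorProduct.assoc k L H H (T.δ.rTensor H (i.rTensor H X)) := by
      intro X
      induction X with
      | zero => simp
      | add X Y hX hY => simp only [map_add, hX, hY]
      | tmul l h =>
        simp only [LinearMap.rTensor_tmul, ← hδ]
        generalize δ l = Y
        induction Y with
        | zero => simp
        | add X Y hX hY => simp only [map_add, TensorProduct.add_tmul, hX, hY]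
        | tmul l g => simp
    rw [h₁, hδ, T.coassoc, ← hδ]
    exact LinearMap.congr_fun ((LinearMap.lTensor_comp_rTensor L' i _).trans
      (LinearMap.rTensor_comp_lTensor L' i _).symm) (δ l)
  δ_lm a l := by
    apply Module.Flat.rTensor_preserves_injective_linearMap (M := H) i hi
    rw [hδ, hlm, T.δ_lm, ← hδ]
    generalize C.ρ a = X
    generalize δ l = Y
    induction X with
    | zero => simp
    | add X Y hX hY => simp only [map_add, LinearMap.add_apply, hX, hY]
    | tmul a h =>
      induction Y with
      | zero => simp
      | add X Y hX hY => simp only [map_add, hX, hY]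
      | tmul l g => simp [hlm]
  δ_rm a l := by
    apply Module.Flat.rTensor_preserves_injective_linearMap (M := H) i hi
    rw [hδ, hrm, T.δ_rm, ← hδ]
    generalize C.ρ a = X
    generalize δ l = Y
    induction X with
    | zero => simp
    | add X Y hX hY => simp only [map_add, LinearMap.add_apply, hX, hY]
    | tmul a h =>
      induction Y with
      | zero => simp
      | add X Y hX hY => simp only [map_add, hX, hY]
      | tmul l g => simp [hrm]

variable {L : Type*} [AddCommGroup L] [Module k L] (T : C.HopfBimodule L)

section Sub

variable (J : Submodule k L) (hl : ∀ a, ∀ x ∈ J, T.lm a x ∈ J) (hr : ∀ a, ∀ x ∈ J, T.rm a x ∈ J)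
  (hδ : ∀ x ∈ J, T.δ x ∈ LinearMap.range (J.subtype.rTensor H))

/-- The coaction of a subcomodule. -/
noncomputable def subδ : J →ₗ[k] J ⊗[k] H :=
  (LinearEquiv.ofInjective (J.subtype.rTensor H)
    (Module.Flat.rTensor_preserves_injective_linearMap _ J.injective_subtype)).symm.toLinearMap ∘ₗ
    (T.δ ∘ₗ J.subtype).codRestrict _ fun x => hδ x x.2

theorem rTensor_subδ (x : J) : J.subtype.rTensor H (T.subδ J hδ x) = T.δ x :=
  congrArg Subtype.val ((LinearEquiv.ofInjective (J.subtype.rTensor H)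
    (Module.Flat.rTensor_preserves_injective_linearMap _ J.injective_subtype)).apply_symm_apply
      ((T.δ ∘ₗ J.subtype).codRestrict _ (fun x => hδ x x.2) x))

/-- A subspace that is stable under all the operations of a Hopf bimodule. -/
noncomputable def sub : C.HopfBimodule J :=
  T.ofInjective J.subtype J.injective_subtype
    (LinearMap.mk₂ k (fun a x => (⟨T.lm a x, hl a x x.2⟩ : J))
      (fun _ _ _ => Subtype.ext (by simp)) (fun _ _ _ => Subtype.ext (by simp))
      (fun _ _ _ => Subtype.ext (by simp)) (fun _ _ _ => Subtype.ext (by simp)))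
    (LinearMap.mk₂ k (fun a x => (⟨T.rm a x, hr a x x.2⟩ : J))
      (fun _ _ _ => Subtype.ext (by simp)) (fun _ _ _ => Subtype.ext (by simp))
      (fun _ _ _ => Subtype.ext (by simp)) (fun _ _ _ => Subtype.ext (by simp)))
    (T.subδ J hδ) (fun _ _ => rfl) (fun _ _ => rfl) (T.rTensor_subδ J hδ)

end Sub

variable (C) in
/-- The Hopf bimodule `A`. -/
noncomputable def self : C.HopfBimodule A where
  lm := LinearMap.mul k A
  rm := (LinearMap.mul k A).flip
  δ := C.ρ.toLinearMap
  lm_one := by simp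
  lm_mul := by simp [mul_assoc]
  rm_one := by simp
  rm_mul := by simp [mul_assoc]
  lm_rm := by simp [mul_assoc]
  counit := C.counit
  coassoc := C.coassoc
  δ_lm a l := by
    simp only [LinearMap.mul_apply', AlgHom.toLinearMap_apply, map_mul]
    generalize C.ρ a = X
    generalize C.ρ l = Y
    induction X with
    | zero => simp
    | add X Y hX hY => simp only [map_add, LinearMap.add_apply, hX, hY, add_mul]
    | tmul a h =>
      induction Y with
      | zero => simp
      | add X Y hX hY => simp only [map_add, hX, hY, mul_add]
      | tmul l g => simp
  δ_rm a l := by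
    simp only [LinearMap.mul_apply', LinearMap.flip_apply, AlgHom.toLinearMap_apply, map_mul]
    generalize C.ρ a = X
    generalize C.ρ l = Y
    induction X with
    | zero => simp
    | add X Y hX hY => simp only [map_add, LinearMap.add_apply, hX, hY, mul_add]
    | tmul a h =>
      induction Y with
      | zero => simp
      | add X Y hX hY => simp only [map_add, hX, hY, add_mul]
      | tmul l g => simp

/-- The map `(a ⊗ g) ⊗ (l ⊗ h) ↦ (a ⊗ l) ⊗ g h`. -/
noncomputable def collectL (A H L : Type*) [AddCommGroup A] [Module k A] [Ring H] [Algebra k H]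
    [AddCommGroup L] [Module k L] : (A ⊗[k] H) ⊗[k] (L ⊗[k] H) →ₗ[k] (A ⊗[k] L) ⊗[k] H :=
  TensorProduct.map LinearMap.id (LinearMap.mul' k H) ∘ₗ
    (TensorProduct.tensorTensorTensorComm k A H L H).toLinearMap

theorem collectL_tmul {A H L : Type*} [AddCommGroup A] [Module k A] [Ring H] [Algebra k H]
    [AddCommGroup L] [Module k L] (a : A) (g : H) (l : L) (h : H) :
    collectL (k := k) A H L ((a ⊗ₜ[k] g) ⊗ₜ[k] (l ⊗ₜ[k] h)) = (a ⊗ₜ[k] l) ⊗ₜ[k] (g * h) := by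
  simp [collectL]

/-- The diagonal coaction on `A ⊗ L`. -/
noncomputable def tensδ : A ⊗[k] L →ₗ[k] (A ⊗[k] L) ⊗[k] H :=
  collectL A H L ∘ₗ TensorProduct.map C.ρ.toLinearMap T.δ

theorem tensδ_tmul (a : A) (l : L) :
    T.tensδ (a ⊗ₜ[k] l) = collectL A H L (C.ρ a ⊗ₜ[k] T.δ l) := rfl

/-- The algebra in `collectL` is a variable so that H ⊗ H can be put for H here. Coassociativity of
the diagonal coaction then reduces to coassociativity of both factors, multiplied in H ⊗ H. -/
theorem assoc_tensδ (X : A ⊗[k] H) (Z : L ⊗[k] H) :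
    TensorProduct.assoc k (A ⊗[k] L) H H
      (T.tensδ.rTensor H (collectL A H L (X ⊗ₜ[k] Z))) =
      collectL A (H ⊗[k] H) L (TensorProduct.assoc k A H H (C.ρ.toLinearMap.rTensor H X) ⊗ₜ[k]
        TensorProduct.assoc k L H H (T.δ.rTensor H Z)) := by
  induction X with
  | zero => simp
  | add X Y hX hY => simp only [map_add, TensorProduct.add_tmul, hX, hY]
  | tmul a h =>
    induction Z with
    | zero => simp
    | add X Y hX hY => simp only [map_add, TensorProduct.tmul_add, hX, hY]
    | tmul l g =>
      simp only [collectL_tmul, LinearMap.rTensor_tmul, tensδ_tmul, AlgHom.toLinearMap_apply]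
      generalize C.ρ a = X
      generalize T.δ l = Y
      induction X with
      | zero => simp
      | add X Y hX hY => simp only [map_add, TensorProduct.add_tmul, hX, hY]
      | tmul a h' =>
        induction Y with
        | zero => simp
        | add X Y hX hY => simp only [map_add, TensorProduct.tmul_add, TensorProduct.add_tmul, hX, hY]
        | tmul l g' => simp [collectL_tmul]

/-- Here the multiplicativity of the comultiplication of H enters. -/
theorem comul_collectL (X : A ⊗[k] H) (Z : L ⊗[k] H) :
    (Coalgebra.comul (R := k) (A := H)).lTensor (A ⊗[k] L) (collectL A H L (X ⊗ₜ[k] Z)) =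
      collectL A (H ⊗[k] H) L ((Coalgebra.comul (R := k) (A := H)).lTensor A X ⊗ₜ[k]
        (Coalgebra.comul (R := k) (A := H)).lTensor L Z) := by
  induction X with
  | zero => simp
  | add X Y hX hY => simp only [map_add, TensorProduct.add_tmul, hX, hY]
  | tmul a h =>
    induction Z with
    | zero => simp
    | add X Y hX hY => simp only [map_add, TensorProduct.tmul_add, hX, hY]
    | tmul l g => simp [collectL_tmul]

theorem counit_collectL (X : A ⊗[k] H) (Z : L ⊗[k] H) :
    TensorProduct.rid k (A ⊗[k] L) ((Coalgebra.counit (R := k) (A := H)).lTensor (A ⊗[k] L)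
      (collectL A H L (X ⊗ₜ[k] Z))) =
      TensorProduct.rid k A ((Coalgebra.counit (R := k) (A := H)).lTensor A X) ⊗ₜ[k]
        TensorProduct.rid k L ((Coalgebra.counit (R := k) (A := H)).lTensor L Z) := by
  induction X with
  | zero => simp
  | add X Y hX hY => simp only [map_add, TensorProduct.add_tmul, hX, hY]
  | tmul a h =>
    induction Z with
    | zero => simp
    | add X Y hX hY => simp only [map_add, TensorProduct.tmul_add, hX, hY]
    | tmul l g =>
      simp [collectL_tmul, TensorProduct.smul_tmul, TensorProduct.tmul_smul, smul_smul, mul_comm]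

/-- The Hopf bimodule `A ⊗ L` with the outer actions and the diagonal coaction. -/
noncomputable def tens : C.HopfBimodule (A ⊗[k] L) where
  lm := LinearMap.rTensorHom L ∘ₗ LinearMap.mul k A
  rm := LinearMap.lTensorHom A ∘ₗ T.rm
  δ := T.tensδ
  lm_one l := by
    induction l with
    | zero => simp
    | add X Y hX hY => simp only [map_add, hX, hY]
    | tmul a l => simp
  lm_mul a a' l := by
    induction l with
    | zero => simp
    | add X Y hX hY => simp only [map_add, hX, hY]
    | tmul a l => simp [mul_assoc]
  rm_one l := by
    induction l with
    | zero => simp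
    | add X Y hX hY => simp only [map_add, hX, hY]
    | tmul a l => simp [T.rm_one]
  rm_mul a a' l := by
    induction l with
    | zero => simp
    | add X Y hX hY => simp only [map_add, hX, hY]
    | tmul a l => simp [T.rm_mul]
  lm_rm a a' l := by
    induction l with
    | zero => simp
    | add X Y hX hY => simp only [map_add, hX, hY]
    | tmul a l => simp
  counit l := by
    induction l with
    | zero => simp
    | add X Y hX hY => simp only [map_add, hX, hY]
    | tmul a l => rw [tensδ_tmul, counit_collectL, C.counit, T.counit]
  coassoc l := by
    induction l with
    | zero => simp
    | add X Y hX hY => simp only [map_add, hX, hY]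
    | tmul a l => rw [tensδ_tmul, assoc_tensδ, comul_collectL, ← C.coassoc, ← T.coassoc]
  δ_lm c y := by
    induction y with
    | zero => simp
    | add X Y hX hY => simp only [map_add, hX, hY]
    | tmul a l =>
      simp only [LinearMap.comp_apply, LinearMap.coe_rTensorHom, LinearMap.rTensor_tmul,
        LinearMap.mul_apply', tensδ_tmul, map_mul]
      generalize C.ρ a = X
      generalize C.ρ c = Y
      generalize T.δ l = Z
      induction X with
      | zero => simp
      | add X Y hX hY => simp only [map_add, mul_add, TensorProduct.add_tmul, hX, hY]
      | tmul a h =>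
        induction Y with
        | zero => simp
        | add X Y hX hY =>
          simp only [map_add, add_mul, LinearMap.add_apply, TensorProduct.add_tmul, hX, hY]
        | tmul c h' =>
          induction Z with
          | zero => simp
          | add X Y hX hY => simp only [map_add, TensorProduct.tmul_add, hX, hY]
          | tmul l g => simp [collectL_tmul, mul_assoc]
  δ_rm c y := by
    induction y with
    | zero => simp
    | add X Y hX hY => simp only [map_add, hX, hY]
    | tmul a l =>
      simp only [LinearMap.comp_apply, LinearMap.coe_lTensorHom, LinearMap.lTensor_tmul,
        tensδ_tmul, T.δ_rm]
      generalize C.ρ a = X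
      generalize C.ρ c = Y
      generalize T.δ l = Z
      induction X with
      | zero => simp
      | add X Y hX hY => simp only [map_add, TensorProduct.add_tmul, hX, hY]
      | tmul a h =>
        induction Y with
        | zero => simp
        | add X Y hX hY =>
          simp only [map_add, LinearMap.add_apply, TensorProduct.tmul_add, hX, hY]
        | tmul c h' =>
          induction Z with
          | zero => simp
          | add X Y hX hY => simp only [map_add, TensorProduct.tmul_add, hX, hY]
          | tmul l g => simp [collectL_tmul, mul_assoc]

theorem tens_lm_tmul (a c : A) (l : L) : T.tens.lm a (c ⊗ₜ[k] l) = (a * c) ⊗ₜ[k] l := rfl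

theorem tens_rm_tmul (a c : A) (l : L) : T.tens.rm a (c ⊗ₜ[k] l) = c ⊗ₜ[k] T.rm a l := rfl

theorem tens_δ_tmul (a : A) (l : L) :
    T.tens.δ (a ⊗ₜ[k] l) = collectL A H L (C.ρ a ⊗ₜ[k] T.δ l) := rfl

end Constructions

end HopfBimodule

end ESCalculus.RightComoduleAlgebra

namespace ESCalculus.RightComoduleAlgebra

variable {k : Type u} {H : Type v} {A : Type w} [Field k] [Ring H] [HopfAlgebra k H]
  [Ring A] [Algebra k A] {C : RightComoduleAlgebra k H A}

/-! ### The algebra ℋ, its source and its target, computed in A ⊗ A. -/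

section ESAlgebra

theorem esIncl_injective : Function.Injective C.esIncl :=
  (unopR k A).injective.comp C.esVal_injective

theorem esIncl_mem (x : C.ES) : C.esIncl x ∈ C.diagCoinv := x.2

theorem exists_esIncl_eq {z : A ⊗[k] A} (hz : z ∈ C.diagCoinv) : ∃ x : C.ES, C.esIncl x = z :=
  ⟨⟨(unopR k A).symm z, by
    change unopR k A ((unopR k A).symm z) ∈ C.diagCoinv
    rwa [LinearEquiv.apply_symm_apply]⟩, (unopR k A).apply_symm_apply z⟩

theorem range_esIncl : LinearMap.range C.esIncl = C.diagCoinv :=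
  le_antisymm (by rintro _ ⟨x, rfl⟩; exact esIncl_mem x) fun _ hz => exists_esIncl_eq hz

theorem unopR_mul (x y : A ⊗[k] Aᵐᵒᵖ) : unopR k A (x * y) =
    TensorProduct.map₂ (LinearMap.mul k A) (LinearMap.mul k A).flip (unopR k A x)
      (unopR k A y) := by
  induction x with
  | zero => simp
  | add x₁ x₂ h₁ h₂ => simp only [add_mul, map_add, LinearMap.add_apply, h₁, h₂]
  | tmul a a' =>
    obtain ⟨a', rfl⟩ := op_surjective a'
    induction y with
    | zero => simp
    | add x₁ x₂ h₁ h₂ => simp only [mul_add, map_add, h₁, h₂]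
    | tmul c c' =>
      obtain ⟨c', rfl⟩ := op_surjective c'
      rw [Algebra.TensorProduct.tmul_mul_tmul, ← op_mul, unopR_tmul, unopR_tmul, unopR_tmul]
      simp

theorem esIncl_mul (x y : C.ES) : C.esIncl (x * y) =
    TensorProduct.map₂ (LinearMap.mul k A) (LinearMap.mul k A).flip (C.esIncl x)
      (C.esIncl y) := by
  refine (congrArg (unopR k A) (map_mul C.esVal x y)).trans (unopR_mul _ _)

theorem esIncl_one : C.esIncl 1 = 1 ⊗ₜ[k] 1 := by
  refine (congrArg (unopR k A) (map_one C.esVal)).trans ?_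
  rw [Algebra.TensorProduct.one_def, ← op_one, unopR_tmul]

theorem esIncl_source (b : C.coinv) : C.esIncl (C.source b) = (b : A) ⊗ₜ[k] 1 :=
  unopR_tmul (b : A) 1

theorem esIncl_target (b : C.coinv) : C.esIncl (C.target b) = 1 ⊗ₜ[k] (b : A) :=
  unopR_tmul 1 (b : A)

theorem esIncl_target_mul (b : C.coinv) (x : C.ES) :
    C.esIncl (C.target b * x) = (LinearMap.mulRight k (b : A)).lTensor A (C.esIncl x) := by
  rw [esIncl_mul, esIncl_target]
  generalize C.esIncl x = z
  induction z with
  | zero => simp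
  | add x₁ x₂ h₁ h₂ => simp only [map_add, h₁, h₂]
  | tmul c c' => simp

theorem esIncl_source_mul (b : C.coinv) (x : C.ES) :
    C.esIncl (C.source b * x) = (LinearMap.mulLeft k (b : A)).rTensor A (C.esIncl x) := by
  rw [esIncl_mul, esIncl_source]
  generalize C.esIncl x = z
  induction z with
  | zero => simp
  | add x₁ x₂ h₁ h₂ => simp only [map_add, h₁, h₂]
  | tmul c c' => simp

theorem esIncl_mul_source (b : C.coinv) (x : C.ES) :
    C.esIncl (x * C.source b) = (LinearMap.mulRight k (b : A)).rTensor A (C.esIncl x) := by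
  rw [esIncl_mul, esIncl_source]
  generalize C.esIncl x = z
  induction z with
  | zero => simp
  | add x₁ x₂ h₁ h₂ => simp only [map_add, LinearMap.add_apply, h₁, h₂]
  | tmul c c' => simp

theorem source_one : C.source 1 = 1 := esIncl_injective (by simp [esIncl_source, esIncl_one])

theorem target_one : C.target 1 = 1 := esIncl_injective (by simp [esIncl_target, esIncl_one])

theorem target_mul (b c : C.coinv) : C.target (b * c) = C.target c * C.target b :=
  esIncl_injective (by simp [esIncl_target_mul, esIncl_target])

theorem target_add (b c : C.coinv) : C.target (b + c) = C.target b + C.target c :=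
  esIncl_injective (by simp [esIncl_target, TensorProduct.tmul_add])

theorem target_smul (t : k) (b : C.coinv) : C.target (t • b) = t • C.target b :=
  esIncl_injective (by simp [esIncl_target])

variable (C) in
theorem rAct_rES : C.RAct C.rES where
  one m := by simp [rES, target_one]
  mul b c m := by simp [rES, target_mul]
  add b c m := by simp [rES, target_add, add_mul]
  smul t b m := by simp [rES, target_smul]

end ESAlgebra

namespace HopfBimodule

theorem esIncl_rES (b : C.coinv) (x : C.ES) :
    C.esIncl (C.rES b x) = (self C).tens.rm (b : A) (C.esIncl x) := esIncl_target_mul b x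

/-- This is the structure theorem for A ⊗ A, whose coinvariants are ℋ: (q ⊗ q') ⊗ a ↦ q ⊗ q'a
identifies ℋ ⊗_B A with A ⊗ A. In particular ℋ generates A ⊗ A under right multiplication by A. -/
theorem actMap_esIncl_bijective (hG : C.IsHopfGalois) (hF : C.IsLeftFaithfullyFlat) :
    Function.Bijective ((self C).tens.actMap C.rES C.esIncl esIncl_rES) := by
  let e : C.ES →ₗ[k] (self C).tens.coinv := C.esIncl.codRestrict _ esIncl_mem
  have he : Function.Bijective e := by
    refine ⟨fun x y h => esIncl_injective (congrArg Subtype.val h), fun z => ?_⟩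
    obtain ⟨x, hx⟩ := exists_esIncl_eq z.2
    exact ⟨x, Subtype.ext hx⟩
  have he' : ∀ b m, e (C.rES b m) = (self C).tens.rmCo b (e m) := fun b m =>
    Subtype.ext (esIncl_rES b m)
  have := BalTensor.map_bijective (r := C.rES) (r' := (self C).tens.rmCo) (l := C.lB) (l' := C.lB)
    he' (fun _ _ => rfl) he Function.bijective_id (g := LinearMap.id)
  have h := ((self C).tens.actMap_coinv_bijective hG hF).comp this
  rw [← LinearMap.coe_comp] at h
  convert h using 2
  exact BalTensor.hom_ext fun _ _ => rfl

/-! ### The identification of ℋ ⊗_B L^{co H} with (A ⊗ L)^{co H}. -/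

section Emb

variable {L : Type*} [AddCommGroup L] [Module k L] (T : C.HopfBimodule L)
  {M : Type*} [AddCommGroup M] [Module k M]

/-- The map `(q ⊗ q') ⊗ m ↦ q ⊗ q' f(m)`. -/
noncomputable def embLin (f : M →ₗ[k] L) : (A ⊗[k] A) ⊗[k] M →ₗ[k] A ⊗[k] L :=
  TensorProduct.lift ((LinearMap.lTensorHom A ∘ₗ T.lm.flip ∘ₗ f).flip)

theorem embLin_tmul (f : M →ₗ[k] L) (z : A ⊗[k] A) (m : M) :
    T.embLin f (z ⊗ₜ[k] m) = (T.lm.flip (f m)).lTensor A z := rfl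

theorem embLin_tmul_tmul (f : M →ₗ[k] L) (q q' : A) (m : M) :
    T.embLin f ((q ⊗ₜ[k] q') ⊗ₜ[k] m) = q ⊗ₜ[k] T.lm q' (f m) := rfl

/-- The map `ES ⊗_B M → A ⊗ L`, `(q ⊗ q') ⊗ m ↦ q ⊗ q' f(m)`, for a map `f` of left
`B`-modules. -/
noncomputable def emb (l : C.coinv → Module.End k M) (f : M →ₗ[k] L)
    (hf : ∀ b m, f (l b m) = T.lm (b : A) (f m)) : BalTensor C.rES l →ₗ[k] A ⊗[k] L :=
  BalTensor.lift _ _ (T.embLin f ∘ₗ C.esIncl.rTensor M) (by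
    intro b x m
    simp only [LinearMap.comp_apply, LinearMap.rTensor_tmul, embLin_tmul, hf]
    rw [rES, LinearMap.mulLeft_apply, esIncl_target_mul, ← LinearMap.lTensor_comp_apply]
    congr 2
    ext c
    simp [T.lm_mul])

theorem emb_mk (l : C.coinv → Module.End k M) (f : M →ₗ[k] L)
    (hf : ∀ b m, f (l b m) = T.lm (b : A) (f m)) (x : C.ES) (m : M) :
    T.emb l f hf (BalTensor.mk _ _ (x ⊗ₜ[k] m)) = (T.lm.flip (f m)).lTensor A (C.esIncl x) := rfl

/-- A coinvariant l contributes the factor 1 to the coaction, so q ⊗ q' ↦ q ⊗ q'l is colinear and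
takes ℋ to coinvariants of A ⊗ L. -/
theorem tens_δ_lTensor {l : L} (hl : l ∈ T.coinv) (z : A ⊗[k] A) :
    T.tens.δ ((T.lm.flip l).lTensor A z) = ((T.lm.flip l).lTensor A).rTensor H (C.diag z) := by
  rw [mem_coinv] at hl
  induction z with
  | zero => simp
  | add x y hx hy => simp only [map_add, hx, hy]
  | tmul a a' =>
    rw [LinearMap.lTensor_tmul, tens_δ_tmul, LinearMap.flip_apply, T.δ_lm, hl, diag_tmul]
    generalize C.ρ a = X
    generalize C.ρ a' = Y
    induction X with
    | zero => simp
    | add X Y hX hY => simp only [map_add, TensorProduct.add_tmul, hX, hY]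
    | tmul a h =>
      induction Y with
      | zero => simp
      | add X Y hX hY =>
        simp only [map_add, LinearMap.add_apply, TensorProduct.tmul_add, hX, hY]
      | tmul c h' => simp [collectL_tmul, collect]

theorem lTensor_esIncl_mem {l : L} (hl : l ∈ T.coinv) (x : C.ES) :
    (T.lm.flip l).lTensor A (C.esIncl x) ∈ T.tens.coinv := by
  rw [mem_coinv, T.tens_δ_lTensor hl, show C.diag (C.esIncl x) = _ from esIncl_mem x]
  simp

theorem embLin_mem (f : M →ₗ[k] L) (hf : ∀ m, f m ∈ T.coinv) (z : C.ES ⊗[k] M) :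
    T.embLin f (C.esIncl.rTensor M z) ∈ T.tens.coinv := by
  induction z with
  | zero => simp
  | add x y hx hy => rw [map_add, map_add]; exact add_mem hx hy
  | tmul x m => exact T.lTensor_esIncl_mem (hf m) x

theorem emb_mem (l : C.coinv → Module.End k M) (f : M →ₗ[k] L)
    (hf : ∀ b m, f (l b m) = T.lm (b : A) (f m)) (hco : ∀ m, f m ∈ T.coinv)
    (y : BalTensor C.rES l) : T.emb l f hf y ∈ T.tens.coinv := by
  obtain ⟨z, rfl⟩ := BalTensor.mk_surjective _ _ y
  exact T.embLin_mem f hco z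

/-- Base change of ℋ ⊗_B A ≅ A ⊗ A along the left A-module L. -/
theorem emb_id_bijective (hG : C.IsHopfGalois) (hF : C.IsLeftFaithfullyFlat) :
    Function.Bijective (T.emb T.lmB LinearMap.id fun _ _ => rfl) :=
  baseChange_bijective (k := k) (V := A) (r := C.rES) (lA := C.lB) (lL := T.lmB) 1
    (LinearMap.mulRight k) T.lm (by simp) (by simp) (by simp [mul_assoc])
    (by simp [lB, mul_assoc]) T.lm_one (by simp [T.lm_mul]) (by simp [lB, T.lm_mul]) C.esIncl
    ((self C).tens.actMap C.rES C.esIncl esIncl_rES) (fun _ _ => rfl)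
    (actMap_esIncl_bijective hG hF) _ (fun _ _ => rfl)

/-- The left action of `B` on the coinvariants. -/
def lmCo (b : C.coinv) : Module.End k T.coinv :=
  (T.lm (b : A)).restrict fun _ hl => T.lm_mem_coinv b hl

theorem subtype_lmCo (b : C.coinv) (m : T.coinv) :
    T.coinv.subtype (T.lmCo b m) = T.lm (b : A) (T.coinv.subtype m) := rfl

end Emb

section Key

variable {L : Type w} [AddCommGroup L] [Module k L] (T : C.HopfBimodule L)

/-- By the recognition principle it is enough to identify (ℋ ⊗_B L^{co H}) ⊗_B A with A ⊗ L. After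
reassociation, the structure theorem for L turns L^{co H} ⊗_B A into L, and `emb_id_bijective` turns
ℋ ⊗_B L into A ⊗ L. -/
theorem emb_subtype (hG : C.IsHopfGalois) (hF : C.IsLeftFaithfullyFlat) :
    Function.Injective (T.emb T.lmCo T.coinv.subtype T.subtype_lmCo) ∧
      LinearMap.range (T.emb T.lmCo T.coinv.subtype T.subtype_lmCo) = T.tens.coinv := by
  -- The balancing uses the left action of B on L^{co H}; the right action, which commutes with it,
  -- remains available for descent.
  let r : C.coinv → Module.End k (BalTensor C.rES T.lmCo) := fun b =>
    BalTensor.map LinearMap.id (T.rmCo b) (fun _ _ => rfl) fun c m => Subtype.ext (T.lm_rm c b m).symm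
  have hr' : ∀ b x m, r b (BalTensor.mk C.rES T.lmCo (x ⊗ₜ[k] m)) =
      BalTensor.mk C.rES T.lmCo (x ⊗ₜ[k] T.rmCo b m) := fun _ _ _ => rfl
  have hr : C.RAct r :=
    { one := fun y => LinearMap.congr_fun (f := r 1) (g := LinearMap.id)
        (BalTensor.hom_ext fun x m => by rw [hr', T.rAct_rmCo.one]; rfl) y
      mul := fun b c y => LinearMap.congr_fun (f := r (b * c)) (g := r c ∘ₗ r b)
        (BalTensor.hom_ext fun x m => by
          rw [LinearMap.comp_apply, hr', hr', hr', T.rAct_rmCo.mul]) y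
      add := fun b c y => LinearMap.congr_fun (f := r (b + c)) (g := r b + r c)
        (BalTensor.hom_ext fun x m => by
          rw [LinearMap.add_apply, hr', hr', hr', T.rAct_rmCo.add, TensorProduct.tmul_add,
            map_add]) y
      smul := fun t b y => LinearMap.congr_fun (f := r (t • b)) (g := t • r b)
        (BalTensor.hom_ext fun x m => by
          rw [LinearMap.smul_apply, hr', hr', T.rAct_rmCo.smul, TensorProduct.tmul_smul,
            map_smul]) y }
  have hf : ∀ b y, T.emb T.lmCo T.coinv.subtype T.subtype_lmCo (r b y) =
      T.tens.rm (b : A) (T.emb T.lmCo T.coinv.subtype T.subtype_lmCo y) := by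
    intro b y
    refine LinearMap.congr_fun (f := T.emb T.lmCo T.coinv.subtype T.subtype_lmCo ∘ₗ r b)
      (g := T.tens.rm (b : A) ∘ₗ T.emb T.lmCo T.coinv.subtype T.subtype_lmCo)
      (BalTensor.hom_ext fun x m => ?_) y
    rw [LinearMap.comp_apply, LinearMap.comp_apply, hr', emb_mk, emb_mk]
    generalize C.esIncl x = z
    induction z with
    | zero => simp
    | add x y hx hy => simp only [map_add, hx, hy]
    | tmul q q' =>
      have hb : ((T.rmCo b m : T.coinv) : L) = T.rm (b : A) m := rfl
      simp [tens_rm_tmul, hb, T.lm_rm]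
  refine T.tens.injective_and_range_eq hG hF hr _ hf
    (T.emb_mem _ _ _ fun m => m.2) ?_
  let l₂ : C.coinv → Module.End k (BalTensor T.rmCo C.lB) := fun b =>
    BalTensor.map (T.lmCo b) LinearMap.id (fun c m => Subtype.ext (T.lm_rm b c m)) (fun _ _ => rfl)
  have hact : ∀ b y, T.actMap T.rmCo T.coinv.subtype T.subtype_rmCo (l₂ b y) =
      T.lmB b (T.actMap T.rmCo T.coinv.subtype T.subtype_rmCo y) := by
    intro b y
    refine LinearMap.congr_fun
      (f := T.actMap T.rmCo T.coinv.subtype T.subtype_rmCo ∘ₗ l₂ b)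
      (g := T.lmB b ∘ₗ T.actMap T.rmCo T.coinv.subtype T.subtype_rmCo)
      (BalTensor.hom_ext fun m a => ?_) y
    exact (T.lm_rm b a m).symm
  let e := BalTensor.assoc (rM := C.rES) (lN := T.lmCo) (rN := T.rmCo) (lP := C.lB) (r := r)
    (l := l₂) hr' (fun _ _ _ => rfl)
  have h := (T.emb_id_bijective hG hF).comp ((BalTensor.map_bijective (r := C.rES) (r' := C.rES)
    (f := LinearMap.id) (fun _ _ => rfl) hact Function.bijective_id
      (T.actMap_coinv_bijective hG hF)).comp e.bijective)
  have key : T.tens.actMap r (T.emb T.lmCo T.coinv.subtype T.subtype_lmCo) hf =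
      (T.emb T.lmB LinearMap.id fun _ _ => rfl) ∘ₗ (BalTensor.map LinearMap.id
        (T.actMap T.rmCo T.coinv.subtype T.subtype_rmCo) (fun _ _ => rfl) hact :
          BalTensor C.rES l₂ →ₗ[k] BalTensor C.rES T.lmB) ∘ₗ e.toLinearMap := by
    refine BalTensor.hom_ext fun y a => ?_
    obtain ⟨y, rfl⟩ := BalTensor.mk_surjective _ _ y
    induction y with
    | zero => simp
    | add x y hx hy => simp only [map_add, TensorProduct.add_tmul, hx, hy]
    | tmul x m =>
      have h₁ : e (BalTensor.mk r C.lB (BalTensor.mk C.rES T.lmCo (x ⊗ₜ[k] m) ⊗ₜ[k] a)) =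
        BalTensor.mk C.rES l₂ (x ⊗ₜ[k] BalTensor.mk T.rmCo C.lB (m ⊗ₜ[k] a)) := rfl
      rw [actMap_mk, emb_mk, LinearMap.comp_apply, LinearMap.comp_apply, LinearEquiv.coe_coe, h₁,
        BalTensor.map_mk, TensorProduct.map_tmul, actMap_mk, emb_mk]
      generalize C.esIncl x = z
      induction z with
      | zero => simp
      | add x y hx hy => simp only [map_add, hx, hy]
      | tmul q q' => simp [tens_rm_tmul, T.lm_rm]
  rw [key]
  exact h

/-- The form in which the result is used: M is any left B-module that is identified with L^{co H},
for instance ℋ, ℋ⁺, a quotient ℋ⁺/I or (A ⊗ L)^{co H}. Iteration handles the triple tensor products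
of coassociativity. -/
theorem emb_injective_range (hG : C.IsHopfGalois) (hF : C.IsLeftFaithfullyFlat)
    {M : Type*} [AddCommGroup M] [Module k M] (l : C.coinv → Module.End k M) (f : M →ₗ[k] L)
    (hf : ∀ b m, f (l b m) = T.lm (b : A) (f m)) (hinj : Function.Injective f)
    (hrange : LinearMap.range f = T.coinv) :
    Function.Injective (T.emb l f hf) ∧ LinearMap.range (T.emb l f hf) = T.tens.coinv := by
  have hco : ∀ m, f m ∈ T.coinv := fun m => hrange ▸ ⟨m, rfl⟩
  let e : M →ₗ[k] T.coinv := f.codRestrict _ hco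
  have he : Function.Bijective e := by
    refine ⟨fun x y h => hinj (congrArg Subtype.val h), fun z => ?_⟩
    obtain ⟨x, hx⟩ : (z : L) ∈ LinearMap.range f := by rw [hrange]; exact z.2
    exact ⟨x, Subtype.ext hx⟩
  have he' : ∀ b m, e (l b m) = T.lmCo b (e m) := fun b m => Subtype.ext (hf b m)
  have hb := BalTensor.map_bijective (r := C.rES) (r' := C.rES) (f := LinearMap.id)
    (fun _ _ => rfl) he' Function.bijective_id he
  have key : T.emb l f hf = T.emb T.lmCo T.coinv.subtype T.subtype_lmCo ∘ₗ
      BalTensor.map LinearMap.id e (fun _ _ => rfl) he' := BalTensor.hom_ext fun _ _ => rfl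
  obtain ⟨h₁, h₂⟩ := T.emb_subtype hG hF
  rw [key]
  refine ⟨h₁.comp hb.1, ?_⟩
  rw [LinearMap.range_comp, LinearMap.range_eq_top.2 hb.2, Submodule.map_top, h₂]

end Key

end HopfBimodule

end ESCalculus.RightComoduleAlgebra

namespace ESCalculus.RightComoduleAlgebra

variable {k : Type u} {H : Type v} {A : Type w} [Field k] [Ring H] [HopfAlgebra k H]
  [Ring A] [Algebra k A] {C : RightComoduleAlgebra k H A}

namespace HopfBimodule

/-! ### Canonical maps for left modules, and the role of the antipode. -/

section LeftGalois

variable {L : Type*} [AddCommGroup L] [Module k L] (T : C.HopfBimodule L)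

/-- The map `l ⊗ h ↦ l₍₀₎ ⊗ m(l₍₁₎ ⊗ h)`. -/
noncomputable def twist (m : H ⊗[k] H →ₗ[k] H) : L ⊗[k] H →ₗ[k] L ⊗[k] H :=
  m.lTensor L ∘ₗ (TensorProduct.assoc k L H H).toLinearMap ∘ₗ T.δ.rTensor H

theorem twist_tmul (m : H ⊗[k] H →ₗ[k] H) (l : L) (h : H) :
    T.twist m (l ⊗ₜ[k] h) = (m ∘ₗ (TensorProduct.mk k H H).flip h).lTensor L (T.δ l) := by
  simp only [twist, LinearMap.comp_apply, LinearMap.rTensor_tmul, LinearEquiv.coe_coe]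
  generalize T.δ l = X
  induction X with
  | zero => simp
  | add X Y hX hY => simp only [map_add, TensorProduct.add_tmul, hX, hY]
  | tmul l g => simp

/-- By coassociativity an iterated coaction is one coaction followed by a linear map on H, so
antipode identities can be applied inside H alone. -/
theorem twist_lTensor_δ (m : H ⊗[k] H →ₗ[k] H) (g : H →ₗ[k] H) (l : L) :
    T.twist m (g.lTensor L (T.δ l)) =
      (m ∘ₗ g.lTensor H ∘ₗ Coalgebra.comul (R := k) (A := H)).lTensor L (T.δ l) := by
  have h : ∀ X : L ⊗[k] H, T.twist m (g.lTensor L X) =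
      (m ∘ₗ g.lTensor H).lTensor L (TensorProduct.assoc k L H H (T.δ.rTensor H X)) := by
    intro X
    induction X with
    | zero => simp
    | add X Y hX hY => simp only [map_add, hX, hY]
    | tmul l h =>
      rw [LinearMap.lTensor_tmul, twist_tmul, LinearMap.rTensor_tmul]
      generalize T.δ l = X
      induction X with
      | zero => simp
      | add X Y hX hY => simp only [map_add, TensorProduct.add_tmul, hX, hY]
      | tmul l g => simp
  rw [h, T.coassoc, ← LinearMap.lTensor_comp_apply]
  rfl

theorem counit_smul_δ (l : L) (h : H) :
    ((Coalgebra.counit (R := k) (A := H)).smulRight h).lTensor L (T.δ l) = l ⊗ₜ[k] h := by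
  conv_rhs => rw [← T.counit l]
  generalize T.δ l = X
  induction X with
  | zero => simp
  | add X Y hX hY => simp only [map_add, TensorProduct.add_tmul, hX, hY]
  | tmul l g => simp [TensorProduct.smul_tmul]

/-- The inverse of l ⊗ h ↦ l₀ ⊗ l₁h is l ⊗ h ↦ l₀ ⊗ S(l₁)h; both composites collapse by the antipode
axioms. -/
theorem twist_mul'_bijective : Function.Bijective (T.twist (LinearMap.mul' k H)) := by
  let S : H →ₗ[k] H := HopfAlgebra.antipode k
  refine Function.bijective_iff_has_inverse.2
    ⟨T.twist (LinearMap.mul' k H ∘ₗ S.rTensor H), fun x => ?_, fun x => ?_⟩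
  · induction x with
    | zero => simp
    | add x y hx hy => simp only [map_add, hx, hy]
    | tmul l h =>
      have h₁ : LinearMap.mul' k H ∘ₗ (TensorProduct.mk k H H).flip h = LinearMap.mulRight k h := by
        ext g; simp
      rw [twist_tmul, h₁, twist_lTensor_δ, ← T.counit_smul_δ l h]
      congr 2
      ext g
      have h₂ : (LinearMap.mul' k H ∘ₗ S.rTensor H) ∘ₗ (LinearMap.mulRight k h).lTensor H =
          LinearMap.mulRight k h ∘ₗ LinearMap.mul' k H ∘ₗ S.rTensor H :=
        TensorProduct.ext' fun x y => by simp [mul_assoc]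
      have h₃ := HopfAlgebra.mul_antipode_rTensor_comul_apply (R := k) g
      have h₄ := LinearMap.congr_fun h₂ (Coalgebra.comul (R := k) g)
      simp only [LinearMap.comp_apply] at h₄ ⊢
      rw [h₄, h₃]
      simp [Algebra.smul_def]
  · induction x with
    | zero => simp
    | add x y hx hy => simp only [map_add, hx, hy]
    | tmul l h =>
      have h₁ : (LinearMap.mul' k H ∘ₗ S.rTensor H) ∘ₗ (TensorProduct.mk k H H).flip h =
          LinearMap.mulRight k h ∘ₗ S := by
        ext g; simp
      rw [twist_tmul, h₁, twist_lTensor_δ, ← T.counit_smul_δ l h]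
      congr 2
      ext g
      have h₂ : LinearMap.mul' k H ∘ₗ (LinearMap.mulRight k h ∘ₗ S).lTensor H =
          LinearMap.mulRight k h ∘ₗ LinearMap.mul' k H ∘ₗ S.lTensor H :=
        TensorProduct.ext' fun x y => by simp [mul_assoc]
      have h₃ := HopfAlgebra.mul_antipode_lTensor_comul_apply (R := k) g
      have h₄ := LinearMap.congr_fun h₂ (Coalgebra.comul (R := k) g)
      simp only [LinearMap.comp_apply] at h₄ ⊢
      rw [h₄, h₃]
      simp [Algebra.smul_def]

theorem twist_antipode_δ (l : L) :
    T.twist (LinearMap.mul' k H) ((HopfAlgebra.antipode k (A := H)).lTensor L (T.δ l)) =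
      l ⊗ₜ[k] 1 := by
  rw [twist_lTensor_δ, ← T.counit_smul_δ l 1]
  congr 2
  ext g
  have h₃ := HopfAlgebra.mul_antipode_lTensor_comul_apply (R := k) g
  simp only [LinearMap.comp_apply]
  rw [h₃]
  simp [Algebra.smul_def]

/-- The map `A ⊗_B L → L ⊗ H`, `a ⊗ l ↦ a l₍₀₎ ⊗ l₍₁₎`. -/
noncomputable def leftCan : BalTensor C.rB T.lmB →ₗ[k] L ⊗[k] H :=
  BalTensor.lift _ _
    (TensorProduct.lift ((LinearMap.rTensorHom H ∘ₗ T.lm).compl₂ T.δ)) (by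
      intro b a l
      simp only [TensorProduct.lift.tmul, LinearMap.compl₂_apply, LinearMap.comp_apply, T.δ_lm,
        C.ρ_coinv]
      generalize T.δ l = X
      induction X with
      | zero => simp
      | add X Y hX hY => simp only [map_add, hX, hY]
      | tmul l h => simp [rB, T.lm_mul])

theorem leftCan_mk (a : A) (l : L) :
    T.leftCan (BalTensor.mk _ _ (a ⊗ₜ[k] l)) = (T.lm a).rTensor H (T.δ l) := rfl

/-- The map `A ⊗_B L → L ⊗ H`, `a ⊗ l ↦ a₍₀₎ l ⊗ a₍₁₎`. -/
noncomputable def leftCan' : BalTensor C.rB T.lmB →ₗ[k] L ⊗[k] H :=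
  BalTensor.lift _ _
    (TensorProduct.lift ((LinearMap.rTensorHom H ∘ₗ T.lm.flip).flip ∘ₗ C.ρ.toLinearMap)) (by
      intro b a l
      simp only [TensorProduct.lift.tmul, LinearMap.flip_apply, LinearMap.comp_apply,
        rB, LinearMap.mulRight_apply, AlgHom.toLinearMap_apply, map_mul, C.ρ_coinv]
      generalize C.ρ a = X
      induction X with
      | zero => simp
      | add X Y hX hY => simp only [map_add, add_mul, hX, hY]
      | tmul l h => simp [T.lm_mul])

theorem leftCan'_mk (a : A) (l : L) :
    T.leftCan' (BalTensor.mk _ _ (a ⊗ₜ[k] l)) = (T.lm.flip l).rTensor H (C.ρ a) := rfl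

/-- The chain is al₀ ⊗ l₁ ↦ al₀ ⊗ S(l₁) ↦ a₀l₀ ⊗ a₁l₁S(l₂) = a₀l ⊗ a₁. Once S is bijective, the two
left canonical maps thus differ by bijections only. -/
theorem twist_leftCan : T.twist (LinearMap.mul' k H) ∘ₗ
    (HopfAlgebra.antipode k (A := H)).lTensor L ∘ₗ T.leftCan = T.leftCan' := by
  refine BalTensor.hom_ext fun a l => ?_
  have h₁ : ∀ X : L ⊗[k] H, (HopfAlgebra.antipode k (A := H)).lTensor L ((T.lm a).rTensor H X) =
      (T.lm a).rTensor H ((HopfAlgebra.antipode k (A := H)).lTensor L X) := by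
    intro X
    induction X with
    | zero => simp
    | add X Y hX hY => simp only [map_add, hX, hY]
    | tmul l h => simp
  have h₂ : ∀ X : L ⊗[k] H, T.twist (LinearMap.mul' k H) ((T.lm a).rTensor H X) =
      TensorProduct.map₂ T.lm (LinearMap.mul k H) (C.ρ a) (T.twist (LinearMap.mul' k H) X) := by
    intro X
    induction X with
    | zero => simp
    | add X Y hX hY => simp only [map_add, hX, hY]
    | tmul l h =>
      rw [LinearMap.rTensor_tmul, twist_tmul, twist_tmul, T.δ_lm]
      generalize C.ρ a = X
      generalize T.δ l = Y
      induction X with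
      | zero => simp
      | add X Y hX hY => simp only [map_add, LinearMap.add_apply, hX, hY]
      | tmul a g =>
        induction Y with
        | zero => simp
        | add X Y hX hY => simp only [map_add, hX, hY]
        | tmul l g' => simp [mul_assoc]
  rw [LinearMap.comp_apply, LinearMap.comp_apply, leftCan_mk, leftCan'_mk, h₁, h₂,
    twist_antipode_δ]
  generalize C.ρ a = X
  induction X with
  | zero => simp
  | add X Y hX hY => simp only [map_add, LinearMap.add_apply, hX, hY]
  | tmul a h => simp

theorem lTensor_antipode_bijective (hS : Function.Bijective (HopfAlgebra.antipode k (A := H))) :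
    Function.Bijective ((HopfAlgebra.antipode k (A := H)).lTensor L) := by
  have : (HopfAlgebra.antipode k (A := H)).lTensor L =
      (LinearEquiv.lTensor L (LinearEquiv.ofBijective _ hS)).toLinearMap := rfl
  rw [this]
  exact LinearEquiv.bijective _

variable (C) in
theorem self_lm (a c : A) : (self C).lm a c = a * c := rfl

theorem self_leftCan'_bijective (hS : Function.Bijective (HopfAlgebra.antipode k (A := H)))
    (hG : C.IsHopfGalois) : Function.Bijective (self C).leftCan' := by
  rw [← twist_leftCan, LinearMap.coe_comp, LinearMap.coe_comp]
  refine (twist_mul'_bijective _).comp ((lTensor_antipode_bijective hS).comp ?_)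
  let φ : BalTensor C.rB (self C).lmB →ₗ[k] C.ABA :=
    BalTensor.map LinearMap.id LinearMap.id (fun _ _ => rfl) (fun _ _ => rfl)
  have hφ : Function.Bijective φ :=
    BalTensor.map_bijective _ _ Function.bijective_id Function.bijective_id
  have : (self C).leftCan = C.galoisMap ∘ₗ φ := BalTensor.hom_ext fun a a' => by
    rw [leftCan_mk, LinearMap.comp_apply]
    exact (galoisMap_mk a a').symm
  rw [this, LinearMap.coe_comp]
  exact Function.Bijective.comp hG hφ

/-- For L = A the map a ⊗ c ↦ a₀c ⊗ a₁ is right A-linear in c, so it can be base changed to any left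
A-module. The map `leftCan` is linear only for the diagonal action, which is why its bijectivity is
obtained by way of `leftCan'`. -/
theorem leftCan'_bijective (hS : Function.Bijective (HopfAlgebra.antipode k (A := H)))
    (hG : C.IsHopfGalois) : Function.Bijective T.leftCan' := by
  let μ := (TensorProduct.comm k A H).toLinearMap ∘ₗ (self C).leftCan'
  have hμ : Function.Bijective μ := by
    rw [LinearMap.coe_comp]
    exact (LinearEquiv.bijective _).comp (self_leftCan'_bijective hS hG)
  have hμ' : ∀ m a, μ (BalTensor.mk C.rB (self C).lmB (m ⊗ₜ[k] a)) =
      (LinearMap.mulRight k a).lTensor H (TensorProduct.comm k A H (C.ρ m)) := by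
    intro m a
    rw [LinearMap.comp_apply, leftCan'_mk, LinearEquiv.coe_coe, comm_rTensor]
    rfl
  have h := baseChange_bijective (k := k) (V := H) (r := C.rB) (lA := (self C).lmB)
    (lL := T.lmB) 1
    (LinearMap.mulRight k) T.lm (by simp) (by simp) (by simp [mul_assoc])
    (by simp [self_lm, mul_assoc])
    T.lm_one (by simp [T.lm_mul]) (by simp [self_lm, T.lm_mul])
    ((TensorProduct.comm k A H).toLinearMap ∘ₗ C.ρ.toLinearMap) μ hμ' hμ
    ((TensorProduct.comm k L H).toLinearMap ∘ₗ T.leftCan')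
    (by
      intro m a
      rw [LinearMap.comp_apply, leftCan'_mk, LinearEquiv.coe_coe, comm_rTensor]
      rfl)
  rw [LinearMap.coe_comp] at h
  exact (Function.Bijective.of_comp_iff' (LinearEquiv.bijective _) _).1 h

theorem leftCan_bijective (hS : Function.Bijective (HopfAlgebra.antipode k (A := H)))
    (hG : C.IsHopfGalois) : Function.Bijective T.leftCan := by
  have h := T.leftCan'_bijective hS hG
  rw [← twist_leftCan, LinearMap.coe_comp, LinearMap.coe_comp] at h
  exact (Function.Bijective.of_comp_iff' (lTensor_antipode_bijective hS) _).1
    ((Function.Bijective.of_comp_iff' T.twist_mul'_bijective _).1 h)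

end LeftGalois

/-! ### The second isomorphism A ⊗_B ℋ ≅ A ⊗ A. -/

section LeftES

theorem lES_apply (b : C.coinv) (x : C.ES) : C.lES C.ES b x = C.source b * x := rfl

variable (C) in
/-- The map `A ⊗_B ES → A ⊗ A`, `e ⊗ (a ⊗ a') ↦ e a ⊗ a'`. -/
noncomputable def leftES : BalTensor C.rB (C.lES C.ES) →ₗ[k] A ⊗[k] A :=
  BalTensor.lift _ _ (TensorProduct.lift ((self C).tens.lm.compl₂ C.esIncl)) (by
    intro b e x
    simp only [TensorProduct.lift.tmul, LinearMap.compl₂_apply, lES_apply, esIncl_source_mul, rB,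
      LinearMap.mulRight_apply, HopfBimodule.lm_mul]
    rfl)

theorem leftES_mk (e : A) (x : C.ES) :
    leftES C (BalTensor.mk _ _ (e ⊗ₜ[k] x)) = (self C).tens.lm e (C.esIncl x) := rfl

/-- The mirror image of `actMap_esIncl_bijective`, obtained without flatness of A as a right
B-module. The map is tested after tensoring with A over B on the right. Then the source becomes A
⊗_B (A ⊗ A), the target becomes (A ⊗ A) ⊗_B A, and both are isomorphic to (A ⊗ A) ⊗ H, through
`leftCan` and `canMap`. The bijective antipode enters through `leftCan`. -/
theorem leftES_bijective (hS : Function.Bijective (HopfAlgebra.antipode k (A := H)))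
    (hG : C.IsHopfGalois) (hF : C.IsLeftFaithfullyFlat) : Function.Bijective (leftES C) := by
  let T := (self C).tens
  have hcomm : ∀ (b c : C.coinv) (x : C.ES),
      C.rES b (C.lES C.ES c x) = C.lES C.ES c (C.rES b x) := fun b c x => by
    rw [lES_apply, lES_apply, rES, LinearMap.mulLeft_apply, LinearMap.mulLeft_apply, ← mul_assoc,
      ← mul_assoc, C.source_mul_target]
  let r : C.coinv → Module.End k (BalTensor C.rB (C.lES C.ES)) := fun b =>
    BalTensor.map LinearMap.id (C.rES b) (fun _ _ => rfl) (hcomm b)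
  have hr' : ∀ b e x, r b (BalTensor.mk C.rB (C.lES C.ES) (e ⊗ₜ[k] x)) =
      BalTensor.mk C.rB (C.lES C.ES) (e ⊗ₜ[k] C.rES b x) := fun _ _ _ => rfl
  have hr : C.RAct r :=
    { one := fun y => LinearMap.congr_fun (f := r 1) (g := LinearMap.id)
        (BalTensor.hom_ext fun x m => by rw [hr', C.rAct_rES.one]; rfl) y
      mul := fun b c y => LinearMap.congr_fun (f := r (b * c)) (g := r c ∘ₗ r b)
        (BalTensor.hom_ext fun x m => by
          rw [LinearMap.comp_apply, hr', hr', hr', C.rAct_rES.mul]) y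
      add := fun b c y => LinearMap.congr_fun (f := r (b + c)) (g := r b + r c)
        (BalTensor.hom_ext fun x m => by
          rw [LinearMap.add_apply, hr', hr', hr', C.rAct_rES.add, TensorProduct.tmul_add,
            map_add]) y
      smul := fun t b y => LinearMap.congr_fun (f := r (t • b)) (g := t • r b)
        (BalTensor.hom_ext fun x m => by
          rw [LinearMap.smul_apply, hr', hr', C.rAct_rES.smul, TensorProduct.tmul_smul,
            map_smul]) y }
  have hf : ∀ b y, leftES C (r b y) = T.rmB b (leftES C y) := by
    intro b y
    refine LinearMap.congr_fun (f := leftES C ∘ₗ r b) (g := T.rmB b ∘ₗ leftES C)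
      (BalTensor.hom_ext fun e x => ?_) y
    rw [LinearMap.comp_apply, LinearMap.comp_apply, hr', leftES_mk, leftES_mk, esIncl_rES]
    exact T.lm_rm e b _
  have hinj := hF.injective_iff hr T.rAct_rmB (leftES C) hf
  have hsurj := hF.surjective_iff hr T.rAct_rmB (leftES C) hf
  suffices h : Function.Bijective (BalTensor.map (leftES C) LinearMap.id hf (fun _ _ => rfl) :
      BalTensor r C.lB →ₗ[k] BalTensor T.rmB C.lB) from ⟨hinj.2 h.1, hsurj.2 h.2⟩
  rw [← Function.Bijective.of_comp_iff' (canMap_bijective (C := C) hG T.rm T.rm_one T.rm_mul),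
    ← LinearMap.coe_comp]
  let l₂ : C.coinv → Module.End k (BalTensor C.rES C.lB) := fun b =>
    BalTensor.map (C.lES C.ES b) LinearMap.id (fun c m => (hcomm c b m).symm) (fun _ _ => rfl)
  have hact : ∀ b y, T.actMap C.rES C.esIncl esIncl_rES (l₂ b y) =
      T.lmB b (T.actMap C.rES C.esIncl esIncl_rES y) := by
    intro b y
    refine LinearMap.congr_fun
      (f := T.actMap C.rES C.esIncl esIncl_rES ∘ₗ l₂ b)
      (g := T.lmB b ∘ₗ T.actMap C.rES C.esIncl esIncl_rES)
      (BalTensor.hom_ext fun x a => ?_) y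
    have h₁ : T.actMap C.rES C.esIncl esIncl_rES (l₂ b (BalTensor.mk C.rES C.lB (x ⊗ₜ[k] a))) =
      T.rm a (C.esIncl (C.source b * x)) := rfl
    rw [LinearMap.comp_apply, LinearMap.comp_apply, h₁, esIncl_source_mul, actMap_mk]
    exact (T.lm_rm b a _).symm
  let e := BalTensor.assoc (rM := C.rB) (lN := C.lES C.ES) (rN := C.rES) (lP := C.lB) (r := r)
    (l := l₂) hr' (fun _ _ _ => rfl)
  have h := (T.leftCan_bijective hS hG).comp ((BalTensor.map_bijective (r := C.rB) (r' := C.rB)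
    (f := LinearMap.id) (fun _ _ => rfl) hact Function.bijective_id
      (actMap_esIncl_bijective hG hF)).comp e.bijective)
  -- Both sides send e ⊗ x ⊗ a to e x a₀ ⊗ a₁, because x is coinvariant.
  have key : canMap T.rm T.rm_mul ∘ₗ (BalTensor.map (leftES C) LinearMap.id hf (fun _ _ => rfl) :
      BalTensor r C.lB →ₗ[k] BalTensor T.rmB C.lB) =
      T.leftCan ∘ₗ (BalTensor.map LinearMap.id
        (T.actMap C.rES C.esIncl esIncl_rES) (fun _ _ => rfl) hact :
          BalTensor C.rB l₂ →ₗ[k] BalTensor C.rB T.lmB) ∘ₗ e.toLinearMap := by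
    refine BalTensor.hom_ext fun y a => ?_
    obtain ⟨y, rfl⟩ := BalTensor.mk_surjective _ _ y
    induction y with
    | zero => simp
    | add x y hx hy => simp only [map_add, TensorProduct.add_tmul, hx, hy]
    | tmul c x =>
      have h₁ : e (BalTensor.mk r C.lB (BalTensor.mk C.rB (C.lES C.ES) (c ⊗ₜ[k] x) ⊗ₜ[k] a)) =
        BalTensor.mk C.rB l₂ (c ⊗ₜ[k] BalTensor.mk C.rES C.lB (x ⊗ₜ[k] a)) := rfl
      have hx : T.δ (C.esIncl x) = C.esIncl x ⊗ₜ[k] (1 : H) := esIncl_mem x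
      rw [LinearMap.comp_apply, LinearMap.comp_apply, LinearMap.comp_apply, LinearEquiv.coe_coe, h₁,
        BalTensor.map_mk, TensorProduct.map_tmul, BalTensor.map_mk, TensorProduct.map_tmul,
        actMap_mk, leftCan_mk, T.δ_rm, hx, leftES_mk]
      refine (canMap_mk T.rm T.rm_mul _ a).trans ?_
      generalize C.ρ a = X
      generalize C.esIncl x = z
      induction X with
      | zero => simp
      | add x y hx hy => simp only [map_add, LinearMap.add_apply, hx, hy]
      | tmul a h => simp [T, HopfBimodule.lm_rm]
  rw [key]
  exact h

end LeftES

end HopfBimodule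

end ESCalculus.RightComoduleAlgebra

namespace ESCalculus.RightComoduleAlgebra

variable {k : Type u} {H : Type v} {A : Type w} [Field k] [Ring H] [HopfAlgebra k H]
  [Ring A] [Algebra k A] {C : RightComoduleAlgebra k H A}

namespace HopfBimodule

/-! ### Insertion of units, and the two-sided action of A ⊗ A on a bimodule. -/

section Insert

variable {L : Type*} [AddCommGroup L] [Module k L] (T : C.HopfBimodule L)

variable (k A L) in
/-- The map `a ⊗ l ↦ a ⊗ (1 ⊗ l)`. -/
noncomputable def ins : A ⊗[k] L →ₗ[k] A ⊗[k] (A ⊗[k] L) := (TensorProduct.mk k A L 1).lTensor A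

theorem ins_tmul (a : A) (l : L) : ins k A L (a ⊗ₜ[k] l) = a ⊗ₜ[k] (1 ⊗ₜ[k] l) := rfl

theorem tens_δ_one_tmul (l : L) :
    T.tens.δ (1 ⊗ₜ[k] l) = (TensorProduct.mk k A L 1).rTensor H (T.δ l) := by
  rw [tens_δ_tmul, map_one, Algebra.TensorProduct.one_def]
  generalize T.δ l = Y
  induction Y with
  | zero => simp
  | add X Y hX hY => simp only [map_add, TensorProduct.tmul_add, hX, hY]
  | tmul l g => simp [collectL_tmul]

theorem tens_δ_lTensor_map {L' : Type*} [AddCommGroup L'] [Module k L'] (T' : C.HopfBimodule L')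
    (f : L →ₗ[k] L') (hf : ∀ l, T'.δ (f l) = f.rTensor H (T.δ l)) (z : A ⊗[k] L) :
    T'.tens.δ (f.lTensor A z) = (f.lTensor A).rTensor H (T.tens.δ z) := by
  induction z with
  | zero => simp
  | add x y hx hy => simp only [map_add, hx, hy]
  | tmul a l =>
    rw [LinearMap.lTensor_tmul, tens_δ_tmul, tens_δ_tmul, hf]
    generalize C.ρ a = X
    generalize T.δ l = Y
    induction X with
    | zero => simp
    | add X Y hX hY => simp only [map_add, TensorProduct.add_tmul, hX, hY]
    | tmul a h =>
      induction Y with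
      | zero => simp
      | add X Y hX hY => simp only [map_add, TensorProduct.tmul_add, hX, hY]
      | tmul l g => simp [collectL_tmul]

theorem map_mem_coinv {L' : Type*} [AddCommGroup L'] [Module k L'] (T' : C.HopfBimodule L')
    (f : L →ₗ[k] L') (hf : ∀ l, T'.δ (f l) = f.rTensor H (T.δ l)) {l : L} (hl : l ∈ T.coinv) :
    f l ∈ T'.coinv := by
  rw [mem_coinv] at hl ⊢
  rw [hf, hl]
  rfl

theorem lTensor_mem_coinv {L' : Type*} [AddCommGroup L'] [Module k L'] (T' : C.HopfBimodule L')
    (f : L →ₗ[k] L') (hf : ∀ l, T'.δ (f l) = f.rTensor H (T.δ l)) {z : A ⊗[k] L}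
    (hz : z ∈ T.tens.coinv) : f.lTensor A z ∈ T'.tens.coinv :=
  T.tens.map_mem_coinv T'.tens _ (T.tens_δ_lTensor_map T' f hf) hz

theorem ins_mem_coinv {z : A ⊗[k] L} (hz : z ∈ T.tens.coinv) :
    ins k A L z ∈ T.tens.tens.coinv := by
  have h := T.lTensor_mem_coinv T.tens (TensorProduct.mk k A L 1) T.tens_δ_one_tmul hz
  exact h

/-- The two-sided action `a ⊗ a' ↦ (l ↦ a l a')`. -/
def lr : A ⊗[k] A →ₗ[k] Module.End k L :=
  TensorProduct.lift ((LinearMap.mul k (Module.End k L)).compl₁₂ T.lm T.rm)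

theorem lr_tmul (a a' : A) (l : L) : T.lr (a ⊗ₜ[k] a') l = T.lm a (T.rm a' l) := rfl

theorem lr_mul (y z : A ⊗[k] A) (l : L) :
    T.lr (TensorProduct.map₂ (LinearMap.mul k A) (LinearMap.mul k A).flip y z) l =
      T.lr y (T.lr z l) := by
  induction y with
  | zero => simp
  | add x y hx hy => simp only [map_add, LinearMap.add_apply, hx, hy]
  | tmul a a' =>
    induction z with
    | zero => simp
    | add x y hx hy => simp only [map_add, LinearMap.add_apply, hx, hy]
    | tmul c c' => simp [lr_tmul, T.lm_mul, T.rm_mul, T.lm_rm]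

theorem lr_one (l : L) : T.lr (1 ⊗ₜ[k] 1) l = l := by rw [lr_tmul, T.lm_one, T.rm_one]

/-- For coinvariant l the coaction of a l a' involves only the product a₁a'₁, which is the diagonal
coaction of a ⊗ a'. Hence ℋ acts on L^{co H}. -/
theorem δ_lr {l : L} (hl : l ∈ T.coinv) (z : A ⊗[k] A) :
    T.δ (T.lr z l) = (T.lr.flip l).rTensor H (C.diag z) := by
  rw [mem_coinv] at hl
  induction z with
  | zero => simp
  | add x y hx hy => simp only [map_add, LinearMap.add_apply, hx, hy]
  | tmul a a' =>
    rw [lr_tmul, T.δ_lm, T.δ_rm, hl, diag_tmul]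
    generalize C.ρ a = X
    generalize C.ρ a' = Y
    induction X with
    | zero => simp
    | add X Y hX hY => simp only [map_add, LinearMap.add_apply, TensorProduct.add_tmul, hX, hY]
    | tmul a h =>
      induction Y with
      | zero => simp
      | add X Y hX hY =>
        simp only [map_add, LinearMap.add_apply, TensorProduct.tmul_add, hX, hY]
      | tmul c h' => simp [lr_tmul, collect]

theorem lr_mem_coinv {l : L} (hl : l ∈ T.coinv) (x : C.ES) : T.lr (C.esIncl x) l ∈ T.coinv := by
  rw [mem_coinv, T.δ_lr hl, show C.diag (C.esIncl x) = _ from esIncl_mem x]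
  rfl

theorem rm_lr (a : A) (z : A ⊗[k] A) (l : L) : T.rm a (T.lr z l) =
    T.lr ((self C).tens.rm a z) l := by
  induction z with
  | zero => simp
  | add x y hx hy => simp only [map_add, LinearMap.add_apply, hx, hy]
  | tmul c c' =>
    rw [lr_tmul, ← T.lm_rm, ← T.rm_mul]
    rfl

end Insert

/-! ### Existence and uniqueness of the coproduct of ℋ. -/

section Coproduct

variable (C) in
/-- Right multiplication by elements of `A` on `A ⊗_B A`. -/
noncomputable def rABA (c : A) : Module.End k C.ABA :=
  BalTensor.map LinearMap.id (LinearMap.mulRight k c) (fun _ _ => rfl)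
    (fun c a => by simp [lB, mul_assoc])

theorem rABA_mk (c a a' : A) : rABA C c (BalTensor.mk C.rB C.lB (a ⊗ₜ[k] a')) =
    BalTensor.mk C.rB C.lB (a ⊗ₜ[k] (a' * c)) := rfl

theorem galoisMap_rABA (c : A) (y : C.ABA) :
    C.galoisMap (rABA C c y) = C.galoisMap y * C.ρ c := by
  refine LinearMap.congr_fun (f := C.galoisMap ∘ₗ rABA C c)
    (g := LinearMap.mulRight k (C.ρ c) ∘ₗ C.galoisMap) (BalTensor.hom_ext fun a a' => ?_) y
  rw [LinearMap.comp_apply, LinearMap.comp_apply, rABA_mk, galoisMap_mk, galoisMap_mk, map_mul,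
    LinearMap.mulRight_apply]
  generalize C.ρ a' = X
  induction X with
  | zero => simp
  | add X Y hX hY => simp only [map_add, add_mul, hX, hY]
  | tmul a' h =>
    generalize C.ρ c = X
    induction X with
    | zero => simp
    | add X Y hX hY => simp only [map_add, mul_add, hX, hY]
    | tmul c' h => simp [mul_assoc]

variable (C) in
/-- Right multiplication as a bilinear map. -/
noncomputable def rABAlin : A →ₗ[k] Module.End k C.ABA where
  toFun := rABA C
  map_add' c c' := BalTensor.hom_ext fun a a' => by
    rw [LinearMap.add_apply, rABA_mk, rABA_mk, rABA_mk, mul_add, TensorProduct.tmul_add, map_add]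
  map_smul' t c := BalTensor.hom_ext fun a a' => by
    rw [RingHom.id_apply, LinearMap.smul_apply, rABA_mk, rABA_mk, mul_smul_comm,
      TensorProduct.tmul_smul, map_smul]

theorem galoisMap_translation (hG : C.IsHopfGalois) (h : H) :
    C.galoisMap (C.translation hG h) = 1 ⊗ₜ[k] h :=
  (LinearEquiv.ofBijective C.galoisMap hG).apply_symm_apply _

/-- The map `a ↦ a₍₀₎ ⊗ τ(a₍₁₎)`. -/
noncomputable def rhoTau (hG : C.IsHopfGalois) : A →ₗ[k] A ⊗[k] C.ABA :=
  (C.translation hG).lTensor A ∘ₗ C.ρ.toLinearMap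

/-- Since χ(τ(h)c) = (1 ⊗ h)ρ(c), the injective map A ⊗ χ turns the left side into the diagonal
coaction of z and the right side into z ⊗ 1. Coinvariance of z is thus the identity a₀ ⊗ τ(a₁)a' = a
⊗ (a' ⊗_B 1). -/
theorem rhoTau_rABA (hG : C.IsHopfGalois) (z : A ⊗[k] A) (hz : z ∈ C.diagCoinv) :
    TensorProduct.lift (((LinearMap.lTensorHom A ∘ₗ rABAlin C).flip ∘ₗ rhoTau hG)) z =
      (BalTensor.mk C.rB C.lB ∘ₗ (TensorProduct.mk k A A).flip 1).lTensor A z := by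
  apply Module.Flat.lTensor_preserves_injective_linearMap (M := A) C.galoisMap hG.1
  have h₁ : ∀ z : A ⊗[k] A, C.galoisMap.lTensor A
      (TensorProduct.lift (((LinearMap.lTensorHom A ∘ₗ rABAlin C).flip ∘ₗ rhoTau hG)) z) =
      TensorProduct.assoc k A A H (C.diag z) := by
    intro z
    induction z with
    | zero => simp
    | add x y hx hy => simp only [map_add, hx, hy]
    | tmul a a' =>
      rw [TensorProduct.lift.tmul, diag_tmul]
      change C.galoisMap.lTensor A ((rABA C a').lTensor A (rhoTau hG a)) = _
      rw [rhoTau, LinearMap.comp_apply, AlgHom.toLinearMap_apply]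
      generalize C.ρ a = X
      induction X with
      | zero => simp
      | add X Y hX hY => simp only [map_add, TensorProduct.add_tmul, hX, hY]
      | tmul a h =>
        rw [LinearMap.lTensor_tmul, LinearMap.lTensor_tmul, LinearMap.lTensor_tmul, galoisMap_rABA,
          galoisMap_translation]
        generalize C.ρ a' = Y
        induction Y with
        | zero => simp
        | add X Y hX hY =>
          simp only [map_add, mul_add, TensorProduct.tmul_add, hX, hY]
        | tmul a' h' => simp [collect]
  rw [h₁, show C.diag z = z ⊗ₜ[k] (1 : H) from hz]
  clear hz
  induction z with
  | zero => simp
  | add x y hx hy => simp only [map_add, TensorProduct.add_tmul, hx, hy]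
  | tmul a a' =>
    rw [LinearMap.lTensor_tmul, LinearMap.lTensor_tmul, LinearMap.comp_apply]
    have h₂ : C.galoisMap (BalTensor.mk C.rB C.lB ((TensorProduct.mk k A A).flip 1 a')) =
        a' ⊗ₜ[k] 1 := by
      refine (galoisMap_mk a' 1).trans ?_
      simp [Algebra.TensorProduct.one_def]
    rw [h₂, TensorProduct.assoc_tmul]

theorem esIncl_lES (b : C.coinv) (x : C.ES) :
    C.esIncl (C.lES C.ES b x) = (self C).tens.lm (b : A) (C.esIncl x) := esIncl_source_mul b x

variable (C) in
/-- The map `ES ⊗_B ES → A ⊗ (A ⊗ A)`, `(a ⊗ a') ⊗ (c ⊗ c') ↦ a ⊗ a' c ⊗ c'`. -/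
noncomputable def embES : C.ESTensor C.ES →ₗ[k] A ⊗[k] (A ⊗[k] A) :=
  (self C).tens.emb (C.lES C.ES) C.esIncl esIncl_lES

theorem embES_mk (z : C.ES ⊗[k] C.ES) :
    embES C (C.esMk C.ES z) = (self C).tens.embLin C.esIncl (C.esIncl.rTensor C.ES z) := rfl

theorem embES_injective_range (hG : C.IsHopfGalois) (hF : C.IsLeftFaithfullyFlat) :
    Function.Injective (embES C) ∧ LinearMap.range (embES C) = (self C).tens.tens.coinv :=
  (self C).tens.emb_injective_range hG hF _ _ _ esIncl_injective range_esIncl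

variable (C) in
/-- The multiplication `A ⊗_B A → A`. -/
noncomputable def mulBal : C.ABA →ₗ[k] A :=
  BalTensor.lift C.rB C.lB (LinearMap.mul' k A) (by simp [rB, lB, mul_assoc])

theorem mulBal_mk (a a' : A) : mulBal C (BalTensor.mk C.rB C.lB (a ⊗ₜ[k] a')) = a * a' := rfl

/-- The multiplication `(a ⊗ (a' ⊗_B c)) ⊗ c' ↦ a ⊗ (a' c ⊗ c')`. -/
noncomputable def mulABA : (A ⊗[k] C.ABA) ⊗[k] A →ₗ[k] A ⊗[k] (A ⊗[k] A) :=
  (TensorProduct.assoc k A A A).toLinearMap ∘ₗ ((mulBal C).lTensor A).rTensor A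

theorem mulABA_esSquareIncl (y : C.ESTensor C.ES) : mulABA (C.esSquareIncl y) = embES C y := by
  obtain ⟨z, rfl⟩ := C.esMk C.ES |>.range_eq_top.1 (Submodule.range_mkQ _) y
  change mulABA (C.regroup (TensorProduct.map C.esIncl C.esIncl z)) = _
  rw [embES_mk]
  induction z with
  | zero => simp
  | add x y hx hy => simp only [map_add, hx, hy]
  | tmul x y =>
    rw [TensorProduct.map_tmul, LinearMap.rTensor_tmul, embLin_tmul]
    generalize C.esIncl x = z
    generalize C.esIncl y = z'
    induction z with
    | zero => simp
    | add x y hx hy => simp only [map_add, TensorProduct.add_tmul, hx, hy]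
    | tmul a a' =>
      induction z' with
      | zero => simp
      | add x y hx hy =>
        simp only [map_add, TensorProduct.tmul_add, LinearMap.lTensor_add, LinearMap.add_apply,
          hx, hy]
      | tmul c c' => rfl

/-- Multiplying out the middle factor A ⊗_B A gives `embES`, which is injective by descent. -/
theorem esSquareIncl_injective (hG : C.IsHopfGalois) (hF : C.IsLeftFaithfullyFlat) :
    Function.Injective C.esSquareIncl := by
  intro x y h
  apply (embES_injective_range hG hF).1
  rw [← mulABA_esSquareIncl, ← mulABA_esSquareIncl, h]

/-- The map `a ⊗ (c ⊗ c') ↦ (a₍₀₎ ⊗ τ(a₍₁₎) c) ⊗ c'`. -/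
noncomputable def splitABA (hG : C.IsHopfGalois) :
    A ⊗[k] (A ⊗[k] A) →ₗ[k] (A ⊗[k] C.ABA) ⊗[k] A :=
  (TensorProduct.lift ((LinearMap.lTensorHom A ∘ₗ rABAlin C).flip ∘ₗ rhoTau hG)).rTensor A ∘ₗ
    (TensorProduct.assoc k A A A).symm.toLinearMap

/-- On the image of ℋ ⊗_B ℋ the multiplication of the middle factor can be undone: a ⊗ a'c ⊗ c' goes
to a₀ ⊗ τ(a₁)a'c ⊗ c', which `rhoTau_rABA` rewrites as a ⊗ (a' ⊗_B c) ⊗ c'. -/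
theorem splitABA_embES (hG : C.IsHopfGalois) (y : C.ESTensor C.ES) :
    splitABA hG (embES C y) = C.esSquareIncl y := by
  obtain ⟨z, rfl⟩ := C.esMk C.ES |>.range_eq_top.1 (Submodule.range_mkQ _) y
  change _ = C.regroup (TensorProduct.map C.esIncl C.esIncl z)
  rw [embES_mk]
  induction z with
  | zero => simp
  | add x y hx hy => simp only [map_add, hx, hy]
  | tmul x y =>
    rw [TensorProduct.map_tmul, LinearMap.rTensor_tmul, embLin_tmul]
    have hx := rhoTau_rABA hG _ (esIncl_mem x)
    generalize C.esIncl y = z'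
    induction z' with
    | zero => simp
    | add x y hx hy =>
      simp only [map_add, TensorProduct.tmul_add, LinearMap.lTensor_add, LinearMap.add_apply,
        hx, hy]
    | tmul c c' =>
      have h₁ : ∀ z : A ⊗[k] A, splitABA hG
          (((self C).tens.lm.flip (c ⊗ₜ[k] c')).lTensor A z) =
          ((rABA C c).lTensor A (TensorProduct.lift ((LinearMap.lTensorHom A ∘ₗ
            rABAlin C).flip ∘ₗ rhoTau hG) z)) ⊗ₜ[k] c' := by
        intro z
        induction z with
        | zero => simp
        | add x y hx hy => simp only [map_add, TensorProduct.add_tmul, hx, hy]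
        | tmul a a' =>
          change ((rABA C (a' * c)).lTensor A (rhoTau hG a)) ⊗ₜ[k] c' =
            ((rABA C c).lTensor A ((rABA C a').lTensor A (rhoTau hG a))) ⊗ₜ[k] c'
          rw [← LinearMap.lTensor_comp_apply]
          congr 3
          exact BalTensor.hom_ext fun a a'' => by
            rw [LinearMap.comp_apply, rABA_mk, rABA_mk, rABA_mk, mul_assoc]
      have h₂ : ∀ z : A ⊗[k] A, C.regroup (z ⊗ₜ[k] (c ⊗ₜ[k] c')) =
          ((rABA C c).lTensor A ((BalTensor.mk C.rB C.lB ∘ₗ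
            (TensorProduct.mk k A A).flip 1).lTensor A z)) ⊗ₜ[k] c' := by
        intro z
        induction z with
        | zero => simp
        | add x y hx hy => simp only [map_add, TensorProduct.add_tmul, hx, hy]
        | tmul a a' =>
          rw [LinearMap.lTensor_tmul, LinearMap.lTensor_tmul, LinearMap.comp_apply,
            LinearMap.flip_apply, TensorProduct.mk_apply, rABA_mk, one_mul]
          rfl
      rw [h₁, h₂, hx]

theorem splitABA_ins (hG : C.IsHopfGalois) (z : A ⊗[k] A) :
    splitABA hG (ins k A A z) = (rhoTau hG).rTensor A z := by
  induction z with
  | zero => simp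
  | add x y hx hy => simp only [map_add, hx, hy]
  | tmul a a' =>
    change ((rABA C 1).lTensor A (rhoTau hG a)) ⊗ₜ[k] a' = rhoTau hG a ⊗ₜ[k] a'
    have : rABA C 1 = LinearMap.id := BalTensor.hom_ext fun a a' => by
      rw [rABA_mk, mul_one, LinearMap.id_apply]
    rw [this, LinearMap.lTensor_id, LinearMap.id_apply]

/-- The element a ⊗ 1 ⊗ a' is coinvariant, so it comes from ℋ ⊗_B ℋ, and `splitABA` sends it to the
prescribed a₀ ⊗ τ(a₁) ⊗ a'. This proves the existence on which the definition of `Δ` branches. -/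
theorem esSquareIncl_comul (hG : C.IsHopfGalois) (hF : C.IsLeftFaithfullyFlat) :
    C.esSquareIncl ∘ₗ C.Δ hG = C.comulFormula hG := by
  have h : ∃ D : C.ES →ₗ[k] C.ESTensor C.ES, C.esSquareIncl ∘ₗ D = C.comulFormula hG := by
    obtain ⟨h₁, h₂⟩ := embES_injective_range (C := C) hG hF
    let e := LinearEquiv.ofInjective (embES C) h₁
    let i : C.ES →ₗ[k] LinearMap.range (embES C) :=
      (ins k A A ∘ₗ C.esIncl).codRestrict _ fun x => by
        rw [h₂]
        exact (self C).ins_mem_coinv (esIncl_mem x)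
    refine ⟨e.symm.toLinearMap ∘ₗ i, LinearMap.ext fun x => ?_⟩
    have h₃ : embES C (e.symm (i x)) = ins k A A (C.esIncl x) :=
      congrArg Subtype.val (e.apply_symm_apply (i x))
    change C.esSquareIncl (e.symm (i x)) = _
    rw [← splitABA_embES hG, h₃, splitABA_ins]
    rfl
  rw [Δ, dif_pos h]
  exact h.choose_spec

/-- Multiplying the two legs of τ(h) gives ε(h)1, so collapsing the middle of the formula for the
coproduct leaves a ⊗ 1 ⊗ a'. Later computations with `Δ` rest on this identity alone. -/
theorem embES_comul (hG : C.IsHopfGalois) (hF : C.IsLeftFaithfullyFlat) (x : C.ES) :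
    embES C (C.Δ hG x) = ins k A A (C.esIncl x) := by
  rw [← mulABA_esSquareIncl, ← LinearMap.comp_apply C.esSquareIncl, esSquareIncl_comul hG hF]
  change mulABA ((rhoTau hG).rTensor A (C.esIncl x)) = _
  have h : ∀ a : A, (mulBal C).lTensor A (rhoTau hG a) = a ⊗ₜ[k] 1 := by
    intro a
    -- The product A ⊗_B A → A is the Galois map followed by the counit of H.
    have h₁ : ∀ y : C.ABA, mulBal C y = TensorProduct.rid k A
        ((Coalgebra.counit (R := k) (A := H)).lTensor A (C.galoisMap y)) := by
      intro y
      refine LinearMap.congr_fun (g := (TensorProduct.rid k A).toLinearMap ∘ₗ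
        (Coalgebra.counit (R := k) (A := H)).lTensor A ∘ₗ C.galoisMap)
        (BalTensor.hom_ext fun a a' => ?_) y
      rw [LinearMap.comp_apply, LinearMap.comp_apply, galoisMap_mk]
      conv_lhs => rw [← C.counit a']
      rw [mulBal_mk]
      generalize C.ρ a' = X
      induction X with
      | zero => simp
      | add X Y hX hY => simp only [map_add, mul_add, hX, hY]
      | tmul a' h => simp
    conv_rhs => rw [← C.counit a]
    rw [rhoTau, LinearMap.comp_apply, AlgHom.toLinearMap_apply]
    generalize C.ρ a = X
    induction X with
    | zero => simp
    | add X Y hX hY => simp only [map_add, TensorProduct.add_tmul, hX, hY]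
    | tmul a h =>
      rw [LinearMap.lTensor_tmul, LinearMap.lTensor_tmul, h₁, galoisMap_translation]
      simp [TensorProduct.smul_tmul]
  generalize C.esIncl x = z
  induction z with
  | zero => simp
  | add x y hx hy => simp only [map_add, hx, hy]
  | tmul a a' =>
    rw [LinearMap.rTensor_tmul, mulABA, LinearMap.comp_apply, LinearMap.rTensor_tmul, h]
    rfl

end Coproduct

end HopfBimodule

end ESCalculus.RightComoduleAlgebra

namespace ESCalculus.RightComoduleAlgebra

variable {k : Type u} {H : Type v} {A : Type w} [Field k] [Ring H] [HopfAlgebra k H]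
  [Ring A] [Algebra k A] {C : RightComoduleAlgebra k H A}

namespace HopfBimodule

/-! ### The tensor square of ℋ over the source map as (A ⊗ A ⊗ A)^{co H}. -/

section SourceGalois

variable (C) in
/-- The right action of `B` on the bialgebroid through the source map. -/
noncomputable def rSource (b : C.coinv) : Module.End k C.ES := LinearMap.mulRight k (C.source b)

variable (k A) in
/-- The map `a ⊗ a' ↦ a ⊗ (a' ⊗ 1)`. -/
noncomputable def insOne : A ⊗[k] A →ₗ[k] A ⊗[k] (A ⊗[k] A) :=
  ((TensorProduct.mk k A A).flip 1).lTensor A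

theorem insOne_tmul (a a' : A) : insOne k A (a ⊗ₜ[k] a') = a ⊗ₜ[k] (a' ⊗ₜ[k] 1) := rfl

theorem tens_δ_tmul_one (a : A) : (self C).tens.δ ((TensorProduct.mk k A A).flip 1 a) =
    ((TensorProduct.mk k A A).flip 1).rTensor H ((self C).δ a) := by
  change C.diag (a ⊗ₜ[k] 1) = ((TensorProduct.mk k A A).flip 1).rTensor H (C.ρ a)
  rw [diag_tmul, map_one, Algebra.TensorProduct.one_def]
  generalize C.ρ a = X
  induction X with
  | zero => simp
  | add X Y hX hY => simp only [map_add, TensorProduct.add_tmul, hX, hY]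
  | tmul a h => simp [collect]

theorem insOne_mem_coinv {z : A ⊗[k] A} (hz : z ∈ C.diagCoinv) :
    insOne k A z ∈ (self C).tens.tens.coinv := by
  have h' := (self C).lTensor_mem_coinv (self C).tens ((TensorProduct.mk k A A).flip 1)
    tens_δ_tmul_one hz
  exact h'

/-- The map `(q ⊗ q') ⊗ (p ⊗ p') ↦ p q ⊗ (q' ⊗ p')` before descending to `⊗_B`. -/
noncomputable def sourceGaloisLin : (A ⊗[k] A) ⊗[k] (A ⊗[k] A) →ₗ[k] A ⊗[k] (A ⊗[k] A) :=
  TensorProduct.lift ((self C).tens.tens.lr.flip ∘ₗ insOne k A)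

theorem sourceGaloisLin_tmul (z z' : A ⊗[k] A) : sourceGaloisLin (C := C) (z ⊗ₜ[k] z') =
    (self C).tens.tens.lr z' (insOne k A z) := rfl

theorem lr_insOne_tmul (q q' p p' : A) :
    (self C).tens.tens.lr (p ⊗ₜ[k] p') (insOne k A (q ⊗ₜ[k] q')) =
      (p * q) ⊗ₜ[k] (q' ⊗ₜ[k] p') := by
  rw [insOne_tmul, lr_tmul, tens_rm_tmul, tens_rm_tmul, tens_lm_tmul]
  change (p * q) ⊗ₜ[k] (q' ⊗ₜ[k] (1 * p')) = _
  rw [one_mul]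

theorem lr_insOne_mul (p z : A ⊗[k] A) (b : A) :
    (self C).tens.tens.lr ((LinearMap.mulRight k b).rTensor A p) (insOne k A z) =
      (self C).tens.tens.lr p (insOne k A ((LinearMap.mulLeft k b).rTensor A z)) := by
  induction p with
  | zero => simp
  | add x y hx hy => simp only [map_add, LinearMap.add_apply, hx, hy]
  | tmul p p' =>
    induction z with
    | zero => simp
    | add x y hx hy => simp only [map_add, hx, hy]
    | tmul q q' =>
      rw [LinearMap.rTensor_tmul, LinearMap.rTensor_tmul, lr_insOne_tmul, lr_insOne_tmul]
      simp [mul_assoc]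

variable (C) in
/-- The map `(q ⊗ q') ⊗_B (p ⊗ p') ↦ p q ⊗ (q' ⊗ p')`, for the tensor product over the source
map. -/
noncomputable def sourceGalois :
    BalTensor (C.lES C.ES) (rSource C) →ₗ[k] A ⊗[k] (A ⊗[k] A) :=
  BalTensor.lift _ _ (sourceGaloisLin (C := C) ∘ₗ TensorProduct.map C.esIncl C.esIncl) (by
    intro b q p
    rw [LinearMap.comp_apply, LinearMap.comp_apply, TensorProduct.map_tmul,
      TensorProduct.map_tmul, sourceGaloisLin_tmul, sourceGaloisLin_tmul, rSource,
      LinearMap.mulRight_apply, esIncl_mul_source, esIncl_lES]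
    exact (lr_insOne_mul _ _ _).symm)

theorem sourceGalois_mk (q p : C.ES) :
    sourceGalois C (BalTensor.mk _ _ (q ⊗ₜ[k] p)) =
      (self C).tens.tens.lr (C.esIncl p) (insOne k A (C.esIncl q)) := rfl

/-- The action of `B` on `A ⊗ A` by right multiplication on the first factor. -/
noncomputable def rFst : A →ₗ[k] Module.End k (A ⊗[k] A) :=
  LinearMap.rTensorHom A ∘ₗ (LinearMap.mul k A).flip

theorem rFst_tmul (a c c' : A) : rFst (k := k) a (c ⊗ₜ[k] c') = (c * a) ⊗ₜ[k] c' := rfl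

/-- The map `(q ⊗ q') ⊗ (c ⊗ c') ↦ q' ⊗ (c q ⊗ c')`, for the tensor product over the source
map. -/
noncomputable def sourceBase :
    BalTensor (C.lES C.ES) (fun b : C.coinv => rFst (k := k) (b : A)) →ₗ[k] A ⊗[k] (A ⊗[k] A) :=
  BalTensor.lift _ _ (TensorProduct.lift ((LinearMap.lTensorHom A ∘ₗ (rFst (k := k)
    (A := A)).flip).flip ∘ₗ (TensorProduct.comm k A A).toLinearMap ∘ₗ C.esIncl)) (by
    intro b q l
    rw [TensorProduct.lift.tmul, TensorProduct.lift.tmul]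
    simp only [LinearMap.comp_apply, LinearMap.flip_apply, LinearEquiv.coe_coe,
      LinearMap.coe_lTensorHom]
    rw [esIncl_lES]
    generalize C.esIncl q = z
    induction z with
    | zero => simp
    | add x y hx hy => simp only [map_add, hx, hy]
    | tmul q q' =>
      induction l with
      | zero => simp
      | add x y hx hy => simp only [map_add, LinearMap.lTensor_add, LinearMap.add_apply, hx, hy]
      | tmul c c' => simp [tens_lm_tmul, rFst_tmul, mul_assoc])

theorem sourceBase_mk (q : C.ES) (l : A ⊗[k] A) :
    sourceBase (C := C) (BalTensor.mk _ _ (q ⊗ₜ[k] l)) =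
      ((rFst (k := k)).flip l).lTensor A (TensorProduct.comm k A A (C.esIncl q)) := rfl

/-- Base change of A ⊗_B ℋ ≅ A ⊗ A, with its factors flipped, along A ⊗ A seen as a right A-module
through its first factor. -/
theorem sourceBase_bijective (hS : Function.Bijective (HopfAlgebra.antipode k (A := H)))
    (hG : C.IsHopfGalois) (hF : C.IsLeftFaithfullyFlat) :
    Function.Bijective (sourceBase (C := C)) := by
  refine baseChange_bijective (k := k) (V := A) (r := C.lES C.ES) (lA := C.rB) 1
    (LinearMap.mulLeft k) (rFst (k := k)) (by simp) (by simp) (by simp)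
    (by simp [rB, mul_assoc]) (fun l => ?_) (fun a c l => ?_) (fun b a l => ?_)
    ((TensorProduct.comm k A A).toLinearMap ∘ₗ C.esIncl)
    ((TensorProduct.comm k A A).toLinearMap ∘ₗ leftES C ∘ₗ
      (BalTensor.comm (C.lES C.ES) C.rB).toLinearMap) (fun q a => ?_) ?_ _ sourceBase_mk
  · induction l with
    | zero => simp
    | add x y hx hy => simp only [map_add, hx, hy]
    | tmul c c' => rw [rFst_tmul, mul_one]
  · induction l with
    | zero => simp
    | add x y hx hy => simp only [map_add, hx, hy]
    | tmul e e' => rw [rFst_tmul, rFst_tmul, rFst_tmul, LinearMap.mulLeft_apply, mul_assoc]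
  · induction l with
    | zero => simp
    | add x y hx hy => simp only [map_add, hx, hy]
    | tmul e e' => rw [rFst_tmul, rFst_tmul, rFst_tmul, rB, LinearMap.mulRight_apply, mul_assoc]
  · rw [LinearMap.comp_apply, LinearMap.comp_apply, LinearEquiv.coe_coe, LinearEquiv.coe_coe,
      BalTensor.comm_mk, leftES_mk, LinearMap.comp_apply, LinearEquiv.coe_coe]
    generalize C.esIncl q = z
    induction z with
    | zero => simp
    | add x y hx hy => simp only [map_add, hx, hy]
    | tmul q q' => simp [tens_lm_tmul]
  · have h := ((TensorProduct.comm k A A).bijective.comp (leftES_bijective hS hG hF)).comp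
      (BalTensor.comm (C.lES C.ES) C.rB).bijective
    exact h

/-- The recognition principle again: tensoring the source with A on the right turns the second ℋ
into A ⊗ A, and `sourceBase` then gives A ⊗ A ⊗ A. As a consequence (A ⊗ A ⊗ A)^{co H} is generated
by the elements p(q ⊗ 1) subject only to the additive relations and the balancing p s(b) · q = p ·
s(b)q. These are relations that p dq respects in every left covariant calculus. -/
theorem sourceGalois_injective_range
    (hS : Function.Bijective (HopfAlgebra.antipode k (A := H)))
    (hG : C.IsHopfGalois) (hF : C.IsLeftFaithfullyFlat) :
    Function.Injective (sourceGalois C) ∧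
      LinearMap.range (sourceGalois C) = (self C).tens.tens.coinv := by
  let S := (self C).tens
  have hcomm : ∀ (b c : C.coinv) (x : C.ES),
      C.rES b (rSource C c x) = rSource C c (C.rES b x) := fun b c x => by
    simp [rES, rSource, mul_assoc]
  let r : C.coinv → Module.End k (BalTensor (C.lES C.ES) (rSource C)) := fun b =>
    BalTensor.map LinearMap.id (C.rES b) (fun _ _ => rfl) (hcomm b)
  have hr' : ∀ b q p, r b (BalTensor.mk (C.lES C.ES) (rSource C) (q ⊗ₜ[k] p)) =
      BalTensor.mk (C.lES C.ES) (rSource C) (q ⊗ₜ[k] C.rES b p) := fun _ _ _ => rfl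
  have hr : C.RAct r :=
    { one := fun y => LinearMap.congr_fun (f := r 1) (g := LinearMap.id)
        (BalTensor.hom_ext fun x m => by rw [hr', C.rAct_rES.one]; rfl) y
      mul := fun b c y => LinearMap.congr_fun (f := r (b * c)) (g := r c ∘ₗ r b)
        (BalTensor.hom_ext fun x m => by
          rw [LinearMap.comp_apply, hr', hr', hr', C.rAct_rES.mul]) y
      add := fun b c y => LinearMap.congr_fun (f := r (b + c)) (g := r b + r c)
        (BalTensor.hom_ext fun x m => by
          rw [LinearMap.add_apply, hr', hr', hr', C.rAct_rES.add, TensorProduct.tmul_add,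
            map_add]) y
      smul := fun t b y => LinearMap.congr_fun (f := r (t • b)) (g := t • r b)
        (BalTensor.hom_ext fun x m => by
          rw [LinearMap.smul_apply, hr', hr', C.rAct_rES.smul, TensorProduct.tmul_smul,
            map_smul]) y }
  have hf : ∀ b y, sourceGalois C (r b y) = S.tens.rm (b : A) (sourceGalois C y) := by
    intro b y
    refine LinearMap.congr_fun (f := sourceGalois C ∘ₗ r b)
      (g := S.tens.rm (b : A) ∘ₗ sourceGalois C) (BalTensor.hom_ext fun q p => ?_) y
    rw [LinearMap.comp_apply, LinearMap.comp_apply, hr', sourceGalois_mk, sourceGalois_mk,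
      rm_lr, esIncl_rES]
  refine S.tens.injective_and_range_eq hG hF hr _ hf (fun y => ?_) ?_
  · obtain ⟨z, rfl⟩ := BalTensor.mk_surjective _ _ y
    induction z with
    | zero => simp
    | add x y hx hy => simp only [map_add]; exact add_mem hx hy
    | tmul q p => exact S.tens.lr_mem_coinv (insOne_mem_coinv (esIncl_mem q)) p
  let l₂ : C.coinv → Module.End k (BalTensor C.rES C.lB) := fun b =>
    BalTensor.map (rSource C b) LinearMap.id (fun c m => (hcomm c b m).symm) (fun _ _ => rfl)
  have hact : ∀ b y, S.actMap C.rES C.esIncl esIncl_rES (l₂ b y) =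
      rFst (k := k) (b : A) (S.actMap C.rES C.esIncl esIncl_rES y) := by
    intro b y
    refine LinearMap.congr_fun
      (f := S.actMap C.rES C.esIncl esIncl_rES ∘ₗ l₂ b)
      (g := rFst (k := k) (b : A) ∘ₗ S.actMap C.rES C.esIncl esIncl_rES)
      (BalTensor.hom_ext fun p a => ?_) y
    have h₁ : S.actMap C.rES C.esIncl esIncl_rES (l₂ b (BalTensor.mk C.rES C.lB (p ⊗ₜ[k] a))) =
      S.rm a (C.esIncl (p * C.source b)) := rfl
    rw [LinearMap.comp_apply, LinearMap.comp_apply, h₁, esIncl_mul_source, actMap_mk]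
    generalize C.esIncl p = z
    induction z with
    | zero => simp
    | add x y hx hy => simp only [map_add, hx, hy]
    | tmul p p' => rfl
  let e := BalTensor.assoc (rM := C.lES C.ES) (lN := rSource C) (rN := C.rES) (lP := C.lB) (r := r)
    (l := l₂) hr' (fun _ _ _ => rfl)
  -- `sourceBase` puts the middle factor first; `leftComm` restores the order.
  have h := (TensorProduct.leftComm k A A A).bijective.comp
    ((sourceBase_bijective hS hG hF).comp ((BalTensor.map_bijective (r := C.lES C.ES)
    (r' := C.lES C.ES) (f := LinearMap.id) (fun _ _ => rfl) hact Function.bijective_id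
      (actMap_esIncl_bijective hG hF)).comp e.bijective))
  have key : S.tens.actMap r (sourceGalois C) hf = (TensorProduct.leftComm k A A A).toLinearMap ∘ₗ
      sourceBase ∘ₗ (BalTensor.map LinearMap.id
        (S.actMap C.rES C.esIncl esIncl_rES) (fun _ _ => rfl) hact :
          BalTensor (C.lES C.ES) l₂ →ₗ[k] BalTensor (C.lES C.ES)
            (fun b : C.coinv => rFst (k := k) (b : A))) ∘ₗ e.toLinearMap := by
    refine BalTensor.hom_ext fun y a => ?_
    obtain ⟨y, rfl⟩ := BalTensor.mk_surjective _ _ y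
    induction y with
    | zero => simp
    | add x y hx hy => simp only [map_add, TensorProduct.add_tmul, hx, hy]
    | tmul q p =>
      have h₁ : e (BalTensor.mk r C.lB (BalTensor.mk (C.lES C.ES) (rSource C) (q ⊗ₜ[k] p) ⊗ₜ[k] a)) =
        BalTensor.mk (C.lES C.ES) l₂ (q ⊗ₜ[k] BalTensor.mk C.rES C.lB (p ⊗ₜ[k] a)) := rfl
      rw [LinearMap.comp_apply, LinearMap.comp_apply, LinearMap.comp_apply, LinearEquiv.coe_coe, LinearEquiv.coe_coe, h₁,
        BalTensor.map_mk, TensorProduct.map_tmul, actMap_mk, actMap_mk, sourceBase_mk,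
        sourceGalois_mk, rm_lr]
      change S.tens.lr (S.rm a (C.esIncl p)) _ = TensorProduct.leftComm k A A A
        (((rFst (k := k)).flip (S.rm a (C.esIncl p))).lTensor A _)
      generalize S.rm a (C.esIncl p) = z
      generalize C.esIncl q = z'
      induction z with
      | zero => simp
      | add x y hx hy =>
        simp only [map_add, LinearMap.lTensor_add, LinearMap.add_apply, hx, hy]
      | tmul p p' =>
        induction z' with
        | zero => simp
        | add x y hx hy => simp only [map_add, hx, hy]
        | tmul q q' =>
          rw [lr_insOne_tmul]
          simp [rFst_tmul]
  rw [key]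
  exact h

end SourceGalois

end HopfBimodule

end ESCalculus.RightComoduleAlgebra

namespace ESCalculus.RightComoduleAlgebra

variable {k : Type u} {H : Type v} {A : Type w} [Field k] [Ring H] [HopfAlgebra k H]
  [Ring A] [Algebra k A] {C : RightComoduleAlgebra k H A}

namespace HopfBimodule

/-! ### The inner action on A ⊗ L. -/

section InnerAction

variable {L : Type*} [AddCommGroup L] [Module k L] (T : C.HopfBimodule L)

/-- The inner action `x ⊗ x' ↦ (a ⊗ l ↦ a x ⊗ x' l)` on `A ⊗ L`. -/
noncomputable def rr : A ⊗[k] A →ₗ[k] Module.End k (A ⊗[k] L) :=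
  TensorProduct.lift ((TensorProduct.mapBilinear (RingHom.id k) A L A L).compl₁₂
    (LinearMap.mul k A).flip T.lm)

theorem rr_tmul (x x' a : A) (l : L) :
    T.rr (x ⊗ₜ[k] x') (a ⊗ₜ[k] l) = (a * x) ⊗ₜ[k] T.lm x' l := rfl

theorem rr_mul (y z : A ⊗[k] A) (m : A ⊗[k] L) :
    T.rr (TensorProduct.map₂ (LinearMap.mul k A) (LinearMap.mul k A).flip y z) m =
      T.rr z (T.rr y m) := by
  induction m with
  | zero => simp
  | add m n hm hn => simp only [map_add, hm, hn]
  | tmul a l =>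
    induction y with
    | zero => simp
    | add x y hx hy => simp only [map_add, LinearMap.add_apply, hx, hy]
    | tmul c c' =>
      induction z with
      | zero => simp
      | add x y hx hy => simp only [map_add, LinearMap.add_apply, hx, hy]
      | tmul x x' => simp [rr_tmul, T.lm_mul, mul_assoc]

theorem rr_one (m : A ⊗[k] L) : T.rr (1 ⊗ₜ[k] 1) m = m := by
  induction m with
  | zero => simp
  | add m n hm hn => simp only [map_add, hm, hn]
  | tmul a l => rw [rr_tmul, mul_one, T.lm_one]

theorem lr_rr (y z : A ⊗[k] A) (m : A ⊗[k] L) :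
    T.tens.lr y (T.rr z m) = T.rr z (T.tens.lr y m) := by
  induction m with
  | zero => simp
  | add m n hm hn => simp only [map_add, hm, hn]
  | tmul a l =>
    induction y with
    | zero => simp
    | add x y hx hy => simp only [map_add, LinearMap.add_apply, hx, hy]
    | tmul c c' =>
      induction z with
      | zero => simp
      | add x y hx hy => simp only [map_add, LinearMap.add_apply, hx, hy]
      | tmul x x' => simp [rr_tmul, lr_tmul, tens_lm_tmul, tens_rm_tmul, T.lm_rm, mul_assoc]

theorem rm_rr (z : A ⊗[k] A) (a : A) (m : A ⊗[k] L) :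
    T.tens.rm a (T.rr z m) = T.rr z (T.tens.rm a m) := by
  induction m with
  | zero => simp
  | add m n hm hn => simp only [map_add, hm, hn]
  | tmul c l =>
    induction z with
    | zero => simp
    | add x y hx hy => simp only [map_add, LinearMap.add_apply, hx, hy]
    | tmul x x' => simp [rr_tmul, tens_rm_tmul, T.lm_rm]

/-- The legs of z stand between those of a and l, in the product a₁x₁x'₁l₁. Expanding ρ(a) and δ(l)
into finite sums makes the expression a linear function of the diagonal coaction of z, into which
coinvariance of z can be inserted. -/
theorem tens_δ_rr_tmul (z : A ⊗[k] A) (hz : z ∈ C.diagCoinv) (a : A) (l : L) :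
    T.tens.δ (T.rr z (a ⊗ₜ[k] l)) = (T.rr z).rTensor H (T.tens.δ (a ⊗ₜ[k] l)) := by
  classical
  obtain ⟨s, hs⟩ := TensorProduct.exists_finset (C.ρ a)
  obtain ⟨t, ht⟩ := TensorProduct.exists_finset (T.δ l)
  have key : ∀ z : A ⊗[k] A, T.tens.δ (T.rr z (a ⊗ₜ[k] l)) = ∑ i ∈ s, ∑ j ∈ t,
      TensorProduct.map (T.rr.flip (i.1 ⊗ₜ[k] j.1))
        (LinearMap.mulLeft k i.2 ∘ₗ LinearMap.mulRight k j.2) (C.diag z) := by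
    intro z
    induction z with
    | zero => simp
    | add x y hx hy =>
      simp only [map_add, LinearMap.add_apply, hx, hy, Finset.sum_add_distrib]
    | tmul x x' =>
      rw [rr_tmul, tens_δ_tmul, map_mul, T.δ_lm, diag_tmul, hs, ht]
      generalize C.ρ x = X
      generalize C.ρ x' = X'
      simp only [Finset.sum_mul, TensorProduct.sum_tmul, TensorProduct.tmul_sum, map_sum]
      rw [Finset.sum_comm]
      refine Finset.sum_congr rfl fun i _ => Finset.sum_congr rfl fun j _ => ?_
      induction X with
      | zero => simp
      | add X Y hX hY => simp only [map_add, mul_add, TensorProduct.add_tmul, hX, hY]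
      | tmul x h =>
        induction X' with
        | zero => simp
        | add X Y hX hY =>
          simp only [map_add, LinearMap.add_apply, TensorProduct.tmul_add, hX, hY]
        | tmul x' h' => simp [collectL_tmul, collect, rr_tmul, mul_assoc]
  rw [key, show C.diag z = z ⊗ₜ[k] (1 : H) from hz, tens_δ_tmul, hs, ht]
  simp only [TensorProduct.sum_tmul, TensorProduct.tmul_sum, map_sum]
  rw [Finset.sum_comm]
  refine Finset.sum_congr rfl fun i _ => Finset.sum_congr rfl fun j _ => ?_
  simp [collectL_tmul]

theorem rr_mem_coinv {m : A ⊗[k] L} (hm : m ∈ T.tens.coinv) (x : C.ES) :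
    T.rr (C.esIncl x) m ∈ T.tens.coinv := by
  have h : ∀ m, T.tens.δ (T.rr (C.esIncl x) m) = (T.rr (C.esIncl x)).rTensor H (T.tens.δ m) := by
    intro m
    induction m with
    | zero => simp
    | add m n hm hn => simp only [map_add, hm, hn]
    | tmul a l => exact T.tens_δ_rr_tmul _ (esIncl_mem x) a l
  rw [mem_coinv] at hm ⊢
  rw [h, hm]
  rfl

end InnerAction

/-! ### The ℋ-bimodule (A ⊗ L)^{co H} and its coaction. -/

section CoForms

variable {L : Type w} [AddCommGroup L] [Module k L] (T : C.HopfBimodule L)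

/-- The coinvariants `(A ⊗ L)^{co H}`, which form a bimodule over the bialgebroid. -/
def CoForms : Type _ := T.tens.coinv

noncomputable instance : AddCommGroup T.CoForms := inferInstanceAs (AddCommGroup T.tens.coinv)

noncomputable instance : Module k T.CoForms := inferInstanceAs (Module k T.tens.coinv)

/-- The inclusion of `(A ⊗ L)^{co H}` into `A ⊗ L`. -/
noncomputable def coVal : T.CoForms →ₗ[k] A ⊗[k] L := T.tens.coinv.subtype

theorem coVal_injective : Function.Injective T.coVal := Subtype.val_injective

theorem coVal_mem (η : T.CoForms) : T.coVal η ∈ T.tens.coinv := η.2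

theorem range_coVal : LinearMap.range T.coVal = T.tens.coinv := Submodule.range_subtype _

/-- A coinvariant element as an element of `CoForms`. -/
def coMk (m : A ⊗[k] L) (hm : m ∈ T.tens.coinv) : T.CoForms := ⟨m, hm⟩

/-- The left action multiplies a ⊗ l on its outer sides, the right action defined afterwards on its
inner sides. They commute because they touch different places. -/
noncomputable instance : SMul C.ES T.CoForms where
  smul x η := T.coMk (T.tens.lr (C.esIncl x) (T.coVal η)) (T.tens.lr_mem_coinv η.2 x)

theorem coVal_smul (x : C.ES) (η : T.CoForms) :
    T.coVal (x • η) = T.tens.lr (C.esIncl x) (T.coVal η) := rfl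

noncomputable instance : Module C.ES T.CoForms where
  one_smul η := T.coVal_injective (by rw [coVal_smul, esIncl_one, lr_one])
  mul_smul x y η := T.coVal_injective (by rw [coVal_smul, esIncl_mul, lr_mul]; rfl)
  smul_zero x := T.coVal_injective (by rw [coVal_smul, map_zero, map_zero])
  smul_add x η ξ := T.coVal_injective (by rw [coVal_smul, map_add, map_add, map_add]; rfl)
  add_smul x y η := T.coVal_injective (by
    rw [coVal_smul, map_add, map_add, LinearMap.add_apply, map_add]; rfl)
  zero_smul η := T.coVal_injective (by rw [coVal_smul, map_zero, map_zero, map_zero]; rfl)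

instance : IsScalarTower k C.ES T.CoForms where
  smul_assoc t x η := T.coVal_injective (by
    rw [coVal_smul, map_smul, map_smul, map_smul, coVal_smul]; rfl)

noncomputable instance : SMul C.ESᵐᵒᵖ T.CoForms where
  smul x η := T.coMk (T.rr (C.esIncl x.unop) (T.coVal η)) (T.rr_mem_coinv η.2 x.unop)

theorem coVal_op_smul (x : C.ES) (η : T.CoForms) :
    T.coVal (op x • η) = T.rr (C.esIncl x) (T.coVal η) := rfl

theorem coVal_unop_smul (x : C.ESᵐᵒᵖ) (η : T.CoForms) :
    T.coVal (x • η) = T.rr (C.esIncl x.unop) (T.coVal η) := rfl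

noncomputable instance : Module C.ESᵐᵒᵖ T.CoForms where
  one_smul η := T.coVal_injective (by rw [coVal_unop_smul, unop_one, esIncl_one, rr_one])
  mul_smul x y η := T.coVal_injective (by
    rw [coVal_unop_smul, unop_mul, esIncl_mul, rr_mul]; rfl)
  smul_zero x := T.coVal_injective (by rw [coVal_unop_smul, map_zero, map_zero])
  smul_add x η ξ := T.coVal_injective (by rw [coVal_unop_smul, map_add, map_add, map_add]; rfl)
  add_smul x y η := T.coVal_injective (by
    rw [coVal_unop_smul, unop_add, map_add, map_add, LinearMap.add_apply, map_add]; rfl)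
  zero_smul η := T.coVal_injective (by
    rw [coVal_unop_smul, unop_zero, map_zero, map_zero, map_zero]; rfl)

instance : IsScalarTower k C.ESᵐᵒᵖ T.CoForms where
  smul_assoc t x η := T.coVal_injective (by
    rw [coVal_unop_smul, unop_smul, map_smul, map_smul, map_smul, coVal_unop_smul]; rfl)

instance : SMulCommClass C.ES C.ESᵐᵒᵖ T.CoForms where
  smul_comm x y η := T.coVal_injective (by
    rw [coVal_smul, coVal_unop_smul, coVal_unop_smul, coVal_smul, lr_rr])

theorem lr_source (b : C.coinv) (m : A ⊗[k] L) :
    T.tens.lr (C.esIncl (C.source b)) m = T.tens.lm (b : A) m := by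
  rw [esIncl_source, lr_tmul, T.tens.rm_one]

theorem coVal_lES (b : C.coinv) (η : T.CoForms) :
    T.coVal (C.lES T.CoForms b η) = T.tens.lm (b : A) (T.coVal η) := T.lr_source b _

/-- The embedding `ES ⊗_B (A ⊗ L)^{co H} → A ⊗ (A ⊗ L)`. -/
noncomputable def coEmb : C.ESTensor T.CoForms →ₗ[k] A ⊗[k] (A ⊗[k] L) :=
  T.tens.emb (C.lES T.CoForms) T.coVal T.coVal_lES

theorem coEmb_mk_tmul (x : C.ES) (η : T.CoForms) :
    T.coEmb (C.esMk T.CoForms (x ⊗ₜ[k] η)) =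
      (T.tens.lm.flip (T.coVal η)).lTensor A (C.esIncl x) := rfl

theorem coEmb_injective_range (hG : C.IsHopfGalois) (hF : C.IsLeftFaithfullyFlat) :
    Function.Injective T.coEmb ∧ LinearMap.range T.coEmb = T.tens.tens.coinv :=
  T.tens.emb_injective_range hG hF _ _ _ T.coVal_injective T.range_coVal

/-- The left coaction on `(A ⊗ L)^{co H}`. -/
noncomputable def coAct (hG : C.IsHopfGalois) (hF : C.IsLeftFaithfullyFlat) :
    T.CoForms →ₗ[k] C.ESTensor T.CoForms :=
  (LinearEquiv.ofInjective T.coEmb (T.coEmb_injective_range hG hF).1).symm.toLinearMap ∘ₗ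
    (ins k A L ∘ₗ T.coVal).codRestrict (LinearMap.range T.coEmb) fun η => by
      rw [(T.coEmb_injective_range hG hF).2]
      exact T.ins_mem_coinv η.2

theorem coEmb_coAct (hG : C.IsHopfGalois) (hF : C.IsLeftFaithfullyFlat) (η : T.CoForms) :
    T.coEmb (T.coAct hG hF η) = ins k A L (T.coVal η) :=
  congrArg Subtype.val ((LinearEquiv.ofInjective T.coEmb
    (T.coEmb_injective_range hG hF).1).apply_symm_apply _)

theorem spanA_rr {V : Submodule k (A ⊗[k] L)} {z : A ⊗[k] A} (hV : ∀ m ∈ V, T.rr z m ∈ V)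
    {m : A ⊗[k] L} (hm : m ∈ T.tens.spanA V) : T.rr z m ∈ T.tens.spanA V := by
  have h : T.tens.spanA V ≤ (T.tens.spanA V).comap (T.rr z) := by
    rw [spanA, Submodule.span_le]
    rintro _ ⟨a, v, hv, rfl⟩
    rw [SetLike.mem_coe, Submodule.mem_comap, ← T.rm_rr]
    exact T.tens.rm_mem_spanA V a (T.tens.le_spanA V (hV v hv))
  exact h hm

end CoForms

end HopfBimodule

end ESCalculus.RightComoduleAlgebra

namespace ESCalculus.RightComoduleAlgebra

variable {k : Type u} {H : Type v} {A : Type w} [Field k] [Ring H] [HopfAlgebra k H]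
  [Ring A] [Algebra k A] {C : RightComoduleAlgebra k H A}

namespace HopfBimodule

/-! ### Counit, induced right B-action, and products in the Takeuchi product. -/

section CoForms

variable {L : Type w} [AddCommGroup L] [Module k L] (T : C.HopfBimodule L)

theorem coEmb_sourceMulLeft (b : C.coinv) (y : C.ESTensor T.CoForms) :
    T.coEmb (C.sourceMulLeft T.CoForms b y) = T.tens.tens.lm (b : A) (T.coEmb y) := by
  refine LinearMap.congr_fun (f := T.coEmb ∘ₗ C.sourceMulLeft T.CoForms b)
    (g := T.tens.tens.lm (b : A) ∘ₗ T.coEmb) (BalTensor.hom_ext fun x m => ?_) y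
  have h : T.coEmb (C.sourceMulLeft T.CoForms b (C.esMk T.CoForms (x ⊗ₜ[k] m))) =
    (T.tens.lm.flip (T.coVal m)).lTensor A (C.esIncl (C.source b * x)) := rfl
  refine h.trans ?_
  rw [LinearMap.comp_apply, coEmb_mk_tmul, esIncl_source_mul]
  generalize C.esIncl x = z
  induction z with
  | zero => simp
  | add x y hx hy => simp only [map_add, hx, hy]
  | tmul c c' => rfl

theorem ins_lm (a : A) (m : A ⊗[k] L) :
    ins k A L (T.tens.lm a m) = T.tens.tens.lm a (ins k A L m) := by
  induction m with
  | zero => simp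
  | add x y hx hy => simp only [map_add, hx, hy]
  | tmul c c' => rfl

theorem coAct_source (hG : C.IsHopfGalois) (hF : C.IsLeftFaithfullyFlat) (b : C.coinv)
    (η : T.CoForms) : T.coAct hG hF (C.source b • η) =
      C.sourceMulLeft T.CoForms b (T.coAct hG hF η) := by
  apply (T.coEmb_injective_range hG hF).1
  rw [coEmb_coAct, coEmb_sourceMulLeft, coEmb_coAct, coVal_smul, lr_source, ins_lm]

/-- The map `a ⊗ m ↦ a b m`. -/
noncomputable def contractA (b : A) : A ⊗[k] (A ⊗[k] L) →ₗ[k] A ⊗[k] L :=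
  TensorProduct.lift (T.tens.lm ∘ₗ LinearMap.mulRight k b)

theorem contractA_tmul (b a : A) (m : A ⊗[k] L) :
    T.contractA b (a ⊗ₜ[k] m) = T.tens.lm (a * b) m := rfl

/-- As ε is the product of A, contraction with the counit amounts to multiplying the first slot,
times b, into the second. -/
theorem coVal_contract (b : C.coinv) (y : C.ESTensor T.CoForms) :
    T.coVal (C.contract T.CoForms b y) = T.contractA (b : A) (T.coEmb y) := by
  refine LinearMap.congr_fun (f := T.coVal ∘ₗ C.contract T.CoForms b)
    (g := T.contractA (b : A) ∘ₗ T.coEmb) (BalTensor.hom_ext fun x m => ?_) y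
  have h : C.contract T.CoForms b (C.esMk T.CoForms (x ⊗ₜ[k] m)) =
    C.source (C.ε (x * C.source b)) • m := rfl
  rw [LinearMap.comp_apply, LinearMap.comp_apply, h, coVal_smul, lr_source, coEmb_mk_tmul]
  have h₂ : ((C.ε (x * C.source b) : C.coinv) : A) =
    LinearMap.mul' k A (C.esIncl (x * C.source b)) := rfl
  rw [h₂, esIncl_mul_source]
  generalize C.esIncl x = z
  induction z with
  | zero => simp
  | add x y hx hy => simp only [map_add, LinearMap.add_apply, hx, hy]
  | tmul c c' =>
    rw [LinearMap.rTensor_tmul, LinearMap.lTensor_tmul, LinearMap.mul'_apply, contractA_tmul,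
      T.tens.lm_mul]
    rfl

theorem contractA_ins (b : A) (m : A ⊗[k] L) :
    T.contractA b (ins k A L m) = T.rr (b ⊗ₜ[k] 1) m := by
  induction m with
  | zero => simp
  | add x y hx hy => simp only [map_add, hx, hy]
  | tmul c l =>
    rw [ins_tmul, contractA_tmul, tens_lm_tmul, rr_tmul, T.lm_one, mul_one]

/-- The inserted unit is absorbed, which leaves ab ⊗ l. The case b = 1 is the counit axiom; general
b gives the compatibility with the right B-action. -/
theorem contract_coAct (hG : C.IsHopfGalois) (hF : C.IsLeftFaithfullyFlat) (b : C.coinv)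
    (η : T.CoForms) : C.contract T.CoForms b (T.coAct hG hF η) = op (C.source b) • η := by
  apply T.coVal_injective
  rw [coVal_contract, coEmb_coAct, contractA_ins, coVal_op_smul, esIncl_source]

/-- For Y = (a ⊗ a') ⊗ (e ⊗ e'), the product with (h ⊗ h') ⊗ m embeds as ah ⊗ h'a'e m e'. It depends
on Y only through the embedded element a ⊗ a'e ⊗ e', so it is independent of the representative of
the coproduct and can be evaluated on p ⊗ 1 ⊗ p'. -/
theorem embLin_leftProd {L : Type*} [AddCommGroup L] [Module k L] (T : C.HopfBimodule L)
    {Y : (A ⊗[k] A) ⊗[k] (A ⊗[k] A)} {x : A ⊗[k] A}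
    (hY : (self C).tens.embLin LinearMap.id Y = ins k A A x) (Z : (A ⊗[k] A) ⊗[k] L) :
    T.embLin LinearMap.id (TensorProduct.map₂
      (TensorProduct.map₂ (LinearMap.mul k A) (LinearMap.mul k A).flip) T.lr Y Z) =
      T.tens.lr x (T.embLin LinearMap.id Z) := by
  induction Z with
  | zero => simp
  | add x y hx hy => simp only [map_add, hx, hy]
  | tmul t m =>
    induction t with
    | zero => simp
    | add x y hx hy => simp only [map_add, TensorProduct.add_tmul, hx, hy]
    | tmul h h' =>
      have key : ∀ Y : (A ⊗[k] A) ⊗[k] (A ⊗[k] A),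
          T.embLin LinearMap.id (TensorProduct.map₂
            (TensorProduct.map₂ (LinearMap.mul k A) (LinearMap.mul k A).flip) T.lr Y
            ((h ⊗ₜ[k] h') ⊗ₜ[k] m)) =
          TensorProduct.map (LinearMap.mulRight k h) (T.lm h' ∘ₗ T.lr.flip m)
            ((self C).tens.embLin LinearMap.id Y) := by
        intro Y
        induction Y with
        | zero => simp
        | add x y hx hy => simp only [map_add, LinearMap.add_apply, hx, hy]
        | tmul y y' =>
          induction y with
          | zero => simp
          | add x y hx hy =>
            simp only [map_add, TensorProduct.add_tmul, LinearMap.add_apply, hx, hy]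
          | tmul a a' =>
            induction y' with
            | zero => simp
            | add x y hx hy =>
              simp only [map_add, TensorProduct.tmul_add, LinearMap.add_apply, hx, hy]
            | tmul e e' =>
              simp [embLin_tmul_tmul, lr_tmul, tens_lm_tmul, T.lm_mul]
      rw [key, hY, embLin_tmul_tmul]
      clear hY
      induction x with
      | zero => simp
      | add x y hx hy => simp only [map_add, LinearMap.add_apply, hx, hy]
      | tmul p p' =>
        simp [ins_tmul, lr_tmul, tens_lm_tmul, tens_rm_tmul, T.lm_rm, T.lm_one]

/-- The product of (h ⊗ h') ⊗ (c ⊗ l) with (a ⊗ a') ⊗ (e ⊗ e') embeds as ha ⊗ a'h'ce ⊗ e'l. It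
depends on Z only through h ⊗ h'c ⊗ l, but h'c separates a' from e. Only after this slot has become
the unit of the inserted element does Y enter through a ⊗ a'e ⊗ e' alone. This is the reason for the
two successive reductions. -/
theorem embLin_rightProd {Y : (A ⊗[k] A) ⊗[k] (A ⊗[k] A)} {x : A ⊗[k] A}
    (hY : (self C).tens.embLin LinearMap.id Y = ins k A A x)
    {Z : (A ⊗[k] A) ⊗[k] (A ⊗[k] L)} {m : A ⊗[k] L}
    (hZ : T.tens.embLin LinearMap.id Z = ins k A L m) :
    T.tens.embLin LinearMap.id (TensorProduct.map₂
      (TensorProduct.map₂ (LinearMap.mul k A) (LinearMap.mul k A).flip).flip T.rr Y Z) =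
      ins k A L (T.rr x m) := by
  have key : ∀ (Y : (A ⊗[k] A) ⊗[k] (A ⊗[k] A)) (Z : (A ⊗[k] A) ⊗[k] (A ⊗[k] L)),
      T.tens.embLin LinearMap.id (TensorProduct.map₂
      (TensorProduct.map₂ (LinearMap.mul k A) (LinearMap.mul k A).flip).flip T.rr Y Z) =
      TensorProduct.lift ((LinearMap.mul k (Module.End k (A ⊗[k] (A ⊗[k] L)))).compl₁₂
        T.tens.rr (LinearMap.lTensorHom A ∘ₗ T.rr)) Y (T.tens.embLin LinearMap.id Z) := by
    intro Y Z
    induction Y with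
    | zero => simp
    | add x y hx hy => simp only [map_add, LinearMap.add_apply, hx, hy]
    | tmul y y' =>
      induction y with
      | zero => simp
      | add x y hx hy => simp only [map_add, TensorProduct.add_tmul, LinearMap.add_apply, hx, hy]
      | tmul a a' =>
        induction y' with
        | zero => simp
        | add x y hx hy =>
          simp only [map_add, TensorProduct.tmul_add, LinearMap.add_apply, hx, hy]
        | tmul e e' =>
          induction Z with
          | zero => simp
          | add x y hx hy => simp only [map_add, hx, hy]
          | tmul t m =>
            induction t with
            | zero => simp
            | add x y hx hy => simp only [map_add, TensorProduct.add_tmul, hx, hy]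
            | tmul h h' =>
              induction m with
              | zero => simp
              | add x y hx hy => simp only [map_add, TensorProduct.tmul_add, hx, hy]
              | tmul c l =>
                simp [embLin_tmul_tmul, rr_tmul, tens_lm_tmul, mul_assoc]
  rw [key, hZ]
  clear hZ
  induction m with
  | zero => simp
  | add x y hx hy => simp only [map_add, hx, hy]
  | tmul a l =>
    have key₂ : ∀ Y : (A ⊗[k] A) ⊗[k] (A ⊗[k] A),
        TensorProduct.lift ((LinearMap.mul k (Module.End k (A ⊗[k] (A ⊗[k] L)))).compl₁₂
        T.tens.rr (LinearMap.lTensorHom A ∘ₗ T.rr)) Y (ins k A L (a ⊗ₜ[k] l)) =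
        TensorProduct.map (LinearMap.mulLeft k a) ((T.lm.flip l).lTensor A)
          ((self C).tens.embLin LinearMap.id Y) := by
      intro Y
      induction Y with
      | zero => simp
      | add x y hx hy => simp only [map_add, LinearMap.add_apply, hx, hy]
      | tmul y y' =>
        induction y with
        | zero => simp
        | add x y hx hy => simp only [map_add, TensorProduct.add_tmul, LinearMap.add_apply, hx, hy]
        | tmul a a' =>
          induction y' with
          | zero => simp
          | add x y hx hy =>
            simp only [map_add, TensorProduct.tmul_add, LinearMap.add_apply, hx, hy]
          | tmul e e' => simp [embLin_tmul_tmul, rr_tmul, tens_lm_tmul, ins_tmul]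
    rw [key₂, hY]
    clear hY
    induction x with
    | zero => simp
    | add x y hx hy => simp only [map_add, LinearMap.add_apply, hx, hy]
    | tmul p p' => simp [ins_tmul, rr_tmul]

end CoForms

end HopfBimodule

end ESCalculus.RightComoduleAlgebra

namespace ESCalculus.RightComoduleAlgebra

variable {k : Type u} {H : Type v} {A : Type w} [Field k] [Ring H] [HopfAlgebra k H]
  [Ring A] [Algebra k A] {C : RightComoduleAlgebra k H A}

namespace HopfBimodule

/-! ### Bimodule compatibility, coassociativity and colinear maps for (A ⊗ L)^{co H}. -/

section CoForms

variable {L : Type w} [AddCommGroup L] [Module k L] (T : C.HopfBimodule L)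

theorem embLin_map {M : Type*} [AddCommGroup M] [Module k M] {N : Type*} [AddCommGroup N]
    [Module k N] {P : Type*} [AddCommGroup P] [Module k P] (T : C.HopfBimodule P)
    (g : M →ₗ[k] A ⊗[k] A) (f : N →ₗ[k] P) (z : M ⊗[k] N) :
    T.embLin f (g.rTensor N z) = T.embLin LinearMap.id (TensorProduct.map g f z) := by
  induction z with
  | zero => simp
  | add x y hx hy => simp only [map_add, hx, hy]
  | tmul m n => rfl

theorem coEmb_mk_map (z : C.ES ⊗[k] T.CoForms) : T.coEmb (C.esMk T.CoForms z) =
    T.tens.embLin LinearMap.id (TensorProduct.map C.esIncl T.coVal z) :=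
  embLin_map _ _ _ _

theorem embES_mk_map (z : C.ES ⊗[k] C.ES) : embES C (C.esMk C.ES z) =
    (self C).tens.embLin LinearMap.id (TensorProduct.map C.esIncl C.esIncl z) :=
  embLin_map _ _ _ _

theorem map_rightProd (y : C.ES ⊗[k] C.ES) (z : C.ES ⊗[k] T.CoForms) :
    TensorProduct.map C.esIncl T.coVal (C.rightProd T.CoForms y z) =
      TensorProduct.map₂ (TensorProduct.map₂ (LinearMap.mul k A) (LinearMap.mul k A).flip).flip
        T.rr (TensorProduct.map C.esIncl C.esIncl y) (TensorProduct.map C.esIncl T.coVal z) := by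
  induction y with
  | zero => simp
  | add x y hx hy => simp only [map_add, LinearMap.add_apply, hx, hy]
  | tmul g g' =>
    induction z with
    | zero => simp
    | add x y hx hy => simp only [map_add, hx, hy]
    | tmul h m =>
      change C.esIncl (h * g) ⊗ₜ[k] T.coVal (op g' • m) = _
      rw [esIncl_mul, coVal_op_smul]
      rfl

theorem ins_lr (x : A ⊗[k] A) (m : A ⊗[k] L) :
    ins k A L (T.tens.lr x m) = T.tens.tens.lr x (ins k A L m) := by
  induction m with
  | zero => simp
  | add x y hx hy => simp only [map_add, hx, hy]
  | tmul c l =>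
    induction x with
    | zero => simp
    | add x y hx hy => simp only [map_add, LinearMap.add_apply, hx, hy]
    | tmul p p' => rfl

/-- Common source of the left action on ℋ ⊗_B M for M equal to (A ⊗ L)^{co H}, ℋ⁺ or ℋ⁺/I. In each
case M maps ℋ-equivariantly to a Hopf bimodule, and multiplication by a representative of the
coproduct of x becomes the outer action of x. -/
theorem embLin_esIncl_leftProd (hG : C.IsHopfGalois) (hF : C.IsLeftFaithfullyFlat)
    {M : Type*} [AddCommGroup M] [Module k M] [Module C.ES M] [IsScalarTower k C.ES M]
    {P : Type*} [AddCommGroup P] [Module k P] (T : C.HopfBimodule P) (f : M →ₗ[k] P)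
    (hf : ∀ (x : C.ES) (m : M), f (x • m) = T.lr (C.esIncl x) (f m)) (x : C.ES)
    (y : C.ES ⊗[k] C.ES) (hy : C.esMk C.ES y = C.Δ hG x) (z : C.ES ⊗[k] M) :
    T.embLin f (C.esIncl.rTensor M (C.leftProd M y z)) =
      T.tens.lr (C.esIncl x) (T.embLin f (C.esIncl.rTensor M z)) := by
  have h : TensorProduct.map C.esIncl f (C.leftProd M y z) =
      TensorProduct.map₂ (TensorProduct.map₂ (LinearMap.mul k A) (LinearMap.mul k A).flip)
        T.lr (TensorProduct.map C.esIncl C.esIncl y) (TensorProduct.map C.esIncl f z) := by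
    clear hy
    induction y with
    | zero => simp
    | add x y hx hy => simp only [map_add, LinearMap.add_apply, hx, hy]
    | tmul g g' =>
      induction z with
      | zero => simp
      | add x y hx hy => simp only [map_add, hx, hy]
      | tmul h m =>
        change C.esIncl (g * h) ⊗ₜ[k] f (g' • m) = _
        rw [esIncl_mul, hf]
        rfl
  rw [embLin_map, embLin_map, h]
  refine T.embLin_leftProd ?_ _
  rw [← embES_mk_map, hy, embES_comul hG hF]

theorem coEmb_leftProd (hG : C.IsHopfGalois) (hF : C.IsLeftFaithfullyFlat)
    (x : C.ES) (y : C.ES ⊗[k] C.ES) (hy : C.esMk C.ES y = C.Δ hG x)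
    (z : C.ES ⊗[k] T.CoForms) : T.coEmb (C.esMk T.CoForms (C.leftProd T.CoForms y z)) =
      T.tens.tens.lr (C.esIncl x) (T.coEmb (C.esMk T.CoForms z)) :=
  embLin_esIncl_leftProd hG hF T.tens T.coVal (fun _ _ => rfl) x y hy z

theorem coAct_left (hG : C.IsHopfGalois) (hF : C.IsLeftFaithfullyFlat)
    (x : C.ES) (η : T.CoForms) (y : C.ES ⊗[k] C.ES) (z : C.ES ⊗[k] T.CoForms)
    (hy : C.esMk C.ES y = C.Δ hG x) (hz : C.esMk T.CoForms z = T.coAct hG hF η) :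
    T.coAct hG hF (x • η) = C.esMk T.CoForms (C.leftProd T.CoForms y z) := by
  apply (T.coEmb_injective_range hG hF).1
  rw [T.coEmb_leftProd hG hF x y hy, hz, coEmb_coAct, coEmb_coAct, coVal_smul, ins_lr]

theorem coAct_right (hG : C.IsHopfGalois) (hF : C.IsLeftFaithfullyFlat)
    (x : C.ES) (η : T.CoForms) (y : C.ES ⊗[k] C.ES) (z : C.ES ⊗[k] T.CoForms)
    (hy : C.esMk C.ES y = C.Δ hG x) (hz : C.esMk T.CoForms z = T.coAct hG hF η) :
    T.coAct hG hF (op x • η) = C.esMk T.CoForms (C.rightProd T.CoForms y z) := by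
  apply (T.coEmb_injective_range hG hF).1
  rw [coEmb_coAct, coVal_op_smul, coEmb_mk_map, map_rightProd]
  refine (T.embLin_rightProd ?_ ?_).symm
  · rw [← embES_mk_map, hy, embES_comul hG hF]
  · rw [← coEmb_mk_map, hz, coEmb_coAct]

/-- The embedding `ES ⊗_B ES ⊗_B (A ⊗ L)^{co H} → A ⊗ (A ⊗ (A ⊗ L))`. -/
noncomputable def coEmb₃ : BalTensor₃ C.rES (C.lES C.ES) C.rES (C.lES T.CoForms) →ₗ[k]
    A ⊗[k] (A ⊗[k] (A ⊗[k] L)) :=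
  T.tens.tens.emb (C.sourceMulLeft T.CoForms) T.coEmb T.coEmb_sourceMulLeft ∘ₗ
    (bal₃RightEquiv C.rES (C.lES C.ES) C.rES (C.lES T.CoForms) (C.sourceMulLeft T.CoForms)
      fun _ _ _ => rfl).symm.toLinearMap

/-- The embedding theorem is used twice, the second time with M = ℋ ⊗_B (A ⊗ L)^{co H}, which the
first use identifies with (A ⊗ (A ⊗ L))^{co H}. -/
theorem coEmb₃_injective (hG : C.IsHopfGalois) (hF : C.IsLeftFaithfullyFlat) :
    Function.Injective T.coEmb₃ := by
  have h := (T.tens.tens.emb_injective_range hG hF (C.sourceMulLeft T.CoForms) T.coEmb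
    T.coEmb_sourceMulLeft (T.coEmb_injective_range hG hF).1 (T.coEmb_injective_range hG hF).2).1
  exact h.comp (bal₃RightEquiv C.rES (C.lES C.ES) C.rES (C.lES T.CoForms)
    (C.sourceMulLeft T.CoForms) fun _ _ _ => rfl).symm.injective

theorem coEmb₃_right (x : C.ES) (y : C.ESTensor T.CoForms) :
    T.coEmb₃ (toBal₃Right C.rES (C.lES C.ES) C.rES (C.lES T.CoForms) (x ⊗ₜ[k] y)) =
      (T.tens.tens.lm.flip (T.coEmb y)).lTensor A (C.esIncl x) := by
  have h : toBal₃Right C.rES (C.lES C.ES) C.rES (C.lES T.CoForms) (x ⊗ₜ[k] y) =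
    bal₃RightEquiv C.rES (C.lES C.ES) C.rES (C.lES T.CoForms) (C.sourceMulLeft T.CoForms)
      (fun _ _ _ => rfl) (BalTensor.mk _ _ (x ⊗ₜ[k] y)) := rfl
  rw [h, coEmb₃, LinearMap.comp_apply, LinearEquiv.coe_coe, LinearEquiv.symm_apply_apply, emb_mk]

theorem coEmb₃_left (y : C.ESTensor C.ES) (η : T.CoForms) :
    T.coEmb₃ (toBal₃Left C.rES (C.lES C.ES) C.rES (C.lES T.CoForms) (y ⊗ₜ[k] η)) =
      ((T.tens.lm.flip (T.coVal η)).lTensor A).lTensor A (embES C y) := by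
  obtain ⟨z, rfl⟩ := BalTensor.mk_surjective _ _ y
  induction z with
  | zero => simp
  | add x y hx hy => simp only [map_add, TensorProduct.add_tmul, hx, hy]
  | tmul x x' =>
    rw [toBal₃Left_tmul, ← toBal₃Right_tmul, coEmb₃_right]
    have h : embES C (BalTensor.mk C.rES (C.lES C.ES) (x ⊗ₜ[k] x')) =
      ((self C).tens.lm.flip (C.esIncl x')).lTensor A (C.esIncl x) := rfl
    have h' : T.coEmb (BalTensor.mk C.rES (C.lES T.CoForms) (x' ⊗ₜ[k] η)) =
      (T.tens.lm.flip (T.coVal η)).lTensor A (C.esIncl x') := rfl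
    rw [h, h']
    generalize C.esIncl x = z
    generalize C.esIncl x' = z'
    induction z with
    | zero => simp
    | add x y hx hy => simp only [map_add, hx, hy]
    | tmul p p' =>
      induction z' with
      | zero => simp
      | add x y hx hy =>
        simp only [map_add, LinearMap.lTensor_add, LinearMap.add_apply, hx, hy]
      | tmul q q' => simp [tens_lm_tmul]

/-- Embedded in A ⊗ A ⊗ A ⊗ L, both sides insert two units: a ⊗ l ↦ a ⊗ 1 ⊗ 1 ⊗ l. -/
theorem coAct_coassoc (hG : C.IsHopfGalois) (hF : C.IsLeftFaithfullyFlat)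
    (η : T.CoForms) (z : C.ES ⊗[k] T.CoForms)
    (hz : C.esMk T.CoForms z = T.coAct hG hF η) :
    toBal₃Left C.rES (C.lES C.ES) C.rES (C.lES T.CoForms) ((C.Δ hG).rTensor T.CoForms z) =
      toBal₃Right C.rES (C.lES C.ES) C.rES (C.lES T.CoForms)
        ((T.coAct hG hF).lTensor C.ES z) := by
  apply T.coEmb₃_injective hG hF
  have h₁ : ∀ z, T.coEmb₃ (toBal₃Left C.rES (C.lES C.ES) C.rES (C.lES T.CoForms)
      ((C.Δ hG).rTensor T.CoForms z)) = ins k A (A ⊗[k] L) (T.coEmb (C.esMk T.CoForms z)) := by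
    intro z
    induction z with
    | zero => simp
    | add x y hx hy => simp only [map_add, hx, hy]
    | tmul x η =>
      rw [LinearMap.rTensor_tmul, coEmb₃_left, embES_comul hG hF, coEmb_mk_tmul]
      generalize C.esIncl x = z
      induction z with
      | zero => simp
      | add x y hx hy => simp only [map_add, hx, hy]
      | tmul p p' => rfl
  have h₂ : ∀ z, T.coEmb₃ (toBal₃Right C.rES (C.lES C.ES) C.rES (C.lES T.CoForms)
      ((T.coAct hG hF).lTensor C.ES z)) =
        (ins k A L).lTensor A (T.coEmb (C.esMk T.CoForms z)) := by
    intro z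
    induction z with
    | zero => simp
    | add x y hx hy => simp only [map_add, hx, hy]
    | tmul x η =>
      rw [LinearMap.lTensor_tmul, coEmb₃_right, coEmb_coAct, coEmb_mk_tmul]
      generalize C.esIncl x = z
      induction z with
      | zero => simp
      | add x y hx hy => simp only [map_add, hx, hy]
      | tmul p p' => simp [ins_lm]
  rw [h₁, h₂, hz, coEmb_coAct]
  generalize T.coVal η = m
  induction m with
  | zero => simp
  | add x y hx hy => simp only [map_add, hx, hy]
  | tmul p p' => rfl

/-- The map `x ⊗ x' ↦ x ⊗ f(x')` from the bialgebroid to `(A ⊗ L)^{co H}`, for a colinear map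
`f`. -/
noncomputable def coMap (f : A →ₗ[k] L) (hf : ∀ a, T.δ (f a) = f.rTensor H (C.ρ a)) :
    C.ES →ₗ[k] T.CoForms :=
  (f.lTensor A ∘ₗ C.esIncl).codRestrict T.tens.coinv fun x =>
    (self C).lTensor_mem_coinv T f hf (esIncl_mem x)

theorem coVal_coMap (f : A →ₗ[k] L) (hf : ∀ a, T.δ (f a) = f.rTensor H (C.ρ a)) (x : C.ES) :
    T.coVal (T.coMap f hf x) = f.lTensor A (C.esIncl x) := rfl

theorem coMap_source_mul (f : A →ₗ[k] L) (hf : ∀ a, T.δ (f a) = f.rTensor H (C.ρ a))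
    (b : C.coinv) (x : C.ES) : T.coMap f hf (C.source b * x) = C.source b • T.coMap f hf x := by
  apply T.coVal_injective
  rw [coVal_smul, coVal_coMap, coVal_coMap, lr_source, esIncl_source_mul]
  generalize C.esIncl x = z
  induction z with
  | zero => simp
  | add x y hx hy => simp only [map_add, hx, hy]
  | tmul p p' => rfl

theorem coMap_mul_source (f : A →ₗ[k] L) (hf : ∀ a, T.δ (f a) = f.rTensor H (C.ρ a))
    (b : C.coinv) (x : C.ES) :
    T.coMap f hf (x * C.source b) = op (C.source b) • T.coMap f hf x := by
  apply T.coVal_injective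
  rw [coVal_op_smul, coVal_coMap, coVal_coMap, esIncl_source, esIncl_mul_source]
  generalize C.esIncl x = z
  induction z with
  | zero => simp
  | add x y hx hy => simp only [map_add, hx, hy]
  | tmul p p' => simp [rr_tmul, T.lm_one]

theorem coEmb_map_coMap (f : A →ₗ[k] L) (hf : ∀ a, T.δ (f a) = f.rTensor H (C.ρ a))
    (h : ∀ b x, (LinearMap.id : C.ES →ₗ[k] C.ES) (C.rES b x) = C.rES b (LinearMap.id x))
    (h' : ∀ b x, T.coMap f hf (C.lES C.ES b x) = C.lES T.CoForms b (T.coMap f hf x))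
    (y : C.ESTensor C.ES) :
    T.coEmb (BalTensor.map LinearMap.id (T.coMap f hf) h h' y) =
      (f.lTensor A).lTensor A (embES C y) := by
  refine LinearMap.congr_fun (f := T.coEmb ∘ₗ BalTensor.map LinearMap.id (T.coMap f hf) h h')
    (g := (f.lTensor A).lTensor A ∘ₗ embES C) (BalTensor.hom_ext fun x x' => ?_) y
  have e₁ : embES C (BalTensor.mk C.rES (C.lES C.ES) (x ⊗ₜ[k] x')) =
    ((self C).tens.lm.flip (C.esIncl x')).lTensor A (C.esIncl x) := rfl
  have e₂ : T.coEmb (BalTensor.map LinearMap.id (T.coMap f hf) h h'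
      (BalTensor.mk C.rES (C.lES C.ES) (x ⊗ₜ[k] x'))) =
    (T.tens.lm.flip (f.lTensor A (C.esIncl x'))).lTensor A (C.esIncl x) := rfl
  rw [LinearMap.comp_apply, LinearMap.comp_apply, e₁, e₂]
  generalize C.esIncl x = z
  generalize C.esIncl x' = z'
  induction z with
  | zero => simp
  | add x y hx hy => simp only [map_add, hx, hy]
  | tmul p p' =>
    induction z' with
    | zero => simp
    | add x y hx hy =>
      simp only [map_add, LinearMap.lTensor_add, LinearMap.add_apply, hx, hy]
    | tmul q q' => rfl

theorem coAct_coMap (hG : C.IsHopfGalois) (hF : C.IsLeftFaithfullyFlat)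
    (f : A →ₗ[k] L) (hf : ∀ a, T.δ (f a) = f.rTensor H (C.ρ a))
    (h : ∀ b x, (LinearMap.id : C.ES →ₗ[k] C.ES) (C.rES b x) = C.rES b (LinearMap.id x))
    (h' : ∀ b x, T.coMap f hf (C.lES C.ES b x) = C.lES T.CoForms b (T.coMap f hf x))
    (x : C.ES) : T.coAct hG hF (T.coMap f hf x) =
      BalTensor.map LinearMap.id (T.coMap f hf) h h' (C.Δ hG x) := by
  apply (T.coEmb_injective_range hG hF).1
  rw [coEmb_coAct, coEmb_map_coMap, embES_comul hG hF, coVal_coMap]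
  generalize C.esIncl x = z
  induction z with
  | zero => simp
  | add x y hx hy => simp only [map_add, hx, hy]
  | tmul p p' => rfl

end CoForms

end HopfBimodule

end ESCalculus.RightComoduleAlgebra

namespace ESCalculus.RightComoduleAlgebra

variable {k : Type u} {H : Type v} {A : Type w} [Field k] [Ring H] [HopfAlgebra k H]
  [Ring A] [Algebra k A] {C : RightComoduleAlgebra k H A}

namespace HopfBimodule

/-! ### The left covariant calculus induced by a right covariant calculus. -/

section Differential

variable {L : Type w} [AddCommGroup L] [Module k L] (T : C.HopfBimodule L)

/-- The map `a ⊗ a' ↦ d(a) a'`. -/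
noncomputable def dMul (d : A →ₗ[k] L) : A ⊗[k] A →ₗ[k] L := TensorProduct.lift (T.rm.flip ∘ₗ d)

theorem dMul_tmul (d : A →ₗ[k] L) (a a' : A) : T.dMul d (a ⊗ₜ[k] a') = T.rm a' (d a) := rfl

/-- Links the generators p(q ⊗ 1) of (A ⊗ A ⊗ A)^{co H} with the forms p dq; spanning statements
about the former carry over along the map `dMul`. -/
theorem lTensor_dMul_lr (d : A →ₗ[k] L) (p q : A ⊗[k] A) :
    (T.dMul d).lTensor A ((self C).tens.tens.lr p (insOne k A q)) =
      T.tens.lr p (d.lTensor A q) := by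
  induction p with
  | zero => simp
  | add x y hx hy => simp only [map_add, LinearMap.add_apply, hx, hy]
  | tmul p p' =>
    induction q with
    | zero => simp
    | add x y hx hy => simp only [map_add, hx, hy]
    | tmul q q' =>
      rw [lr_insOne_tmul]
      rfl

theorem lTensor_dMul_rm (d : A →ₗ[k] L) (a : A) (z : A ⊗[k] (A ⊗[k] A)) :
    (T.dMul d).lTensor A ((self C).tens.tens.rm a z) = T.tens.rm a ((T.dMul d).lTensor A z) := by
  induction z with
  | zero => simp
  | add x y hx hy => simp only [map_add, hx, hy]
  | tmul p z =>
    induction z with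
    | zero => simp
    | add x y hx hy => simp only [map_add, TensorProduct.tmul_add, hx, hy]
    | tmul q q' =>
      change p ⊗ₜ[k] T.rm (q' * a) (d q) = p ⊗ₜ[k] T.rm a (T.rm q' (d q))
      rw [T.rm_mul]

end Differential

end HopfBimodule

open HopfBimodule

namespace RightCovariantCalculus

variable (Y : C.RightCovariantCalculus)

/-- The bimodule of one-forms of a right covariant calculus. -/
noncomputable def hopf : C.HopfBimodule Y.Ω where
  lm := lact k A Y.Ω
  rm := ract k A Y.Ω
  δ := Y.coact
  lm_one l := one_smul A l
  lm_mul a a' l := mul_smul a a' l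
  rm_one l := one_smul Aᵐᵒᵖ l
  rm_mul a a' l := mul_smul (op a') (op a) l
  lm_rm a a' l := smul_comm a (op a') l
  counit := Y.counit
  coassoc := Y.coassoc
  δ_lm := Y.coact_left
  δ_rm := Y.coact_right

theorem hopf_rm (a : A) (ω : Y.Ω) : Y.hopf.rm a ω = op a • ω := rfl

theorem d_one : Y.d 1 = 0 := by
  have h := Y.leibniz 1 1
  rw [mul_one, op_one, one_smul, one_smul] at h
  simpa using h

/-- The differential of the induced calculus on the bialgebroid. -/
noncomputable def coD : C.ES →ₗ[k] Y.hopf.CoForms := Y.hopf.coMap Y.d Y.coact_d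

theorem coVal_coD (x : C.ES) : Y.hopf.coVal (Y.coD x) = Y.d.lTensor A (C.esIncl x) := rfl

/-- For x = a ⊗ a' and y = c ⊗ c' the product is ac ⊗ c'a', and d(c'a') = (dc')a' + c' da'. The
first summand is the outer action of x on dy, the second the inner action of y on dx. -/
theorem coD_leibniz (x y : C.ES) : Y.coD (x * y) = op y • Y.coD x + x • Y.coD y := by
  apply Y.hopf.coVal_injective
  rw [map_add, coVal_op_smul, coVal_smul, coVal_coD, coVal_coD, coVal_coD, esIncl_mul]
  generalize C.esIncl x = z
  generalize C.esIncl y = z'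
  induction z with
  | zero => simp
  | add x y hx hy =>
    simp only [map_add, LinearMap.add_apply, hx, hy]
    abel
  | tmul a a' =>
    induction z' with
    | zero => simp
    | add x y hx hy =>
      simp only [map_add, LinearMap.add_apply, hx, hy]
      abel
    | tmul c c' =>
      simp only [TensorProduct.map₂_apply_tmul, TensorProduct.map_tmul, LinearMap.mul_apply', LinearMap.flip_apply,
        LinearMap.lTensor_tmul, Y.leibniz, rr_tmul, lr_tmul, tens_lm_tmul, tens_rm_tmul,
        TensorProduct.tmul_add]
      rw [add_comm]
      rfl

/-- By the Leibniz rule a da' = d(aa') - (da)a', so coefficients may as well stand on the right. -/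
theorem spanA_range_dMul : LinearMap.range (Y.hopf.dMul Y.d) = ⊤ := by
  rw [eq_top_iff, ← Y.span_d, Submodule.span_le]
  rintro _ ⟨a, a', rfl⟩
  refine ⟨(a * a') ⊗ₜ[k] 1 - a ⊗ₜ[k] a', ?_⟩
  rw [map_sub, dMul_tmul, dMul_tmul, Y.leibniz, Y.hopf.rm_one, hopf_rm]
  abel

/-- By descent it suffices that the forms p dq generate A ⊗ Ω under right multiplication by A. They
are the images of the elements p(q ⊗ 1) under the surjection A ⊗ A ⊗ A → A ⊗ Ω, and those elements
span the coinvariants, which generate A ⊗ A ⊗ A. -/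
theorem coD_span (hS : Function.Bijective (HopfAlgebra.antipode k (A := H)))
    (hG : C.IsHopfGalois) (hF : C.IsLeftFaithfullyFlat) :
    Submodule.span k {ω | ∃ x y : C.ES, ω = x • Y.coD y} = ⊤ := by
  set W := Submodule.span k {ω | ∃ x y : C.ES, ω = x • Y.coD y} with hW
  have h₁ : ∀ y, (Y.hopf.dMul Y.d).lTensor A (sourceGalois C y) ∈ W.map Y.hopf.coVal := by
    intro y
    obtain ⟨z, rfl⟩ := BalTensor.mk_surjective _ _ y
    induction z with
    | zero => simp
    | add x y hx hy => simp only [map_add]; exact add_mem hx hy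
    | tmul q p =>
      rw [sourceGalois_mk, lTensor_dMul_lr]
      exact ⟨p • Y.coD q, Submodule.subset_span ⟨p, q, rfl⟩, rfl⟩
  have h₂ : Y.hopf.tens.spanA (W.map Y.hopf.coVal) = ⊤ := by
    have h : ∀ z, (Y.hopf.dMul Y.d).lTensor A z ∈ Y.hopf.tens.spanA (W.map Y.hopf.coVal) := by
      intro z
      have hz : z ∈ (self C).tens.tens.spanA (self C).tens.tens.coinv := by
        rw [spanA_coinv _ hG hF]; trivial
      rw [← (sourceGalois_injective_range hS hG hF).2] at hz
      refine Submodule.span_induction ?_ ?_ ?_ ?_ hz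
      · rintro _ ⟨a, _, ⟨y, rfl⟩, rfl⟩
        rw [lTensor_dMul_rm]
        exact Y.hopf.tens.rm_mem_spanA _ a (Y.hopf.tens.le_spanA _ (h₁ y))
      · simp
      · intro x y _ _ hx hy
        rw [map_add]; exact add_mem hx hy
      · intro t x _ hx
        rw [map_smul]; exact Submodule.smul_mem _ t hx
    rw [eq_top_iff]
    intro m _
    obtain ⟨z, rfl⟩ := LinearMap.lTensor_surjective A
      (LinearMap.range_eq_top.1 Y.spanA_range_dMul) m
    exact h z
  have h₃ : W.map Y.hopf.coVal = Y.hopf.tens.coinv := by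
    refine Y.hopf.tens.eq_coinv_of_spanA_eq_top hG hF _ ?_ ?_ h₂
    · rintro _ ⟨η, _, rfl⟩
      exact η.2
    · rintro b _ ⟨η, hη, rfl⟩
      -- Right multiplication by b is the left action of t(b), and W is stable under the left action
      -- of ℋ.
      refine ⟨C.target b • η, ?_, ?_⟩
      · refine Submodule.span_induction (p := fun η _ => C.target b • η ∈ W) ?_ ?_ ?_ ?_ hη
        · rintro _ ⟨x, y, rfl⟩
          exact Submodule.subset_span ⟨C.target b * x, y, smul_smul _ _ _⟩
        · simp
        · intro x y _ _ hx hy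
          rw [smul_add]; exact add_mem hx hy
        · intro t x _ hx
          rw [smul_comm]; exact Submodule.smul_mem _ t hx
      · rw [coVal_smul, esIncl_target, lr_tmul, Y.hopf.tens.lm_one]
  rw [eq_top_iff]
  intro η _
  obtain ⟨ξ, hξ, h⟩ : Y.hopf.coVal η ∈ W.map Y.hopf.coVal := h₃ ▸ η.2
  exact Y.hopf.coVal_injective h ▸ hξ

/-- The left covariant calculus on the bialgebroid that is induced by a right covariant calculus
on `A`. -/
noncomputable def leftCalculus (hS : Function.Bijective (HopfAlgebra.antipode k (A := H)))
    (hG : C.IsHopfGalois) (hF : C.IsLeftFaithfullyFlat) : C.LeftCovariantCalculus hG where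
  Ω := Y.hopf.CoForms
  d := Y.coD
  d_source_mul := Y.hopf.coMap_source_mul Y.d Y.coact_d
  d_mul_source := Y.hopf.coMap_mul_source Y.d Y.coact_d
  leibniz := Y.coD_leibniz
  span_d := Y.coD_span hS hG hF
  coact := Y.hopf.coAct hG hF
  coact_source := Y.hopf.coAct_source hG hF
  counit η := by
    rw [contract_coAct, source_one, op_one, one_smul]
  coassoc := Y.hopf.coAct_coassoc hG hF
  induced_right := Y.hopf.contract_coAct hG hF
  coact_left := Y.hopf.coAct_left hG hF
  coact_right := Y.hopf.coAct_right hG hF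
  coact_d x := Y.hopf.coAct_coMap hG hF Y.d Y.coact_d _ _ x

end RightCovariantCalculus

end ESCalculus.RightComoduleAlgebra

namespace ESCalculus.RightComoduleAlgebra

variable {k : Type u} {H : Type v} {A : Type w} [Field k] [Ring H] [HopfAlgebra k H]
  [Ring A] [Algebra k A] {C : RightComoduleAlgebra k H A}

/-! ### Quotients of Hopf bimodules, and calculi built from them. -/

namespace HopfBimodule

theorem map₂_rTensor {L L' : Type*} [AddCommGroup L] [Module k L] [AddCommGroup L'] [Module k L']
    (f : L →ₗ[k] L') (m : A →ₗ[k] Module.End k L) (m' : A →ₗ[k] Module.End k L')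
    (μ : H →ₗ[k] Module.End k H) (hf : ∀ a l, f (m a l) = m' a (f l)) (X : A ⊗[k] H)
    (Z : L ⊗[k] H) :
    f.rTensor H (TensorProduct.map₂ m μ X Z) = TensorProduct.map₂ m' μ X (f.rTensor H Z) := by
  induction X with
  | zero => simp
  | add x y hx hy => simp only [map_add, LinearMap.add_apply, hx, hy]
  | tmul a h =>
    induction Z with
    | zero => simp
    | add x y hx hy => simp only [map_add, hx, hy]
    | tmul l g => simp [hf]

section Quotient

variable {L : Type*} [AddCommGroup L] [Module k L] (T : C.HopfBimodule L)

/-- The quotient of a Hopf bimodule by a subspace that is stable under all the operations. -/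
noncomputable def quot (J : Submodule k L) (hl : ∀ a, ∀ x ∈ J, T.lm a x ∈ J)
    (hr : ∀ a, ∀ x ∈ J, T.rm a x ∈ J) (hδ : ∀ x ∈ J, J.mkQ.rTensor H (T.δ x) = 0) :
    C.HopfBimodule (L ⧸ J) where
  lm :=
    { toFun := fun a => J.mapQ J (T.lm a) (hl a)
      map_add' := fun a b => Submodule.linearMap_qext _ (LinearMap.ext fun l => by simp)
      map_smul' := fun a b => Submodule.linearMap_qext _ (LinearMap.ext fun l => by simp) }
  rm :=
    { toFun := fun a => J.mapQ J (T.rm a) (hr a)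
      map_add' := fun a b => Submodule.linearMap_qext _ (LinearMap.ext fun l => by simp)
      map_smul' := fun a b => Submodule.linearMap_qext _ (LinearMap.ext fun l => by simp) }
  δ := J.liftQ (J.mkQ.rTensor H ∘ₗ T.δ) hδ
  lm_one l := by
    obtain ⟨l, rfl⟩ := J.mkQ_surjective l
    exact congrArg J.mkQ (T.lm_one l)
  lm_mul a a' l := by
    obtain ⟨l, rfl⟩ := J.mkQ_surjective l
    exact congrArg J.mkQ (T.lm_mul a a' l)
  rm_one l := by
    obtain ⟨l, rfl⟩ := J.mkQ_surjective l
    exact congrArg J.mkQ (T.rm_one l)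
  rm_mul a a' l := by
    obtain ⟨l, rfl⟩ := J.mkQ_surjective l
    exact congrArg J.mkQ (T.rm_mul a a' l)
  lm_rm a a' l := by
    obtain ⟨l, rfl⟩ := J.mkQ_surjective l
    exact congrArg J.mkQ (T.lm_rm a a' l)
  counit l := by
    obtain ⟨l, rfl⟩ := J.mkQ_surjective l
    refine Eq.trans ?_ (congrArg J.mkQ (T.counit l))
    change TensorProduct.rid k _ ((Coalgebra.counit (R := k) (A := H)).lTensor _
      (J.mkQ.rTensor H (T.δ l))) = _
    generalize T.δ l = Z
    induction Z with
    | zero => simp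
    | add x y hx hy => simp only [map_add, hx, hy]
    | tmul l g => simp
  coassoc l := by
    obtain ⟨l, rfl⟩ := J.mkQ_surjective l
    change TensorProduct.assoc k _ H H ((J.liftQ (J.mkQ.rTensor H ∘ₗ T.δ) hδ).rTensor H
      (J.mkQ.rTensor H (T.δ l))) = (Coalgebra.comul (R := k) (A := H)).lTensor _
      (J.mkQ.rTensor H (T.δ l))
    have h₁ : ∀ Z : L ⊗[k] H, TensorProduct.assoc k _ H H
        ((J.liftQ (J.mkQ.rTensor H ∘ₗ T.δ) hδ).rTensor H (J.mkQ.rTensor H Z)) =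
        J.mkQ.rTensor (H ⊗[k] H) (TensorProduct.assoc k _ H H (T.δ.rTensor H Z)) := by
      intro Z
      induction Z with
      | zero => simp
      | add x y hx hy => simp only [map_add, hx, hy]
      | tmul l g =>
        change TensorProduct.assoc k _ H H ((J.mkQ.rTensor H (T.δ l)) ⊗ₜ[k] g) =
          J.mkQ.rTensor (H ⊗[k] H) (TensorProduct.assoc k _ H H (T.δ l ⊗ₜ[k] g))
        generalize T.δ l = Z
        induction Z with
        | zero => simp
        | add x y hx hy => simp only [map_add, TensorProduct.add_tmul, hx, hy]
        | tmul l g => rfl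
    have h₂ : ∀ Z : L ⊗[k] H, (Coalgebra.comul (R := k) (A := H)).lTensor _ (J.mkQ.rTensor H Z) =
        J.mkQ.rTensor (H ⊗[k] H) ((Coalgebra.comul (R := k) (A := H)).lTensor _ Z) := by
      intro Z
      induction Z with
      | zero => simp
      | add x y hx hy => simp only [map_add, hx, hy]
      | tmul l g => rfl
    rw [h₁, h₂, T.coassoc]
  δ_lm a l := by
    obtain ⟨l, rfl⟩ := J.mkQ_surjective l
    change J.mkQ.rTensor H (T.δ (T.lm a l)) = TensorProduct.map₂ _ _ _ (J.mkQ.rTensor H (T.δ l))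
    rw [T.δ_lm]
    exact map₂_rTensor _ _ _ _ (fun _ _ => rfl) _ _
  δ_rm a l := by
    obtain ⟨l, rfl⟩ := J.mkQ_surjective l
    change J.mkQ.rTensor H (T.δ (T.rm a l)) = TensorProduct.map₂ _ _ _ (J.mkQ.rTensor H (T.δ l))
    rw [T.δ_rm]
    exact map₂_rTensor _ _ _ _ (fun _ _ => rfl) _ _

/-- The left module structure of a Hopf bimodule. -/
@[reducible] noncomputable def leftModule : Module A L where
  smul a l := T.lm a l
  one_smul := T.lm_one
  mul_smul := T.lm_mul
  smul_zero a := map_zero _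
  smul_add a := map_add _
  add_smul a b l := by
    change T.lm (a + b) l = T.lm a l + T.lm b l
    rw [map_add, LinearMap.add_apply]
  zero_smul l := by
    change T.lm 0 l = 0
    rw [map_zero, LinearMap.zero_apply]

/-- The right module structure of a Hopf bimodule. -/
@[reducible] noncomputable def rightModule : Module Aᵐᵒᵖ L where
  smul a l := T.rm a.unop l
  one_smul := T.rm_one
  mul_smul a b l := T.rm_mul b.unop a.unop l
  smul_zero a := map_zero _
  smul_add a := map_add _
  add_smul a b l := by
    change T.rm (a + b).unop l = T.rm a.unop l + T.rm b.unop l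
    rw [unop_add, map_add, LinearMap.add_apply]
  zero_smul l := by
    change T.rm (0 : Aᵐᵒᵖ).unop l = 0
    rw [unop_zero, map_zero, LinearMap.zero_apply]

end Quotient

/-- A right covariant calculus from a Hopf bimodule with a differential. -/
noncomputable def calculus {L : Type w} [AddCommGroup L] [Module k L] (T : C.HopfBimodule L)
    (d : A →ₗ[k] L) (leibniz : ∀ a a', d (a * a') = T.rm a' (d a) + T.lm a (d a'))
    (span_d : Submodule.span k {ω | ∃ a a' : A, ω = T.lm a (d a')} = ⊤)
    (coact_d : ∀ a, T.δ (d a) = d.rTensor H (C.ρ a)) : C.RightCovariantCalculus :=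
  letI := T.leftModule
  letI := T.rightModule
  haveI : IsScalarTower k A L := ⟨fun t a l => by
    change T.lm (t • a) l = t • T.lm a l
    rw [map_smul, LinearMap.smul_apply]⟩
  haveI : IsScalarTower k Aᵐᵒᵖ L := ⟨fun t a l => by
    change T.rm (t • a).unop l = t • T.rm a.unop l
    rw [unop_smul, map_smul, LinearMap.smul_apply]⟩
  haveI : SMulCommClass A Aᵐᵒᵖ L := ⟨fun a b l => T.lm_rm a b.unop l⟩
  { Ω := L
    d := d
    leibniz := leibniz
    span_d := span_d
    coact := T.δ
    counit := T.counit
    coassoc := T.coassoc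
    coact_left := T.δ_lm
    coact_right := T.δ_rm
    coact_d := coact_d }

end HopfBimodule

end ESCalculus.RightComoduleAlgebra

namespace ESCalculus.RightComoduleAlgebra

variable {k : Type u} {H : Type v} {A : Type w} [Field k] [Ring H] [HopfAlgebra k H]
  [Ring A] [Algebra k A] {C : RightComoduleAlgebra k H A}

open HopfBimodule

/-! ### The universal calculus on A and its covariant quotients. -/

section Universal

theorem mul'_leftMul (c : A) (z : A ⊗[k] A) :
    LinearMap.mul' k A (leftMul c z) = c * LinearMap.mul' k A z := by
  induction z with
  | zero => simp
  | add x y hx hy => simp only [map_add, mul_add, hx, hy]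
  | tmul a a' => simp [leftMul, mul_assoc]

theorem mul'_rightMul (c : A) (z : A ⊗[k] A) :
    LinearMap.mul' k A (rightMul c z) = LinearMap.mul' k A z * c := by
  induction z with
  | zero => simp
  | add x y hx hy => simp only [map_add, add_mul, hx, hy]
  | tmul a a' => simp [rightMul, mul_assoc]

theorem mem_range_rTensor_ker {V V' : Type w} [AddCommGroup V] [Module k V] [AddCommGroup V']
    [Module k V'] (g : V →ₗ[k] V') {z : V ⊗[k] H} (hz : g.rTensor H z = 0) :
    z ∈ LinearMap.range ((LinearMap.ker g).subtype.rTensor H) :=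
  (Module.Flat.rTensor_exact H (LinearMap.exact_subtype_ker_map g) z).1 hz

/-- The product A ⊗ A → A is colinear, so by flatness of H its kernel is a subcomodule. -/
theorem diag_mem_range_univ {z : A ⊗[k] A} (hz : z ∈ univ k A) :
    C.diag z ∈ LinearMap.range ((univ k A).subtype.rTensor H) := by
  refine mem_range_rTensor_ker (LinearMap.mul' k A) ?_
  rw [mul'_diag, show LinearMap.mul' k A z = 0 from hz, map_zero]

variable (C) in
/-- The Hopf bimodule of universal one-forms. -/
noncomputable def univHopf : C.HopfBimodule (univ k A) :=
  (self C).tens.sub (univ k A)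
    (fun a x hx => by
      change LinearMap.mul' k A (leftMul a x) = 0
      rw [mul'_leftMul, show LinearMap.mul' k A x = 0 from hx, mul_zero])
    (fun a x hx => by
      change LinearMap.mul' k A (rightMul a x) = 0
      rw [mul'_rightMul, show LinearMap.mul' k A x = 0 from hx, zero_mul])
    fun _ hx => diag_mem_range_univ hx

theorem val_univHopf_lm (a : A) (x : univ k A) :
    ((univHopf C).lm a x : A ⊗[k] A) = leftMul a (x : A ⊗[k] A) := rfl

theorem val_univHopf_rm (a : A) (x : univ k A) :
    ((univHopf C).rm a x : A ⊗[k] A) = rightMul a (x : A ⊗[k] A) := rfl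

theorem rTensor_univHopf_δ (x : univ k A) :
    (univ k A).subtype.rTensor H ((univHopf C).δ x) = C.diag x :=
  (self C).tens.rTensor_subδ _ (fun _ hx => diag_mem_range_univ hx) x

theorem rTensor_subtype_univ_injective :
    Function.Injective ((univ k A).subtype.rTensor H) :=
  Module.Flat.rTensor_preserves_injective_linearMap _ (univ k A).injective_subtype

variable (k A) in
/-- The projection `a ⊗ a' ↦ a ⊗ a' - a a' ⊗ 1` onto the universal calculus. -/
noncomputable def projUniv : A ⊗[k] A →ₗ[k] univ k A :=
  (LinearMap.id - (TensorProduct.mk k A A).flip 1 ∘ₗ LinearMap.mul' k A).codRestrict _ fun z => by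
    change LinearMap.mul' k A (z - LinearMap.mul' k A z ⊗ₜ[k] 1) = 0
    rw [map_sub, LinearMap.mul'_apply, mul_one, sub_self]

theorem val_projUniv (z : A ⊗[k] A) :
    (projUniv k A z : A ⊗[k] A) = z - LinearMap.mul' k A z ⊗ₜ[k] 1 := rfl

theorem projUniv_univ (x : univ k A) : projUniv k A x = x :=
  Subtype.ext (by
    rw [val_projUniv, show LinearMap.mul' k A (x : A ⊗[k] A) = 0 from x.2, TensorProduct.zero_tmul,
      sub_zero])

variable (k A) in
/-- The universal differential `a ↦ 1 ⊗ a - a ⊗ 1`. -/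
noncomputable def dUniv : A →ₗ[k] univ k A := projUniv k A ∘ₗ TensorProduct.mk k A A 1

theorem val_dUniv (a : A) : (dUniv k A a : A ⊗[k] A) = 1 ⊗ₜ[k] a - a ⊗ₜ[k] 1 := by
  change 1 ⊗ₜ[k] a - (1 * a) ⊗ₜ[k] 1 = _
  rw [one_mul]

theorem projUniv_tmul (a a' : A) :
    projUniv k A (a ⊗ₜ[k] a') = (univHopf C).lm a (dUniv k A a') := by
  apply Subtype.ext
  rw [val_univHopf_lm, val_dUniv, val_projUniv]
  simp [leftMul]

theorem dUniv_leibniz (a a' : A) :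
    dUniv k A (a * a') = (univHopf C).rm a' (dUniv k A a) + (univHopf C).lm a (dUniv k A a') := by
  apply Subtype.ext
  rw [Submodule.coe_add, val_univHopf_lm, val_univHopf_rm, val_dUniv, val_dUniv, val_dUniv]
  simp [leftMul, rightMul]

theorem univHopf_δ_dUniv (a : A) :
    (univHopf C).δ (dUniv k A a) = (dUniv k A).rTensor H (C.ρ a) := by
  apply rTensor_subtype_univ_injective
  rw [rTensor_univHopf_δ, val_dUniv, map_sub, diag_tmul, diag_tmul, map_one,
    Algebra.TensorProduct.one_def]
  generalize C.ρ a = X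
  induction X with
  | zero => simp
  | add x y hx hy =>
    simp only [map_add, TensorProduct.add_tmul, TensorProduct.tmul_add, ← hx, ← hy]
    abel
  | tmul a h =>
    rw [LinearMap.rTensor_tmul, LinearMap.rTensor_tmul, Submodule.subtype_apply, val_dUniv]
    simp [collect, TensorProduct.sub_tmul]

variable {J : Submodule k (A ⊗[k] A)}

/-- The Hopf bimodule `Ω^u_A / J`. -/
noncomputable def IsCovariantSub.quotHopf (hJ : C.IsCovariantSub J) :
    C.HopfBimodule (univ k A ⧸ J.submoduleOf (univ k A)) :=
  (univHopf C).quot _ (fun a x hx => hJ.left_mem a x hx) (fun a x hx => hJ.right_mem a x hx)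
    fun x hx => by
      obtain ⟨z, hz⟩ := hJ.diag_mem x hx
      have h : (univHopf C).δ x = (Submodule.inclusion hJ.le_univ).rTensor H z := by
        apply rTensor_subtype_univ_injective
        rw [rTensor_univHopf_δ, ← hz, ← LinearMap.rTensor_comp_apply]
        rfl
      rw [h, ← LinearMap.rTensor_comp_apply]
      have h0 : (J.submoduleOf (univ k A)).mkQ ∘ₗ Submodule.inclusion hJ.le_univ = 0 :=
        LinearMap.ext fun y => (Submodule.Quotient.mk_eq_zero _).2 y.2
      rw [h0, LinearMap.rTensor_zero, LinearMap.zero_apply]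

/-- The right covariant calculus `Ω^u_A / J`. -/
noncomputable def IsCovariantSub.calculus (hJ : C.IsCovariantSub J) : C.RightCovariantCalculus :=
  hJ.quotHopf.calculus ((J.submoduleOf (univ k A)).mkQ ∘ₗ dUniv k A)
    (fun a a' => by
      rw [LinearMap.comp_apply, dUniv_leibniz (C := C), map_add]
      rfl)
    (by
      rw [eq_top_iff]
      intro ω _
      obtain ⟨x, rfl⟩ := (J.submoduleOf (univ k A)).mkQ_surjective ω
      rw [← projUniv_univ x]
      generalize (x : A ⊗[k] A) = z
      induction z with
      | zero => simp
      | add x y hx hy => rw [map_add, map_add]; exact add_mem hx hy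
      | tmul a a' =>
        rw [projUniv_tmul (C := C)]
        exact Submodule.subset_span ⟨a, a', rfl⟩)
    fun a => by
      change (J.submoduleOf (univ k A)).mkQ.rTensor H ((univHopf C).δ (dUniv k A a)) = _
      rw [univHopf_δ_dUniv, ← LinearMap.rTensor_comp_apply]

end Universal

/-! ### Classification of right covariant calculi by their relations. -/

namespace RightCovariantCalculus

variable (Y : C.RightCovariantCalculus)

/-- The map `a ⊗ a' ↦ a d(a')`. -/
noncomputable def mulD : A ⊗[k] A →ₗ[k] Y.Ω := TensorProduct.lift ((lact k A Y.Ω).compl₂ Y.d)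

theorem mulD_tmul (a a' : A) : Y.mulD (a ⊗ₜ[k] a') = a • Y.d a' := rfl

theorem mulD_leftMul (c : A) (z : A ⊗[k] A) : Y.mulD (leftMul c z) = c • Y.mulD z := by
  induction z with
  | zero => simp
  | add x y hx hy => simp only [map_add, smul_add, hx, hy]
  | tmul a a' => exact mul_smul c a _

/-- The Leibniz rule leaves an error term that contains the product of z. It vanishes on Ω^u, and
there a ⊗ a' ↦ a da' is a bimodule map. -/
theorem mulD_rightMul (c : A) (z : A ⊗[k] A) :
    Y.mulD (rightMul c z) = op c • Y.mulD z + LinearMap.mul' k A z • Y.d c := by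
  induction z with
  | zero => simp
  | add x y hx hy => simp only [map_add, smul_add, add_smul, hx, hy]; abel
  | tmul a a' =>
    change a • Y.d (a' * c) = op c • a • Y.d a' + (a * a') • Y.d c
    rw [Y.leibniz, smul_add, smul_comm, mul_smul]

theorem coact_mulD (z : A ⊗[k] A) : Y.coact (Y.mulD z) = Y.mulD.rTensor H (C.diag z) := by
  induction z with
  | zero => simp
  | add x y hx hy => simp only [map_add, hx, hy]
  | tmul a a' =>
    rw [mulD_tmul, Y.coact_left, Y.coact_d, diag_tmul]
    generalize C.ρ a = X
    generalize C.ρ a' = X'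
    induction X with
    | zero => simp
    | add x y hx hy => simp only [map_add, LinearMap.add_apply, TensorProduct.add_tmul, hx, hy]
    | tmul a h =>
      induction X' with
      | zero => simp
      | add x y hx hy => simp only [map_add, TensorProduct.tmul_add, hx, hy]
      | tmul a' h' => rfl

theorem mulD_projUniv (z : A ⊗[k] A) : Y.mulD (projUniv k A z) = Y.mulD z := by
  rw [val_projUniv, map_sub, mulD_tmul, Y.d_one, smul_zero, sub_zero]

theorem mulD_surjective : Function.Surjective Y.mulD := by
  rw [← LinearMap.range_eq_top, eq_top_iff, ← Y.span_d, Submodule.span_le]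
  rintro _ ⟨a, a', rfl⟩
  exact ⟨a ⊗ₜ[k] a', rfl⟩

/-- The quotient map from the universal calculus. -/
noncomputable def univMap : univ k A →ₗ[k] Y.Ω := Y.mulD ∘ₗ (univ k A).subtype

theorem univMap_apply (x : univ k A) : Y.univMap x = Y.mulD x := rfl

theorem univMap_surjective : Function.Surjective Y.univMap := by
  intro ω
  obtain ⟨z, rfl⟩ := Y.mulD_surjective ω
  exact ⟨projUniv k A z, Y.mulD_projUniv z⟩

/-- The kernel of the quotient map from the universal calculus. -/
noncomputable def relations : Submodule k (A ⊗[k] A) := univ k A ⊓ LinearMap.ker Y.mulD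

theorem mem_relations {z : A ⊗[k] A} : z ∈ Y.relations ↔ z ∈ univ k A ∧ Y.mulD z = 0 := Iff.rfl

theorem isCovariantSub_relations : C.IsCovariantSub Y.relations where
  le_univ := inf_le_left
  left_mem c x hx := by
    refine ⟨?_, ?_⟩
    · change LinearMap.mul' k A (leftMul c x) = 0
      rw [mul'_leftMul, show LinearMap.mul' k A x = 0 from hx.1, mul_zero]
    · change Y.mulD (leftMul c x) = 0
      rw [mulD_leftMul, show Y.mulD x = 0 from hx.2, smul_zero]
  right_mem c x hx := by
    refine ⟨?_, ?_⟩
    · change LinearMap.mul' k A (rightMul c x) = 0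
      rw [mul'_rightMul, show LinearMap.mul' k A x = 0 from hx.1, zero_mul]
    · change Y.mulD (rightMul c x) = 0
      rw [mulD_rightMul, show Y.mulD x = 0 from hx.2, show LinearMap.mul' k A x = 0 from hx.1,
        smul_zero, zero_smul, add_zero]
  diag_mem x hx := by
    have h₁ := rTensor_univHopf_δ (C := C) ⟨x, hx.1⟩
    have h₂ : Y.univMap.rTensor H ((univHopf C).δ ⟨x, hx.1⟩) = 0 := by
      change (Y.mulD ∘ₗ (univ k A).subtype).rTensor H _ = 0
      rw [LinearMap.rTensor_comp_apply, h₁, ← coact_mulD, show Y.mulD x = 0 from hx.2, map_zero]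
    obtain ⟨z, hz⟩ := mem_range_rTensor_ker Y.univMap h₂
    let e : LinearMap.ker Y.univMap →ₗ[k] Y.relations :=
      ((univ k A).subtype ∘ₗ (LinearMap.ker Y.univMap).subtype).codRestrict _ fun y =>
        ⟨y.1.2, y.2⟩
    refine ⟨e.rTensor H z, ?_⟩
    rw [← LinearMap.rTensor_comp_apply]
    refine Eq.trans ?_ h₁
    rw [← hz, ← LinearMap.rTensor_comp_apply]
    rfl

/-- Compatibility with the left action and with d leaves no freedom: a d_u a' has to go to a da'.
Consequently J can be read off from the calculus, which gives uniqueness. -/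
theorem QuotIso.toEquiv_mk {J : Submodule k (A ⊗[k] A)} {Y : C.RightCovariantCalculus}
    (f : Y.QuotIso J) (x : univ k A) : f.toEquiv (Submodule.Quotient.mk x) = Y.mulD x := by
  have h : ∀ z : A ⊗[k] A, f.toEquiv (Submodule.Quotient.mk (projUniv k A z)) = Y.mulD z := by
    intro z
    induction z with
    | zero => simp
    | add x y hx hy => rw [map_add, Submodule.Quotient.mk_add, map_add, map_add, hx, hy]
    | tmul a a' =>
      rw [projUniv_tmul (C := C), f.map_left a (dUniv k A a') _ (val_univHopf_lm _ _),
        ← f.map_d a' _ (val_dUniv a')]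
      rfl
  rw [← h, projUniv_univ]

theorem QuotIso.eq_relations {J : Submodule k (A ⊗[k] A)} (hJ : J ≤ univ k A)
    {Y : C.RightCovariantCalculus} (f : Y.QuotIso J) : J = Y.relations := by
  have h : ∀ x : univ k A, (x : A ⊗[k] A) ∈ J ↔ Y.mulD x = 0 := by
    intro x
    rw [← f.toEquiv_mk, f.toEquiv.map_eq_zero_iff, Submodule.Quotient.mk_eq_zero]
    rfl
  ext z
  exact ⟨fun hz => ⟨hJ hz, (h ⟨z, hJ hz⟩).1 hz⟩, fun hz => (h ⟨z, hz.1⟩).2 hz.2⟩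

theorem ker_univMap : LinearMap.ker Y.univMap = Y.relations.submoduleOf (univ k A) := by
  ext x
  exact ⟨fun h => ⟨x.2, h⟩, fun h => h.2⟩

/-- A right covariant calculus is a quotient of the universal calculus. -/
noncomputable def quotIso : Y.QuotIso Y.relations where
  toEquiv := (Submodule.quotEquivOfEq _ _ Y.ker_univMap.symm).trans
    (Y.univMap.quotKerEquivOfSurjective Y.univMap_surjective)
  map_left c x y h := by
    change Y.mulD (y : A ⊗[k] A) = c • Y.mulD (x : A ⊗[k] A)
    rw [h, mulD_leftMul]
  map_right c x y h := by
    change Y.mulD (y : A ⊗[k] A) = op c • Y.mulD (x : A ⊗[k] A)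
    rw [h, mulD_rightMul, show LinearMap.mul' k A (x : A ⊗[k] A) = 0 from x.2, zero_smul, add_zero]
  map_coact x := by
    refine ⟨(univHopf C).δ x, rTensor_univHopf_δ x, ?_⟩
    change Y.coact (Y.mulD (x : A ⊗[k] A)) = Y.univMap.rTensor H ((univHopf C).δ x)
    rw [coact_mulD, univMap, LinearMap.rTensor_comp_apply, rTensor_univHopf_δ]
  map_d a x h := by
    change Y.d a = Y.mulD (x : A ⊗[k] A)
    rw [h, map_sub, mulD_tmul, mulD_tmul, Y.d_one, smul_zero, sub_zero, one_smul]

end RightCovariantCalculus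

theorem IsCovariantSub.relations_calculus {J : Submodule k (A ⊗[k] A)}
    (hJ : C.IsCovariantSub J) : hJ.calculus.relations = J := by
  have h : ∀ z : A ⊗[k] A, hJ.calculus.mulD z = (J.submoduleOf (univ k A)).mkQ (projUniv k A z) := by
    intro z
    induction z with
    | zero => simp only [map_zero]; rfl
    | add x y hx hy => simp only [map_add, hx, hy]; rfl
    | tmul a a' =>
      rw [projUniv_tmul (C := C)]
      rfl
  ext z
  rw [RightCovariantCalculus.mem_relations, h]
  constructor
  · rintro ⟨h₁, h₂⟩
    have h₃ := (Submodule.Quotient.mk_eq_zero _).1 h₂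
    have h₄ : (projUniv k A z : A ⊗[k] A) = z := congrArg Subtype.val (projUniv_univ ⟨z, h₁⟩)
    exact h₄ ▸ h₃
  · intro hz
    refine ⟨hJ.le_univ hz, (Submodule.Quotient.mk_eq_zero _).2 ?_⟩
    have h₄ : (projUniv k A z : A ⊗[k] A) = z :=
      congrArg Subtype.val (projUniv_univ ⟨z, hJ.le_univ hz⟩)
    change (projUniv k A z : A ⊗[k] A) ∈ J
    rw [h₄]
    exact hz

/-- The quotients of the universal calculus by the same subspace are isomorphic. -/
theorem RightCovariantCalculus.nonempty_iso {X Y : C.RightCovariantCalculus}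
    (h : X.relations = Y.relations) : Nonempty (X.Iso Y) := by
  have f := X.quotIso
  have g := Y.quotIso
  rw [← h] at g
  have key : ∀ z : A ⊗[k] A, (f.toEquiv.symm.trans g.toEquiv) (X.mulD z) = Y.mulD z := by
    intro z
    rw [← X.mulD_projUniv, ← Y.mulD_projUniv, ← f.toEquiv_mk, ← g.toEquiv_mk,
      LinearEquiv.trans_apply, LinearEquiv.symm_apply_apply]
  have key' : ∀ ω : X.Ω, ∃ x : univ k A, ω = X.mulD x := fun ω => by
    obtain ⟨x, hx⟩ := X.univMap_surjective ω
    exact ⟨x, hx.symm⟩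
  refine ⟨⟨f.toEquiv.symm.trans g.toEquiv, fun a ω => ?_, fun a ω => ?_, fun a => ?_,
    fun ω => ?_⟩⟩
  · obtain ⟨x, rfl⟩ := key' ω
    rw [← X.mulD_leftMul, key, key, mulD_leftMul]
  · obtain ⟨x, rfl⟩ := key' ω
    have h₀ : LinearMap.mul' k A (x : A ⊗[k] A) = 0 := x.2
    have h₁ := X.mulD_rightMul a x
    have h₂ := Y.mulD_rightMul a x
    rw [h₀, zero_smul, add_zero] at h₁ h₂
    rw [← h₁, key, key, h₂]
  · have h₁ := key (1 ⊗ₜ[k] a)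
    rwa [mulD_tmul, mulD_tmul, one_smul, one_smul] at h₁
  · obtain ⟨x, rfl⟩ := key' ω
    rw [key, coact_mulD, coact_mulD, ← LinearMap.rTensor_comp_apply]
    congr 2
    exact (LinearMap.ext key).symm

/-- Isomorphic calculi are quotients of the universal calculus by the same subspace. -/
theorem RightCovariantCalculus.Iso.relations_eq {X Y : C.RightCovariantCalculus} (f : X.Iso Y) :
    X.relations = Y.relations := by
  have h : ∀ z : A ⊗[k] A, f.toEquiv (X.mulD z) = Y.mulD z := by
    intro z
    induction z with
    | zero => simp
    | add x y hx hy => simp only [map_add, hx, hy]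
    | tmul a a' => rw [mulD_tmul, mulD_tmul, f.map_left, f.map_d]
  ext z
  rw [mem_relations, mem_relations, ← h, f.toEquiv.map_eq_zero_iff]

end ESCalculus.RightComoduleAlgebra

namespace ESCalculus.RightComoduleAlgebra

variable {k : Type u} {H : Type v} {A : Type w} [Field k] [Ring H] [HopfAlgebra k H]
  [Ring A] [Algebra k A] {C : RightComoduleAlgebra k H A}

open HopfBimodule

/-- The map `ES ⊗_B f` for a left `B`-linear map `f`. -/
noncomputable def esTensorMap {M N : Type*} [AddCommGroup M] [Module k M] [Module C.ES M]
    [IsScalarTower k C.ES M] [AddCommGroup N] [Module k N] [Module C.ES N]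
    [IsScalarTower k C.ES N] (f : M →ₗ[k] N)
    (hf : ∀ b m, f (C.lES M b m) = C.lES N b (f m)) : C.ESTensor M →ₗ[k] C.ESTensor N :=
  BalTensor.map LinearMap.id f (fun _ _ => rfl) hf

theorem esTensorMap_mk {M N : Type*} [AddCommGroup M] [Module k M] [Module C.ES M]
    [IsScalarTower k C.ES M] [AddCommGroup N] [Module k N] [Module C.ES N]
    [IsScalarTower k C.ES N] (f : M →ₗ[k] N)
    (hf : ∀ b m, f (C.lES M b m) = C.lES N b (f m)) (z : C.ES ⊗[k] M) :
    esTensorMap f hf (C.esMk M z) = C.esMk N (f.lTensor C.ES z) := rfl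

/-! ### The bimodule (A ⊗ A ⊗ A)^{co H} and its generators. -/

section TripleForms

variable (C) in
/-- The bimodule `(A ⊗ A ⊗ A)^{co H}` over the bialgebroid. -/
abbrev TripleForms : Type w := (self C).tens.CoForms

variable (C) in
/-- The map `x ⊗ x' ↦ x ⊗ x' ⊗ 1`. -/
noncomputable def fst : C.ES →ₗ[k] C.TripleForms :=
  (self C).tens.coMap ((TensorProduct.mk k A A).flip 1) tens_δ_tmul_one

variable (C) in
/-- The map `x ⊗ x' ↦ x ⊗ 1 ⊗ x'`. -/
noncomputable def outer : C.ES →ₗ[k] C.TripleForms :=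
  (self C).tens.coMap (TensorProduct.mk k A A 1) (self C).tens_δ_one_tmul

theorem one_tmul_mem_coinv {z : A ⊗[k] A} (hz : z ∈ C.diagCoinv) :
    TensorProduct.mk k A (A ⊗[k] A) 1 z ∈ (self C).tens.tens.coinv := by
  have h := (self C).tens.map_mem_coinv (self C).tens.tens (TensorProduct.mk k A (A ⊗[k] A) 1)
    (self C).tens.tens_δ_one_tmul (l := z) hz
  exact h

variable (C) in
/-- The map `x ⊗ x' ↦ 1 ⊗ x ⊗ x'`. -/
noncomputable def snd : C.ES →ₗ[k] C.TripleForms :=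
  (TensorProduct.mk k A (A ⊗[k] A) 1 ∘ₗ C.esIncl).codRestrict (self C).tens.tens.coinv fun x =>
    one_tmul_mem_coinv (esIncl_mem x)

theorem coVal_fst (x : C.ES) : (self C).tens.coVal (fst C x) = insOne k A (C.esIncl x) := rfl

theorem coVal_outer (x : C.ES) : (self C).tens.coVal (outer C x) = ins k A A (C.esIncl x) := rfl

theorem coVal_snd (x : C.ES) : (self C).tens.coVal (snd C x) = 1 ⊗ₜ[k] C.esIncl x := rfl

theorem fst_mul (q x : C.ES) : fst C (q * x) = op x • fst C q := by
  apply (self C).tens.coVal_injective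
  rw [coVal_op_smul, coVal_fst, coVal_fst, esIncl_mul]
  generalize C.esIncl x = z
  generalize C.esIncl q = z'
  induction z with
  | zero => simp
  | add x y hx hy => simp only [map_add, LinearMap.add_apply, hx, hy]
  | tmul p p' =>
    induction z' with
    | zero => simp
    | add x y hx hy => simp only [map_add, LinearMap.add_apply, hx, hy]
    | tmul q q' => rfl

theorem smul_outer (p x : C.ES) : p • outer C x = outer C (p * x) := by
  apply (self C).tens.coVal_injective
  rw [coVal_smul, coVal_outer, coVal_outer, esIncl_mul]
  generalize C.esIncl x = z
  generalize C.esIncl p = z'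
  induction z with
  | zero => simp
  | add x y hx hy => simp only [map_add, hx, hy]
  | tmul p p' =>
    induction z' with
    | zero => simp
    | add x y hx hy => simp only [map_add, LinearMap.add_apply, hx, hy]
    | tmul q q' => rfl

/-- Only the generator with q = 1 is involved. Since d1 = 0, these elements vanish in every calculus
and serve as corrections that move an element into the kernel of the product. -/
theorem outer_eq_smul (x : C.ES) : outer C x = x • fst C 1 := by
  apply (self C).tens.coVal_injective
  rw [coVal_smul, coVal_outer, coVal_fst, esIncl_one]
  generalize C.esIncl x = z
  induction z with
  | zero => simp
  | add x y hx hy => simp only [map_add, LinearMap.add_apply, hx, hy]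
  | tmul p p' => rw [lr_insOne_tmul, mul_one]; rfl

variable (hS : Function.Bijective (HopfAlgebra.antipode k (A := H)))
  (hG : C.IsHopfGalois) (hF : C.IsLeftFaithfullyFlat)

/-- The isomorphism `q ⊗_B p ↦ p (q ⊗ 1)` from the tensor product over the source map. -/
noncomputable def sourceEquiv :
    BalTensor (C.lES C.ES) (rSource C) ≃ₗ[k] C.TripleForms :=
  (LinearEquiv.ofInjective (sourceGalois C) (sourceGalois_injective_range hS hG hF).1).trans
    (LinearEquiv.ofEq _ _ (sourceGalois_injective_range hS hG hF).2)

theorem sourceEquiv_mk (q p : C.ES) :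
    sourceEquiv hS hG hF (BalTensor.mk _ _ (q ⊗ₜ[k] p)) = p • fst C q := rfl

theorem tripleForms_induction (hS : Function.Bijective (HopfAlgebra.antipode k (A := H)))
    (hG : C.IsHopfGalois) (hF : C.IsLeftFaithfullyFlat) {P : C.TripleForms → Prop}
    (zero : P 0) (add : ∀ ζ ξ, P ζ → P ξ → P (ζ + ξ)) (smul : ∀ p q : C.ES, P (p • fst C q))
    (ζ : C.TripleForms) : P ζ := by
  obtain ⟨y, rfl⟩ := (sourceEquiv hS hG hF).surjective ζ
  obtain ⟨z, rfl⟩ := BalTensor.mk_surjective _ _ y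
  induction z with
  | zero => simpa using zero
  | add x y hx hy => rw [map_add, map_add]; exact add _ _ hx hy
  | tmul q p => exact smul p q

/-- The product `(a ⊗ a' ⊗ a'') ↦ a ⊗ a' a''` on coinvariants. -/
noncomputable def mulForms : C.TripleForms →ₗ[k] C.ES :=
  BalTensor.lift (C.lES C.ES) (rSource C) (TensorProduct.lift (LinearMap.mul k C.ES).flip) (by
    intro b q p
    exact (mul_assoc p (C.source b) q).symm) ∘ₗ (sourceEquiv hS hG hF).symm.toLinearMap

theorem mulForms_smul_fst (p q : C.ES) : mulForms hS hG hF (p • fst C q) = p * q := by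
  rw [mulForms, LinearMap.comp_apply, ← sourceEquiv_mk hS hG hF, LinearEquiv.coe_coe,
    LinearEquiv.symm_apply_apply]
  rfl

theorem fst_lES (b : C.coinv) (x : C.ES) :
    fst C (C.lES C.ES b x) = C.lES C.TripleForms b (fst C x) :=
  (self C).tens.coMap_source_mul ((TensorProduct.mk k A A).flip 1) tens_δ_tmul_one b x

theorem coAct_fst (q : C.ES) : (self C).tens.coAct hG hF (fst C q) =
    esTensorMap (fst C) fst_lES (C.Δ hG q) :=
  (self C).tens.coAct_coMap hG hF ((TensorProduct.mk k A A).flip 1) tens_δ_tmul_one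
    (fun _ _ => rfl) fst_lES q

/-- The product was defined through the generators p(q ⊗ 1), so that its values lie in ℋ by
construction; on generators it agrees with multiplying the last two factors. -/
theorem esIncl_mulForms (ζ : C.TripleForms) :
    C.esIncl (mulForms hS hG hF ζ) = (LinearMap.mul' k A).lTensor A ((self C).tens.coVal ζ) := by
  induction ζ using tripleForms_induction hS hG hF with
  | zero =>
    simp
  | add ζ ξ h₁ h₂ =>
    simp only [map_add, h₁, h₂]
  | smul p q =>
    rw [mulForms_smul_fst, coVal_smul, coVal_fst, esIncl_mul]
    generalize C.esIncl p = z
    generalize C.esIncl q = z'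
    induction z with
    | zero => simp
    | add x y hx hy => simp only [map_add, LinearMap.add_apply, hx, hy]
    | tmul p p' =>
      induction z' with
      | zero => simp
      | add x y hx hy => simp only [map_add, hx, hy]
      | tmul q q' => rw [lr_insOne_tmul]; simp

end TripleForms

/-! ### Left covariant calculi as quotients of (A ⊗ A ⊗ A)^{co H}. -/

namespace LeftCovariantCalculus

variable {hG : C.IsHopfGalois} (X : C.LeftCovariantCalculus hG)

theorem d_one : X.d 1 = 0 := by
  have h := X.leibniz 1 1
  rw [mul_one, op_one, one_smul, one_smul] at h
  simpa using h

variable (hS : Function.Bijective (HopfAlgebra.antipode k (A := H))) (hF : C.IsLeftFaithfullyFlat)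

/-- The map `p (q ⊗ 1) ↦ p dq` from `(A ⊗ A ⊗ A)^{co H}` to the one-forms. -/
noncomputable def formMap : C.TripleForms →ₗ[k] X.Ω :=
  BalTensor.lift (C.lES C.ES) (rSource C) (TensorProduct.lift ((lact k C.ES X.Ω).flip ∘ₗ X.d)) (by
    intro b q p
    have h : X.d (C.source b * q) = C.source b • X.d q := X.d_source_mul b q
    change p • X.d (C.source b * q) = (p * C.source b) • X.d q
    rw [h, mul_smul]) ∘ₗ (sourceEquiv hS hG hF).symm.toLinearMap

theorem formMap_smul_fst (p q : C.ES) : X.formMap hS hF (p • fst C q) = p • X.d q := by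
  rw [formMap, LinearMap.comp_apply, ← sourceEquiv_mk hS hG hF, LinearEquiv.coe_coe,
    LinearEquiv.symm_apply_apply]
  rfl

theorem formMap_fst (q : C.ES) : X.formMap hS hF (fst C q) = X.d q := by
  rw [← one_smul C.ES (fst C q), formMap_smul_fst, one_smul]

theorem formMap_smul (x : C.ES) (ζ : C.TripleForms) :
    X.formMap hS hF (x • ζ) = x • X.formMap hS hF ζ := by
  induction ζ using tripleForms_induction hS hG hF with
  | zero =>
    simp
  | add ζ ξ h₁ h₂ =>
    simp only [smul_add, map_add, h₁, h₂]
  | smul p q =>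
    rw [smul_smul, formMap_smul_fst, formMap_smul_fst, smul_smul]

theorem formMap_outer (x : C.ES) : X.formMap hS hF (outer C x) = 0 := by
  rw [outer_eq_smul, formMap_smul_fst, X.d_one, smul_zero]

/-- From p d(qx) = (p dq)x + pq dx: right linearity fails exactly by the product of ζ times dx, and
holds on the kernel of `mulForms`. -/
theorem formMap_op_smul (x : C.ES) (ζ : C.TripleForms) :
    X.formMap hS hF (op x • ζ) = op x • X.formMap hS hF ζ + mulForms hS hG hF ζ • X.d x := by
  induction ζ using tripleForms_induction hS hG hF with
  | zero =>
    simp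
  | add ζ ξ h₁ h₂ =>
    simp only [smul_add, map_add, add_smul, h₁, h₂]
    abel
  | smul p q =>
    rw [← smul_comm p (op x), ← fst_mul, formMap_smul_fst, formMap_smul_fst, mulForms_smul_fst,
      X.leibniz, smul_add, ← smul_comm p (op x), mul_smul]

theorem formMap_surjective : Function.Surjective (X.formMap hS hF) := by
  rw [← LinearMap.range_eq_top, eq_top_iff, ← X.span_d, Submodule.span_le]
  rintro _ ⟨x, y, rfl⟩
  exact ⟨x • fst C y, X.formMap_smul_fst hS hF x y⟩

theorem lTensor_leftProd {M N : Type*} [AddCommGroup M] [Module k M] [Module C.ES M]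
    [IsScalarTower k C.ES M] [AddCommGroup N] [Module k N] [Module C.ES N]
    [IsScalarTower k C.ES N] (f : M →ₗ[k] N) (hf : ∀ (x : C.ES) (m : M), f (x • m) = x • f m)
    (y : C.ES ⊗[k] C.ES) (z : C.ES ⊗[k] M) :
    f.lTensor C.ES (C.leftProd M y z) = C.leftProd N y (f.lTensor C.ES z) := by
  induction y with
  | zero => simp
  | add x y hx hy => simp only [map_add, LinearMap.add_apply, hx, hy]
  | tmul g g' =>
    induction z with
    | zero => simp
    | add x y hx hy => simp only [map_add, hx, hy]
    | tmul h m =>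
      change (g * h) ⊗ₜ[k] f (g' • m) = (g * h) ⊗ₜ[k] (g' • f m)
      rw [hf]

theorem formMap_lES (b : C.coinv) (ζ : C.TripleForms) :
    X.formMap hS hF (C.lES C.TripleForms b ζ) = C.lES X.Ω b (X.formMap hS hF ζ) :=
  X.formMap_smul hS hF (C.source b) ζ

/-- On the generators p(q ⊗ 1) this combines the multiplicativity of the coaction with the
colinearity of d. -/
theorem coact_formMap (ζ : C.TripleForms) : X.coact (X.formMap hS hF ζ) =
    esTensorMap (X.formMap hS hF) (X.formMap_lES hS hF) ((self C).tens.coAct hG hF ζ) := by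
  induction ζ using tripleForms_induction hS hG hF with
  | zero =>
    simp
  | add ζ ξ h₁ h₂ =>
    simp only [map_add, h₁, h₂]
  | smul p q =>
    obtain ⟨y, hy⟩ := BalTensor.mk_surjective _ _ (C.Δ hG p)
    obtain ⟨z, hz⟩ := BalTensor.mk_surjective _ _ (C.Δ hG q)
    have h₁ : C.esMk X.Ω (X.d.lTensor C.ES z) = X.coact (X.d q) := by
      rw [X.coact_d, ← hz]
      rfl
    have h₂ : C.esMk C.TripleForms ((fst C).lTensor C.ES z) =
        (self C).tens.coAct hG hF (fst C q) := by
      rw [coAct_fst, ← hz]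
      rfl
    rw [formMap_smul_fst, X.coact_left p _ y _ hy h₁, (self C).tens.coAct_left hG hF p _ y _ hy h₂]
    rw [esTensorMap_mk, lTensor_leftProd _ (X.formMap_smul hS hF), ← LinearMap.lTensor_comp_apply]
    congr 4
    exact LinearMap.ext fun q => (X.formMap_fst hS hF q).symm

/-- The calculi are determined by the relations between the elements `p (q ⊗ 1)`. -/
theorem nonempty_iso {X X' : C.LeftCovariantCalculus hG}
    (h : LinearMap.ker (X.formMap hS hF) = LinearMap.ker (X'.formMap hS hF)) :
    Nonempty (X.Iso X') := by
  let e : X.Ω ≃ₗ[k] X'.Ω :=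
    ((X.formMap hS hF).quotKerEquivOfSurjective (X.formMap_surjective hS hF)).symm.trans
      ((Submodule.quotEquivOfEq _ _ h).trans
        ((X'.formMap hS hF).quotKerEquivOfSurjective (X'.formMap_surjective hS hF)))
  have he : ∀ ζ, e (X.formMap hS hF ζ) = X'.formMap hS hF ζ := by
    intro ζ
    have h₁ : ((X.formMap hS hF).quotKerEquivOfSurjective
        (X.formMap_surjective hS hF)).symm (X.formMap hS hF ζ) = Submodule.Quotient.mk ζ := by
      rw [LinearEquiv.symm_apply_eq]
      rfl
    simp only [e, LinearEquiv.trans_apply, h₁]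
    rfl
  have hl : ∀ (x : C.ES) (ω : X.Ω), e (x • ω) = x • e ω := by
    intro x ω
    obtain ⟨ζ, rfl⟩ := X.formMap_surjective hS hF ω
    rw [← formMap_smul, he, he, formMap_smul]
  have hd : ∀ x, e (X.d x) = X'.d x := by
    intro x
    rw [← X.formMap_fst hS hF, he, formMap_fst]
  refine ⟨⟨e, hl, fun x ω => ?_, hd, fun ω => ?_⟩⟩
  · obtain ⟨ζ, rfl⟩ := X.formMap_surjective hS hF ω
    have h₁ := X.formMap_op_smul hS hF x ζ
    have h₂ := X'.formMap_op_smul hS hF x ζ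
    -- The error terms of the two right linearity formulas correspond under e and cancel.
    have h₃ := congrArg e h₁
    rw [he, map_add, hl, hd, h₂] at h₃
    rw [he]
    exact (add_right_cancel h₃).symm
  · obtain ⟨ζ, rfl⟩ := X.formMap_surjective hS hF ω
    rw [he, coact_formMap, coact_formMap]
    obtain ⟨z, hz⟩ := BalTensor.mk_surjective _ _ ((self C).tens.coAct hG hF ζ)
    rw [← hz]
    rw [esTensorMap_mk, esTensorMap_mk]
    change _ = C.esMk X'.Ω (e.toLinearMap.lTensor C.ES ((X.formMap hS hF).lTensor C.ES z))
    rw [← LinearMap.lTensor_comp_apply]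
    congr 3
    exact LinearMap.ext fun ζ => (he ζ).symm

end LeftCovariantCalculus

/-- The map from `(A ⊗ A ⊗ A)^{co H}` to the one-forms of an induced calculus. -/
theorem RightCovariantCalculus.coVal_formMap (Y : C.RightCovariantCalculus)
    (hS : Function.Bijective (HopfAlgebra.antipode k (A := H)))
    (hG : C.IsHopfGalois) (hF : C.IsLeftFaithfullyFlat) (ζ : C.TripleForms) :
    Y.hopf.coVal ((Y.leftCalculus hS hG hF).formMap hS hF ζ) =
      (Y.hopf.dMul Y.d).lTensor A ((self C).tens.coVal ζ) := by
  induction ζ using tripleForms_induction hS hG hF with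
  | zero =>
    rw [map_zero, map_zero, map_zero]
    exact map_zero _
  | add ζ ξ h₁ h₂ =>
    rw [map_add, map_add, map_add, ← h₁, ← h₂]
    exact map_add _ _ _
  | smul p q =>
    rw [LeftCovariantCalculus.formMap_smul_fst, coVal_smul, coVal_fst, lTensor_dMul_lr]
    rfl

end ESCalculus.RightComoduleAlgebra

namespace ESCalculus.RightComoduleAlgebra

variable {k : Type u} {H : Type v} {A : Type w} [Field k] [Ring H] [HopfAlgebra k H]
  [Ring A] [Algebra k A] {C : RightComoduleAlgebra k H A}

open HopfBimodule

/-! ### ℋ⁺ as the coinvariants of Ω^u, and ℋ ⊗_B ℋ⁺ inside (A ⊗ A ⊗ A)^{co H}. -/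

section Plus

theorem mem_plus_iff {x : C.ES} : x ∈ C.plus ↔ C.esIncl x ∈ univ k A :=
  ⟨fun h => congrArg Subtype.val (show C.ε x = 0 from h), fun h => Subtype.ext h⟩

theorem map_ker_ε : (LinearMap.ker C.ε).map C.esIncl = univ k A ⊓ C.diagCoinv := by
  ext z
  constructor
  · rintro ⟨x, hx, rfl⟩
    exact ⟨mem_plus_iff.1 hx, esIncl_mem x⟩
  · rintro ⟨h₁, h₂⟩
    obtain ⟨x, rfl⟩ := exists_esIncl_eq h₂
    exact ⟨x, mem_plus_iff.2 h₁, rfl⟩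

theorem lr_tens_self (y z : A ⊗[k] A) : (self C).tens.lr y z =
    TensorProduct.map₂ (LinearMap.mul k A) (LinearMap.mul k A).flip y z := by
  induction y with
  | zero => simp
  | add x y hx hy => simp only [map_add, LinearMap.add_apply, hx, hy]
  | tmul a a' =>
    induction z with
    | zero => simp
    | add x y hx hy => simp only [map_add, hx, hy]
    | tmul c c' => rfl

theorem HopfBimodule.map_lr {L L' : Type*} [AddCommGroup L] [Module k L] [AddCommGroup L']
    [Module k L'] (T : C.HopfBimodule L) (T' : C.HopfBimodule L') (f : L →ₗ[k] L')
    (hl : ∀ a l, f (T.lm a l) = T'.lm a (f l)) (hr : ∀ a l, f (T.rm a l) = T'.rm a (f l))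
    (z : A ⊗[k] A) (l : L) : f (T.lr z l) = T'.lr z (f l) := by
  induction z with
  | zero => simp
  | add x y hx hy => simp only [map_add, LinearMap.add_apply, hx, hy]
  | tmul a a' => rw [lr_tmul, hl, hr, lr_tmul]

theorem HopfBimodule.lTensor_lm {L L' : Type*} [AddCommGroup L] [Module k L] [AddCommGroup L']
    [Module k L'] (T : C.HopfBimodule L) (T' : C.HopfBimodule L') (f : L →ₗ[k] L') (a : A)
    (m : A ⊗[k] L) : f.lTensor A (T.tens.lm a m) = T'.tens.lm a (f.lTensor A m) := by
  induction m with
  | zero => simp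
  | add x y hx hy => simp only [map_add, hx, hy]
  | tmul c l => rfl

theorem HopfBimodule.lTensor_rm {L L' : Type*} [AddCommGroup L] [Module k L] [AddCommGroup L']
    [Module k L'] (T : C.HopfBimodule L) (T' : C.HopfBimodule L') (f : L →ₗ[k] L')
    (hr : ∀ a l, f (T.rm a l) = T'.rm a (f l)) (a : A)
    (m : A ⊗[k] L) : f.lTensor A (T.tens.rm a m) = T'.tens.rm a (f.lTensor A m) := by
  induction m with
  | zero => simp
  | add x y hx hy => simp only [map_add, hx, hy]
  | tmul c l => rw [tens_rm_tmul, LinearMap.lTensor_tmul, hr]; rfl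

variable (C) in
/-- The inclusion of the kernel of the counit into the universal calculus. -/
noncomputable def plusUniv : C.plus →ₗ[k] univ k A :=
  (C.esIncl ∘ₗ C.plus.subtype.restrictScalars k).codRestrict _ fun x => mem_plus_iff.1 x.2

theorem subtype_lr_univHopf (z : A ⊗[k] A) (x : univ k A) :
    ((univHopf C).lr z x : A ⊗[k] A) = (self C).tens.lr z x :=
  (univHopf C).map_lr (self C).tens (univ k A).subtype (fun _ _ => rfl) (fun _ _ => rfl) z x

theorem plusUniv_smul (x : C.ES) (u : C.plus) :
    plusUniv C (x • u) = (univHopf C).lr (C.esIncl x) (plusUniv C u) := by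
  apply Subtype.ext
  rw [subtype_lr_univHopf, lr_tens_self]
  exact esIncl_mul x u

theorem plusUniv_lES (b : C.coinv) (u : C.plus) :
    plusUniv C (C.lES C.plus b u) = (univHopf C).lm (b : A) (plusUniv C u) := by
  refine (plusUniv_smul (C.source b) u).trans ?_
  rw [esIncl_source, lr_tmul, (univHopf C).rm_one]

theorem plusUniv_injective : Function.Injective (plusUniv C) := fun _ _ h =>
  Subtype.ext (esIncl_injective (congrArg Subtype.val h))

theorem mem_coinv_univHopf {x : univ k A} :
    x ∈ (univHopf C).coinv ↔ (x : A ⊗[k] A) ∈ C.diagCoinv := by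
  rw [mem_coinv, ← rTensor_subtype_univ_injective.eq_iff, rTensor_univHopf_δ]
  rfl

/-- The counit is the restriction of the product of A, so its kernel and the coinvariants of Ω^u are
cut out of A ⊗ A by the same two conditions. -/
theorem range_plusUniv : LinearMap.range (plusUniv C) = (univHopf C).coinv := by
  ext x
  rw [mem_coinv_univHopf]
  constructor
  · rintro ⟨u, rfl⟩
    exact esIncl_mem _
  · intro h
    obtain ⟨u, hu⟩ := exists_esIncl_eq h
    exact ⟨⟨u, mem_plus_iff.2 (by rw [hu]; exact x.2)⟩, Subtype.ext hu⟩

variable (C) in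
/-- The embedding `ES ⊗_B ES⁺ → A ⊗ Ω^u_A`. -/
noncomputable def plusEmb : C.ESTensor C.plus →ₗ[k] A ⊗[k] univ k A :=
  (univHopf C).emb (C.lES C.plus) (plusUniv C) plusUniv_lES

theorem plusEmb_mk (z : C.ES ⊗[k] C.plus) : plusEmb C (C.esMk C.plus z) =
    (univHopf C).embLin (plusUniv C) (C.esIncl.rTensor C.plus z) := rfl

theorem plusEmb_injective_range (hG : C.IsHopfGalois) (hF : C.IsLeftFaithfullyFlat) :
    Function.Injective (plusEmb C) ∧ LinearMap.range (plusEmb C) = (univHopf C).tens.coinv :=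
  (univHopf C).emb_injective_range hG hF _ _ _ plusUniv_injective range_plusUniv

theorem plusEmb_leftProd (hG : C.IsHopfGalois) (hF : C.IsLeftFaithfullyFlat) (x : C.ES)
    (y : C.ES ⊗[k] C.ES) (hy : C.esMk C.ES y = C.Δ hG x) (z : C.ES ⊗[k] C.plus) :
    plusEmb C (C.esMk C.plus (C.leftProd C.plus y z)) =
      (univHopf C).tens.lr (C.esIncl x) (plusEmb C (C.esMk C.plus z)) :=
  embLin_esIncl_leftProd hG hF (univHopf C) (plusUniv C) plusUniv_smul x y hy z

theorem embES_plus (z : C.ES ⊗[k] C.plus) :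
    embES C (C.esMk C.ES ((C.plus.subtype.restrictScalars k).lTensor C.ES z)) =
      (univ k A).subtype.lTensor A (plusEmb C (C.esMk C.plus z)) := by
  induction z with
  | zero => simp
  | add x y hx hy => simp only [map_add, hx, hy]
  | tmul x u =>
    change ((self C).tens.lm.flip (C.esIncl u)).lTensor A (C.esIncl x) =
      (univ k A).subtype.lTensor A (((univHopf C).lm.flip (plusUniv C u)).lTensor A (C.esIncl x))
    rw [← LinearMap.lTensor_comp_apply]
    rfl

theorem plusForms_mem (m : A ⊗[k] univ k A) (hm : m ∈ (univHopf C).tens.coinv) :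
    (univ k A).subtype.lTensor A m ∈ (self C).tens.tens.coinv :=
  (univHopf C).lTensor_mem_coinv (self C).tens (univ k A).subtype
    (fun x => (rTensor_univHopf_δ x).symm) hm

/-- The embedding of `ES ⊗_B ES⁺` into `(A ⊗ A ⊗ A)^{co H}`. -/
noncomputable def plusForms : C.ESTensor C.plus →ₗ[k] C.TripleForms :=
  ((univ k A).subtype.lTensor A ∘ₗ plusEmb C).codRestrict (self C).tens.tens.coinv fun y =>
    plusForms_mem _ ((univHopf C).emb_mem (C.lES C.plus) (plusUniv C) plusUniv_lES
      (fun m => by rw [← range_plusUniv]; exact ⟨m, rfl⟩) y)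

theorem coVal_plusForms (y : C.ESTensor C.plus) :
    (self C).tens.coVal (plusForms y) = (univ k A).subtype.lTensor A (plusEmb C y) := rfl

theorem plusForms_injective (hG : C.IsHopfGalois) (hF : C.IsLeftFaithfullyFlat) :
    Function.Injective (plusForms (C := C)) := by
  intro y y' h
  apply (plusEmb_injective_range hG hF).1
  exact Module.Flat.lTensor_preserves_injective_linearMap (M := A) _
    (univ k A).injective_subtype (congrArg (self C).tens.coVal h)

theorem plusForms_leftProd (hG : C.IsHopfGalois) (hF : C.IsLeftFaithfullyFlat) (x : C.ES)
    (y : C.ES ⊗[k] C.ES) (hy : C.esMk C.ES y = C.Δ hG x) (z : C.ES ⊗[k] C.plus) :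
    plusForms (C.esMk C.plus (C.leftProd C.plus y z)) = x • plusForms (C.esMk C.plus z) := by
  apply (self C).tens.coVal_injective
  rw [coVal_plusForms, plusEmb_leftProd hG hF x y hy, coVal_smul, coVal_plusForms]
  exact (univHopf C).tens.map_lr (self C).tens.tens _
    ((univHopf C).lTensor_lm (self C).tens _)
    ((univHopf C).lTensor_rm (self C).tens _ fun _ _ => rfl) _ _

theorem mulForms_plusForms (hS : Function.Bijective (HopfAlgebra.antipode k (A := H)))
    (hG : C.IsHopfGalois) (hF : C.IsLeftFaithfullyFlat) (y : C.ESTensor C.plus) :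
    mulForms hS hG hF (plusForms y) = 0 := by
  apply esIncl_injective
  rw [esIncl_mulForms, coVal_plusForms, map_zero, ← LinearMap.lTensor_comp_apply,
    show LinearMap.mul' k A ∘ₗ (univ k A).subtype = 0 from LinearMap.ext fun x => x.2,
    LinearMap.lTensor_zero, LinearMap.zero_apply]

theorem plusForms_one (u : C.plus) :
    plusForms (C.esMk C.plus (1 ⊗ₜ[k] u)) = snd C u := by
  apply (self C).tens.coVal_injective
  rw [coVal_plusForms, coVal_snd, plusEmb_mk, LinearMap.rTensor_tmul, embLin_tmul, esIncl_one,
    LinearMap.lTensor_tmul, LinearMap.lTensor_tmul, LinearMap.flip_apply, (univHopf C).lm_one]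
  rfl

theorem plusForms_of_eq (hG : C.IsHopfGalois) (hF : C.IsLeftFaithfullyFlat) (q : C.ES)
    (z : C.ES ⊗[k] C.plus)
    (hz : C.esMk C.ES ((C.plus.subtype.restrictScalars k).lTensor C.ES z) =
      C.Δ hG q - C.esMk C.ES (q ⊗ₜ[k] 1)) :
    plusForms (C.esMk C.plus z) = outer C q - fst C q := by
  apply (self C).tens.coVal_injective
  rw [coVal_plusForms, ← embES_plus, hz, map_sub, map_sub, embES_comul hG hF, coVal_outer,
    coVal_fst]
  congr 1
  change ((self C).tens.lm.flip (C.esIncl 1)).lTensor A (C.esIncl q) = _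
  rw [esIncl_one, insOne]
  congr 2
  ext a
  simp [tens_lm_tmul]

/-- The difference Δq - q ⊗ 1 embeds as (A ⊗ d_u)(q), which is a coinvariant of A ⊗ Ω^u and
therefore comes from ℋ ⊗_B ℋ⁺. This gives a meaning to applying id ⊗ π to it. -/
theorem exists_comul_sub (hG : C.IsHopfGalois) (hF : C.IsLeftFaithfullyFlat) (q : C.ES) :
    ∃ z : C.ES ⊗[k] C.plus,
      C.esMk C.ES ((C.plus.subtype.restrictScalars k).lTensor C.ES z) =
        C.Δ hG q - C.esMk C.ES (q ⊗ₜ[k] 1) ∧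
      plusEmb C (C.esMk C.plus z) = (dUniv k A).lTensor A (C.esIncl q) := by
  have h : (dUniv k A).lTensor A (C.esIncl q) ∈ (univHopf C).tens.coinv :=
    (self C).lTensor_mem_coinv (univHopf C) (dUniv k A) univHopf_δ_dUniv (esIncl_mem q)
  rw [← (plusEmb_injective_range hG hF).2] at h
  obtain ⟨y, hy⟩ := h
  obtain ⟨z, rfl⟩ := BalTensor.mk_surjective _ _ y
  refine ⟨z, ?_, hy⟩
  apply (embES_injective_range hG hF).1
  have h₁ : embES C (C.esMk C.ES (q ⊗ₜ[k] 1)) =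
    ((self C).tens.lm.flip (C.esIncl 1)).lTensor A (C.esIncl q) := rfl
  rw [embES_plus, hy, map_sub, embES_comul hG hF, h₁, esIncl_one]
  generalize C.esIncl q = z
  induction z with
  | zero => simp
  | add x y hx hy => simp only [map_add, hx, hy]; abel
  | tmul a a' =>
    rw [LinearMap.lTensor_tmul, LinearMap.lTensor_tmul, Submodule.subtype_apply, val_dUniv,
      ins_tmul, LinearMap.lTensor_tmul, LinearMap.flip_apply, tens_lm_tmul,
      TensorProduct.tmul_sub, mul_one]

end Plus

/-! ### An ideal and its calculus determine each other. -/

namespace LeftCovariantCalculus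

variable {hG : C.IsHopfGalois} {I : Ideal C.ES}

variable (I) in
/-- The projection `ES⁺ → ES⁺ / I`. -/
noncomputable def plusProj : C.plus →ₗ[k] C.plusQuot I := (I.submoduleOf C.plus).mkQ.restrictScalars k

theorem plusProj_smul (x : C.ES) (u : C.plus) : plusProj I (x • u) = x • plusProj I u := rfl

theorem plusProj_lES (b : C.coinv) (u : C.plus) :
    plusProj I (C.lES C.plus b u) = C.lES (C.plusQuot I) b (plusProj I u) := rfl

theorem plusProj_surjective : Function.Surjective (plusProj I) :=
  (I.submoduleOf C.plus).mkQ_surjective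

namespace IdealIso

variable {X : C.LeftCovariantCalculus hG} (f : X.IdealIso I)

/-- The map from `ES ⊗_B ES⁺` to the one-forms. -/
noncomputable def onPlus : C.ESTensor C.plus →ₗ[k] X.Ω :=
  f.toEquiv.toLinearMap ∘ₗ esTensorMap (plusProj I) plusProj_lES

theorem map_left' (x : C.ES) (y : C.ES ⊗[k] C.ES) (hy : C.esMk C.ES y = C.Δ hG x)
    (z : C.ES ⊗[k] C.plusQuot I) :
    f.toEquiv (C.esMk (C.plusQuot I) (C.leftProd (C.plusQuot I) y z)) =
      x • f.toEquiv (C.esMk (C.plusQuot I) z) := by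
  induction z with
  | zero => simp
  | add z z' h h' => simp only [map_add, smul_add, h, h']
  | tmul g v => exact f.map_left x g v y hy

theorem onPlus_leftProd (x : C.ES) (y : C.ES ⊗[k] C.ES) (hy : C.esMk C.ES y = C.Δ hG x)
    (z : C.ES ⊗[k] C.plus) :
    f.onPlus (C.esMk C.plus (C.leftProd C.plus y z)) = x • f.onPlus (C.esMk C.plus z) := by
  rw [onPlus, LinearMap.comp_apply, LinearMap.comp_apply, esTensorMap_mk, esTensorMap_mk,
    lTensor_leftProd _ plusProj_smul]
  exact f.map_left' x y hy _

variable (hS : Function.Bijective (HopfAlgebra.antipode k (A := H))) (hF : C.IsLeftFaithfullyFlat)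

/-- The differential of q = x ⊗ x' is represented in ℋ ⊗_B ℋ⁺ by x ⊗ 1 ⊗ x' - x ⊗ x' ⊗ 1, while
`formMap` takes the subtracted term to dq and kills the other one. So the isomorphism is forced by
the calculus, with the sign that appears in `onPlus_eq`. -/
theorem exists_onPlus_eq (ζ : C.TripleForms) : ∃ y : C.ESTensor C.plus,
    plusForms y = outer C (mulForms hS hG hF ζ) - ζ ∧ f.onPlus y = X.formMap hS hF ζ := by
  induction ζ using tripleForms_induction hS hG hF with
  | zero => exact ⟨0, by simp, by simp⟩
  | add ζ ξ h₁ h₂ =>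
    obtain ⟨y, h₁, h₃⟩ := h₁
    obtain ⟨y', h₂, h₄⟩ := h₂
    refine ⟨y + y', ?_, ?_⟩
    · simp only [map_add, h₁, h₂]
      abel
    · simp only [map_add, h₃, h₄]
  | smul p q =>
    obtain ⟨y, hy⟩ := BalTensor.mk_surjective _ _ (C.Δ hG p)
    obtain ⟨z, hz, hd⟩ := f.map_d q
    refine ⟨C.esMk C.plus (C.leftProd C.plus y z), ?_, ?_⟩
    · rw [plusForms_leftProd hG hF p y hy, plusForms_of_eq hG hF q z hz, mulForms_smul_fst,
        smul_sub, smul_outer]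
    · rw [f.onPlus_leftProd p y hy, formMap_smul_fst, hd]
      rfl

theorem onPlus_eq (y : C.ESTensor C.plus) :
    f.onPlus y = -X.formMap hS hF (plusForms y) := by
  obtain ⟨y', h₁, h₂⟩ := f.exists_onPlus_eq hS hF (plusForms y)
  rw [mulForms_plusForms, map_zero, zero_sub, ← map_neg] at h₁
  rw [plusForms_injective hG hF h₁, map_neg] at h₂
  rw [← h₂, neg_neg]

/-- Contraction with the counit recovers [u] from 1 ⊗ [u], so u lies in I exactly when 1 ⊗ [u]
vanishes. The resulting criterion no longer mentions the isomorphism or I, which makes the ideal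
unique. -/
theorem mem_iff (f : X.IdealIso I) (u : C.plus) : (u : C.ES) ∈ I ↔ X.formMap hS hF (snd C u) = 0 := by
  rw [← plusForms_one, ← neg_eq_zero, ← f.onPlus_eq hS hF]
  change _ ↔ f.toEquiv (C.esMk (C.plusQuot I) (1 ⊗ₜ[k] plusProj I u)) = 0
  rw [f.toEquiv.map_eq_zero_iff]
  have h : C.contract (C.plusQuot I) 1 (C.esMk (C.plusQuot I) (1 ⊗ₜ[k] plusProj I u)) =
      plusProj I u := by
    change C.source (C.ε (1 * C.source 1)) • plusProj I u = plusProj I u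
    have h₁ : C.ε (1 * C.source 1) = 1 := by
      apply Subtype.ext
      change LinearMap.mul' k A (C.esIncl (1 * C.source 1)) = 1
      rw [one_mul, source_one, esIncl_one, LinearMap.mul'_apply, mul_one]
    rw [h₁, source_one, one_smul]
  constructor
  · intro hu
    have h₀ : plusProj I u = 0 := (Submodule.Quotient.mk_eq_zero _).2 hu
    rw [h₀, TensorProduct.tmul_zero, map_zero]
  · intro h₀
    rw [h₀, map_zero] at h
    exact (Submodule.Quotient.mk_eq_zero (I.submoduleOf C.plus)).1 h.symm

theorem eq_of_idealIso (f : X.IdealIso I) {I' : Ideal C.ES} (hI : I ≤ C.plus) (hI' : I' ≤ C.plus)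
    (f' : X.IdealIso I') (hS : Function.Bijective (HopfAlgebra.antipode k (A := H)))
    (hF : C.IsLeftFaithfullyFlat) : I = I' := by
  ext x
  constructor
  · intro hx
    exact (f'.mem_iff hS hF ⟨x, hI hx⟩).2 ((f.mem_iff hS hF ⟨x, hI hx⟩).1 hx)
  · intro hx
    exact (f.mem_iff hS hF ⟨x, hI' hx⟩).2 ((f'.mem_iff hS hF ⟨x, hI' hx⟩).1 hx)

/-- The right side involves the calculus only through I. Two calculi of the same ideal therefore
have the same relations and are isomorphic. -/
theorem formMap_eq_zero_iff (f : X.IdealIso I) (ζ : C.TripleForms) (y : C.ESTensor C.plus)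
    (hy : plusForms y = outer C (mulForms hS hG hF ζ) - ζ) :
    X.formMap hS hF ζ = 0 ↔ esTensorMap (plusProj I) plusProj_lES y = 0 := by
  obtain ⟨y', h₁, h₂⟩ := f.exists_onPlus_eq hS hF ζ
  obtain rfl := plusForms_injective hG hF (hy.trans h₁.symm)
  rw [← h₂, onPlus, LinearMap.comp_apply, LinearEquiv.coe_coe, f.toEquiv.map_eq_zero_iff]

theorem nonempty_iso (f : X.IdealIso I) {X' : C.LeftCovariantCalculus hG} (f' : X'.IdealIso I)
    (hS : Function.Bijective (HopfAlgebra.antipode k (A := H))) (hF : C.IsLeftFaithfullyFlat) :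
    Nonempty (X.Iso X') := by
  refine LeftCovariantCalculus.nonempty_iso hS hF ?_
  ext ζ
  obtain ⟨y, hy, -⟩ := f.exists_onPlus_eq hS hF ζ
  rw [LinearMap.mem_ker, LinearMap.mem_ker, f.formMap_eq_zero_iff hS hF ζ y hy,
    f'.formMap_eq_zero_iff hS hF ζ y hy]

/-- The calculus of an ideal is determined up to isomorphism. -/
noncomputable def trans {X' : C.LeftCovariantCalculus hG} (g : X.Iso X') : X'.IdealIso I where
  toEquiv := f.toEquiv.trans g.toEquiv
  map_right x h v := by
    rw [LinearEquiv.trans_apply, LinearEquiv.trans_apply, f.map_right, g.map_right]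
  map_left x h v y hy := by
    rw [LinearEquiv.trans_apply, LinearEquiv.trans_apply, f.map_left x h v y hy, g.map_left]
  map_coact h v y hy := by
    rw [LinearEquiv.trans_apply, g.map_coact, f.map_coact h v y hy]
    change C.esMk X'.Ω (g.toEquiv.toLinearMap.lTensor C.ES _) = _
    rw [← LinearMap.lTensor_comp_apply]
    rfl
  map_d x := by
    obtain ⟨z, hz, h⟩ := f.map_d x
    refine ⟨z, hz, ?_⟩
    rw [LinearEquiv.trans_apply, ← h, g.map_d]

end IdealIso

end LeftCovariantCalculus

end ESCalculus.RightComoduleAlgebra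

namespace ESCalculus.RightComoduleAlgebra

variable {k : Type u} {H : Type v} {A : Type w} [Field k] [Ring H] [HopfAlgebra k H]
  [Ring A] [Algebra k A] {C : RightComoduleAlgebra k H A}

open HopfBimodule

theorem IsCovariantSub.lr_mem {J : Submodule k (A ⊗[k] A)} (hJ : C.IsCovariantSub J)
    (z : A ⊗[k] A) {m : A ⊗[k] A} (hm : m ∈ J) : (self C).tens.lr z m ∈ J := by
  induction z with
  | zero => simp
  | add x y hx hy => rw [map_add, LinearMap.add_apply]; exact add_mem hx hy
  | tmul a a' => exact hJ.left_mem a _ (hJ.right_mem a' _ hm)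

/-- The left ideal `J^{co H}` of the bialgebroid. -/
noncomputable def IsCovariantSub.coIdeal {J : Submodule k (A ⊗[k] A)}
    (hJ : C.IsCovariantSub J) : Ideal C.ES where
  carrier := {x | C.esIncl x ∈ J}
  add_mem' := by
    intro x y hx hy
    change C.esIncl (x + y) ∈ J
    rw [map_add]
    exact add_mem hx hy
  zero_mem' := by
    change C.esIncl 0 ∈ J
    rw [map_zero]
    exact zero_mem J
  smul_mem' := by
    intro x y hy
    change C.esIncl (x * y) ∈ J
    rw [esIncl_mul, ← lr_tens_self (C := C)]
    exact hJ.lr_mem _ hy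

theorem IsCovariantSub.mem_coIdeal {J : Submodule k (A ⊗[k] A)} (hJ : C.IsCovariantSub J)
    {x : C.ES} : x ∈ hJ.coIdeal ↔ C.esIncl x ∈ J := Iff.rfl

theorem IsCovariantSub.coIdeal_le {J : Submodule k (A ⊗[k] A)} (hJ : C.IsCovariantSub J) :
    hJ.coIdeal ≤ C.plus := fun _ hx => mem_plus_iff.2 (hJ.le_univ hx)

/-! ### The induced calculus is that of the ideal J^{co H}. -/

namespace RightCovariantCalculus

variable (Y : C.RightCovariantCalculus)

/-- The left ideal of the bialgebroid that belongs to a right covariant calculus. -/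
noncomputable abbrev ideal : Ideal C.ES := Y.isCovariantSub_relations.coIdeal

theorem univMap_lm (a : A) (x : univ k A) :
    Y.univMap ((univHopf C).lm a x) = Y.hopf.lm a (Y.univMap x) := Y.mulD_leftMul a x

theorem univMap_rm (a : A) (x : univ k A) :
    Y.univMap ((univHopf C).rm a x) = Y.hopf.rm a (Y.univMap x) := by
  have h := Y.mulD_rightMul a (x : A ⊗[k] A)
  rw [show LinearMap.mul' k A (x : A ⊗[k] A) = 0 from x.2, zero_smul, add_zero] at h
  exact h

theorem hopf_δ_univMap (x : univ k A) :
    Y.hopf.δ (Y.univMap x) = Y.univMap.rTensor H ((univHopf C).δ x) := by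
  change Y.coact (Y.mulD (x : A ⊗[k] A)) = (Y.mulD ∘ₗ (univ k A).subtype).rTensor H _
  rw [coact_mulD, LinearMap.rTensor_comp_apply, rTensor_univHopf_δ]

/-- The embedding of `ES⁺ / I` into the one-forms, for the ideal of the calculus. -/
noncomputable def plusMap : C.plusQuot Y.ideal →ₗ[k] Y.Ω :=
  ((Y.ideal.submoduleOf C.plus).restrictScalars k).liftQ (Y.univMap ∘ₗ plusUniv C)
      (fun _ hx => hx.2) ∘ₗ
    (Submodule.Quotient.restrictScalarsEquiv k (Y.ideal.submoduleOf C.plus)).symm.toLinearMap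

theorem plusMap_proj (u : C.plus) :
    Y.plusMap (LeftCovariantCalculus.plusProj Y.ideal u) = Y.univMap (plusUniv C u) := rfl

theorem plusMap_injective : Function.Injective Y.plusMap := by
  rw [injective_iff_map_eq_zero]
  intro v hv
  obtain ⟨u, rfl⟩ := LeftCovariantCalculus.plusProj_surjective v
  exact (Submodule.Quotient.mk_eq_zero (Y.ideal.submoduleOf C.plus)).2
    ⟨(plusUniv C u).2, hv⟩

theorem plusMap_smul (x : C.ES) (v : C.plusQuot Y.ideal) :
    Y.plusMap (x • v) = Y.hopf.lr (C.esIncl x) (Y.plusMap v) := by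
  obtain ⟨u, rfl⟩ := LeftCovariantCalculus.plusProj_surjective v
  rw [← LeftCovariantCalculus.plusProj_smul, plusMap_proj, plusMap_proj, plusUniv_smul]
  exact (univHopf C).map_lr Y.hopf Y.univMap Y.univMap_lm Y.univMap_rm _ _

theorem plusMap_lES (b : C.coinv) (v : C.plusQuot Y.ideal) :
    Y.plusMap (C.lES (C.plusQuot Y.ideal) b v) = Y.hopf.lm (b : A) (Y.plusMap v) := by
  refine (Y.plusMap_smul (C.source b) v).trans ?_
  rw [esIncl_source, lr_tmul, Y.hopf.rm_one]

/-- Ω^u is generated over A by its coinvariants ℋ⁺, so Ω is generated by their images, and descent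
says that these images are all of Ω^{co H}. Passing to coinvariants thus preserves the surjectivity
of Ω^u → Ω. -/
theorem range_plusMap (hG : C.IsHopfGalois) (hF : C.IsLeftFaithfullyFlat) :
    LinearMap.range Y.plusMap = Y.hopf.coinv := by
  refine Y.hopf.eq_coinv_of_spanA_eq_top hG hF _ ?_ ?_ ?_
  · rintro _ ⟨v, rfl⟩
    obtain ⟨u, rfl⟩ := LeftCovariantCalculus.plusProj_surjective v
    refine (univHopf C).map_mem_coinv Y.hopf Y.univMap Y.hopf_δ_univMap ?_
    rw [← range_plusUniv]
    exact ⟨u, rfl⟩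
  · rintro b _ ⟨v, rfl⟩
    refine ⟨C.target b • v, ?_⟩
    rw [plusMap_smul, esIncl_target, lr_tmul, Y.hopf.lm_one]
  · rw [eq_top_iff]
    intro ω _
    obtain ⟨x, rfl⟩ := Y.univMap_surjective ω
    have hx : x ∈ (univHopf C).spanA (univHopf C).coinv := by
      rw [spanA_coinv _ hG hF]; trivial
    rw [← range_plusUniv] at hx
    refine Submodule.span_induction ?_ ?_ ?_ ?_ hx
    · rintro _ ⟨a, _, ⟨u, rfl⟩, rfl⟩
      rw [univMap_rm]
      exact Y.hopf.rm_mem_spanA _ a (Y.hopf.le_spanA _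
        ⟨LeftCovariantCalculus.plusProj Y.ideal u, rfl⟩)
    · rw [map_zero]
      exact zero_mem _
    · intro x y _ _ hx hy
      rw [map_add]; exact add_mem hx hy
    · intro t x _ hx
      rw [map_smul]; exact Submodule.smul_mem _ t hx

/-- The embedding of `ES ⊗_B ES⁺ / I` into `A ⊗ Ω`. -/
noncomputable def quotEmb : C.ESTensor (C.plusQuot Y.ideal) →ₗ[k] A ⊗[k] Y.Ω :=
  Y.hopf.emb (C.lES (C.plusQuot Y.ideal)) Y.plusMap Y.plusMap_lES

theorem quotEmb_mk (z : C.ES ⊗[k] C.plusQuot Y.ideal) :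
    Y.quotEmb (C.esMk (C.plusQuot Y.ideal) z) =
      Y.hopf.embLin Y.plusMap (C.esIncl.rTensor (C.plusQuot Y.ideal) z) := rfl

theorem quotEmb_mk_tmul (g : C.ES) (v : C.plusQuot Y.ideal) :
    Y.quotEmb (C.esMk (C.plusQuot Y.ideal) (g ⊗ₜ[k] v)) =
      (Y.hopf.lm.flip (Y.plusMap v)).lTensor A (C.esIncl g) := rfl

theorem quotEmb_injective_range (hG : C.IsHopfGalois) (hF : C.IsLeftFaithfullyFlat) :
    Function.Injective Y.quotEmb ∧ LinearMap.range Y.quotEmb = Y.hopf.tens.coinv :=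
  Y.hopf.emb_injective_range hG hF _ _ _ Y.plusMap_injective (Y.range_plusMap hG hF)

theorem quotEmb_proj (z : C.ES ⊗[k] C.plus) :
    Y.quotEmb (C.esMk (C.plusQuot Y.ideal)
      ((LeftCovariantCalculus.plusProj Y.ideal).lTensor C.ES z)) =
      Y.univMap.lTensor A (plusEmb C (C.esMk C.plus z)) := by
  induction z with
  | zero => simp
  | add x y hx hy => simp only [map_add, hx, hy]
  | tmul g u =>
    rw [LinearMap.lTensor_tmul, quotEmb_mk_tmul, plusEmb_mk, LinearMap.rTensor_tmul, embLin_tmul,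
      ← LinearMap.lTensor_comp_apply]
    congr 2
    exact LinearMap.ext fun a => (Y.univMap_lm a (plusUniv C u)).symm

/-- The isomorphism of `ES ⊗_B ES⁺ / I` with the one-forms of the induced calculus. -/
noncomputable def quotEquiv (hG : C.IsHopfGalois) (hF : C.IsLeftFaithfullyFlat) :
    C.ESTensor (C.plusQuot Y.ideal) ≃ₗ[k] Y.hopf.CoForms :=
  (LinearEquiv.ofInjective Y.quotEmb (Y.quotEmb_injective_range hG hF).1).trans
    (LinearEquiv.ofEq _ _ (Y.quotEmb_injective_range hG hF).2)

theorem coVal_quotEquiv (hG : C.IsHopfGalois) (hF : C.IsLeftFaithfullyFlat)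
    (y : C.ESTensor (C.plusQuot Y.ideal)) :
    Y.hopf.coVal (Y.quotEquiv hG hF y) = Y.quotEmb y := rfl

theorem coEmb_quotEquiv (hG : C.IsHopfGalois) (hF : C.IsLeftFaithfullyFlat)
    (v : C.plusQuot Y.ideal) (y : C.ES ⊗[k] C.ES) :
    Y.hopf.coEmb (C.esMk Y.hopf.CoForms (((Y.quotEquiv hG hF).toLinearMap ∘ₗ
      C.esMk (C.plusQuot Y.ideal) ∘ₗ
        (TensorProduct.mk k C.ES (C.plusQuot Y.ideal)).flip v).lTensor C.ES y)) =
      ((Y.hopf.lm.flip (Y.plusMap v)).lTensor A).lTensor A (embES C (C.esMk C.ES y)) := by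
  induction y with
  | zero => simp
  | add x y hx hy =>
    rw [map_add, map_add, map_add, map_add, map_add, map_add, hx, hy]
  | tmul x x' =>
    rw [LinearMap.lTensor_tmul, coEmb_mk_tmul]
    have h : embES C (C.esMk C.ES (x ⊗ₜ[k] x')) =
      ((self C).tens.lm.flip (C.esIncl x')).lTensor A (C.esIncl x) := rfl
    have h' : Y.hopf.coVal (((Y.quotEquiv hG hF).toLinearMap ∘ₗ C.esMk (C.plusQuot Y.ideal) ∘ₗ
        (TensorProduct.mk k C.ES (C.plusQuot Y.ideal)).flip v) x') =
      (Y.hopf.lm.flip (Y.plusMap v)).lTensor A (C.esIncl x') := rfl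
    rw [h, h', ← LinearMap.lTensor_comp_apply]
    congr 2
    refine LinearMap.ext fun a => ?_
    generalize C.esIncl x' = z
    induction z with
    | zero => simp
    | add x y hx hy =>
      simp only [map_add, LinearMap.comp_add, LinearMap.add_apply, hx, hy]
    | tmul p p' => simp [tens_lm_tmul]


theorem quotEquiv_mul (hG : C.IsHopfGalois) (hF : C.IsLeftFaithfullyFlat) (x g : C.ES)
    (v : C.plusQuot Y.ideal) :
    Y.quotEquiv hG hF (C.esMk (C.plusQuot Y.ideal) ((g * x) ⊗ₜ[k] v)) =
      op x • Y.quotEquiv hG hF (C.esMk (C.plusQuot Y.ideal) (g ⊗ₜ[k] v)) := by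
  apply Y.hopf.coVal_injective
  rw [coVal_op_smul, coVal_quotEquiv, coVal_quotEquiv, quotEmb_mk_tmul, quotEmb_mk_tmul,
    esIncl_mul]
  generalize C.esIncl g = z
  generalize C.esIncl x = z'
  induction z with
  | zero => simp
  | add x y hx hy => simp only [map_add, LinearMap.add_apply, hx, hy]
  | tmul p p' =>
    induction z' with
    | zero => simp
    | add x y hx hy => simp only [map_add, LinearMap.add_apply, hx, hy]
    | tmul q q' => simp [rr_tmul, Y.hopf.lm_mul]

theorem quotEquiv_leftProd (hG : C.IsHopfGalois) (hF : C.IsLeftFaithfullyFlat) (x : C.ES)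
    (z : C.ES ⊗[k] C.plusQuot Y.ideal) (y : C.ES ⊗[k] C.ES) (hy : C.esMk C.ES y = C.Δ hG x) :
    Y.quotEquiv hG hF (C.esMk (C.plusQuot Y.ideal) (C.leftProd (C.plusQuot Y.ideal) y z)) =
      x • Y.quotEquiv hG hF (C.esMk (C.plusQuot Y.ideal) z) := by
  apply Y.hopf.coVal_injective
  rw [coVal_smul, coVal_quotEquiv, coVal_quotEquiv, quotEmb_mk, quotEmb_mk]
  exact embLin_esIncl_leftProd hG hF Y.hopf Y.plusMap Y.plusMap_smul x y hy z

theorem coAct_quotEquiv (hG : C.IsHopfGalois) (hF : C.IsLeftFaithfullyFlat) (g : C.ES)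
    (v : C.plusQuot Y.ideal) (y : C.ES ⊗[k] C.ES) (hy : C.esMk C.ES y = C.Δ hG g) :
    Y.hopf.coAct hG hF (Y.quotEquiv hG hF (C.esMk (C.plusQuot Y.ideal) (g ⊗ₜ[k] v))) =
      C.esMk Y.hopf.CoForms (((Y.quotEquiv hG hF).toLinearMap ∘ₗ
        C.esMk (C.plusQuot Y.ideal) ∘ₗ
          (TensorProduct.mk k C.ES (C.plusQuot Y.ideal)).flip v).lTensor C.ES y) := by
  apply (Y.hopf.coEmb_injective_range hG hF).1
  rw [coEmb_coAct, coEmb_quotEquiv, coVal_quotEquiv, quotEmb_mk_tmul, hy, embES_comul hG hF]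
  generalize C.esIncl g = z
  induction z with
  | zero => simp
  | add x y hx hy => simp only [map_add, hx, hy]
  | tmul p p' => rfl

theorem exists_coD_eq (hG : C.IsHopfGalois) (hF : C.IsLeftFaithfullyFlat) (x : C.ES) :
    ∃ z : C.ES ⊗[k] C.plus, C.esMk C.ES ((C.plus.subtype.restrictScalars k).lTensor C.ES z) =
        C.Δ hG x - C.esMk C.ES (x ⊗ₜ[k] 1) ∧
      Y.coD x = Y.quotEquiv hG hF (C.esMk (C.plusQuot Y.ideal)
        ((LeftCovariantCalculus.plusProj Y.ideal).lTensor C.ES z)) := by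
  obtain ⟨z, hz, h⟩ := exists_comul_sub hG hF x
  refine ⟨z, hz, ?_⟩
  apply Y.hopf.coVal_injective
  rw [coVal_quotEquiv, quotEmb_proj, h, ← LinearMap.lTensor_comp_apply]
  refine (Y.coVal_coD x).trans ?_
  congr 2
  refine LinearMap.ext fun a => ?_
  rw [LinearMap.comp_apply, univMap_apply, val_dUniv, map_sub, mulD_tmul, mulD_tmul, Y.d_one,
    smul_zero, sub_zero, one_smul]

/-- The induced calculus on the bialgebroid is the one of the ideal `J^{co H}`. -/
noncomputable def idealIso (hS : Function.Bijective (HopfAlgebra.antipode k (A := H)))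
    (hG : C.IsHopfGalois) (hF : C.IsLeftFaithfullyFlat) :
    (Y.leftCalculus hS hG hF).IdealIso Y.ideal where
  toEquiv := Y.quotEquiv hG hF
  map_right := Y.quotEquiv_mul hG hF
  map_left x g v := Y.quotEquiv_leftProd hG hF x (g ⊗ₜ[k] v)
  map_coact := Y.coAct_quotEquiv hG hF
  map_d := Y.exists_coD_eq hG hF

end RightCovariantCalculus

end ESCalculus.RightComoduleAlgebra

namespace ESCalculus.RightComoduleAlgebra

variable {k : Type u} {H : Type v} {A : Type w} [Field k] [Ring H] [HopfAlgebra k H]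
  [Ring A] [Algebra k A] {C : RightComoduleAlgebra k H A}

open HopfBimodule

/-! ### Linearity of the product map and auxiliary facts on kernels. -/

section MulForms

variable (hS : Function.Bijective (HopfAlgebra.antipode k (A := H)))
  (hG : C.IsHopfGalois) (hF : C.IsLeftFaithfullyFlat)

theorem mulForms_smul (x : C.ES) (ζ : C.TripleForms) :
    mulForms hS hG hF (x • ζ) = x * mulForms hS hG hF ζ := by
  induction ζ using tripleForms_induction hS hG hF with
  | zero => simp
  | add ζ ξ h₁ h₂ => simp only [smul_add, map_add, mul_add, h₁, h₂]
  | smul p q => rw [smul_smul, mulForms_smul_fst, mulForms_smul_fst, mul_assoc]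

theorem mulForms_op_smul (x : C.ES) (ζ : C.TripleForms) :
    mulForms hS hG hF (op x • ζ) = mulForms hS hG hF ζ * x := by
  induction ζ using tripleForms_induction hS hG hF with
  | zero => simp
  | add ζ ξ h₁ h₂ => simp only [smul_add, map_add, add_mul, h₁, h₂]
  | smul p q =>
    rw [← smul_comm p (op x), ← fst_mul, mulForms_smul_fst, mulForms_smul_fst, mul_assoc]

theorem mulForms_outer (x : C.ES) : mulForms hS hG hF (outer C x) = x := by
  rw [outer_eq_smul, mulForms_smul_fst, mul_one]

end MulForms

variable (k A) in
/-- The projection `a ⊗ a' ↦ a ⊗ a' - 1 ⊗ a a'`. -/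
noncomputable def projOne : A ⊗[k] A →ₗ[k] A ⊗[k] A :=
  LinearMap.id - TensorProduct.mk k A A 1 ∘ₗ LinearMap.mul' k A

theorem lTensor_projOne (v : A ⊗[k] (A ⊗[k] A)) :
    (projOne k A).lTensor A v = v - ins k A A ((LinearMap.mul' k A).lTensor A v) := by
  rw [projOne, LinearMap.lTensor_sub, LinearMap.sub_apply, LinearMap.lTensor_id,
    LinearMap.id_apply, LinearMap.lTensor_comp_apply]
  rfl

theorem ins_lTensor (f : A ⊗[k] A →ₗ[k] A ⊗[k] A) (v : A ⊗[k] (A ⊗[k] A)) :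
    (f.lTensor A).lTensor A (ins k A (A ⊗[k] A) v) = ins k A (A ⊗[k] A) (f.lTensor A v) := by
  induction v with
  | zero => simp
  | add x y hx hy => simp only [map_add, hx, hy]
  | tmul a z => rfl

theorem mem_range_lTensor_ker {V V' : Type*} [AddCommGroup V] [Module k V] [AddCommGroup V']
    [Module k V'] (g : V →ₗ[k] V') {z : A ⊗[k] V} (hz : g.lTensor A z = 0) :
    z ∈ LinearMap.range ((LinearMap.ker g).subtype.lTensor A) :=
  (Module.Flat.lTensor_exact A (LinearMap.exact_subtype_ker_map g) z).1 hz

/-- For coinvariant v one has δ(va) = va₀ ⊗ a₁, so an A-module generated by coinvariants is a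
subcomodule. -/
theorem HopfBimodule.δ_mem_of_mem_spanA {L : Type w} [AddCommGroup L] [Module k L]
    (T : C.HopfBimodule L) (V : Submodule k L) (hV : V ≤ T.coinv) {l : L} (hl : l ∈ T.spanA V) :
    T.δ l ∈ LinearMap.range ((T.spanA V).subtype.rTensor H) := by
  have h : T.spanA V ≤ (LinearMap.range ((T.spanA V).subtype.rTensor H)).comap T.δ := by
    nth_rewrite 1 [spanA]
    rw [Submodule.span_le]
    rintro _ ⟨a, v, hv, rfl⟩
    rw [SetLike.mem_coe, Submodule.mem_comap, T.δ_rm, (T.mem_coinv).1 (hV hv)]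
    generalize C.ρ a = X
    induction X with
    | zero => simp
    | add x y hx hy => rw [map_add, LinearMap.add_apply]; exact add_mem hx hy
    | tmul a h =>
      rw [TensorProduct.map₂_apply_tmul]
      exact ⟨⟨T.rm a v, T.rm_mem_spanA V a (T.le_spanA V hv)⟩ ⊗ₜ[k] _, rfl⟩
  exact h hl

/-! ### From a left covariant calculus back to a covariant subspace of Ω^u. -/

namespace LeftCovariantCalculus

variable {hG : C.IsHopfGalois} (X : C.LeftCovariantCalculus hG)
  (hS : Function.Bijective (HopfAlgebra.antipode k (A := H))) (hF : C.IsLeftFaithfullyFlat)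

/-- The relations `∑ p dq = 0` with `∑ p q = 0`, as a subspace of `A ⊗ A ⊗ A`. -/
noncomputable def formRel : Submodule k (A ⊗[k] (A ⊗[k] A)) :=
  (LinearMap.ker (X.formMap hS hF) ⊓ LinearMap.ker (mulForms hS hG hF)).map (self C).tens.coVal

theorem formRel_le : X.formRel hS hF ≤ (self C).tens.tens.coinv := by
  rintro _ ⟨ζ, _, rfl⟩
  exact (self C).tens.coVal_mem ζ

theorem coVal_mem_formRel {ζ : C.TripleForms} (h₁ : X.formMap hS hF ζ = 0)
    (h₂ : mulForms hS hG hF ζ = 0) : (self C).tens.coVal ζ ∈ X.formRel hS hF :=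
  ⟨ζ, ⟨h₁, h₂⟩, rfl⟩

theorem lr_mem_formRel (x : C.ES) {v : A ⊗[k] (A ⊗[k] A)} (hv : v ∈ X.formRel hS hF) :
    (self C).tens.tens.lr (C.esIncl x) v ∈ X.formRel hS hF := by
  obtain ⟨ζ, ⟨h₁, h₂⟩, rfl⟩ := hv
  rw [SetLike.mem_coe, LinearMap.mem_ker] at h₁ h₂
  rw [← coVal_smul]
  exact X.coVal_mem_formRel hS hF (by rw [formMap_smul, h₁, smul_zero])
    (by rw [mulForms_smul, h₂, mul_zero])

theorem rr_mem_formRel (x : C.ES) {v : A ⊗[k] (A ⊗[k] A)} (hv : v ∈ X.formRel hS hF) :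
    (self C).tens.rr (C.esIncl x) v ∈ X.formRel hS hF := by
  obtain ⟨ζ, ⟨h₁, h₂⟩, rfl⟩ := hv
  rw [SetLike.mem_coe, LinearMap.mem_ker] at h₁ h₂
  rw [← coVal_op_smul]
  exact X.coVal_mem_formRel hS hF
    (by rw [formMap_op_smul, h₁, h₂, smul_zero, zero_smul, add_zero])
    (by rw [mulForms_op_smul, h₂, zero_mul])

theorem rm_mem_formRel (b : C.coinv) {v : A ⊗[k] (A ⊗[k] A)} (hv : v ∈ X.formRel hS hF) :
    (self C).tens.tens.rm (b : A) v ∈ X.formRel hS hF := by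
  have h := X.lr_mem_formRel hS hF (C.target b) hv
  rwa [esIncl_target, lr_tmul, (self C).tens.tens.lm_one] at h

/-- The sub-bimodule of `A ⊗ A ⊗ A` that is generated by the relations. -/
noncomputable abbrev formSpan : Submodule k (A ⊗[k] (A ⊗[k] A)) :=
  (self C).tens.tens.spanA (X.formRel hS hF)

theorem mem_formRel_of_mem_formSpan {ζ : C.TripleForms}
    (h : (self C).tens.coVal ζ ∈ X.formSpan hS hF) : (self C).tens.coVal ζ ∈ X.formRel hS hF :=
  (self C).tens.tens.mem_of_mem_spanA hG hF _ (X.formRel_le hS hF)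
    (fun b _ hv => X.rm_mem_formRel hS hF b hv) ((self C).tens.coVal_mem ζ) h

/-- The relations are stable under the outer action of ℋ, and A ⊗ A = ℋA by
`actMap_esIncl_bijective`; the surplus factor from A stands on the right, where the span absorbs it.
This is how stability under left multiplication by A is obtained from a right span. -/
theorem lr_mem_formSpan (z : A ⊗[k] A) {v : A ⊗[k] (A ⊗[k] A)} (hv : v ∈ X.formRel hS hF) :
    (self C).tens.tens.lr z v ∈ X.formSpan hS hF := by
  obtain ⟨y, rfl⟩ := (actMap_esIncl_bijective hG hF).2 z
  refine (self C).tens.actMap_mem C.rES C.esIncl esIncl_rES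
    ((X.formSpan hS hF).comap ((self C).tens.tens.lr.flip v)) (fun a x => ?_) y
  rw [Submodule.mem_comap, LinearMap.flip_apply, ← rm_lr]
  exact rm_mem_spanA _ _ a (le_spanA _ _ (X.lr_mem_formRel hS hF x hv))

theorem lm_mem_formSpan (a : A) {v : A ⊗[k] (A ⊗[k] A)} (hv : v ∈ X.formSpan hS hF) :
    (self C).tens.tens.lm a v ∈ X.formSpan hS hF := by
  have h : X.formSpan hS hF ≤ (X.formSpan hS hF).comap ((self C).tens.tens.lm a) := by
    nth_rewrite 1 [formSpan, spanA]
    rw [Submodule.span_le]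
    rintro _ ⟨c, v, hv, rfl⟩
    exact X.lr_mem_formSpan hS hF (a ⊗ₜ[k] c) hv
  exact h hv

theorem rr_mem_formSpan (x : C.ES) {v : A ⊗[k] (A ⊗[k] A)} (hv : v ∈ X.formSpan hS hF) :
    (self C).tens.rr (C.esIncl x) v ∈ X.formSpan hS hF :=
  (self C).tens.spanA_rr (fun _ hm => X.rr_mem_formRel hS hF x hm) hv

theorem lTensor_mul'_of_mem_formRel {v : A ⊗[k] (A ⊗[k] A)} (hv : v ∈ X.formRel hS hF) :
    (LinearMap.mul' k A).lTensor A v = 0 := by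
  obtain ⟨ζ, ⟨_, h₂⟩, rfl⟩ := hv
  rw [SetLike.mem_coe, LinearMap.mem_ker] at h₂
  rw [← esIncl_mulForms hS hG hF, h₂, map_zero]

theorem lTensor_mul'_of_mem_formSpan {v : A ⊗[k] (A ⊗[k] A)} (hv : v ∈ X.formSpan hS hF) :
    (LinearMap.mul' k A).lTensor A v = 0 := by
  have h : X.formSpan hS hF ≤ LinearMap.ker ((LinearMap.mul' k A).lTensor A) := by
    rw [formSpan, spanA, Submodule.span_le]
    rintro _ ⟨c, v, hv, rfl⟩
    rw [SetLike.mem_coe, LinearMap.mem_ker,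
      (self C).tens.lTensor_rm (self C) (LinearMap.mul' k A) (fun a l => mul'_rightMul a l),
      X.lTensor_mul'_of_mem_formRel hS hF hv, map_zero]
  exact h hv

/-- Subtracting a multiple of `1 ⊗ 1 ⊗ 1` moves an element into the kernel of the product. -/
theorem lTensor_projOne_coVal (ζ : C.TripleForms) :
    (projOne k A).lTensor A ((self C).tens.coVal ζ) =
      (self C).tens.coVal (ζ - outer C (mulForms hS hG hF ζ)) := by
  rw [lTensor_projOne, map_sub, coVal_outer, esIncl_mulForms]

theorem lTensor_projOne_mem {η : C.TripleForms} (hη : X.formMap hS hF η = 0) :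
    (projOne k A).lTensor A ((self C).tens.coVal η) ∈ X.formRel hS hF := by
  rw [lTensor_projOne_coVal (hG := hG) hS hF]
  exact X.coVal_mem_formRel hS hF (by rw [map_sub, hη, formMap_outer, sub_zero])
    (by rw [map_sub, mulForms_outer, sub_self])

/-- As the relation ζ maps to 0, the coaction of ζ, which embeds as v with a unit inserted, dies in
ℋ ⊗_B Ω. By right exactness it is represented in ℋ ⊗ ker(`formMap`). A projection that fixes the
inserted element then moves the representative from ker(`formMap`) into the relations with vanishing
product. -/
theorem ins_mem {v : A ⊗[k] (A ⊗[k] A)} (hv : v ∈ X.formRel hS hF) :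
    ins k A (A ⊗[k] A) v ∈ LinearMap.range ((X.formSpan hS hF).subtype.lTensor A) := by
  have hv' := X.lTensor_mul'_of_mem_formRel hS hF hv
  obtain ⟨ζ, ⟨h₁, _⟩, rfl⟩ := hv
  rw [SetLike.mem_coe, LinearMap.mem_ker] at h₁
  obtain ⟨y, hy⟩ := BalTensor.mk_surjective _ _ ((self C).tens.coAct hG hF ζ)
  have h₂ := X.coact_formMap hS hF ζ
  rw [h₁, map_zero, ← hy] at h₂
  obtain ⟨z, hz⟩ := BalTensor.map_id_ker (X.formMap_lES hS hF) (X.formMap_surjective hS hF) y h₂.symm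
  rw [hy] at hz
  have h₃ := congrArg (self C).tens.coEmb hz
  rw [coEmb_coAct] at h₃
  -- `projOne` applied to the last two slots fixes the inserted element because the product kills v,
  -- and it carries ker(`formMap`) into the relations.
  have h₄ := ins_lTensor (projOne k A) ((self C).tens.coVal ζ)
  rw [lTensor_projOne, hv', map_zero, sub_zero, ← h₃] at h₄
  rw [← h₃, ← h₄]
  clear h₄ h₃ hz h₂ hy hv' h₁
  induction z with
  | zero => simp
  | add x y hx hy => simp only [map_add]; exact add_mem hx hy
  | tmul x η =>
    have h : (self C).tens.coEmb (C.esMk C.TripleForms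
        ((LinearMap.ker (X.formMap hS hF)).subtype.lTensor C.ES (x ⊗ₜ[k] η))) =
      ((self C).tens.tens.lm.flip ((self C).tens.coVal η)).lTensor A (C.esIncl x) := rfl
    have h' := X.lTensor_projOne_mem hS hF η.2
    refine (congrArg (· ∈ LinearMap.range ((X.formSpan hS hF).subtype.lTensor A))
      (congrArg (((projOne k A).lTensor A).lTensor A) h)).mpr ?_
    generalize C.esIncl x = z
    induction z with
    | zero => simp
    | add x y hx hy => simp only [map_add]; exact add_mem hx hy
    | tmul c c' =>
      rw [LinearMap.lTensor_tmul, LinearMap.lTensor_tmul, LinearMap.flip_apply,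
        (self C).tens.lTensor_lm (self C).tens (projOne k A)]
      exact ⟨c ⊗ₜ[k] ⟨_, X.lm_mem_formSpan hS hF c' (le_spanA _ _ h')⟩, rfl⟩

/-- The map `l ↦ 1 ⊗ l` modulo the relations. -/
noncomputable def modFormSpan : A ⊗[k] A →ₗ[k] (A ⊗[k] (A ⊗[k] A)) ⧸ X.formSpan hS hF :=
  (X.formSpan hS hF).mkQ ∘ₗ TensorProduct.mk k A (A ⊗[k] A) 1

/-- The subspace `{w | 1 ⊗ w is a relation}`. -/
noncomputable def oneForms : Submodule k (A ⊗[k] A) := LinearMap.ker (X.modFormSpan hS hF)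

theorem mem_oneForms {w : A ⊗[k] A} :
    w ∈ X.oneForms hS hF ↔ (1 : A) ⊗ₜ[k] w ∈ X.formSpan hS hF :=
  Submodule.Quotient.mk_eq_zero _

/-- Descent along k → A. Inserting a unit takes the generated module N into A ⊗ N, so N is killed by
A ⊗ φ, where φ is w ↦ 1 ⊗ w modulo N. Flatness over k makes the kernel of A ⊗ φ equal to A ⊗ ker φ.
The other inclusion is stability of N under left multiplication by A. -/
theorem formSpan_eq_range :
    X.formSpan hS hF = LinearMap.range ((X.oneForms hS hF).subtype.lTensor A) := by
  apply le_antisymm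
  · nth_rewrite 1 [formSpan, spanA]
    rw [Submodule.span_le]
    rintro _ ⟨c, v, hv, rfl⟩
    refine mem_range_lTensor_ker (X.modFormSpan hS hF) ?_
    obtain ⟨m, hm⟩ := X.ins_mem hS hF hv
    have h : ∀ v, (X.modFormSpan hS hF).lTensor A v =
        (X.formSpan hS hF).mkQ.lTensor A (ins k A (A ⊗[k] A) v) := fun v => by
      rw [modFormSpan, LinearMap.lTensor_comp_apply]
      rfl
    have h' : ins k A (A ⊗[k] A) ((self C).tens.tens.rm c v) =
        (self C).tens.tens.tens.rm c (ins k A (A ⊗[k] A) v) :=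
      (self C).tens.lTensor_rm (self C).tens.tens (TensorProduct.mk k A (A ⊗[k] A) 1)
        (fun _ _ => rfl) c v
    rw [h, h', ← hm]
    clear h h' hm
    induction m with
    | zero => simp
    | add x y hx hy => simp only [map_add, hx, hy, add_zero]
    | tmul a x =>
      have h := (Submodule.Quotient.mk_eq_zero _).2 (rm_mem_spanA _ _ c x.2)
      exact (congrArg (a ⊗ₜ[k] ·) h).trans (TensorProduct.tmul_zero _ _)
  · rintro _ ⟨m, rfl⟩
    induction m with
    | zero => simp
    | add x y hx hy => rw [map_add]; exact add_mem hx hy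
    | tmul a x =>
      have h := X.lm_mem_formSpan hS hF a ((X.mem_oneForms hS hF).1 x.2)
      rw [tens_lm_tmul, mul_one] at h
      exact h

theorem isCovariantSub_oneForms : C.IsCovariantSub (X.oneForms hS hF) where
  le_univ w hw := by
    have h := X.lTensor_mul'_of_mem_formSpan hS hF ((X.mem_oneForms hS hF).1 hw)
    have h' := congrArg (LinearMap.mul' k A) h
    rwa [LinearMap.lTensor_tmul, LinearMap.mul'_apply, one_mul, map_zero] at h'
  left_mem c w hw := by
    rw [mem_oneForms] at hw ⊢
    -- Replacing w by cw is the inner action of 1 ⊗ c on 1 ⊗ w, whereas N is known to be stable only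
    -- under the inner action of ℋ. By `leftES_bijective`, 1 ⊗ c is a sum of elements ex with e in A
    -- and x in ℋ, and the inner action of ex on 1 ⊗ w is that of x followed by left multiplication
    -- by e.
    have key : ∀ y, (self C).tens.rr (leftES C y) (1 ⊗ₜ[k] w) ∈ X.formSpan hS hF := by
      intro y
      obtain ⟨z, rfl⟩ := BalTensor.mk_surjective _ _ y
      induction z with
      | zero => simp
      | add x y hx hy =>
        rw [map_add, map_add, map_add, LinearMap.add_apply]; exact add_mem hx hy
      | tmul e x =>
        have h := X.lm_mem_formSpan hS hF e (X.rr_mem_formSpan hS hF x hw)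
        rw [leftES_mk]
        convert h using 1
        generalize C.esIncl x = z
        induction z with
        | zero => simp
        | add x y hx hy => simp only [map_add, LinearMap.add_apply, hx, hy]
        | tmul a a' => simp [rr_tmul, tens_lm_tmul]
    obtain ⟨y, hy⟩ := (leftES_bijective hS hG hF).2 (1 ⊗ₜ[k] c)
    have h := key y
    rw [hy, rr_tmul, mul_one] at h
    exact h
  right_mem c w hw := by
    rw [mem_oneForms] at hw ⊢
    exact rm_mem_spanA _ _ c hw
  diag_mem w hw := by
    refine mem_range_rTensor_ker (X.modFormSpan hS hF) ?_
    obtain ⟨m, hm⟩ := (self C).tens.tens.δ_mem_of_mem_spanA _ (X.formRel_le hS hF)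
      ((X.mem_oneForms hS hF).1 hw)
    have h := (self C).tens.tens_δ_one_tmul w
    rw [← hm] at h
    rw [modFormSpan, LinearMap.rTensor_comp_apply]
    refine (congrArg ((X.formSpan hS hF).mkQ.rTensor H) h.symm).trans ?_
    rw [← LinearMap.rTensor_comp_apply]
    have h0 : (X.formSpan hS hF).mkQ ∘ₗ (X.formSpan hS hF).subtype = 0 :=
      LinearMap.ext fun x => (Submodule.Quotient.mk_eq_zero _).2 x.2
    rw [h0, LinearMap.rTensor_zero, LinearMap.zero_apply]

end LeftCovariantCalculus

namespace RightCovariantCalculus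

variable (Y : C.RightCovariantCalculus)

theorem dMul_eq (z : A ⊗[k] A) :
    Y.hopf.dMul Y.d z = Y.d (LinearMap.mul' k A z) - Y.mulD z := by
  induction z with
  | zero => simp
  | add x y hx hy => simp only [map_add, hx, hy]; abel
  | tmul a a' =>
    rw [dMul_tmul, LinearMap.mul'_apply, Y.leibniz, mulD_tmul, hopf_rm, add_sub_cancel_right]

/-- By the Leibniz rule, A ⊗ `dMul` is the negative of A ⊗ `mulD` on the kernel of the product. Such
v lie in A ⊗ Ω^u, and flatness of A over k identifies the kernel with A tensored with the relations
of the calculus. -/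
theorem lTensor_dMul_eq_zero_iff {v : A ⊗[k] (A ⊗[k] A)}
    (hv : (LinearMap.mul' k A).lTensor A v = 0) :
    (Y.hopf.dMul Y.d).lTensor A v = 0 ↔
      v ∈ LinearMap.range (Y.relations.subtype.lTensor A) := by
  constructor
  · intro h
    have h₁ : Y.hopf.dMul Y.d = Y.d ∘ₗ LinearMap.mul' k A - Y.mulD := LinearMap.ext Y.dMul_eq
    rw [h₁, LinearMap.lTensor_sub, LinearMap.sub_apply, LinearMap.lTensor_comp_apply, hv, map_zero,
      zero_sub, neg_eq_zero] at h
    have h₂ : Y.univMap ∘ₗ projUniv k A = Y.mulD := LinearMap.ext Y.mulD_projUniv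
    rw [← h₂, LinearMap.lTensor_comp_apply] at h
    obtain ⟨m, hm⟩ := mem_range_lTensor_ker Y.univMap h
    have h₃ : (univ k A).subtype.lTensor A ((projUniv k A).lTensor A v) = v := by
      have h₄ : (univ k A).subtype ∘ₗ projUniv k A = LinearMap.id -
        (TensorProduct.mk k A A).flip 1 ∘ₗ LinearMap.mul' k A := rfl
      rw [← LinearMap.lTensor_comp_apply, h₄, LinearMap.lTensor_sub, LinearMap.sub_apply,
        LinearMap.lTensor_comp_apply, hv, map_zero, sub_zero, LinearMap.lTensor_id,
        LinearMap.id_apply]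
    let e : LinearMap.ker Y.univMap →ₗ[k] Y.relations :=
      ((univ k A).subtype ∘ₗ (LinearMap.ker Y.univMap).subtype).codRestrict _ fun y =>
        ⟨y.1.2, y.2⟩
    refine ⟨e.lTensor A m, ?_⟩
    rw [← h₃, ← hm, ← LinearMap.lTensor_comp_apply, ← LinearMap.lTensor_comp_apply]
    rfl
  · rintro ⟨m, rfl⟩
    have h : Y.hopf.dMul Y.d ∘ₗ Y.relations.subtype = 0 := LinearMap.ext fun x => by
      have h₁ : LinearMap.mul' k A (x : A ⊗[k] A) = 0 := x.2.1
      have h₂ : Y.mulD (x : A ⊗[k] A) = 0 := x.2.2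
      rw [LinearMap.comp_apply, Submodule.subtype_apply, dMul_eq, h₁, h₂, map_zero, sub_zero]
      rfl
    rw [← LinearMap.lTensor_comp_apply, h, LinearMap.lTensor_zero, LinearMap.zero_apply]

end RightCovariantCalculus

/-- Every left covariant calculus is induced by a right covariant calculus. -/
theorem LeftCovariantCalculus.nonempty_iso_leftCalculus {hG : C.IsHopfGalois}
    (X : C.LeftCovariantCalculus hG) (hS : Function.Bijective (HopfAlgebra.antipode k (A := H)))
    (hF : C.IsLeftFaithfullyFlat) (Y : C.RightCovariantCalculus)
    (hY : Y.relations = X.oneForms hS hF) : Nonempty ((Y.leftCalculus hS hG hF).Iso X) := by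
  refine LeftCovariantCalculus.nonempty_iso hS hF ?_
  ext ζ
  -- The correction is invisible to both form maps and makes the product vanish, so both kernels can
  -- be compared with A ⊗ W.
  set ξ := ζ - outer C (mulForms hS hG hF ζ) with hξ
  have h₁ : mulForms hS hG hF ξ = 0 := by rw [hξ, map_sub, mulForms_outer, sub_self]
  have h₂ : X.formMap hS hF ζ = X.formMap hS hF ξ := by
    rw [hξ, map_sub, formMap_outer, sub_zero]
  have h₃ : (Y.leftCalculus hS hG hF).formMap hS hF ζ =
      (Y.leftCalculus hS hG hF).formMap hS hF ξ := by
    rw [hξ, map_sub, formMap_outer, sub_zero]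
  have h₄ : (LinearMap.mul' k A).lTensor A ((self C).tens.coVal ξ) = 0 := by
    rw [← esIncl_mulForms hS hG hF, h₁, map_zero]
  -- By descent, a coinvariant in the module generated by the relations is itself a relation.
  have h₅ : X.formMap hS hF ξ = 0 ↔ (self C).tens.coVal ξ ∈ X.formSpan hS hF := by
    refine ⟨fun h => le_spanA _ _ (X.coVal_mem_formRel hS hF h h₁), fun h => ?_⟩
    obtain ⟨ξ', ⟨h, _⟩, h'⟩ := X.mem_formRel_of_mem_formSpan hS hF h
    rw [← (self C).tens.coVal_injective h']
    exact h
  have h₆ : (Y.leftCalculus hS hG hF).formMap hS hF ξ = 0 ↔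
      (Y.hopf.dMul Y.d).lTensor A ((self C).tens.coVal ξ) = 0 := by
    rw [← Y.coVal_formMap hS hG hF]
    exact ⟨fun h => (congrArg Y.hopf.coVal h).trans (map_zero _),
      fun h => Y.hopf.coVal_injective (h.trans (map_zero _).symm)⟩
  rw [LinearMap.mem_ker, LinearMap.mem_ker, h₂, h₃, h₅, h₆, Y.lTensor_dMul_eq_zero_iff h₄, hY,
    X.formSpan_eq_range hS hF]

end ESCalculus.RightComoduleAlgebra

namespace ESCalculus.RightComoduleAlgebra

variable {k : Type u} {H : Type v} {A : Type w} [Field k] [Ring H] [HopfAlgebra k H]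
  [Ring A] [Algebra k A] {C : RightComoduleAlgebra k H A}

open HopfBimodule

/-! ### The correspondence between left ideals and covariant subspaces. -/

section Extend

variable {I : Ideal C.ES}

theorem extend_le_iff {J : Submodule k (A ⊗[k] A)} :
    C.extend I ≤ J ↔ ∀ (a : A) (x : C.ES), x ∈ I → leftMul a (C.esIncl x) ∈ J := by
  rw [extend, Submodule.span_le]
  constructor
  · intro h a x hx
    exact h ⟨a, x, hx, rfl⟩
  · rintro h _ ⟨a, x, hx, rfl⟩
    exact h a x hx

theorem leftMul_mem_extend {x : C.ES} (hx : x ∈ I) (a : A) :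
    leftMul a (C.esIncl x) ∈ C.extend I :=
  Submodule.subset_span ⟨a, x, hx, rfl⟩

variable (I) in
/-- A left ideal as a subspace of `A ⊗ A`. -/
noncomputable def idealMap : Submodule k (A ⊗[k] A) :=
  (Submodule.restrictScalars k I).map C.esIncl

theorem mem_idealMap {x : C.ES} (hx : x ∈ I) : C.esIncl x ∈ idealMap I := ⟨x, hx, rfl⟩

theorem idealMap_le : idealMap I ≤ (self C).tens.coinv := by
  rintro _ ⟨x, _, rfl⟩
  exact esIncl_mem x

theorem rm_mem_idealMap (b : C.coinv) {z : A ⊗[k] A} (hz : z ∈ idealMap I) :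
    (self C).tens.rm (b : A) z ∈ idealMap I := by
  obtain ⟨x, hx, rfl⟩ := hz
  exact ⟨C.target b * x, I.mul_mem_left _ hx, esIncl_rES b x⟩

theorem lr_mem_spanA_idealMap (hG : C.IsHopfGalois) (hF : C.IsLeftFaithfullyFlat)
    (z : A ⊗[k] A) {x : C.ES} (hx : x ∈ I) :
    (self C).tens.lr z (C.esIncl x) ∈ (self C).tens.spanA (idealMap I) := by
  obtain ⟨y, rfl⟩ := (actMap_esIncl_bijective hG hF).2 z
  refine (self C).tens.actMap_mem C.rES C.esIncl esIncl_rES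
    (((self C).tens.spanA (idealMap I)).comap ((self C).tens.lr.flip (C.esIncl x)))
    (fun a p => ?_) y
  rw [Submodule.mem_comap, LinearMap.flip_apply, ← rm_lr, lr_tens_self, ← esIncl_mul]
  exact rm_mem_spanA _ _ a (le_spanA _ _ (mem_idealMap (I.mul_mem_left p hx)))

theorem lr_mem_extend (hS : Function.Bijective (HopfAlgebra.antipode k (A := H)))
    (hG : C.IsHopfGalois) (hF : C.IsLeftFaithfullyFlat) (z : A ⊗[k] A) {x : C.ES} (hx : x ∈ I) :
    (self C).tens.lr z (C.esIncl x) ∈ C.extend I := by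
  obtain ⟨y, rfl⟩ := (leftES_bijective hS hG hF).2 z
  obtain ⟨z, rfl⟩ := BalTensor.mk_surjective _ _ y
  induction z with
  | zero => simp
  | add x y hx hy => rw [map_add, map_add, map_add, LinearMap.add_apply]; exact add_mem hx hy
  | tmul e p =>
    have h := leftMul_mem_extend (I.mul_mem_left p hx) e
    rw [leftES_mk]
    convert h using 1
    rw [esIncl_mul, ← lr_tens_self (C := C)]
    generalize C.esIncl p = z
    induction z with
    | zero => simp
    | add x y hx hy => simp only [map_add, LinearMap.add_apply, hx, hy]
    | tmul a a' =>
      change (self C).tens.lr ((e * a) ⊗ₜ[k] a') _ =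
        (self C).tens.lm e ((self C).tens.lr (a ⊗ₜ[k] a') _)
      rw [lr_tmul, lr_tmul, (self C).tens.lm_mul]

/-- The definition uses left multiples of I, descent speaks of right ones. Writing a ⊗ 1 as a sum of
elements of ℋ times elements of A on the right gives AI ⊆ IA; writing 1 ⊗ a as a sum of elements of
A on the left times elements of ℋ gives the converse, as I is a left ideal. -/
theorem extend_eq_spanA (hS : Function.Bijective (HopfAlgebra.antipode k (A := H)))
    (hG : C.IsHopfGalois) (hF : C.IsLeftFaithfullyFlat) :
    C.extend I = (self C).tens.spanA (idealMap I) := by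
  apply le_antisymm
  · rw [extend_le_iff]
    intro a x hx
    have h := lr_mem_spanA_idealMap hG hF (a ⊗ₜ[k] 1) hx
    rwa [lr_tmul, (self C).tens.rm_one] at h
  · rw [spanA, Submodule.span_le]
    rintro _ ⟨a, _, ⟨x, hx, rfl⟩, rfl⟩
    have h := lr_mem_extend hS hG hF (1 ⊗ₜ[k] a) hx
    rwa [lr_tmul, (self C).tens.lm_one] at h

theorem isCovariantSub_extend (hI : I ≤ C.plus)
    (hS : Function.Bijective (HopfAlgebra.antipode k (A := H)))
    (hG : C.IsHopfGalois) (hF : C.IsLeftFaithfullyFlat) : C.IsCovariantSub (C.extend I) where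
  le_univ := by
    rw [extend_le_iff]
    intro a x hx
    have h : LinearMap.mul' k A (C.esIncl x) = 0 := mem_plus_iff.1 (hI hx)
    change LinearMap.mul' k A (leftMul a (C.esIncl x)) = 0
    rw [mul'_leftMul, h, mul_zero]
  left_mem c z hz := by
    have h : C.extend I ≤ (C.extend I).comap (leftMul c) := by
      rw [extend_le_iff]
      intro a x hx
      have h := leftMul_mem_extend hx (c * a)
      exact (congrArg (· ∈ C.extend I) ((self C).tens.lm_mul c a (C.esIncl x))).mp h
    exact h hz
  right_mem c z hz := by
    rw [extend_eq_spanA hS hG hF] at hz ⊢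
    exact rm_mem_spanA _ _ c hz
  diag_mem z hz := by
    rw [extend_eq_spanA hS hG hF] at hz ⊢
    exact (self C).tens.δ_mem_of_mem_spanA _ idealMap_le hz

/-- Multiplication by t(b) preserves I, so I is a right B-submodule of the coinvariants and descent
recovers it from the A-module IA = AI. -/
theorem coIdeal_extend (hI : I ≤ C.plus)
    (hS : Function.Bijective (HopfAlgebra.antipode k (A := H)))
    (hG : C.IsHopfGalois) (hF : C.IsLeftFaithfullyFlat) :
    (isCovariantSub_extend hI hS hG hF).coIdeal = I := by
  ext x
  rw [IsCovariantSub.mem_coIdeal]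
  constructor
  · intro h
    rw [extend_eq_spanA hS hG hF] at h
    obtain ⟨y, hy, h'⟩ := (self C).tens.mem_of_mem_spanA hG hF _ idealMap_le
      (fun b _ hv => rm_mem_idealMap b hv) (esIncl_mem x) h
    rw [← esIncl_injective h']
    exact hy
  · intro hx
    rw [extend_eq_spanA hS hG hF]
    exact le_spanA _ _ (mem_idealMap hx)

end Extend

/-! ### Mutual inverseness and the classification up to isomorphism. -/

namespace IsCovariantSub

variable {J : Submodule k (A ⊗[k] A)} (hJ : C.IsCovariantSub J)

theorem map_coIdeal :
    (Submodule.restrictScalars k hJ.coIdeal).map C.esIncl = J ⊓ C.diagCoinv := by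
  ext z
  constructor
  · rintro ⟨x, hx, rfl⟩
    exact ⟨hx, esIncl_mem x⟩
  · rintro ⟨h₁, h₂⟩
    obtain ⟨x, rfl⟩ := exists_esIncl_eq h₂
    exact ⟨x, h₁, rfl⟩

/-- J is itself a Hopf bimodule, so by the structure theorem it is generated by its coinvariants. -/
theorem extend_coIdeal (hS : Function.Bijective (HopfAlgebra.antipode k (A := H)))
    (hG : C.IsHopfGalois) (hF : C.IsLeftFaithfullyFlat) : C.extend hJ.coIdeal = J := by
  apply le_antisymm
  · rw [extend_le_iff]
    exact fun a x hx => hJ.left_mem a _ hx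
  · intro z hz
    rw [extend_eq_spanA hS hG hF]
    let T := (self C).tens.sub J hJ.left_mem hJ.right_mem hJ.diag_mem
    have h : (⟨z, hz⟩ : J) ∈ T.spanA T.coinv := by
      rw [T.spanA_coinv hG hF]; trivial
    have h' : T.spanA T.coinv ≤
        ((self C).tens.spanA (idealMap hJ.coIdeal)).comap J.subtype := by
      rw [spanA, Submodule.span_le]
      rintro _ ⟨a, v, hv, rfl⟩
      refine rm_mem_spanA (self C).tens (idealMap hJ.coIdeal) a (le_spanA _ _ ?_)
      have hv' : (v : A ⊗[k] A) ∈ C.diagCoinv :=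
        T.map_mem_coinv (self C).tens J.subtype
          (fun l => ((self C).tens.rTensor_subδ J hJ.diag_mem l).symm) hv
      obtain ⟨x, hx⟩ := exists_esIncl_eq hv'
      have hxJ : C.esIncl x ∈ J := by rw [hx]; exact v.2
      exact ⟨x, hxJ, hx⟩
    exact h' h

end IsCovariantSub

/-- The correspondence `I ↦ A I` and `J ↦ J^{co H}`. -/
noncomputable def idealEquiv (hS : Function.Bijective (HopfAlgebra.antipode k (A := H)))
    (hG : C.IsHopfGalois) (hF : C.IsLeftFaithfullyFlat) : C.LeftIdealsInPlus ≃ C.CovariantSubs where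
  toFun I := ⟨C.extend I.1, isCovariantSub_extend I.2 hS hG hF⟩
  invFun J := ⟨J.2.coIdeal, J.2.coIdeal_le⟩
  left_inv I := Subtype.ext (coIdeal_extend I.2 hS hG hF)
  right_inv J := Subtype.ext (J.2.extend_coIdeal hS hG hF)

theorem RightCovariantCalculus.ideal_eq (Y : C.RightCovariantCalculus)
    {J : Submodule k (A ⊗[k] A)} (hJ : C.IsCovariantSub J) (h : Y.relations = J) :
    Y.ideal = hJ.coIdeal := by
  subst h
  rfl

theorem IsCovariantSub.nonempty_quotIso {J : Submodule k (A ⊗[k] A)} (hJ : C.IsCovariantSub J) :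
    Nonempty (hJ.calculus.QuotIso J) := by
  have h := hJ.calculus.quotIso
  rw [hJ.relations_calculus] at h
  exact ⟨h⟩

theorem IsCovariantSub.nonempty_idealIso {J : Submodule k (A ⊗[k] A)} (hJ : C.IsCovariantSub J)
    (hS : Function.Bijective (HopfAlgebra.antipode k (A := H)))
    (hG : C.IsHopfGalois) (hF : C.IsLeftFaithfullyFlat) :
    Nonempty ((hJ.calculus.leftCalculus hS hG hF).IdealIso hJ.coIdeal) := by
  have h := hJ.calculus.idealIso hS hG hF
  rw [hJ.calculus.ideal_eq hJ hJ.relations_calculus] at h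
  exact ⟨h⟩

/-- The calculus is induced by Ω^u/W for its space W of one-forms, and the induced calculus belongs
to the ideal W^{co H}. -/
theorem LeftCovariantCalculus.exists_idealIso {hG : C.IsHopfGalois}
    (X : C.LeftCovariantCalculus hG) (hS : Function.Bijective (HopfAlgebra.antipode k (A := H)))
    (hF : C.IsLeftFaithfullyFlat) : ∃ I : C.LeftIdealsInPlus, Nonempty (X.IdealIso I.1) := by
  have hW := X.isCovariantSub_oneForms hS hF
  obtain ⟨g⟩ := X.nonempty_iso_leftCalculus hS hF hW.calculus hW.relations_calculus
  obtain ⟨f⟩ := hW.nonempty_idealIso hS hG hF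
  exact ⟨⟨hW.coIdeal, hW.coIdeal_le⟩, ⟨f.trans g⟩⟩

theorem LeftCovariantCalculus.existsUnique_idealIso {hG : C.IsHopfGalois}
    (X : C.LeftCovariantCalculus hG) (hS : Function.Bijective (HopfAlgebra.antipode k (A := H)))
    (hF : C.IsLeftFaithfullyFlat) : ∃! I : C.LeftIdealsInPlus, Nonempty (X.IdealIso I.1) := by
  obtain ⟨I, ⟨f⟩⟩ := X.exists_idealIso hS hF
  exact ⟨I, ⟨f⟩, fun I' ⟨f'⟩ => Subtype.ext (f'.eq_of_idealIso I'.2 I.2 f hS hF)⟩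

/-- The calculus induced by Ω^u/AI has ideal (AI)^{co H} = I. The axioms are thus inherited from (A
⊗ Ω)^{co H} and need no verification on ℋ ⊗_B ℋ⁺/I. -/
theorem exists_leftCalculus_idealIso (hS : Function.Bijective (HopfAlgebra.antipode k (A := H)))
    (hG : C.IsHopfGalois) (hF : C.IsLeftFaithfullyFlat) (I : C.LeftIdealsInPlus) :
    ∃ X : C.LeftCovariantCalculus hG, Nonempty (X.IdealIso I.1) := by
  have h := (isCovariantSub_extend I.2 hS hG hF).nonempty_idealIso hS hG hF
  rw [coIdeal_extend I.2 hS hG hF] at h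
  exact ⟨_, h⟩

theorem RightCovariantCalculus.existsUnique_quotIso (Y : C.RightCovariantCalculus) :
    ∃! J : C.CovariantSubs, Nonempty (Y.QuotIso J.1) :=
  ⟨⟨Y.relations, Y.isCovariantSub_relations⟩, ⟨Y.quotIso⟩,
    fun J ⟨f⟩ => Subtype.ext (f.eq_relations J.2.le_univ)⟩

/-- Objects that are classified up to isomorphism by parameters. -/
theorem exists_quotient_equiv {α : Type*} (s : Setoid α) {ι : Type*} (R : α → ι → Prop)
    (h₁ : ∀ i, ∃ x, R x i) (h₂ : ∀ x, ∃! i, R x i)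
    (h₃ : ∀ x y i, R x i → R y i → s.r x y) (h₄ : ∀ x y i, s.r x y → R x i → R y i) :
    ∃ e : Quotient s ≃ ι, ∀ x i, R x i → e (Quotient.mk s x) = i := by
  choose g hg using h₁
  choose f hf hf' using h₂
  refine ⟨⟨Quotient.lift f fun x y h => hf' y _ (h₄ x y _ h (hf x)), fun i => Quotient.mk s (g i),
    fun q => ?_, fun i => (hf' _ _ (hg i)).symm⟩, fun x i h => (hf' x i h).symm⟩
  induction q using Quotient.inductionOn with
  | h x => exact Quotient.sound (h₃ _ _ _ (hg _) (hf x))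

end ESCalculus.RightComoduleAlgebra

open ESCalculus.RightComoduleAlgebra ESCalculus.RightComoduleAlgebra.HopfBimodule

theorem theorem3p5 {k : Type u} {H : Type v} {A : Type w} [Field k] [Ring H] [HopfAlgebra k H]
    [Ring A] [Algebra k A] (C : ESCalculus.RightComoduleAlgebra k H A)
    (hS : Function.Bijective (HopfAlgebra.antipode k (A := H)))
    (hG : C.IsHopfGalois) (hF : C.IsLeftFaithfullyFlat) :
    -- the coproduct is well defined
    (Function.Injective C.esSquareIncl ∧ C.esSquareIncl ∘ₗ C.Δ hG = C.comulFormula hG) ∧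
    -- the kernel of the counit consists of the coinvariants of the universal calculus
    (LinearMap.ker C.ε).map C.esIncl =
      ESCalculus.RightComoduleAlgebra.univ k A ⊓ C.diagCoinv ∧
    -- left covariant calculi on the bialgebroid are classified by left ideals in the kernel
    (∀ I : C.LeftIdealsInPlus, ∃ X : C.LeftCovariantCalculus hG, Nonempty (X.IdealIso I.1)) ∧
    (∀ X : C.LeftCovariantCalculus hG, ∃! I : C.LeftIdealsInPlus, Nonempty (X.IdealIso I.1)) ∧
    -- right covariant calculi on `A` are classified by covariant subbimodules
    (∀ J : C.CovariantSubs, ∃ Y : C.RightCovariantCalculus, Nonempty (Y.QuotIso J.1)) ∧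
    (∀ Y : C.RightCovariantCalculus, ∃! J : C.CovariantSubs, Nonempty (Y.QuotIso J.1)) ∧
    -- `I ↦ A I` and `J ↦ J^{co H}` are mutually inverse and induce a bijection of the
    -- isomorphism classes of calculi
    ∃ e : C.LeftIdealsInPlus ≃ C.CovariantSubs,
      (∀ I, (e I).1 = C.extend I.1) ∧
      (∀ J, (Submodule.restrictScalars k (e.symm J).1).map C.esIncl = J.1 ⊓ C.diagCoinv) ∧
      ∃ E : Quotient (C.leftSetoid hG) ≃ Quotient C.rightSetoid,
        ∀ (I : C.LeftIdealsInPlus) (X : C.LeftCovariantCalculus hG)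
          (Y : C.RightCovariantCalculus),
          Nonempty (X.IdealIso I.1) → Nonempty (Y.QuotIso (e I).1) →
            E (Quotient.mk _ X) = Quotient.mk _ Y := by
  refine ⟨⟨esSquareIncl_injective hG hF, esSquareIncl_comul hG hF⟩, map_ker_ε,
    exists_leftCalculus_idealIso hS hG hF, fun X => X.existsUnique_idealIso hS hF,
    fun J => ⟨J.2.calculus, J.2.nonempty_quotIso⟩, fun Y => Y.existsUnique_quotIso,
    idealEquiv hS hG hF, fun _ => rfl, fun J => J.2.map_coIdeal, ?_⟩
  obtain ⟨eL, hL⟩ := exists_quotient_equiv (C.leftSetoid hG)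
    (fun X (I : C.LeftIdealsInPlus) => Nonempty (X.IdealIso I.1))
    (exists_leftCalculus_idealIso hS hG hF) (fun X => X.existsUnique_idealIso hS hF)
    (fun X X' I ⟨f⟩ ⟨f'⟩ => f.nonempty_iso f' hS hF) (fun X X' I ⟨g⟩ ⟨f⟩ => ⟨f.trans g⟩)
  obtain ⟨eR, hR⟩ := exists_quotient_equiv C.rightSetoid
    (fun Y (J : C.CovariantSubs) => Nonempty (Y.QuotIso J.1))
    (fun J => ⟨J.2.calculus, J.2.nonempty_quotIso⟩) (fun Y => Y.existsUnique_quotIso)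
    (fun Y Y' J ⟨f⟩ ⟨f'⟩ => RightCovariantCalculus.nonempty_iso
      ((f.eq_relations J.2.le_univ).symm.trans (f'.eq_relations J.2.le_univ)))
    (fun Y Y' J ⟨g⟩ ⟨f⟩ => ⟨by
      rw [f.eq_relations J.2.le_univ, g.relations_eq]
      exact Y'.quotIso⟩)
  -- Isomorphism classes on the two sides are parametrised by I and by J, so the bijection of
  -- classes is I ↦ AI read through both parametrisations.
  refine ⟨eL.trans ((idealEquiv hS hG hF).trans eR.symm), fun I X Y hX hY => ?_⟩
  rw [Equiv.trans_apply, Equiv.trans_apply, hL X I hX, Equiv.symm_apply_eq, hR Y _ hY]
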